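/- **Theorem (uniqueness for the continuity equation).** *Setting.* Let $X$ be a Polish space with a $\sigma$-finite Borel measure $\mathfrak m$ of full support; write $L^p=L^p(X,\mathfrak m)$, $p\in[1,\infty]$, and $L^0$ for the a.e. classes of real measurable functions. Let $\mathcal E:L^2\to[0,\infty]$ be a symmetric Dirichlet form: a lower semicontinuous quadratic form, with dense domain $\mathbb V=\{\mathcal E<\infty\}$, such that $\mathcal E(\eta\circ f)\le\mathcal E(f)$ for every $1$-Lipschitz $\eta:\mathbb R\to\mathbb R$ with $\eta(0)=0$. Put $\mathcal E(f,g)=\frac14(\mathcal E(f+g)-\mathcal E(f-g))$ and $\|f\|_{\mathbb V}^2=\|f\|_2^2+\mathcal E(f)$. Assume that $\mathcal E$ is strongly local ($\mathcal E(f,g)=0$ for $f,g\in\mathbb V$ whenever $(f+a)g=0$ a.e. for some $a\in\mathbb R$) and has a carré du champ, i.e. a symmetric, positive, continuous bilinear map $\Gamma:\mathbb V\times\mathbb V\to L^1$ with $$\int\varphi\,\Gamma(f)\,d\mathfrak m=\mathcal E(f,f\varphi)-\tfrac12\mathcal E(f^2,\varphi)\qquad\text{for all } f,\varphi\in\mathbb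 V\cap L^\infty,\qquad \Gamma(f):=\Gamma(f,f).$$ The Laplacian is defined by $\mathcal E(f,g)=-\int g\,\Delta f\,d\mathfrak m$ for all $g\in\mathbb V$, and $\mathsf P_tf$ is the heat flow: the unique $C^1$ curve $(0,\infty)\to L^2$ with values in $D(\Delta)$, with $\frac{d}{dt}\mathsf P_tf=\Delta\mathsf P_tf$ and $\mathsf P_tf\to f$ in $L^2$ as $t\downarrow0$. For $p\in[1,\infty]$ let $\mathbb V_p=\{f\in\mathbb V\cap L^p:\sqrt{\Gamma(f)}\in L^p\}$ with norm $\|f\|_{\mathbb V}+\|f\|_p+\|\sqrt{\Gamma(f)}\|_p$. The *$L^p$-$\Gamma$ inequality* holds if there is $c_p>0$ with $\|\sqrt{\Gamma(\mathsf P_tf)}\|_p\le c_pt^{-1/2}\|f\|_p$ for all $f\in L^2\cap L^p$, $t\in(0,1)$. Let $\mathscr A\subset\mathbb V$ be a linear subspace with $\mathscr A\subset L^p$ for every $p\in[1,\infty]$, dense in $\mathbb V$, with $\Phi(f_1,\dots,f_n)\in\mathscr A$ whenever $f_i\in\mathscr A$, $\Phi\in C^1(\mathbb R^n)$ and $\Phi(0)=0$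 (in particular $\mathscr A$ is an algebra), contained and dense in $\mathbb V_p$ for every $p\in[1,2]$, and contained in $\mathbb V_\infty$. A *derivation* is a linear map $\boldsymbol b:\mathscr A\to L^0$, $f\mapsto df(\boldsymbol b)$, with $d(fg)(\boldsymbol b)=f\,dg(\boldsymbol b)+g\,df(\boldsymbol b)$ and $|df(\boldsymbol b)|\le h\sqrt{\Gamma(f)}$ a.e. for all $f,g\in\mathscr A$, for some $h\in L^0$. Let $I=(0,T)$ with $0<T<\infty$. A *Borel family of derivations* is $\boldsymbol b=(\boldsymbol b_t)_{t\in I}$ such that $(t,x)\mapsto df(\boldsymbol b_t)(x)$ is measurable for each $f\in\mathscr A$ (has a Borel version that agrees with it a.e. in $X$ for a.e. $t$) and there is a Borel $h:I\times X\to[0,\infty)$ such that, for a.e. $t\in I$, $|df(\boldsymbol b_t)|\le h(t,\cdot)\sqrt{\Gamma(f)}$ a.e. for all $f\in\mathscr A$; $|\boldsymbol b|$ denotes the (a.e.) smallest such $h$. One writes $\operatorname{div}\boldsymbol b_t=d_t$ if $\int df(\boldsymbol b_t)\,d\mathfrak m=-\int f\,d_t\,d\mathfrak m$ for all $f\in\mathscr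 A$. *Assumptions.* Let $1<s\le r<\infty$ and $q\in(1,\infty]$ with $q^{-1}+r^{-1}+s^{-1}=1$. Assume that for $p\in\{r,s\}$ the algebra $\mathscr A$ is contained and dense in $\mathbb V_p$ and the $L^p$-$\Gamma$ inequality holds, and that there are $f_n\in\mathscr A$ with $0\le f_n\le1$, $f_n\uparrow1$ a.e. and $\sqrt{\Gamma(f_n)}\rightharpoonup0$ weakly-$*$ in $L^\infty$. Let $\boldsymbol b$ be a Borel family of derivations with $$|\boldsymbol b|\in L^1_t(L^q_x+L^\infty_x),\qquad \operatorname{div}\boldsymbol b\in L^1_t(L^q_x+L^\infty_x),\qquad \|D^{sym}\boldsymbol b_t\|_{r,s}\in L^1(0,T).$$ Here $\|D^{sym}\boldsymbol b_t\|_{r,s}$ is the smallest $c\in[0,\infty]$ such that $$\Bigl|\tfrac12\int\bigl[df(\boldsymbol b_t)\,\Delta g+dg(\boldsymbol b_t)\,\Delta f-(\operatorname{div}\boldsymbol b_t)\,\Gamma(f,g)\bigr]\,d\mathfrak m\Bigr|\le c\,\|\sqrt{\Gamma(f)}\|_r\,\|\sqrt{\Gamma(g)}\|_s$$ for all $f\in\mathbb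 V_r$ with $\Delta f\in L^r\cap L^2$ and all $g\in\mathbb V_s$ with $\Delta g\in L^s\cap L^2$ (the value $c=\infty$ meaning that no finite constant works), where $\boldsymbol b_t$ is extended by density from $\mathscr A$ to continuous operators $\mathbb V_r\to L^{s'}+L^2$ and $\mathbb V_s\to L^{r'}+L^2$, with $1/r+1/r'=1/s+1/s'=1$. *Conclusion.* For every $\bar u\in L^r\cap L^2$ there is at most one $u\in L^\infty_t(L^r_x\cap L^2_x)$, with $t\mapsto u_t$ weakly continuous in $[0,T)$ in duality with $\mathscr A$ (i.e. $t\mapsto\int\varphi u_t\,d\mathfrak m$ is continuous for every $\varphi\in\mathscr A$), that is a weak solution of $\frac{d}{dt}u_t+\operatorname{div}(u_t\boldsymbol b_t)=0$ in $(0,T)\times X$ with initial condition $\bar u$, i.e. $$\int_0^T\!\!\int\bigl[-\psi'\varphi-\psi\,d\varphi(\boldsymbol b_t)\bigr]u_t\,d\mathfrak m\,dt=\psi(0)\int\varphi\,\bar u\,d\mathfrak m\qquad\text{for all }\varphi\in\mathscr A,\ \psi\in C^1([0,T]),\ \psi(T)=0:$$ two such $u,v$ satisfy $u_t=v_t$ a.e.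 in $X$ for every $t\in[0,T)$. -/

import Mathlib

open MeasureTheory Set Filter Topology
open scoped ENNReal NNReal

noncomputable section

namespace ContEq

variable {X : Type*} [MeasurableSpace X]

/-- A densely defined symmetric Dirichlet form on `L²(m)`: a lower semicontinuous quadratic form
with values in `[0, ∞]`, finite on a dense set, and decreasing under normal contractions. -/
structure DirichletForm (m : Measure X) where
  toFun : Lp ℝ 2 m → ℝ≥0∞
  map_smul : ∀ (a : ℝ) (f : Lp ℝ 2 m), toFun (a • f) = ENNReal.ofReal (a ^ 2) * toFun f
  parallelogram : ∀ f g : Lp ℝ 2 m,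
    toFun (f + g) + toFun (f - g) = 2 * (toFun f + toFun g)
  lsc : LowerSemicontinuous toFun
  markov : ∀ (η : ℝ → ℝ) (hη : LipschitzWith 1 η) (h0 : η 0 = 0) (f : Lp ℝ 2 m),
    toFun (hη.compLp h0 f) ≤ toFun f
  dense_domain : Dense {f : Lp ℝ 2 m | toFun f < ∞}

namespace DirichletForm

variable {m : Measure X} (E : DirichletForm m)

/-- The domain `𝕍 = D(E) = {E < ∞}`. -/
def domain : Submodule ℝ (Lp ℝ 2 m) where
  carrier := {f | E.toFun f < ∞}
  zero_mem' := by
    have h := E.map_smul 0 0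
    simp at h
    simp [h]
  add_mem' := by
    intro f g hf hg
    change E.toFun f < ∞ at hf
    change E.toFun g < ∞ at hg
    change E.toFun (f + g) < ∞
    refine lt_of_le_of_lt (le_self_add (a := E.toFun (f + g)) (b := E.toFun (f - g))) ?_
    rw [E.parallelogram]
    exact ENNReal.mul_lt_top (by simp) (ENNReal.add_lt_top.2 ⟨hf, hg⟩)
  smul_mem' := by
    intro a f hf
    change E.toFun f < ∞ at hf
    change E.toFun (a • f) < ∞
    rw [E.map_smul]
    exact ENNReal.mul_lt_top ENNReal.ofReal_lt_top hf

/-- The bilinear form obtained from `E` by polarization (meant for arguments in the domain). -/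
def bilin (f g : Lp ℝ 2 m) : ℝ :=
  ((E.toFun (f + g)).toReal - (E.toFun (f - g)).toReal) / 4

/-- `‖f‖_𝕍 = (‖f‖₂² + E(f))^{1/2}`. -/
def vNorm (f : E.domain) : ℝ :=
  Real.sqrt (‖(f : Lp ℝ 2 m)‖ ^ 2 + (E.toFun f).toReal)

/-- Strong locality: `E(f, g) = 0` whenever `(f + a) g = 0` a.e. for some real `a`. -/
def StronglyLocal : Prop :=
  ∀ f g : E.domain,
    (∃ a : ℝ, ∀ᵐ x ∂m, ((f : Lp ℝ 2 m) x + a) * (g : Lp ℝ 2 m) x = 0) → E.bilin f g = 0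

/-- `h = Δ f`: `f ∈ 𝕍` and `E(f, g) = -∫ g h` for all `g ∈ 𝕍`. -/
def IsLaplacian (f : E.domain) (h : Lp ℝ 2 m) : Prop :=
  ∀ g : E.domain, E.bilin f g = -∫ x, (g : Lp ℝ 2 m) x * h x ∂m

/-- `u` is (on `t > 0`) the heat flow started at `f`: a `C¹` curve in `L²` on `(0, ∞)` with values
in `D(Δ)`, solving `u' = Δ u` and converging to `f` in `L²` as `t ↓ 0`. -/
def IsHeatCurve (f : Lp ℝ 2 m) (u : ℝ → E.domain) : Prop :=
  (∃ v : ℝ → Lp ℝ 2 m, ContinuousOn v (Ioi 0) ∧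
    ∀ t : ℝ, 0 < t →
      HasDerivAt (fun τ => (u τ : Lp ℝ 2 m)) (v t) t ∧ E.IsLaplacian (u t) (v t)) ∧
  Tendsto (fun t => (u t : Lp ℝ 2 m)) (𝓝[>] 0) (𝓝 f)

open Classical in
/-- The heat semigroup `P_t f`, for `t > 0`: the value at time `t` of the heat flow started
at `f` (which exists and is unique on `t > 0` for every `f ∈ L²`). -/
def heat (t : ℝ) (f : Lp ℝ 2 m) : E.domain :=
  if h : ∃ u : ℝ → E.domain, E.IsHeatCurve f u then h.choose t else 0

end DirichletForm

/-- The carré du champ of `E`: a symmetric, positive, continuous bilinear map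
`Γ : 𝕍 × 𝕍 → L¹(m)` with `∫ φ Γ(f, f) = E(f, f φ) - E(f², φ) / 2` for bounded `f, φ ∈ 𝕍`.
The products `f φ` and `f²` are represented by the elements `p`, `sq` of `L²`. -/
structure CarreDuChamp {m : Measure X} (E : DirichletForm m) where
  Γ : E.domain →ₗ[ℝ] E.domain →ₗ[ℝ] Lp ℝ 1 m
  symm : ∀ f g, Γ f g = Γ g f
  nonneg : ∀ f, 0 ≤ Γ f f
  bounded : ∃ K : ℝ, ∀ f, ‖Γ f f‖ ≤ K * E.vNorm f ^ 2
  repr : ∀ f φ : E.domain, MemLp (f : Lp ℝ 2 m) ∞ m → MemLp (φ : Lp ℝ 2 m) ∞ m →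
    ∀ p sq : Lp ℝ 2 m,
      (∀ᵐ x ∂m, p x = (f : Lp ℝ 2 m) x * (φ : Lp ℝ 2 m) x) →
      (∀ᵐ x ∂m, sq x = (f : Lp ℝ 2 m) x ^ 2) →
      ∫ x, (φ : Lp ℝ 2 m) x * Γ f f x ∂m = E.bilin f p - E.bilin sq φ / 2

namespace CarreDuChamp

variable {m : Measure X} {E : DirichletForm m} (C : CarreDuChamp E)

/-- `√Γ(f)`. -/
def sqrtΓ (f : E.domain) : X → ℝ := fun x => Real.sqrt (C.Γ f f x)

/-- `f ∈ 𝕍_p`. -/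
def MemV (p : ℝ≥0∞) (f : E.domain) : Prop :=
  MemLp (f : Lp ℝ 2 m) p m ∧ MemLp (C.sqrtΓ f) p m

/-- `‖f‖_{𝕍_p} = ‖f‖_𝕍 + ‖f‖_p + ‖√Γ(f)‖_p`. -/
def vpNorm (p : ℝ≥0∞) (f : E.domain) : ℝ≥0∞ :=
  ENNReal.ofReal (E.vNorm f) + eLpNorm (f : Lp ℝ 2 m) p m + eLpNorm (C.sqrtΓ f) p m

/-- `A` is contained and dense in `𝕍_p`. -/
def DenseInV (A : Submodule ℝ E.domain) (p : ℝ≥0∞) : Prop :=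
  (∀ f ∈ A, C.MemV p f) ∧
  ∀ f : E.domain, C.MemV p f → ∀ ε : ℝ≥0∞, 0 < ε → ∃ φ ∈ A, C.vpNorm p (f - φ) < ε

/-- The standing assumptions on the algebra `A ⊆ 𝕍` of test functions. (Stability under products
is the case `Φ(x, y) = x y` of `comp`.) -/
structure IsTestAlgebra (A : Submodule ℝ E.domain) : Prop where
  memLp : ∀ f ∈ A, ∀ p : ℝ≥0∞, 1 ≤ p → MemLp (f : Lp ℝ 2 m) p m
  comp : ∀ (n : ℕ) (Φ : (Fin n → ℝ) → ℝ), ContDiff ℝ 1 Φ → Φ 0 = 0 →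
    ∀ f : Fin n → E.domain, (∀ i, f i ∈ A) →
      ∃ g ∈ A, ∀ᵐ x ∂m, (g : Lp ℝ 2 m) x = Φ (fun i => (f i : Lp ℝ 2 m) x)
  dense : ∀ (f : E.domain) (ε : ℝ), 0 < ε → ∃ φ ∈ A, E.vNorm (f - φ) < ε
  denseInV : ∀ p : ℝ≥0∞, 1 ≤ p → p ≤ 2 → C.DenseInV A p
  memV_top : ∀ f ∈ A, C.MemV ∞ f

/-- The `L^p`-`Γ` inequality. -/
def LpGamma (p : ℝ≥0∞) : Prop :=
  ∃ c : ℝ, 0 < c ∧ ∀ f : Lp ℝ 2 m, MemLp f p m → ∀ t ∈ Ioo (0 : ℝ) 1,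
    eLpNorm (C.sqrtΓ (E.heat t f)) p m ≤ ENNReal.ofReal (c / Real.sqrt t) * eLpNorm f p m

/-- `0 ≤ f_n ≤ 1`, `f_n ↑ 1` a.e., and `√Γ(f_n) ⇀ 0` weakly-* in `L^∞`, with `f_n ∈ A`. -/
structure IsCutoffSeq (A : Submodule ℝ E.domain) (f : ℕ → E.domain) : Prop where
  mem : ∀ n, f n ∈ A
  bounds : ∀ n, ∀ᵐ x ∂m, 0 ≤ (f n : Lp ℝ 2 m) x ∧ (f n : Lp ℝ 2 m) x ≤ 1
  mono : ∀ n, ∀ᵐ x ∂m, (f n : Lp ℝ 2 m) x ≤ (f (n + 1) : Lp ℝ 2 m) x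
  tendsto_one : ∀ᵐ x ∂m, Tendsto (fun n => (f n : Lp ℝ 2 m) x) atTop (𝓝 1)
  weakStar : ∀ h : X → ℝ, Integrable h m →
    Tendsto (fun n => ∫ x, h x * C.sqrtΓ (f n) x ∂m) atTop (𝓝 0)

/-- A derivation: a linear map `f ↦ df(b)` from `A` to `L⁰(m)` with the Leibniz rule and
`|df(b)| ≤ g √Γ(f)` for some `g ∈ L⁰(m)`. -/
structure VDerivation (A : Submodule ℝ E.domain) where
  toLin : A →ₗ[ℝ] (X →ₘ[m] ℝ)
  leibniz : ∀ f g h : A,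
    (∀ᵐ x ∂m, (h.1 : Lp ℝ 2 m) x = (f.1 : Lp ℝ 2 m) x * (g.1 : Lp ℝ 2 m) x) →
    ∀ᵐ x ∂m, toLin h x = (f.1 : Lp ℝ 2 m) x * toLin g x + (g.1 : Lp ℝ 2 m) x * toLin f x
  bound : ∃ g : X →ₘ[m] ℝ, ∀ f : A, ∀ᵐ x ∂m, |toLin f x| ≤ g x * C.sqrtΓ f.1 x

variable {C} {A : Submodule ℝ E.domain}

namespace VDerivation

/-- `G = df(b)` for `f ∈ 𝕍_p`, where `b` is extended from `A` by density: some sequence in `A`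
converges to `f` in `𝕍_p` and its images converge to `G` in `L^σ + L²`. -/
def IsExtensionValue (b : C.VDerivation A) (p σ : ℝ≥0∞) (f : E.domain) (G : X →ₘ[m] ℝ) : Prop :=
  ∃ φ : ℕ → A, Tendsto (fun n => C.vpNorm p (f - (φ n).1)) atTop (𝓝 0) ∧
    ∃ h₁ h₂ : ℕ → (X →ₘ[m] ℝ), (∀ n, b.toLin (φ n) - G = h₁ n + h₂ n) ∧
      Tendsto (fun n => eLpNorm (h₁ n) σ m) atTop (𝓝 0) ∧
      Tendsto (fun n => eLpNorm (h₂ n) 2 m) atTop (𝓝 0)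

open Classical in
/-- The continuous extension of `b` to `𝕍_p`, with values in `L^σ + L²`. For `A` dense in `𝕍_p`,
`|b| ∈ L^q + L^∞` and `1/σ = 1/p + 1/q` the value exists and is unique. -/
def ext (b : C.VDerivation A) (p σ : ℝ≥0∞) (f : E.domain) : X →ₘ[m] ℝ :=
  if h : ∃ G, b.IsExtensionValue p σ f G then h.choose else 0

/-- `d` induces the distributional divergence of `b`. -/
def IsDivergence (b : C.VDerivation A) (d : X → ℝ) : Prop :=
  ∀ f : A, ∫ x, b.toLin f x ∂m = -∫ x, (f.1 : Lp ℝ 2 m) x * d x ∂m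

/-- `∫ D^{sym} b (f, g) dm`, for `f ∈ 𝕍_r`, `g ∈ 𝕍_s`, with `d = div b`, `Lf = Δ f`, `Lg = Δ g`. -/
def deformation (b : C.VDerivation A) (d : X → ℝ) (r s : ℝ≥0∞)
    (f g : E.domain) (Lf Lg : Lp ℝ 2 m) : ℝ :=
  -(1 / 2) * ∫ x, (b.ext r s.conjExponent f x * Lg x + b.ext s r.conjExponent g x * Lf x
    - d x * C.Γ f g x) ∂m

/-- The deformation of `b` is of type `(r, s)` with constant `c`. -/
def DeformationBound (b : C.VDerivation A) (d : X → ℝ) (r s : ℝ≥0∞) (c : ℝ≥0) : Prop :=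
  ∀ (f g : E.domain) (Lf Lg : Lp ℝ 2 m),
    C.MemV r f → E.IsLaplacian f Lf → MemLp Lf r m →
    C.MemV s g → E.IsLaplacian g Lg → MemLp Lg s m →
    ENNReal.ofReal |b.deformation d r s f g Lf Lg| ≤
      c * eLpNorm (C.sqrtΓ f) r m * eLpNorm (C.sqrtΓ g) s m

/-- `‖D^{sym} b‖_{r,s}`: the smallest admissible constant, `∞` if there is none. -/
def deformationNorm (b : C.VDerivation A) (d : X → ℝ) (r s : ℝ≥0∞) : ℝ≥0∞ :=
  ⨅ (c : ℝ≥0) (_ : b.DeformationBound d r s c), (c : ℝ≥0∞)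

end VDerivation

/-- `g` is a Borel function on `(0, T) × X` (extended to `ℝ × X`) with values in `[0, ∞)` such that
for a.e. `t ∈ (0, T)` one has `|df(b_t)| ≤ g(t, ·) √Γ(f)` a.e., for all `f ∈ A`. -/
def IsBound (T : ℝ) (b : ℝ → C.VDerivation A) (g : ℝ → X → ℝ) : Prop :=
  Measurable (Function.uncurry g) ∧ (∀ t x, 0 ≤ g t x) ∧
  ∀ᵐ t ∂(volume.restrict (Ioo 0 T)), ∀ f : A,
    ∀ᵐ x ∂m, |(b t).toLin f x| ≤ g t x * C.sqrtΓ f.1 x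

/-- A Borel family of derivations on `(0, T)`; the functions `(t, x) ↦ df(b_t)(x)` are measurable
(up to modification for a.e. `t`, a.e. `x`). -/
def IsBorelFamily (T : ℝ) (b : ℝ → C.VDerivation A) : Prop :=
  (∃ g, IsBound T b g) ∧
  ∀ f : A, ∃ F : ℝ → X → ℝ, Measurable (Function.uncurry F) ∧
    ∀ᵐ t ∂(volume.restrict (Ioo 0 T)), ∀ᵐ x ∂m, (b t).toLin f x = F t x

/-- `g = |b|`, the smallest bound for the family `b`. -/
def IsModulus (T : ℝ) (b : ℝ → C.VDerivation A) (g : ℝ → X → ℝ) : Prop :=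
  IsBound T b g ∧
  ∀ g', IsBound T b g' → ∀ᵐ t ∂(volume.restrict (Ioo 0 T)), ∀ᵐ x ∂m, g t x ≤ g' t x

/-- `u` belongs to `L^∞_t(L^r ∩ L²)`, is weakly continuous in `[0, T)` in duality with `A`, and is
a weak solution of `∂_t u + div(u b) = 0` in `(0, T) × X` with initial condition `u0`. -/
structure IsWeakSolution (T : ℝ) (b : ℝ → C.VDerivation A) (r : ℝ≥0∞) (u0 : Lp ℝ 2 m)
    (u : ℝ → Lp ℝ 2 m) : Prop where
  aestronglyMeasurable : AEStronglyMeasurable u (volume.restrict (Ioo 0 T))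
  bounded : ∃ K : ℝ≥0, ∀ᵐ t ∂(volume.restrict (Ioo 0 T)),
    eLpNorm (u t) r m ≤ K ∧ eLpNorm (u t) 2 m ≤ K
  weaklyContinuous : ∀ φ : A,
    ContinuousOn (fun t => ∫ x, (φ.1 : Lp ℝ 2 m) x * u t x ∂m) (Ico 0 T)
  equation : ∀ (φ : A) (ψ : ℝ → ℝ), ContDiff ℝ 1 ψ → ψ T = 0 →
    ∫ t in Ioo 0 T, ∫ x,
        (-(deriv ψ t) * (φ.1 : Lp ℝ 2 m) x - ψ t * (b t).toLin φ x) * u t x ∂m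
      = ψ 0 * ∫ x, (φ.1 : Lp ℝ 2 m) x * u0 x ∂m

end CarreDuChamp

/-- `g ∈ L¹_t(L^q + L^∞)` on `(0, T) × X`, that is, `g` is the sum of a measurable function in
`L¹_t(L^q)` and one in `L¹_t(L^∞)`. (For measurable `g` this is the same as integrability of
`t ↦ ‖g_t‖_{L^q + L^∞}`, by truncating `g_t` at the level `2 ‖g_t‖_{L^q + L^∞}`.) -/
def MemL1Sum (m : Measure X) (T : ℝ) (q : ℝ≥0∞) (g : ℝ → X → ℝ) : Prop :=
  ∃ g₁ g₂ : ℝ → X → ℝ,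
    Measurable (Function.uncurry g₁) ∧ Measurable (Function.uncurry g₂) ∧
    (∀ᵐ t ∂(volume.restrict (Ioo 0 T)), ∀ᵐ x ∂m, g t x = g₁ t x + g₂ t x) ∧
    ∫⁻ t in Ioo 0 T, eLpNorm (g₁ t) q m < ∞ ∧
    ∫⁻ t in Ioo 0 T, eLpNorm (g₂ t) ∞ m < ∞

end ContEq

end

/-! Let w be the difference of two solutions; it solves the equation with zero initial datum. With
β(z) = √(z² + δ²) - δ, a smooth convex substitute for |z|, the heart of the proof is the
renormalised inequality ∫ β(w_t) κ ≤ ∫₀ᵗ ( ∫ β(w) |b| √Γ(κ) + ∫ |β(w) - w β'(w)| κ |div b| ) dτ for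
κ in the algebra with 0 ≤ κ ≤ 1 (`IsEvolution.ofReal_integral_smoothAbs_le`).

The solution is regularised by the resolvent J = l (l - Δ)⁻¹, with l → ∞. Put f = J w, φ = β'(f) κ
and y = J φ. Because Δf = l (f - w) and Δy = l (y - φ), integration by parts for f and y turns the
commutator Q = ∫ w dy(b) + ∫ φ df(b) + ∫ f y div b into l⁻¹ (2 ∫ D^sym b(f, y) - ∫ div b Γ(f, y)),
so the deformation is evaluated only once (`enorm_commutator_le`). The L^p-Γ inequality passes from
the heat flow to J and gives ‖√Γ(J w)‖ ≤ C √l ‖w‖ in L^r and in L^s. Hence Q stays bounded, and it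
tends to 0 because l^(-1/2) ‖√Γ(J w)‖_r → 0 for each fixed w
(`LpGamma.tendsto_interNorm_sqrtΓ_approx`). The term ∫ φ df(b) = ∫ κ d(β(f))(b) is moved onto κ by
the chain rule, and everything else converges (`Setting.exists_ofReal_integral_mul_extend_le`).

In time, w is only weakly continuous and the test function y depends on time. No derivative is
taken. Convexity bounds ∫ β(J w_t) κ - ∫ β(J w_a) κ by the pairing of w_t - w_a with J φ_t, which is
the integral over (a, t] of the rate of change. On short intervals φ_t may be replaced by φ_τ, and
the estimates are then added up (`IsEvolution.ofReal_integral_smoothAbs_res_le`).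

Letting κ run through the cutoffs removes the gradient term, since β(w) |b| is integrable in space
and time. The divergence term is controlled through |β(z) - z β'(z)| ≤ min (β(z), δ), which lies in
L¹ ∩ L^∞. Gronwall yields ∫ β(w_t) + δ ≤ M δ with M independent of δ. As β decreases in δ, letting δ
→ 0 forces w_t = 0.

Much of the remaining work is foundational. The form domain is made a Hilbert space, the resolvent
is shown to contract L^p, the heat flow is constructed by a functional calculus so that the L^p-Γ
hypothesis refers to it, and the derivations are extended from the algebra to the whole form domain.
-/

noncomputable section

/-! ### The form domain as a Hilbert space, and the resolvent. -/

namespace ContEq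

variable {X : Type*} [MeasurableSpace X]

namespace DirichletForm

variable {m : Measure X} (E : DirichletForm m)

/-- The energy `E(f)` of an element of the domain, as a real number. -/
def energy (f : E.domain) : ℝ := (E.toFun f).toReal

lemma energy_nonneg (f : E.domain) : 0 ≤ E.energy f := ENNReal.toReal_nonneg

lemma toFun_ne_top (f : E.domain) : E.toFun f ≠ ∞ := ne_of_lt f.2

lemma energy_parallelogram (f g : E.domain) :
    E.energy (f + g) + E.energy (f - g) = 2 * (E.energy f + E.energy g) := by
  have h := congrArg ENNReal.toReal (E.parallelogram f g)
  have h1 := E.toFun_ne_top (f + g)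
  have h2 := E.toFun_ne_top (f - g)
  push_cast at h1 h2
  rw [ENNReal.toReal_add h1 h2, ENNReal.toReal_mul,
    ENNReal.toReal_add (E.toFun_ne_top f) (E.toFun_ne_top g)] at h
  simpa [energy] using h

lemma energy_smul (a : ℝ) (f : E.domain) : E.energy (a • f) = a ^ 2 * E.energy f := by
  have h := congrArg ENNReal.toReal (E.map_smul a f)
  rw [ENNReal.toReal_mul, ENNReal.toReal_ofReal (sq_nonneg a)] at h
  simpa [energy] using h

/-- The Jordan–von Neumann computation: four instances of the parallelogram law combine to the
identity that makes the polarised form additive. -/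
lemma energy_add_add (x y z : E.domain) :
    E.energy (x + y + z) = E.energy (x + y) + E.energy (x + z) + E.energy (y + z)
      - E.energy x - E.energy y - E.energy z := by
  have h1 := E.energy_parallelogram (x + z) y
  have h2 := E.energy_parallelogram (y + z) x
  have h3 := E.energy_parallelogram z (x - y)
  have h4 := E.energy_parallelogram x y
  have e1 : x + z + y = x + y + z := by abel
  have e2 : y + z + x = x + y + z := by abel
  have e3 : z + (x - y) = x + z - y := by abel
  have e4 : z - (x - y) = y + z - x := by abel
  rw [e1] at h1; rw [e2] at h2; rw [e3, e4] at h3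
  linarith

lemma bilin_eq (f g : E.domain) :
    E.bilin f g = (E.energy (f + g) - E.energy (f - g)) / 4 := rfl

lemma bilin_eq_half (f g : E.domain) :
    E.bilin f g = (E.energy (f + g) - E.energy f - E.energy g) / 2 := by
  rw [bilin_eq]; linarith [E.energy_parallelogram f g]

lemma bilin_comm (f g : E.domain) : E.bilin f g = E.bilin g f := by
  rw [bilin_eq_half, bilin_eq_half, add_comm]; ring

lemma bilin_self (f : E.domain) : E.bilin f f = E.energy f := by
  rw [bilin_eq_half, ← two_smul ℝ f, energy_smul]; ring

lemma bilin_add_left (f g h : E.domain) :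
    E.bilin (f + g : E.domain) h = E.bilin f h + E.bilin g h := by
  rw [bilin_eq_half, bilin_eq_half, bilin_eq_half, energy_add_add]; ring

lemma abs_bilin_le (f g : E.domain) : |E.bilin f g| ≤ (E.energy f + E.energy g) / 2 := by
  rw [bilin_eq, abs_le]
  have := E.energy_parallelogram f g
  constructor <;> linarith [E.energy_nonneg (f + g), E.energy_nonneg (f - g)]

/-- Additivity alone gives rational homogeneity, and continuity at 0 gives the rest. For continuity,
n |E(a f, g)| = |E(n a f, g)| ≤ (n² a² E(f) + E(g)) / 2. The integer n is taken large against E(g),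
and only then a is taken small. -/
lemma bilin_smul_left (a : ℝ) (f g : E.domain) :
    E.bilin (a • f : E.domain) g = a * E.bilin f g := by
  let φ : ℝ →+ ℝ := AddMonoidHom.mk' (fun a => E.bilin (a • f : E.domain) g) (by
    intro a b
    simp only [add_smul]
    exact E.bilin_add_left (a • f) (b • f) g)
  have hφ : Continuous φ := by
    apply continuous_of_continuousAt_zero
    rw [ContinuousAt, map_zero, Metric.tendsto_nhds_nhds]
    intro ε hε
    obtain ⟨n, hn⟩ := exists_nat_gt (E.energy g / ε)
    have hn0 : (0 : ℝ) < n := lt_of_le_of_lt (by have := E.energy_nonneg g; positivity) hn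
    have hg : E.energy g < n * ε := (div_lt_iff₀ hε).1 hn
    have hf := E.energy_nonneg f
    refine ⟨min 1 (ε / (n * (E.energy f + 1))), by positivity, fun {a} ha => ?_⟩
    rw [dist_zero_right, Real.norm_eq_abs] at *
    have ha1 : |a| < 1 := lt_of_lt_of_le ha (min_le_left _ _)
    have ha2 : |a| * (n * (E.energy f + 1)) < ε := by
      rw [← lt_div_iff₀ (by positivity)]; exact lt_of_lt_of_le ha (min_le_right _ _)
    have h1 : φ (n * a) = n * φ a := by
      rw [← nsmul_eq_mul, map_nsmul, nsmul_eq_mul]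
    have h2 : |φ (n * a)| ≤ ((n * a) ^ 2 * E.energy f + E.energy g) / 2 := by
      have := E.abs_bilin_le ((n * a) • f) g
      rwa [energy_smul] at this
    rw [h1, abs_mul, abs_of_pos hn0] at h2
    have h3 : a ^ 2 ≤ |a| := by rw [← sq_abs]; nlinarith [abs_nonneg a]
    have h4 : (n * a) ^ 2 * E.energy f ≤ n * (|a| * (n * (E.energy f + 1))) := by
      have h5 : a ^ 2 * E.energy f ≤ |a| * (E.energy f + 1) := by nlinarith [abs_nonneg a]
      calc (n * a) ^ 2 * E.energy f = n ^ 2 * (a ^ 2 * E.energy f) := by ring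
        _ ≤ n ^ 2 * (|a| * (E.energy f + 1)) := by gcongr
        _ = _ := by ring
    have h5 : n * |φ a| < n * ε := by
      have : (n : ℝ) * (|a| * (n * (E.energy f + 1))) < n * ε := by gcongr
      linarith
    exact lt_of_mul_lt_mul_left h5 hn0.le
  have h := map_real_smul φ hφ a 1
  simpa [φ] using h

/-- The energy form as a bilinear map on the domain. -/
def form : E.domain →ₗ[ℝ] E.domain →ₗ[ℝ] ℝ :=
  LinearMap.mk₂ ℝ (fun f g => E.bilin f g) E.bilin_add_left
    (fun c f g => by simpa using E.bilin_smul_left c f g)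
    (fun f g h => by
      rw [E.bilin_comm, E.bilin_add_left, E.bilin_comm g, E.bilin_comm h])
    (fun c f g => by
      rw [E.bilin_comm, E.bilin_smul_left, E.bilin_comm, smul_eq_mul])

lemma form_apply (f g : E.domain) : E.form f g = E.bilin f g := rfl

lemma form_self (f : E.domain) : E.form f f = E.energy f := E.bilin_self f

lemma form_comm (f g : E.domain) : E.form f g = E.form g f := E.bilin_comm f g

/-- The domain of `E`, as a type carrying the Hilbert norm `‖·‖_𝕍`. -/
def EnergySpace : Type _ := E.domain

instance : AddCommGroup E.EnergySpace := inferInstanceAs (AddCommGroup E.domain)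
instance : Module ℝ E.EnergySpace := inferInstanceAs (Module ℝ E.domain)

/-- The identification of the domain with the energy space. -/
def toV : E.domain ≃ₗ[ℝ] E.EnergySpace := LinearEquiv.refl ℝ E.domain

/-- The inner product `⟨f, g⟩ + E(f, g)` as a bilinear form on the domain. -/
def graphForm : E.domain →ₗ[ℝ] E.domain →ₗ[ℝ] ℝ :=
  ((innerₗ (Lp ℝ 2 m)).compl₁₂ E.domain.subtype E.domain.subtype) + E.form

lemma graphForm_apply (f g : E.domain) :
    E.graphForm f g = inner ℝ (f : Lp ℝ 2 m) (g : Lp ℝ 2 m) + E.form f g := rfl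

instance innerCore : InnerProductSpace.Core ℝ E.EnergySpace where
  inner f g := E.graphForm (E.toV.symm f) (E.toV.symm g)
  conj_inner_symm f g := by
    simp only [conj_trivial, graphForm_apply]
    rw [real_inner_comm, form_comm]
  re_inner_nonneg f := by
    simp only [graphForm_apply, form_self]
    have := real_inner_self_nonneg (x := (E.toV.symm f : Lp ℝ 2 m))
    exact add_nonneg this (E.energy_nonneg _)
  add_left f g h := by simp
  smul_left f g r := by simp
  definite f h := by
    have h1 := E.energy_nonneg (E.toV.symm f)
    have h2 := real_inner_self_nonneg (x := (E.toV.symm f : Lp ℝ 2 m))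
    rw [graphForm_apply, form_self] at h
    have h4 : inner ℝ (E.toV.symm f : Lp ℝ 2 m) (E.toV.symm f : Lp ℝ 2 m) = 0 := by linarith
    have h5 : E.toV.symm f = 0 := Subtype.ext (inner_self_eq_zero.1 h4)
    simpa using h5

instance : NormedAddCommGroup E.EnergySpace :=
  @InnerProductSpace.Core.toNormedAddCommGroup ℝ E.EnergySpace _ _ _ E.innerCore

instance : InnerProductSpace ℝ E.EnergySpace := InnerProductSpace.ofCore E.innerCore.toCore

lemma inner_toV (f g : E.domain) : inner ℝ (E.toV f) (E.toV g) =
    inner ℝ (f : Lp ℝ 2 m) (g : Lp ℝ 2 m) + E.form f g := rfl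

lemma norm_toV_sq (f : E.domain) : ‖E.toV f‖ ^ 2 = ‖(f : Lp ℝ 2 m)‖ ^ 2 + E.energy f := by
  rw [← real_inner_self_eq_norm_sq, inner_toV, real_inner_self_eq_norm_sq, form_self]

lemma norm_toV (f : E.domain) : ‖E.toV f‖ = E.vNorm f := by
  have := E.norm_toV_sq f
  rw [← Real.sqrt_sq (norm_nonneg (E.toV f)), this]; rfl

lemma norm_coe_le (f : E.domain) : ‖(f : Lp ℝ 2 m)‖ ≤ ‖E.toV f‖ := by
  have h := E.norm_toV_sq f
  have := E.energy_nonneg f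
  exact le_of_abs_le (abs_le_of_sq_le_sq (by linarith) (norm_nonneg _))

/-- The inclusion of the energy space in `L²`. -/
def incl : E.EnergySpace →L[ℝ] Lp ℝ 2 m :=
  LinearMap.mkContinuous (E.domain.subtype ∘ₗ E.toV.symm.toLinearMap) 1
    (fun f => by simpa using E.norm_coe_le (E.toV.symm f))

lemma incl_toV (f : E.domain) : E.incl (E.toV f) = f := rfl

/-- This is where lower semicontinuity of the form enters. A Cauchy sequence converges in `L²`, and
the sublevel sets of `E` are closed there, so the bounds on E(v_n - v_k) survive the limit in k.
They show both that the limit has finite energy and that the convergence holds in energy. -/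
instance : CompleteSpace E.EnergySpace := by
  apply Metric.complete_of_cauchySeq_tendsto
  intro u hu
  obtain ⟨v, rfl⟩ : ∃ v : ℕ → E.domain, u = fun n => E.toV (v n) :=
    ⟨fun n => E.toV.symm (u n), by simp⟩
  have hi : CauchySeq (fun n => E.incl (E.toV (v n))) :=
    hu.map E.incl.uniformContinuous
  simp only [incl_toV] at hi
  obtain ⟨f, hf⟩ := cauchySeq_tendsto_of_complete hi
  have key : ∀ ε > 0, ∃ N, ∀ n ≥ N, E.toFun (v n - f) ≤ ENNReal.ofReal (ε ^ 2) := by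
    intro ε hε
    obtain ⟨N, hN⟩ := Metric.cauchySeq_iff.1 hu ε hε
    refine ⟨N, fun n hn => ?_⟩
    have hc : IsClosed {y | E.toFun y ≤ ENNReal.ofReal (ε ^ 2)} :=
      E.lsc.isClosed_preimage _
    refine hc.mem_of_tendsto (tendsto_const_nhds.sub hf) ?_
    filter_upwards [eventually_ge_atTop N] with k hk
    have h1 := hN n hn k hk
    rw [dist_eq_norm, ← map_sub] at h1
    have h2 := E.norm_toV_sq (v n - v k)
    have h3 : E.energy (v n - v k) ≤ ε ^ 2 := by
      have : ‖E.toV (v n - v k)‖ ^ 2 ≤ ε ^ 2 := by gcongr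
      have := sq_nonneg ‖((v n - v k : E.domain) : Lp ℝ 2 m)‖
      linarith
    exact (ENNReal.le_ofReal_iff_toReal_le (E.toFun_ne_top _) (sq_nonneg ε)).2 h3
  have hfd : f ∈ E.domain := by
    obtain ⟨N, hN⟩ := key 1 one_pos
    have h1 : (v N : Lp ℝ 2 m) - f ∈ E.domain :=
      lt_of_le_of_lt (hN N le_rfl) ENNReal.ofReal_lt_top
    have := E.domain.sub_mem (v N).2 h1
    simpa using this
  refine ⟨E.toV ⟨f, hfd⟩, ?_⟩
  rw [Metric.tendsto_atTop]
  intro ε hε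
  obtain ⟨N, hN⟩ := key (ε / 2) (by positivity)
  obtain ⟨M, hM⟩ := Metric.tendsto_atTop.1 hf (ε / 2) (by positivity)
  refine ⟨max N M, fun n hn => ?_⟩
  have h1 := hN n (le_of_max_le_left hn)
  have h2 := hM n (le_of_max_le_right hn)
  rw [dist_eq_norm] at h2 ⊢
  rw [← map_sub]
  have h3 := E.norm_toV_sq (v n - ⟨f, hfd⟩)
  have h4 : E.energy (v n - ⟨f, hfd⟩) ≤ (ε / 2) ^ 2 :=
    ENNReal.toReal_le_of_le_ofReal (sq_nonneg _) h1
  have h5 : ‖((v n - ⟨f, hfd⟩ : E.domain) : Lp ℝ 2 m)‖ ^ 2 ≤ (ε / 2) ^ 2 := by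
    have : ‖((v n - ⟨f, hfd⟩ : E.domain) : Lp ℝ 2 m)‖ < ε / 2 := h2
    gcongr
  refine lt_of_pow_lt_pow_left₀ 2 hε.le ?_
  nlinarith

/-- The coercive form `E(f, g) + l ⟨f, g⟩` on the energy space. -/
def shiftedForm (l : ℝ) : E.EnergySpace →L[ℝ] E.EnergySpace →L[ℝ] ℝ :=
  -- The inner product of the energy space already contains one copy of the `L²` product, hence l -
  -- 1.
  innerSL ℝ + (l - 1) • (innerSL ℝ).bilinearComp E.incl E.incl

lemma shiftedForm_toV (l : ℝ) (f g : E.domain) :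
    E.shiftedForm l (E.toV f) (E.toV g)
      = E.form f g + l * inner ℝ (f : Lp ℝ 2 m) (g : Lp ℝ 2 m) := by
  simp only [shiftedForm, add_apply, smul_apply,
    ContinuousLinearMap.bilinearComp_apply, incl_toV, smul_eq_mul]
  rw [innerSL_apply_apply, innerSL_apply_apply, inner_toV]; ring

lemma shiftedForm_coercive {l : ℝ} (hl : 0 < l) : IsCoercive (E.shiftedForm l) := by
  refine ⟨min 1 l, by positivity, fun x => ?_⟩
  obtain ⟨f, rfl⟩ := E.toV.surjective x
  rw [shiftedForm_toV, form_self, real_inner_self_eq_norm_sq, mul_assoc, ← sq]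
  rw [norm_toV_sq]
  have h1 := E.energy_nonneg f
  have h2 := sq_nonneg ‖(f : Lp ℝ 2 m)‖
  have h3 : min 1 l ≤ 1 := min_le_left _ _
  have h4 : min 1 l ≤ l := min_le_right _ _
  nlinarith [mul_le_mul_of_nonneg_right h3 h1, mul_le_mul_of_nonneg_right h4 h2]

/-- The normalised resolvent `l (l - Δ)⁻¹`, as a bounded operator into the energy space. -/
def resolventV {l : ℝ} (hl : 0 < l) : Lp ℝ 2 m →L[ℝ] E.EnergySpace :=
  l • ((E.shiftedForm_coercive hl).continuousLinearEquivOfBilin.symm :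
    E.EnergySpace →L[ℝ] E.EnergySpace) ∘L ContinuousLinearMap.adjoint E.incl

/-- The normalised resolvent `l (l - Δ)⁻¹`, with values in the domain. -/
def resolvent {l : ℝ} (hl : 0 < l) : Lp ℝ 2 m →ₗ[ℝ] E.domain :=
  E.toV.symm.toLinearMap ∘ₗ (E.resolventV hl).toLinearMap

/-- The normalised resolvent as an operator on `L²`. -/
def res {l : ℝ} (hl : 0 < l) : Lp ℝ 2 m →L[ℝ] Lp ℝ 2 m :=
  E.incl ∘L E.resolventV hl

variable {E}
variable {l : ℝ} (hl : 0 < l)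

lemma toV_resolvent (w : Lp ℝ 2 m) : E.toV (E.resolvent hl w) = E.resolventV hl w := rfl

lemma coe_resolvent (w : Lp ℝ 2 m) : (E.resolvent hl w : Lp ℝ 2 m) = E.res hl w := rfl

lemma resolvent_spec (w : Lp ℝ 2 m) (g : E.domain) :
    E.form (E.resolvent hl w) g + l * inner ℝ (E.res hl w) (g : Lp ℝ 2 m)
      = l * inner ℝ w (g : Lp ℝ 2 m) := by
  rw [← coe_resolvent, ← shiftedForm_toV, toV_resolvent]
  set e := (E.shiftedForm_coercive hl).continuousLinearEquivOfBilin
  have h1 : E.resolventV hl w = l • e.symm (ContinuousLinearMap.adjoint E.incl w) := rfl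
  rw [h1, ContinuousLinearMap.map_smul, smul_apply, smul_eq_mul]
  congr 1
  have h2 := (E.shiftedForm_coercive hl).continuousLinearEquivOfBilin_apply
    (e.symm (ContinuousLinearMap.adjoint E.incl w)) (E.toV g)
  rw [← h2]
  change inner ℝ (e (e.symm _)) _ = _
  rw [e.apply_symm_apply, ContinuousLinearMap.adjoint_inner_left, incl_toV]

/-- Testing the difference of two solutions with itself gives E(d) + l ‖d‖² = 0. This is the tool by
which elements of the domain are recognised as values of the resolvent. -/
lemma resolvent_unique (w : Lp ℝ 2 m) (f : E.domain)
    (h : ∀ g : E.domain, E.form f g + l * inner ℝ (f : Lp ℝ 2 m) (g : Lp ℝ 2 m)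
      = l * inner ℝ w (g : Lp ℝ 2 m)) :
    f = E.resolvent hl w := by
  rw [← sub_eq_zero]
  set d := f - E.resolvent hl w with hd
  have h1 : E.form d d + l * inner ℝ (d : Lp ℝ 2 m) (d : Lp ℝ 2 m) = 0 := by
    have e1 := h d
    have e2 := resolvent_spec hl w d
    have e3 : E.form d d = E.form f d - E.form (E.resolvent hl w) d := by
      rw [← LinearMap.sub_apply, ← map_sub]
    have e4 : inner ℝ (d : Lp ℝ 2 m) (d : Lp ℝ 2 m)
        = inner ℝ (f : Lp ℝ 2 m) (d : Lp ℝ 2 m) - inner ℝ (E.res hl w) (d : Lp ℝ 2 m) := by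
      rw [← inner_sub_left]; rfl
    rw [e3, e4]; linarith
  rw [form_self, real_inner_self_eq_norm_sq] at h1
  have h2 := E.energy_nonneg d
  have h3 : 0 ≤ l * ‖(d : Lp ℝ 2 m)‖ ^ 2 := by positivity
  have h4 : l * ‖(d : Lp ℝ 2 m)‖ ^ 2 = 0 := by linarith
  have h5 := pow_eq_zero_iff two_ne_zero |>.1 ((mul_eq_zero.1 h4).resolve_left hl.ne')
  exact Subtype.ext (norm_eq_zero.1 h5)

lemma form_resolvent (w : Lp ℝ 2 m) (g : E.domain) :
    E.form (E.resolvent hl w) g = l * inner ℝ (w - E.res hl w) (g : Lp ℝ 2 m) := by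
  have := resolvent_spec hl w g
  rw [inner_sub_left]; linarith

lemma isLaplacian_iff (f : E.domain) (h : Lp ℝ 2 m) :
    E.IsLaplacian f h ↔ ∀ g : E.domain, E.form f g = -inner ℝ h (g : Lp ℝ 2 m) := by
  unfold IsLaplacian
  refine forall_congr' fun g => ?_
  rw [form_apply, L2.inner_def]
  simp

lemma isLaplacian_resolvent (w : Lp ℝ 2 m) :
    E.IsLaplacian (E.resolvent hl w) (l • (E.res hl w - w)) := by
  rw [isLaplacian_iff]
  intro g
  refine (form_resolvent hl w g).trans ?_
  rw [real_inner_smul_left, inner_sub_left, inner_sub_left]; ring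

lemma inner_res_comm (v w : Lp ℝ 2 m) :
    inner ℝ (E.res hl v) w = inner ℝ v (E.res hl w) := by
  have h1 := resolvent_spec hl v (E.resolvent hl w)
  have h2 := resolvent_spec hl w (E.resolvent hl v)
  rw [form_comm, coe_resolvent, real_inner_comm] at h2
  rw [coe_resolvent] at h1
  have h3 : l * inner ℝ v (E.res hl w) = l * inner ℝ w (E.res hl v) := by
    linarith
  rw [real_inner_comm]
  exact (mul_left_cancel₀ hl.ne' h3).symm

lemma energy_resolvent (w : Lp ℝ 2 m) :
    E.energy (E.resolvent hl w) = l * inner ℝ (w - E.res hl w) (E.res hl w) := by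
  rw [← form_self]; exact form_resolvent hl w _

lemma norm_res_sq_le (w : Lp ℝ 2 m) : ‖E.res hl w‖ ^ 2 ≤ inner ℝ w (E.res hl w) := by
  have h1 := energy_resolvent (E := E) hl w
  have h2 := E.energy_nonneg (E.resolvent hl w)
  rw [h1] at h2
  have h3 := nonneg_of_mul_nonneg_right h2 hl
  rw [inner_sub_left, real_inner_self_eq_norm_sq] at h3
  linarith

lemma norm_res_le (w : Lp ℝ 2 m) : ‖E.res hl w‖ ≤ ‖w‖ := by
  have h1 := norm_res_sq_le (E := E) hl w
  have h2 := real_inner_le_norm w (E.res hl w)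
  by_cases h : ‖E.res hl w‖ = 0
  · rw [h]; exact norm_nonneg _
  · have : 0 < ‖E.res hl w‖ := lt_of_le_of_ne (norm_nonneg _) (Ne.symm h)
    nlinarith

/-- Expand E(w) around J w. The cross term is 2 E(J w, w - J w) = 2 l ‖w - J w‖², and the two
squares are nonnegative. This gives a rate l^(-1/2) on the domain. -/
lemma norm_res_sub_sq_le (w : E.domain) :
    l * ‖(w : Lp ℝ 2 m) - E.res hl w‖ ^ 2 ≤ E.energy w := by
  have h1 := form_resolvent hl (w : Lp ℝ 2 m) (w - E.resolvent hl (w : Lp ℝ 2 m))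
  have h2 : ((w - E.resolvent hl (w : Lp ℝ 2 m) : E.domain) : Lp ℝ 2 m) = w - E.res hl w := by
    rw [Submodule.coe_sub, coe_resolvent]
  set J := E.resolvent hl (w : Lp ℝ 2 m)
  have h3 : E.form w w = E.form J J + 2 * E.form J (w - J) + E.form (w - J) (w - J) := by
    simp only [map_sub, LinearMap.sub_apply, E.form_comm w J]
    ring
  rw [h2, real_inner_self_eq_norm_sq] at h1
  have h4 := E.energy_nonneg J
  have h5 := E.energy_nonneg (w - J)
  rw [← form_self] at h4 h5
  have h6 : E.energy w = E.form w w := (E.form_self w).symm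
  have : 0 ≤ l * ‖(w : Lp ℝ 2 m) - E.res hl w‖ ^ 2 := by positivity
  rw [h6, h3]; linarith

variable (E) in
lemma exists_domain_dist_lt (w : Lp ℝ 2 m) {ε : ℝ} (hε : 0 < ε) :
    ∃ v : E.domain, ‖w - v‖ < ε := by
  obtain ⟨v, hv, h⟩ := E.dense_domain.exists_dist_lt w hε
  exact ⟨⟨v, hv⟩, by rwa [dist_eq_norm] at h⟩

/-- The rate on the domain, contractivity and density of the domain. The parameter is n + 1, so that
it is positive and at least 1 for every n. -/
lemma tendsto_res (w : Lp ℝ 2 m) :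
    Tendsto (fun n : ℕ => E.res (Nat.cast_add_one_pos (α := ℝ) n) w) atTop (𝓝 w) := by
  rw [Metric.tendsto_atTop]
  intro ε hε
  obtain ⟨v, hv⟩ := E.exists_domain_dist_lt w (show 0 < ε / 3 by positivity)
  have hE := E.energy_nonneg v
  obtain ⟨N, hN⟩ := exists_nat_gt (E.energy v / (ε / 3) ^ 2)
  refine ⟨N, fun n hn => ?_⟩
  set J := E.res (Nat.cast_add_one_pos (α := ℝ) n)
  have h1 : ‖(v : Lp ℝ 2 m) - J v‖ < ε / 3 := by
    have h : ((n : ℝ) + 1) * ‖(v : Lp ℝ 2 m) - J v‖ ^ 2 ≤ E.energy v :=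
      norm_res_sub_sq_le (Nat.cast_add_one_pos (α := ℝ) n) v
    have h2 : E.energy v < (n + 1) * (ε / 3) ^ 2 := by
      rw [div_lt_iff₀ (by positivity)] at hN
      refine hN.trans_le ?_
      gcongr
      have : (N : ℝ) ≤ n := by exact_mod_cast hn
      linarith
    have h3 := lt_of_mul_lt_mul_left (h.trans_lt h2) (Nat.cast_add_one_pos (α := ℝ) n).le
    exact lt_of_pow_lt_pow_left₀ 2 (by positivity) h3
  have h2 : ‖J (w - v)‖ ≤ ‖w - v‖ := norm_res_le _ _
  have h3 : J w - w = J (w - v) - (w - v) - (v - J v) := by rw [map_sub]; abel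
  rw [dist_eq_norm, h3]
  calc _ ≤ ‖J (w - v)‖ + ‖w - v‖ + ‖v - J v‖ :=
        (norm_sub_le _ _).trans (by gcongr; exact norm_sub_le _ _)
    _ < ε := by linarith

end DirichletForm

end ContEq

end

/-! ### Commuting resolvents and contractivity in L^p. -/

noncomputable section

namespace ContEq

variable {X : Type*} [MeasurableSpace X]

namespace DirichletForm

variable {m : Measure X} {E : DirichletForm m}
variable {l : ℝ} (hl : 0 < l)

/-- The first resolvent identity. It also shows that all resolvents have the same range, which is
used for the continuity of the heat flow at time 0. -/
lemma res_eq_res_comp {k : ℝ} (hk : 0 < k) (w : Lp ℝ 2 m) :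
    E.resolvent hl w = E.resolvent hk ((l / k) • w + (1 - l / k) • E.res hl w) := by
  apply resolvent_unique
  intro g
  rw [form_resolvent, inner_add_left, real_inner_smul_left, real_inner_smul_left,
    inner_sub_left, coe_resolvent]
  field_simp
  ring

/-- The resolvent identity produces J_k J_l. Taking adjoints, with each resolvent symmetric, gives
the same identity with J_l J_k in its place. Comparison settles the case l ≠ k. -/
lemma res_comm {k : ℝ} (hk : 0 < k) (w : Lp ℝ 2 m) :
    E.res hl (E.res hk w) = E.res hk (E.res hl w) := by
  have h1 : ∀ v, E.res hl v = (l / k) • E.res hk v + (1 - l / k) • E.res hk (E.res hl v) := by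
    intro v
    have := congrArg (fun f : E.domain => (f : Lp ℝ 2 m)) (res_eq_res_comp (E := E) hl hk v)
    simp only [coe_resolvent] at this
    conv_lhs => rw [this]
    rw [map_add, ContinuousLinearMap.map_smul, ContinuousLinearMap.map_smul]
  have h2 : E.res hl w = (l / k) • E.res hk w + (1 - l / k) • E.res hl (E.res hk w) := by
    refine ext_inner_right ℝ fun v => ?_
    rw [inner_add_left, real_inner_smul_left, real_inner_smul_left, inner_res_comm,
      inner_res_comm hk, inner_res_comm hl, inner_res_comm hk]
    conv_lhs => rw [h1 v]
    rw [inner_add_right, real_inner_smul_right, real_inner_smul_right]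
  by_cases h : l = k
  · subst h; rfl
  · have h3 : (1 - l / k) ≠ 0 := by
      intro h0
      apply h
      field_simp at h0
      linarith
    have h4 := (h1 w).symm.trans h2
    have h5 := add_left_cancel h4
    exact (smul_right_injective _ h3 h5).symm

lemma resolvent_comm {k : ℝ} (hk : 0 < k) (w : Lp ℝ 2 m) :
    E.resolvent hl (E.res hk w) = E.resolvent hk (E.res hl w) :=
  Subtype.ext (res_comm hl hk w)

/-- A normal contraction of an element of the domain is in the domain. -/
def contract (E : DirichletForm m) {η : ℝ → ℝ} (hη : LipschitzWith 1 η) (h0 : η 0 = 0)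
    (f : E.domain) : E.domain :=
  ⟨hη.compLp h0 (f : Lp ℝ 2 m), lt_of_le_of_lt (E.markov η hη h0 f) f.2⟩

lemma contract_ae {η : ℝ → ℝ} (hη : LipschitzWith 1 η) (h0 : η 0 = 0) (f : E.domain) :
    ∀ᵐ x ∂m, (E.contract hη h0 f : Lp ℝ 2 m) x = η ((f : Lp ℝ 2 m) x) := by
  filter_upwards [hη.coeFn_compLp h0 (f : Lp ℝ 2 m)] with x hx
  exact hx

lemma energy_contract_le {η : ℝ → ℝ} (hη : LipschitzWith 1 η) (h0 : η 0 = 0) (f : E.domain) :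
    E.energy (E.contract hη h0 f) ≤ E.energy f :=
  ENNReal.toReal_mono (E.toFun_ne_top f) (E.markov η hη h0 f)

/-- For monotone η the complement z - η(z) is again a normal contraction. So E(f - η(f)) ≤ E(f),
which reads 2 E(f, η(f)) ≥ E(η(f)) ≥ 0. -/
lemma form_contract_nonneg {η : ℝ → ℝ} (hη : LipschitzWith 1 η) (h0 : η 0 = 0)
    (hm : Monotone η) (f : E.domain) : 0 ≤ E.form f (E.contract hη h0 f) := by
  have hθ : LipschitzWith 1 (fun x => x - η x) := by
    refine LipschitzWith.of_le_add fun x y => ?_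
    have h1 := hη.dist_le_mul x y
    simp only [Real.dist_eq, NNReal.coe_one, one_mul] at h1 ⊢
    rcases le_total x y with h | h
    · have h2 := hm h
      rw [abs_of_nonpos (by linarith), abs_of_nonpos (by linarith)] at h1
      rw [abs_of_nonpos (by linarith)]
      linarith
    · have h2 := hm h
      rw [abs_of_nonneg (by linarith)]
      linarith
  have e : E.contract hθ (by simp [h0]) f = f - E.contract hη h0 f := by
    apply Subtype.ext
    rw [Submodule.coe_sub]
    apply Lp.ext
    filter_upwards [contract_ae hθ (by simp [h0]) f, contract_ae hη h0 f,
      Lp.coeFn_sub (f : Lp ℝ 2 m) (E.contract hη h0 f : Lp ℝ 2 m)] with x h1 h2 h3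
    rw [h1, h3, Pi.sub_apply, h2]
  have h1 := energy_contract_le hθ (by simp [h0]) f
  rw [e, ← form_self, ← form_self] at h1
  simp only [map_sub, LinearMap.sub_apply, E.form_comm (E.contract hη h0 f) f] at h1
  have h2 := E.energy_nonneg (E.contract hη h0 f)
  rw [← form_self] at h2
  linarith

/-- Since E(J w, η(J w)) = l ∫ (w - J w) η(J w), this is the previous positivity after η has been
rescaled to a normal contraction. -/
lemma integral_resolvent_mul_le {K : ℝ≥0} {η : ℝ → ℝ} (hη : LipschitzWith K η) (h0 : η 0 = 0)
    (hm : Monotone η) (w : Lp ℝ 2 m) :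
    ∫ x, E.res hl w x * η (E.res hl w x) ∂m ≤ ∫ x, w x * η (E.res hl w x) ∂m := by
  -- Dividing by K + 1 instead of K covers K = 0 as well.
  have hK : (0 : ℝ) < K + 1 := by positivity
  have hη' : LipschitzWith 1 (fun x => (K + 1 : ℝ)⁻¹ * η x) := by
    refine LipschitzWith.of_dist_le_mul fun x y => ?_
    have h1 := hη.dist_le_mul x y
    simp only [Real.dist_eq, NNReal.coe_one, one_mul] at h1 ⊢
    rw [← mul_sub, abs_mul, abs_of_pos (by positivity), inv_mul_le_iff₀ hK]
    nlinarith [abs_nonneg (x - y)]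
  have h0' : (fun x => (K + 1 : ℝ)⁻¹ * η x) 0 = 0 := by simp [h0]
  have hm' : Monotone (fun x => (K + 1 : ℝ)⁻¹ * η x) := fun x y h =>
    mul_le_mul_of_nonneg_left (hm h) (by positivity)
  set f := E.resolvent hl w
  have h1 := form_contract_nonneg hη' h0' hm' f
  set g := E.contract hη' h0' f
  rw [form_resolvent] at h1
  have h2 := nonneg_of_mul_nonneg_right h1 hl
  rw [inner_sub_left, sub_nonneg, L2.inner_def, L2.inner_def] at h2
  have key : ∀ v : Lp ℝ 2 m, ∫ x, inner ℝ (v x) ((g : Lp ℝ 2 m) x) ∂m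
      = (K + 1 : ℝ)⁻¹ * ∫ x, v x * η (E.res hl w x) ∂m := by
    intro v
    rw [← integral_const_mul]
    apply integral_congr_ae
    filter_upwards [contract_ae hη' h0' f] with x hx
    rw [hx]
    simp only [RCLike.inner_apply, conj_trivial]
    rw [show ((f : Lp ℝ 2 m) x) = E.res hl w x from rfl]
    ring
  rw [key, key] at h2
  exact le_of_mul_le_mul_left h2 (by positivity)

end DirichletForm

/-- Monotone Lipschitz functions on `[0, ∞)` below `x ↦ x ^ a` and converging to it. -/
lemma exists_lipschitz_approx_rpow {a : ℝ} (ha : 0 < a) :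
    ∃ e : ℕ → ℝ → ℝ, ∀ k, (∀ x, 0 ≤ x → 0 ≤ e k x ∧ e k x ≤ x ^ a) ∧ e k 0 = 0 ∧
      (∀ x y, 0 ≤ x → x ≤ y → e k x ≤ e k y) ∧
      (∃ K : ℝ≥0, ∀ x y, 0 ≤ x → x ≤ y → e k y - e k x ≤ K * (y - x)) ∧
      ∀ x, 0 ≤ x → Tendsto (fun k => e k x) atTop (𝓝 (x ^ a)) := by
  rcases le_total a 1 with h | h
  -- For a ≤ 1 the slope blows up at 0, so the power is cut off by the line of slope k. Once the
  -- power lies below that line, Bernoulli's inequality bounds its increments with slope k.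
  · refine ⟨fun k x => min (k * x) (x ^ a), fun k => ⟨fun x hx => ⟨by positivity,
      min_le_right _ _⟩, by simp [ha.ne'], fun x y hx hxy => by dsimp only; gcongr, ⟨k, ?_⟩, ?_⟩⟩
    · intro x y hx hxy
      dsimp only
      rw [NNReal.coe_natCast]
      rcases le_total ((k : ℝ) * x) (x ^ a) with h1 | h1
      · rw [min_eq_left h1]
        have := min_le_left ((k : ℝ) * y) (y ^ a)
        linarith
      · rw [min_eq_right h1]
        rcases hx.eq_or_lt with h2 | h2
        · subst h2
          have := min_le_left ((k : ℝ) * y) (y ^ a)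
          simp only [ha.ne', ne_eq, not_false_eq_true, Real.zero_rpow]
          linarith
        · refine (sub_le_sub_right (min_le_right _ _) _).trans ?_
          have h3 := rpow_one_add_le_one_add_mul_self (s := y / x - 1)
            (by have : 0 ≤ y / x := div_nonneg (hx.trans hxy) hx
                linarith) ha.le h
          rw [add_sub_cancel, Real.div_rpow (by linarith) hx, div_le_iff₀ (by positivity)] at h3
          have h4 : x ^ a * (y / x - 1) = (x ^ a / x) * (y - x) := by field_simp
          have h5 : x ^ a / x ≤ k := by rwa [div_le_iff₀ h2]
          have h6 : 0 ≤ x ^ a * (y / x - 1) := by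
            rw [h4]; exact mul_nonneg (by positivity) (by linarith)
          calc y ^ a - x ^ a ≤ a * (x ^ a * (y / x - 1)) := by nlinarith
            _ ≤ 1 * (x ^ a * (y / x - 1)) := by gcongr
            _ ≤ k * (y - x) := by
              rw [h4, one_mul]; gcongr
    · intro x hx
      rcases hx.eq_or_lt with h2 | h2
      · subst h2; simp [ha.ne']
      · apply tendsto_const_nhds.congr'
        filter_upwards [tendsto_natCast_atTop_atTop.eventually_ge_atTop (x ^ a / x)] with n hn
        rw [min_eq_right]
        rwa [div_le_iff₀ h2] at hn
  -- For a ≥ 1 the slope grows at infinity, so the argument is frozen at k, where the slope is at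
  -- most a k^(a - 1).
  · refine ⟨fun k x => (min x k) ^ a, fun k => ⟨fun x hx => ⟨by positivity, by dsimp only; gcongr; simp⟩,
      by simp [ha.ne'], fun x y hx hxy => by dsimp only; gcongr, ⟨a.toNNReal * (k : ℝ≥0) ^ (a - 1), ?_⟩, ?_⟩⟩
    · intro x y hx hxy
      set x' := min x (k : ℝ)
      set y' := min y (k : ℝ)
      have hx' : 0 ≤ x' := by positivity
      have hxy' : x' ≤ y' := min_le_min_right _ hxy
      have hd : y' - x' ≤ y - x := by
        simp only [x', y']
        rcases le_total x k with h1 | h1 <;> rcases le_total y k with h2 | h2 <;>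
          simp [h1, h2] <;> linarith
      have hy'k : y' ≤ k := min_le_right _ _
      simp only [NNReal.coe_mul, Real.coe_toNNReal _ ha.le, NNReal.coe_rpow, NNReal.coe_natCast]
      rcases (hx'.trans hxy').eq_or_lt with h2 | h2
      · have : x' = 0 := by linarith
        change y' ^ a - x' ^ a ≤ _
        rw [this, ← h2, sub_self]
        exact mul_nonneg (by positivity) (by linarith)
      · have h3 := one_add_mul_self_le_rpow_one_add (s := x' / y' - 1)
            (by have : 0 ≤ x' / y' := by positivity
                linarith) h
        rw [add_sub_cancel, Real.div_rpow hx' h2.le, le_div_iff₀ (by positivity)] at h3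
        have h4 : y' ^ a = y' ^ (a - 1) * y' := by
          rw [← Real.rpow_add_one h2.ne']; simp
        have h5 : y' ^ a * (x' / y' - 1) = y' ^ (a - 1) * (x' - y') := by
          rw [h4]; field_simp
        calc y' ^ a - x' ^ a ≤ a * y' ^ (a - 1) * (y' - x') := by nlinarith
          _ ≤ a * (k : ℝ) ^ (a - 1) * (y - x) := by
            have : 0 ≤ a - 1 := by linarith
            gcongr
    · intro x hx
      apply tendsto_const_nhds.congr'
      filter_upwards [tendsto_natCast_atTop_atTop.eventually_ge_atTop x] with n hn
      rw [min_eq_left hn]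

/-- The natural test function sign(z) |z|^(p-1) is in general not Lipschitz, hence not admissible in
the Markov property. It is replaced by odd extensions of the approximations of the power p - 1. -/
lemma exists_monotone_lipschitz_approx {p : ℝ} (hp : 1 < p) :
    ∃ η : ℕ → ℝ → ℝ, ∀ k, Monotone (η k) ∧ η k 0 = 0 ∧ (∃ K : ℝ≥0, LipschitzWith K (η k)) ∧
      (∀ z, |η k z| ≤ |z| ^ (p - 1)) ∧ (∀ z, 0 ≤ z * η k z) ∧
      ∀ z, Tendsto (fun k => z * η k z) atTop (𝓝 (|z| ^ p)) := by
  obtain ⟨e, he⟩ := exists_lipschitz_approx_rpow (show 0 < p - 1 by linarith)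
  have hpos : ∀ k z, 0 ≤ z → e k (max z 0) - e k (max (-z) 0) = e k z := by
    intro k z hz
    rw [max_eq_left hz, max_eq_right (by linarith), (he k).2.1, sub_zero]
  have hneg : ∀ k z, z ≤ 0 → e k (max z 0) - e k (max (-z) 0) = - e k (-z) := by
    intro k z hz
    rw [max_eq_right hz, max_eq_left (by linarith), (he k).2.1, zero_sub]
  refine ⟨fun k z => e k (max z 0) - e k (max (-z) 0), fun k => ?_⟩
  obtain ⟨hb, h0, hmono, ⟨K, hK⟩, ht⟩ := he k
  have hm1 : Monotone fun z => e k (max z 0) := fun x y hxy =>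
    hmono _ _ (le_max_right _ _) (max_le_max_right 0 hxy)
  have hL1 : LipschitzWith K fun z => e k (max z 0) := by
    have h : ∀ x y, x ≤ y → dist (e k (max x 0)) (e k (max y 0)) ≤ K * dist x y := by
      intro x y hxy
      have h1 := hm1 hxy
      simp only at h1
      have h2 := hK _ _ (le_max_right x 0) (max_le_max_right 0 hxy)
      rw [Real.dist_eq, Real.dist_eq, abs_of_nonpos (by linarith), abs_of_nonpos (by linarith)]
      have h3 : max y 0 - max x 0 ≤ y - x := by
        rcases le_total x 0 with h1 | h1 <;> rcases le_total y 0 with h2 | h2 <;>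
          simp [h1, h2] <;> linarith
      have : (K : ℝ) * (max y 0 - max x 0) ≤ K * (y - x) := by gcongr
      linarith
    refine LipschitzWith.of_dist_le_mul fun x y => ?_
    rcases le_total x y with hxy | hxy
    · exact h x y hxy
    · rw [dist_comm, dist_comm x]; exact h y x hxy
  refine ⟨fun x y hxy => sub_le_sub (hm1 hxy) (hm1 (neg_le_neg hxy)), by simp,
    ⟨K + K, ?_⟩, ?_, ?_, ?_⟩
  · have := hL1.sub (hL1.comp (LipschitzWith.id.neg))
    simpa using this
  · intro z
    simp only
    rcases le_total 0 z with h | h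
    · rw [hpos k z h, abs_of_nonneg (hb z h).1, abs_of_nonneg h]; exact (hb z h).2
    · have h' : 0 ≤ -z := by linarith
      rw [hneg k z h, abs_neg, abs_of_nonneg (hb _ h').1, abs_of_nonpos h]; exact (hb _ h').2
  · intro z
    simp only
    rcases le_total 0 z with h | h
    · rw [hpos k z h]; exact mul_nonneg h (hb z h).1
    · have h' : 0 ≤ -z := by linarith
      rw [hneg k z h]; nlinarith [(hb _ h').1]
  · intro z
    have key : ∀ y : ℝ, 0 ≤ y → Tendsto (fun k => y * e k y) atTop (𝓝 (y ^ p)) := by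
      intro y hy
      have := ((he 0).2.2.2.2 y hy).const_mul y
      rcases hy.eq_or_lt with h2 | h2
      · subst h2; simp [(by linarith : p ≠ 0)]
      · convert this using 2
        nth_rewrite 2 [← Real.rpow_one y]
        rw [← Real.rpow_add h2]; ring_nf
    rcases le_total 0 z with h | h
    · simp only [fun k => hpos k z h]
      rw [abs_of_nonneg h]; exact key z h
    · have h' : 0 ≤ -z := by linarith
      simp only [fun k => hneg k z h]
      rw [abs_of_nonpos h]
      convert key _ h' using 2
      ring

namespace DirichletForm

variable {m : Measure X} {E : DirichletForm m}
variable {l : ℝ} (hl : 0 < l)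

/-- The resolvent is a contraction of `L^p`. -/
lemma lintegral_res_rpow_le {p : ℝ} (hp : 1 < p) (w : Lp ℝ 2 m)
    (hw : ∫⁻ x, ENNReal.ofReal (|w x| ^ p) ∂m < ∞) :
    ∫⁻ x, ENNReal.ofReal (|E.res hl w x| ^ p) ∂m ≤ ∫⁻ x, ENNReal.ofReal (|w x| ^ p) ∂m := by
  obtain ⟨η, hη⟩ := exists_monotone_lipschitz_approx hp
  set f := E.res hl w
  have hp0 : 0 < p := by linarith
  have hfm := (Lp.stronglyMeasurable f).measurable
  have hwm := (Lp.stronglyMeasurable w).measurable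
  have hwint : Integrable (fun x => |w x| ^ p) m := by
    refine ⟨(hwm.abs.pow_const p).aestronglyMeasurable, ?_⟩
    rw [hasFiniteIntegral_iff_ofReal (by filter_upwards with x; positivity)]
    exact hw
  have hηm : ∀ k, Measurable (η k) := fun k => (hη k).1.measurable
  have step : ∀ k, ∫⁻ x, ENNReal.ofReal (f x * η k (f x)) ∂m
      ≤ ∫⁻ x, ENNReal.ofReal (|w x| ^ p) ∂m := by
    intro k
    obtain ⟨hm, h0, ⟨K, hK⟩, hle, hnn, -⟩ := hη k
    have hfi : MemLp (fun x => η k (f x)) 2 m := hK.comp_memLp h0 (Lp.memLp f)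
    have i1 : Integrable (fun x => f x * η k (f x)) m := (Lp.memLp f).integrable_mul hfi
    have i2 : Integrable (fun x => w x * η k (f x)) m := (Lp.memLp w).integrable_mul hfi
    have h1 := integral_resolvent_mul_le (E := E) hl hK h0 hm w
    have hpq : p.HolderConjugate (Real.conjExponent p) := Real.HolderConjugate.conjExponent hp
    set p' := Real.conjExponent p
    have h2 : ∀ x, w x * η k (f x) ≤ |w x| ^ p / p + (f x * η k (f x)) / p' := by
      intro x
      have y1 : w x * η k (f x) ≤ |w x| * |η k (f x)| := by
        rw [← abs_mul]; exact le_abs_self _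
      have y2 := Real.young_inequality_of_nonneg (abs_nonneg (w x)) (abs_nonneg (η k (f x))) hpq
      -- As |η(z)| ≤ |z|^(p-1) and (p - 1)(p' - 1) = 1, the power |η(z)|^(p'-1) is at most |z|. The
      -- conjugate power in Young's inequality is therefore dominated by the quantity to be
      -- estimated.
      have y3 : |η k (f x)| ^ p' ≤ f x * η k (f x) := by
        have z1 : f x * η k (f x) = |f x| * |η k (f x)| := by
          rw [← abs_mul, abs_of_nonneg (hnn _)]
        have z2 : |η k (f x)| ^ (p' - 1) ≤ |f x| := by
          calc |η k (f x)| ^ (p' - 1) ≤ (|f x| ^ (p - 1)) ^ (p' - 1) := by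
                have := hpq.symm.sub_one_pos
                gcongr
                exact hle _
            _ = |f x| := by
                have : (p - 1) * (p' - 1) = 1 := by
                  have := hpq.sub_one_mul_conj
                  linarith
                rw [← Real.rpow_mul (abs_nonneg _), this, Real.rpow_one]
        rcases (abs_nonneg (η k (f x))).eq_or_lt with h | h
        · rw [z1, ← h, Real.zero_rpow hpq.symm.ne_zero, mul_zero]
        · rw [z1]
          calc |η k (f x)| ^ p' = |η k (f x)| ^ (p' - 1) * |η k (f x)| := by
                rw [← Real.rpow_add_one h.ne']; simp
            _ ≤ _ := by gcongr
      have y4 : |η k (f x)| ^ p' / p' ≤ (f x * η k (f x)) / p' := by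
        have := hpq.symm.pos
        gcongr
      linarith
    have h3 : ∫ x, w x * η k (f x) ∂m
        ≤ (∫ x, |w x| ^ p ∂m) / p + (∫ x, f x * η k (f x) ∂m) / p' := by
      rw [← integral_div, ← integral_div, ← integral_add (hwint.div_const p) (i1.div_const p')]
      exact integral_mono i2 ((hwint.div_const p).add (i1.div_const p')) h2
    -- The integral of f η(f) is finite and appears on the right with factor 1/p' = 1 - 1/p, so it
    -- can be absorbed. This is why η must be an approximation and not the power itself.
    have h4 : ∫ x, f x * η k (f x) ∂m ≤ ∫ x, |w x| ^ p ∂m := by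
      have h5 := h1.trans h3
      have h6 : p'⁻¹ = 1 - p⁻¹ := by
        have := hpq.inv_add_inv_eq_one
        linarith
      rw [div_eq_mul_inv, div_eq_mul_inv, h6] at h5
      have h7 : 0 < p⁻¹ := by positivity
      nlinarith
    rw [← ofReal_integral_eq_lintegral_ofReal i1 (by filter_upwards with x; exact hnn _),
      ← ofReal_integral_eq_lintegral_ofReal hwint (by filter_upwards with x; positivity)]
    exact ENNReal.ofReal_le_ofReal h4
  -- Fatou's lemma removes the approximation.
  calc ∫⁻ x, ENNReal.ofReal (|f x| ^ p) ∂m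
      = ∫⁻ x, liminf (fun k => ENNReal.ofReal (f x * η k (f x))) atTop ∂m := by
        apply lintegral_congr
        intro x
        exact ((ENNReal.tendsto_ofReal ((hη 0).2.2.2.2.2 (f x))).liminf_eq).symm
    _ ≤ liminf (fun k => ∫⁻ x, ENNReal.ofReal (f x * η k (f x)) ∂m) atTop :=
        lintegral_liminf_le fun k => (hfm.mul ((hηm k).comp hfm)).ennreal_ofReal
    _ ≤ _ := liminf_le_of_le (by isBoundedDefault) fun b hb => by
        obtain ⟨k, hk⟩ := hb.exists
        exact hk.trans (step k)

lemma eLpNorm_res_le {p : ℝ≥0∞} (hp : 1 < p) (hp' : p < ∞) (w : Lp ℝ 2 m) :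
    eLpNorm (E.res hl w) p m ≤ eLpNorm w p m := by
  have h0 : p ≠ 0 := (zero_lt_one.trans hp).ne'
  have h1 : 1 < p.toReal := by
    have := (ENNReal.toReal_lt_toReal ENNReal.one_ne_top hp'.ne).2 hp
    simpa using this
  by_cases hw : eLpNorm w p m = ∞
  · rw [hw]; exact le_top
  have e : ∀ x : ℝ, ‖x‖ₑ ^ p.toReal = ENNReal.ofReal (|x| ^ p.toReal) := by
    intro x
    rw [← Real.norm_eq_abs, ← ENNReal.ofReal_rpow_of_nonneg (norm_nonneg _) (by linarith),
      ofReal_norm]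
  rw [eLpNorm_eq_lintegral_rpow_enorm_toReal h0 hp'.ne,
    eLpNorm_eq_lintegral_rpow_enorm_toReal h0 hp'.ne]
  have hw2 := lintegral_rpow_enorm_lt_top_of_eLpNorm_lt_top h0 hp'.ne (lt_top_iff_ne_top.2 hw)
  simp only [e] at hw2 ⊢
  exact ENNReal.rpow_le_rpow (lintegral_res_rpow_le hl h1 w hw2) (by positivity)

lemma memLp_res {p : ℝ≥0∞} (hp : 1 < p) (hp' : p < ∞) {w : Lp ℝ 2 m} (hw : MemLp w p m) :
    MemLp (E.res hl w) p m :=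
  ⟨Lp.aestronglyMeasurable _, (eLpNorm_res_le hl hp hp' w).trans_lt hw.2⟩

end DirichletForm

end ContEq

end

/-! ### Continuous functional calculus for a symmetric operator between 0 and 1. -/

noncomputable section

namespace ContEq

section FunctionalCalculus

variable {H : Type*} [NormedAddCommGroup H] [InnerProductSpace ℝ H]

lemma norm_aeval_apply_le_of_finiteDimensional [FiniteDimensional ℝ H] {T : H →ₗ[ℝ] H}
    (hT : T.IsSymmetric) (h0 : ∀ x, 0 ≤ inner ℝ (T x) x) (h1 : ∀ x, inner ℝ (T x) x ≤ ‖x‖ ^ 2)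
    (p : Polynomial ℝ) {M : ℝ} (hM : ∀ t ∈ Icc (0 : ℝ) 1, |p.eval t| ≤ M) (x : H) :
    ‖Polynomial.aeval T p x‖ ≤ M * ‖x‖ := by
  set b := hT.eigenvectorBasis rfl
  set μ := hT.eigenvalues rfl
  have hM0 : 0 ≤ M := (abs_nonneg _).trans (hM 0 (by simp))
  have hb : ∀ i, T (b i) = μ i • b i := fun i => by
    have := hT.apply_eigenvectorBasis rfl i
    simpa only [RCLike.ofReal_real_eq_id, id] using this
  have hb1 : ∀ i, ‖b i‖ = 1 := fun i => b.orthonormal.1 i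
  have hμ : ∀ i, μ i ∈ Icc (0 : ℝ) 1 := by
    intro i
    have e1 := h0 (b i)
    have e2 := h1 (b i)
    rw [hb, real_inner_smul_left, real_inner_self_eq_norm_sq, hb1] at e1 e2
    constructor <;> linarith
  have hp : ∀ i, Polynomial.aeval T p (b i) = p.eval (μ i) • b i := by
    intro i
    have : Module.End.HasEigenvector T (μ i) (b i) := by
      rw [Module.End.hasEigenvector_iff]
      refine ⟨Module.End.mem_eigenspace_iff.2 (hb i), fun h => ?_⟩
      have := hb1 i
      rw [h, norm_zero] at this
      exact zero_ne_one this
    exact Module.End.aeval_apply_of_hasEigenvector this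
  have hx : ∀ i, b.repr (Polynomial.aeval T p x) i = p.eval (μ i) * b.repr x i := by
    intro i
    have : Polynomial.aeval T p x = ∑ j, (p.eval (μ j) * b.repr x j) • b j := by
      conv_lhs => rw [← b.sum_repr x]
      rw [map_sum]
      refine Finset.sum_congr rfl fun j _ => ?_
      rw [map_smul, hp, smul_smul, mul_comm]
    rw [this, b.repr_apply_apply, b.orthonormal.inner_right_fintype]
  have h2 : ‖Polynomial.aeval T p x‖ ^ 2 ≤ (M * ‖x‖) ^ 2 := by
    rw [mul_pow, ← b.repr.norm_map, ← b.repr.norm_map x, EuclideanSpace.norm_sq_eq,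
      EuclideanSpace.norm_sq_eq, Finset.mul_sum]
    refine Finset.sum_le_sum fun i _ => ?_
    rw [hx, norm_mul, mul_pow]
    have := hM _ (hμ i)
    gcongr
    exact this
  exact le_of_abs_le (abs_le_of_sq_le_sq h2 (by positivity))

/-- For a single vector x only the span of x, J x, …, Jⁿ x matters, with n the degree of the
polynomial. The compression of J to this finite-dimensional space is symmetric, lies between 0 and
1, and has the same powers on x up to order n. The finite-dimensional spectral theorem then applies.
-/
lemma norm_aeval_apply_le {J : H →L[ℝ] H} (hJ : ∀ x y, inner ℝ (J x) y = inner ℝ x (J y))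
    (h0 : ∀ x, 0 ≤ inner ℝ (J x) x) (h1 : ∀ x, inner ℝ (J x) x ≤ ‖x‖ ^ 2)
    (p : Polynomial ℝ) {M : ℝ} (hM : ∀ t ∈ Icc (0 : ℝ) 1, |p.eval t| ≤ M) (x : H) :
    ‖Polynomial.aeval J p x‖ ≤ M * ‖x‖ := by
  set n := p.natDegree
  set K : Submodule ℝ H := Submodule.span ℝ (Set.range fun i : Fin (n + 1) => (J ^ (i : ℕ)) x)
  have hmem : ∀ i ≤ n, (J ^ i) x ∈ K := fun i hi =>
    Submodule.subset_span ⟨⟨i, by omega⟩, rfl⟩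
  have : FiniteDimensional ℝ K := FiniteDimensional.span_of_finite ℝ (Set.finite_range _)
  set T : K →ₗ[ℝ] K := K.orthogonalProjectionOnto.toLinearMap ∘ₗ J.toLinearMap ∘ₗ K.subtype
  have hTin : ∀ a b : K, inner ℝ (T a) b = inner ℝ (J a) (b : H) := by
    intro a b
    change inner ℝ (K.orthogonalProjectionOnto (J a)) b = _
    rw [Submodule.inner_orthogonalProjectionOnto_eq_of_mem_right]
  have hTs : T.IsSymmetric := by
    intro a b
    rw [hTin, hJ, ← real_inner_comm, ← hTin, real_inner_comm]
  set x0 : K := ⟨x, by simpa using hmem 0 (Nat.zero_le _)⟩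
  have hpow : ∀ i ≤ n, ((T ^ i) x0 : H) = (J ^ i) x := by
    intro i
    induction i with
    | zero => intro _; simp [x0]
    | succ i ih =>
      intro hi
      have e1 : (T ^ (i + 1)) x0 = T ((T ^ i) x0) := by rw [pow_succ']; rfl
      have e2 : (J ^ (i + 1)) x = J ((J ^ i) x) := by rw [pow_succ']; rfl
      rw [e1, e2]
      change (K.orthogonalProjectionOnto (J ((T ^ i) x0 : H)) : H) = _
      rw [ih (by omega), ← e2]
      exact Submodule.starProjection_eq_self_iff.2 (hmem _ hi)
  have hTp : (Polynomial.aeval T p x0 : H) = Polynomial.aeval J p x := by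
    rw [Polynomial.aeval_eq_sum_range, Polynomial.aeval_eq_sum_range]
    simp only [LinearMap.sum_apply, LinearMap.smul_apply, sum_apply,
      smul_apply, Submodule.coe_sum, Submodule.coe_smul]
    refine Finset.sum_congr rfl fun i hi => ?_
    rw [hpow i (by simp at hi; omega)]
  have h := norm_aeval_apply_le_of_finiteDimensional hTs (fun a => by rw [hTin]; exact h0 _)
    (fun a => by rw [hTin]; exact h1 _) p hM x0
  rw [← hTp]
  exact h

/-- The map from polynomials to continuous functions on `[0, 1]`. -/
def polyToCont : Polynomial ℝ →ₗ[ℝ] C(Icc (0 : ℝ) 1, ℝ) :=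
  (Polynomial.toContinuousMapOnAlgHom (Icc (0 : ℝ) 1)).toLinearMap

lemma denseRange_polyToCont : DenseRange polyToCont := by
  have h := polynomialFunctions_closure_eq_top 0 1
  intro f
  have hf : f ∈ (polynomialFunctions (Icc (0 : ℝ) 1)).topologicalClosure := by
    rw [h]; trivial
  rw [← SetLike.mem_coe, Subalgebra.topologicalClosure_coe] at hf
  refine closure_mono ?_ hf
  rw [polynomialFunctions_coe]
  rfl

/-- The continuous functional calculus of a symmetric operator `0 ≤ J ≤ 1`. -/
def funCalc [CompleteSpace H] (J : H →L[ℝ] H) : C(Icc (0 : ℝ) 1, ℝ) →L[ℝ] (H →L[ℝ] H) :=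
  (Polynomial.aeval J).toLinearMap.extendOfNorm polyToCont

variable {J : H →L[ℝ] H} (hJ : ∀ x y, inner ℝ (J x) y = inner ℝ x (J y))
    (h0 : ∀ x, 0 ≤ inner ℝ (J x) x) (h1 : ∀ x, inner ℝ (J x) x ≤ ‖x‖ ^ 2)

include hJ h0 h1

lemma norm_aeval_le_norm_polyToCont (p : Polynomial ℝ) :
    ‖(Polynomial.aeval J).toLinearMap p‖ ≤ 1 * ‖polyToCont p‖ := by
  rw [one_mul]
  refine ContinuousLinearMap.opNorm_le_bound _ (norm_nonneg _) fun x => ?_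
  refine norm_aeval_apply_le hJ h0 h1 p (fun t ht => ?_) x
  exact (polyToCont p).norm_coe_le_norm ⟨t, ht⟩

variable [CompleteSpace H]

lemma funCalc_poly (p : Polynomial ℝ) : funCalc J (polyToCont p) = Polynomial.aeval J p :=
  LinearMap.extendOfNorm_eq denseRange_polyToCont
    ⟨1, norm_aeval_le_norm_polyToCont hJ h0 h1⟩ p

lemma norm_funCalc_le (f : C(Icc (0 : ℝ) 1, ℝ)) : ‖funCalc J f‖ ≤ ‖f‖ := by
  have := LinearMap.norm_extendOfNorm_apply_le denseRange_polyToCont 1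
    (norm_aeval_le_norm_polyToCont hJ h0 h1) f
  rwa [one_mul] at this

/-- `J` composed with `f(J)` is `(x f)(J)`. -/
lemma apply_funCalc (f g : C(Icc (0 : ℝ) 1, ℝ)) (hg : ∀ t, g t = t * f t) (x : H) :
    J (funCalc J f x) = funCalc J g x := by
  set ι : C(Icc (0 : ℝ) 1, ℝ) := ⟨fun t => t, by fun_prop⟩
  have hg' : g = ι * f := by ext t; exact hg t
  rw [hg']
  have hc : Continuous fun f : C(Icc (0 : ℝ) 1, ℝ) => J ∘L funCalc J f :=
    (ContinuousLinearMap.compL ℝ H H H J).continuous.comp (funCalc J).continuous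
  have hc' : Continuous fun f : C(Icc (0 : ℝ) 1, ℝ) => funCalc J (ι * f) :=
    (funCalc J).continuous.comp (continuous_const.mul continuous_id)
  have hι : ∀ p, ι * polyToCont p = polyToCont (Polynomial.X * p) := by
    intro p; ext t; simp [polyToCont, ι]
  have key : (fun f : C(Icc (0 : ℝ) 1, ℝ) => J ∘L funCalc J f)
      = fun f => funCalc J (ι * f) := by
    refine denseRange_polyToCont.equalizer hc hc' ?_
    ext1 p
    simp only [Function.comp]
    rw [hι, funCalc_poly hJ h0 h1, funCalc_poly hJ h0 h1, map_mul, Polynomial.aeval_X]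
    rfl
  exact congrArg (fun A : H →L[ℝ] H => A x) (congrFun key f)

lemma funCalc_apply (f g : C(Icc (0 : ℝ) 1, ℝ)) (hg : ∀ t, g t = t * f t) (x : H) :
    funCalc J f (J x) = funCalc J g x := by
  rw [← apply_funCalc hJ h0 h1 f g hg]
  have hc : Continuous fun f : C(Icc (0 : ℝ) 1, ℝ) => J ∘L funCalc J f :=
    (ContinuousLinearMap.compL ℝ H H H J).continuous.comp (funCalc J).continuous
  have hc' : Continuous fun f : C(Icc (0 : ℝ) 1, ℝ) => funCalc J f ∘L J :=
    ((ContinuousLinearMap.compL ℝ H H H).flip J).continuous.comp (funCalc J).continuous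
  have key : (fun f : C(Icc (0 : ℝ) 1, ℝ) => funCalc J f ∘L J)
      = fun f => J ∘L funCalc J f := by
    refine denseRange_polyToCont.equalizer hc' hc ?_
    ext1 p
    simp only [Function.comp]
    rw [funCalc_poly hJ h0 h1]
    change Polynomial.aeval J p * J = J * Polynomial.aeval J p
    have := congrArg (Polynomial.aeval J) (Polynomial.X_mul (p := p))
    rw [map_mul, map_mul, Polynomial.aeval_X] at this
    exact this.symm
  exact congrArg (fun A : H →L[ℝ] H => A x) (congrFun key f)

lemma funCalc_id (f : C(Icc (0 : ℝ) 1, ℝ)) (hf : ∀ t, f t = t) : funCalc J f = J := by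
  have : f = polyToCont Polynomial.X := by ext t; simp [polyToCont, hf]
  rw [this, funCalc_poly hJ h0 h1, Polynomial.aeval_X]

end FunctionalCalculus

end ContEq

end

/-! ### Construction and uniqueness of the heat flow. -/

noncomputable section

namespace ContEq

/-- The function `x ↦ F (1 / x - 1)` on `[0, 1]`, extended by `0` at `x = 0`. -/
def pullInv (F : ℝ → ℝ) (hF : Continuous F) (h0 : Tendsto F atTop (𝓝 0)) :
    C(Icc (0 : ℝ) 1, ℝ) where
  toFun x := if (x : ℝ) = 0 then 0 else F ((x : ℝ)⁻¹ - 1)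
  continuous_toFun := by
    rw [continuous_iff_continuousAt]
    intro x
    by_cases hx : (x : ℝ) = 0
    · rw [ContinuousAt, if_pos hx, Metric.tendsto_nhds]
      intro ε hε
      obtain ⟨B, hB⟩ := eventually_atTop.1 (Metric.tendsto_nhds.1 h0 ε hε)
      have hd : 0 < (|B| + 2)⁻¹ := by positivity
      filter_upwards [Metric.ball_mem_nhds x hd] with y hy
      split_ifs with h
      · simpa using hε
      · apply hB
        have hy0 : 0 < (y : ℝ) := lt_of_le_of_ne y.2.1 (Ne.symm h)
        rw [Metric.mem_ball, Subtype.dist_eq, hx, Real.dist_eq, sub_zero, abs_of_pos hy0] at hy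
        have := (lt_inv_comm₀ hy0 (by positivity)).1 hy
        have := le_abs_self B
        linarith
    · have h1 : ContinuousAt (fun y : Icc (0 : ℝ) 1 => F ((y : ℝ)⁻¹ - 1)) x := by
        refine hF.continuousAt.comp ?_
        exact (continuous_subtype_val.continuousAt.inv₀ hx).sub continuousAt_const
      refine h1.congr ?_
      have : ∀ᶠ y : Icc (0 : ℝ) 1 in 𝓝 x, (y : ℝ) ≠ 0 :=
        continuous_subtype_val.continuousAt.eventually_ne hx
      filter_upwards [this] with y hy
      rw [if_neg hy]

lemma norm_le_of_forall_inv {f : C(Icc (0 : ℝ) 1, ℝ)} {M : ℝ} (hM : 0 ≤ M)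
    (h0 : |f ⟨0, by simp⟩| ≤ M)
    (h : ∀ (x : ℝ) (hx : 0 < x) (hx1 : x ≤ 1), |f ⟨x, hx.le, hx1⟩| ≤ M) : ‖f‖ ≤ M := by
  rw [ContinuousMap.norm_le _ hM]
  rintro ⟨x, hx⟩
  rcases hx.1.eq_or_lt with h1 | h1
  · subst h1; exact h0
  · exact h x h1 hx.2

lemma pow_mul_exp_neg_le (n : ℕ) {c u : ℝ} (hc : 0 < c) (hu : 0 ≤ u) :
    u ^ n * Real.exp (-(c * u)) ≤ n.factorial / c ^ n := by
  have h := Real.pow_div_factorial_le_exp (c * u) (by positivity) n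
  rw [Real.exp_neg, ← div_eq_mul_inv, div_le_div_iff₀ (Real.exp_pos _) (by positivity)]
  rw [div_le_iff₀ (by positivity), mul_pow] at h
  nlinarith

/-- The function `u ↦ u ^ j * exp (-t u)` in the variable `x = 1 / (1 + u)`. -/
def heatFun (j : ℕ) {t : ℝ} (ht : 0 < t) : C(Icc (0 : ℝ) 1, ℝ) :=
  pullInv (fun u => u ^ j * Real.exp (-(t * u))) (by fun_prop) (by
    have := Real.tendsto_pow_mul_exp_neg_atTop_nhds_zero j
    have h2 := (this.comp (tendsto_id.const_mul_atTop ht)).const_mul (t ^ j)⁻¹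
    rw [mul_zero] at h2
    refine h2.congr fun u => ?_
    simp only [Function.comp, id, mul_pow]
    field_simp)

lemma heatFun_zero (j : ℕ) {t : ℝ} (ht : 0 < t) : heatFun j ht ⟨0, by simp⟩ = 0 := by
  simp [heatFun, pullInv]

lemma heatFun_pos (j : ℕ) {t : ℝ} (ht : 0 < t) {x : ℝ} (hx : 0 < x) (hx1 : x ≤ 1) :
    heatFun j ht ⟨x, hx.le, hx1⟩ = (x⁻¹ - 1) ^ j * Real.exp (-(t * (x⁻¹ - 1))) := by
  exact if_neg hx.ne'

lemma abs_exp_sub_one_sub_le (y : ℝ) : |Real.exp y - 1 - y| ≤ y ^ 2 * Real.exp |y| := by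
  have h := Complex.norm_exp_sub_sum_le_norm_mul_exp (y : ℂ) 2
  simp only [Finset.sum_range_succ, Finset.sum_range_zero, pow_zero, pow_one, Nat.factorial,
    Complex.norm_real, Real.norm_eq_abs, sq_abs] at h
  have e : Complex.exp y - (0 + 1 / ((1 : ℕ) : ℂ) + y / ((1 * 1 : ℕ) : ℂ))
      = ((Real.exp y - 1 - y : ℝ) : ℂ) := by
    push_cast; ring
  simp only [zero_add] at e h
  rw [e, Complex.norm_real, Real.norm_eq_abs] at h
  exact h

/-- A second-order Taylor bound uniform in u. The restriction |h| ≤ t/2 leaves a factor exp(-t u /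
2), which absorbs the power u^(j + 2). As the functional calculus does not increase norms, this
becomes differentiability in operator norm. -/
lemma norm_heatFun_sub_le (j : ℕ) {t h : ℝ} (ht : 0 < t) (hh : |h| ≤ t / 2) (hth : 0 < t + h) :
    ‖heatFun j hth - heatFun j ht - h • (-heatFun (j + 1) ht)‖
      ≤ (j + 2).factorial / (t / 2) ^ (j + 2) * ‖h ^ 2‖ := by
  refine norm_le_of_forall_inv (by positivity) ?_ fun x hx hx1 => ?_
  · simp only [ContinuousMap.coe_sub, ContinuousMap.coe_smul, ContinuousMap.coe_neg, Pi.sub_apply,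
      Pi.smul_apply, Pi.neg_apply, heatFun_zero]
    simp; positivity
  · simp only [ContinuousMap.coe_sub, ContinuousMap.coe_smul, ContinuousMap.coe_neg, Pi.sub_apply,
      Pi.smul_apply, Pi.neg_apply, heatFun_pos _ _ hx hx1, smul_eq_mul]
    set u := x⁻¹ - 1
    have hu : 0 ≤ u := by
      have := (one_le_inv₀ hx).2 hx1
      simp only [u]; linarith
    have e : u ^ j * Real.exp (-((t + h) * u)) - u ^ j * Real.exp (-(t * u))
        - h * -(u ^ (j + 1) * Real.exp (-(t * u)))
        = u ^ j * Real.exp (-(t * u)) * (Real.exp (-(h * u)) - 1 - -(h * u)) := by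
      rw [show -((t + h) * u) = -(t * u) + -(h * u) by ring, Real.exp_add]; ring
    rw [e, abs_mul, abs_of_nonneg (by positivity)]
    have h1 := abs_exp_sub_one_sub_le (-(h * u))
    have h2 : |-(h * u)| ≤ t / 2 * u := by
      rw [abs_neg, abs_mul, abs_of_nonneg hu]; gcongr
    have h3 : Real.exp (-(t * u)) * Real.exp |-(h * u)| ≤ Real.exp (-(t / 2 * u)) := by
      rw [← Real.exp_add]
      apply Real.exp_le_exp.2
      linarith
    calc u ^ j * Real.exp (-(t * u)) * |Real.exp (-(h * u)) - 1 - -(h * u)|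
        ≤ u ^ j * Real.exp (-(t * u)) * ((-(h * u)) ^ 2 * Real.exp |-(h * u)|) := by gcongr
      _ = h ^ 2 * u ^ (j + 2) * (Real.exp (-(t * u)) * Real.exp |-(h * u)|) := by ring
      _ ≤ h ^ 2 * u ^ (j + 2) * Real.exp (-(t / 2 * u)) := by gcongr
      _ = u ^ (j + 2) * Real.exp (-(t / 2 * u)) * ‖h ^ 2‖ := by
        rw [Real.norm_of_nonneg (sq_nonneg h)]; ring
      _ ≤ _ := by
        gcongr
        exact pow_mul_exp_neg_le (j + 2) (by positivity) hu

namespace DirichletForm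

variable {X : Type*} [MeasurableSpace X] {m : Measure X}

lemma inner_res_self_nonneg (E : DirichletForm m) {l : ℝ} (hl : 0 < l) (x : Lp ℝ 2 m) :
    0 ≤ inner ℝ (E.res hl x) x := by
  rw [real_inner_comm]
  exact (sq_nonneg _).trans (norm_res_sq_le hl x)

lemma inner_res_self_le (E : DirichletForm m) {l : ℝ} (hl : 0 < l) (x : Lp ℝ 2 m) :
    inner ℝ (E.res hl x) x ≤ ‖x‖ ^ 2 := by
  refine (real_inner_le_norm _ _).trans ?_
  rw [sq]
  gcongr
  exact norm_res_le hl x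

variable (E : DirichletForm m)

/-- The operator `(-Δ) ^ j exp (t Δ)`, for `t > 0`. -/
def heatOp (j : ℕ) (t : ℝ) : Lp ℝ 2 m →L[ℝ] Lp ℝ 2 m :=
  if ht : 0 < t then funCalc (E.res one_pos) (heatFun j ht) else 0

variable {E}

lemma hasDerivAt_heatOp (j : ℕ) {t : ℝ} (ht : 0 < t) :
    HasDerivAt (E.heatOp j) (-E.heatOp (j + 1) t) t := by
  rw [hasDerivAt_iff_isLittleO_nhds_zero]
  refine Asymptotics.IsBigO.trans_isLittleO (g := fun h : ℝ => h ^ 2) ?_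
    (Asymptotics.isLittleO_pow_id one_lt_two)
  refine Asymptotics.IsBigO.of_bound ((j + 2).factorial / (t / 2) ^ (j + 2)) ?_
  have : ∀ᶠ h : ℝ in 𝓝 0, |h| < t / 2 := by
    have := Metric.ball_mem_nhds (0 : ℝ) (show 0 < t / 2 by positivity)
    filter_upwards [this] with h hh
    simpa using hh
  filter_upwards [this] with h hh
  have hth : 0 < t + h := by linarith [neg_abs_le h]
  simp only [heatOp, dif_pos ht, dif_pos hth]
  rw [← map_neg, ← ContinuousLinearMap.map_smul, ← map_sub, ← map_sub]
  exact (norm_funCalc_le (inner_res_comm one_pos) (E.inner_res_self_nonneg one_pos)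
    (E.inner_res_self_le one_pos) _).trans (norm_heatFun_sub_le j ht hh.le hth)

/-- On symbols this is x (1 + u) = 1. It exhibits the values of the flow as values of the resolvent,
hence as elements of the domain with an explicit Laplacian. -/
lemma res_heatOp {t : ℝ} (ht : 0 < t) (f : Lp ℝ 2 m) :
    E.res one_pos (E.heatOp 0 t f + E.heatOp 1 t f) = E.heatOp 0 t f := by
  simp only [heatOp, dif_pos ht]
  rw [← add_apply, ← map_add]
  refine apply_funCalc (inner_res_comm one_pos) (E.inner_res_self_nonneg one_pos)
    (E.inner_res_self_le one_pos) _ _ ?_ f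
  rintro ⟨x, hx⟩
  rcases hx.1.eq_or_lt with h1 | h1
  · subst h1; rw [heatFun_zero]; simp
  · rw [ContinuousMap.add_apply, heatFun_pos _ _ h1 hx.2, heatFun_pos _ _ h1 hx.2]
    field_simp
    ring

lemma norm_heatOp_le {t : ℝ} (ht : 0 < t) (f : Lp ℝ 2 m) : ‖E.heatOp 0 t f‖ ≤ ‖f‖ := by
  have h1 : ‖E.heatOp 0 t‖ ≤ 1 := by
    simp only [heatOp, dif_pos ht]
    refine (norm_funCalc_le (inner_res_comm one_pos) (E.inner_res_self_nonneg one_pos)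
      (E.inner_res_self_le one_pos) _).trans ?_
    refine norm_le_of_forall_inv zero_le_one (by rw [heatFun_zero]; simp) fun x hx hx1 => ?_
    rw [heatFun_pos _ _ hx hx1, pow_zero, one_mul, abs_of_pos (Real.exp_pos _)]
    have := (one_le_inv₀ hx).2 hx1
    apply Real.exp_le_one_iff.2
    nlinarith
  exact (ContinuousLinearMap.le_opNorm _ _).trans (mul_le_of_le_one_left (norm_nonneg _) h1)

/-- The symbol x (1 - exp(-t u)) is at most x t u = t (1 - x) ≤ t. -/
lemma norm_heatOp_res_sub_le {t : ℝ} (ht : 0 < t) (f : Lp ℝ 2 m) :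
    ‖E.heatOp 0 t (E.res one_pos f) - E.res one_pos f‖ ≤ t * ‖f‖ := by
  set ι : C(Icc (0 : ℝ) 1, ℝ) := ⟨fun t => t, by fun_prop⟩
  have hJ := inner_res_comm (E := E) one_pos
  have h0 := E.inner_res_self_nonneg one_pos
  have h1 := E.inner_res_self_le one_pos
  simp only [heatOp, dif_pos ht]
  rw [funCalc_apply hJ h0 h1 (heatFun 0 ht) (ι * heatFun 0 ht) (fun t => rfl)]
  nth_rewrite 2 [← funCalc_id hJ h0 h1 ι (fun t => rfl)]
  rw [← sub_apply, ← map_sub]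
  refine (ContinuousLinearMap.le_opNorm _ _).trans ?_
  gcongr
  refine (norm_funCalc_le hJ h0 h1 _).trans ?_
  refine norm_le_of_forall_inv ht.le (by simp [ι, ht.le]) fun x hx hx1 => ?_
  simp only [ContinuousMap.coe_sub, ContinuousMap.coe_mul, Pi.sub_apply, Pi.mul_apply,
    heatFun_pos _ _ hx hx1, pow_zero, one_mul, ι, ContinuousMap.coe_mk]
  have hu : 0 ≤ x⁻¹ - 1 := by
    have := (one_le_inv₀ hx).2 hx1
    linarith
  have e1 := Real.add_one_le_exp (-(t * (x⁻¹ - 1)))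
  have e2 : Real.exp (-(t * (x⁻¹ - 1))) ≤ 1 := by
    apply Real.exp_le_one_iff.2; nlinarith
  rw [abs_of_nonpos (by nlinarith)]
  have e3 : x * (t * (x⁻¹ - 1)) = t * (1 - x) := by field_simp
  nlinarith

/-- On the range of the resolvent the convergence has rate t. That range is dense because J_{n+1} f
→ f and J_{n+1} f lies in the range of J₁. -/
lemma tendsto_heatOp (f : Lp ℝ 2 m) :
    Tendsto (fun t => E.heatOp 0 t f) (𝓝[>] 0) (𝓝 f) := by
  rw [Metric.tendsto_nhds]
  intro ε hε
  obtain ⟨n, hn⟩ := (Metric.tendsto_nhds.1 (tendsto_res (E := E) f) (ε / 3)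
    (by positivity)).exists
  obtain ⟨z, hz⟩ : ∃ z, E.res (Nat.cast_add_one_pos (α := ℝ) n) f = E.res one_pos z :=
    ⟨_, congrArg (fun f : E.domain => (f : Lp ℝ 2 m)) (res_eq_res_comp (E := E) _ one_pos f)⟩
  rw [hz, dist_eq_norm] at hn
  have hb : (0 : ℝ) < ε / 3 / (‖z‖ + 1) := by positivity
  filter_upwards [Ioo_mem_nhdsGT hb] with t ht
  have h1 := norm_heatOp_res_sub_le (E := E) ht.1 z
  have h2 := norm_heatOp_le (E := E) ht.1 (E.res one_pos z - f)
  have h3 : t * ‖z‖ < ε / 3 := by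
    have := (lt_div_iff₀ (by positivity)).1 ht.2
    nlinarith [ht.1]
  have e : E.heatOp 0 t f - f = -(E.heatOp 0 t (E.res one_pos z - f))
      + (E.heatOp 0 t (E.res one_pos z) - E.res one_pos z) + (E.res one_pos z - f) := by
    rw [map_sub]; abel
  rw [dist_eq_norm, e]
  calc _ ≤ ‖E.heatOp 0 t (E.res one_pos z - f)‖
        + ‖E.heatOp 0 t (E.res one_pos z) - E.res one_pos z‖ + ‖E.res one_pos z - f‖ := by
        refine (norm_add_le _ _).trans ?_
        gcongr
        refine (norm_add_le _ _).trans ?_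
        rw [norm_neg]
    _ < ε := by linarith

-- `heat` is a choice guarded by existence, with value 0 otherwise. Without this lemma the L^p-Γ
-- hypothesis would carry no information.
variable (E) in
lemma exists_isHeatCurve (f : Lp ℝ 2 m) : ∃ u, E.IsHeatCurve f u := by
  set u : ℝ → E.domain := fun t => E.resolvent one_pos (E.heatOp 0 t f + E.heatOp 1 t f)
  have hu : ∀ t, 0 < t → (u t : Lp ℝ 2 m) = E.heatOp 0 t f := fun t ht => res_heatOp ht f
  have hd : ∀ j t, 0 < t → HasDerivAt (fun t => E.heatOp j t f) (-E.heatOp (j + 1) t f) t := by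
    intro j t ht
    have := (hasDerivAt_heatOp (E := E) j ht)
    exact ((ContinuousLinearMap.apply ℝ (Lp ℝ 2 m) f).hasFDerivAt.comp_hasDerivAt t this)
  refine ⟨u, ⟨fun t => -E.heatOp 1 t f, ?_, fun t ht => ⟨?_, ?_⟩⟩, ?_⟩
  · intro t ht
    exact (hd 1 t ht).continuousAt.continuousWithinAt.neg
  · refine (hd 0 t ht).congr_of_eventuallyEq ?_
    filter_upwards [lt_mem_nhds ht] with s hs
    exact hu s hs
  · have := isLaplacian_resolvent (E := E) one_pos (E.heatOp 0 t f + E.heatOp 1 t f)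
    rw [res_heatOp ht, one_smul] at this
    have e : -E.heatOp 1 t f = E.heatOp 0 t f - (E.heatOp 0 t f + E.heatOp 1 t f) := by abel
    dsimp only
    rwa [e]
  · refine (tendsto_heatOp (E := E) f).congr' ?_
    filter_upwards [self_mem_nhdsWithin] with t ht
    exact (hu t ht).symm

variable (E) in
lemma isHeatCurve_heat (f : Lp ℝ 2 m) : E.IsHeatCurve f (fun t => E.heat t f) := by
  have h := E.exists_isHeatCurve f
  have : (fun t => E.heat t f) = h.choose := by
    funext t
    rw [heat, dif_pos h]
  rw [this]
  exact h.choose_spec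

/-- The squared `L²` distance of two curves has derivative -2 E(u - v) ≤ 0 on t > 0, and it tends to
0 as t ↓ 0. -/
lemma IsHeatCurve.unique {f : Lp ℝ 2 m} {u v : ℝ → E.domain} (hu : E.IsHeatCurve f u)
    (hv : E.IsHeatCurve f v) {t : ℝ} (ht : 0 < t) : u t = v t := by
  obtain ⟨⟨du, -, hu1⟩, hu0⟩ := hu
  obtain ⟨⟨dv, -, hv1⟩, hv0⟩ := hv
  set d : ℝ → Lp ℝ 2 m := fun t => (u t : Lp ℝ 2 m) - v t
  have hd : ∀ s, 0 < s → HasDerivAt d (du s - dv s) s := fun s hs =>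
    (hu1 s hs).1.sub (hv1 s hs).1
  have hn : ∀ s, 0 < s → HasDerivAt (fun s => ‖d s‖ ^ 2) (2 * inner ℝ (d s) (du s - dv s)) s :=
    fun s hs => (hd s hs).norm_sq
  have hle : ∀ s, 0 < s → 2 * inner ℝ (d s) (du s - dv s) ≤ 0 := by
    intro s hs
    have e1 := (isLaplacian_iff _ _).1 (hu1 s hs).2 (u s - v s)
    have e2 := (isLaplacian_iff _ _).1 (hv1 s hs).2 (u s - v s)
    have e3 := E.energy_nonneg (u s - v s)
    rw [← form_self] at e3
    have e4 : E.form (u s - v s) (u s - v s)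
        = E.form (u s) (u s - v s) - E.form (v s) (u s - v s) := by
      rw [← LinearMap.sub_apply, ← map_sub]
    rw [e4, e1, e2, Submodule.coe_sub] at e3
    rw [real_inner_comm, inner_sub_left]
    linarith
  have hanti : AntitoneOn (fun s => ‖d s‖ ^ 2) (Ioi 0) := by
    refine antitoneOn_of_deriv_nonpos (convex_Ioi 0)
      (fun s hs => (hn s hs).continuousAt.continuousWithinAt) ?_ ?_
    · rw [interior_Ioi]
      exact fun s hs => (hn s hs).differentiableAt.differentiableWithinAt
    · rw [interior_Ioi]
      intro s hs
      rw [(hn s hs).deriv]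
      exact hle s hs
  have hlim : Tendsto (fun s => ‖d s‖ ^ 2) (𝓝[>] 0) (𝓝 0) := by
    have := ((hu0.sub hv0).norm.pow 2)
    simpa using this
  have h1 : ‖d t‖ ^ 2 ≤ 0 := by
    refine ge_of_tendsto hlim ?_
    filter_upwards [Ioo_mem_nhdsGT ht] with s hs
    exact hanti hs.1 ht hs.2.le
  have h2 : d t = 0 := by
    have : ‖d t‖ = 0 := by nlinarith [norm_nonneg (d t)]
    exact norm_eq_zero.1 this
  exact Subtype.ext (sub_eq_zero.1 h2)

/-- The heat flow commutes with the resolvent. -/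
lemma heat_res {l : ℝ} (hl : 0 < l) (w : Lp ℝ 2 m) {t : ℝ} (ht : 0 < t) :
    E.heat t (E.res hl w) = E.resolvent hl (E.heat t w : Lp ℝ 2 m) := by
  refine (E.isHeatCurve_heat (E.res hl w)).unique
    (v := fun t => E.resolvent hl (E.heat t w : Lp ℝ 2 m)) ?_ ht
  obtain ⟨⟨v, hv, h1⟩, h0⟩ := E.isHeatCurve_heat w
  refine ⟨⟨fun t => E.res hl (v t), (E.res hl).continuous.comp_continuousOn hv,
    fun t ht => ⟨?_, ?_⟩⟩, ?_⟩
  · exact (E.res hl).hasFDerivAt.comp_hasDerivAt t (h1 t ht).1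
  · rw [isLaplacian_iff]
    intro g
    have e1 := (isLaplacian_iff _ _).1 (h1 t ht).2 (E.resolvent hl g)
    dsimp only at e1
    rw [form_comm, form_resolvent, coe_resolvent, inner_sub_left] at e1
    rw [form_resolvent, inner_res_comm, ← e1, inner_sub_left, inner_res_comm,
      real_inner_comm, real_inner_comm (E.res hl (g : Lp ℝ 2 m))]
  · exact ((E.res hl).continuous.tendsto w).comp h0

/-- The flow satisfies u = J₁ (u - Δu), with u and Δu continuous in `L²`, and J₁ maps `L²`
continuously into the energy space. -/
lemma continuousOn_toV_heat (w : Lp ℝ 2 m) :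
    ContinuousOn (fun t => E.toV (E.heat t w)) (Ioi 0) := by
  obtain ⟨⟨v, hv, h1⟩, -⟩ := E.isHeatCurve_heat w
  have hc : ContinuousOn (fun t => (E.heat t w : Lp ℝ 2 m)) (Ioi 0) :=
    fun t ht => (h1 t ht).1.continuousAt.continuousWithinAt
  refine ((E.resolventV one_pos).continuous.comp_continuousOn (hc.sub hv)).congr ?_
  intro t ht
  simp only [Function.comp, ← toV_resolvent]
  congr 1
  refine resolvent_unique one_pos _ _ fun g => ?_
  rw [(isLaplacian_iff _ _).1 (h1 t ht).2 g, Pi.sub_apply, inner_sub_left]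
  ring

end DirichletForm

end ContEq

end

/-! ### Pointwise calculus for the carré du champ and gradient balls. -/

noncomputable section

namespace ContEq

variable {X : Type*} [MeasurableSpace X] {m : Measure X}

/-- The norm of `L^p ∩ L²`. -/
def interNorm (p : ℝ≥0∞) (f : X → ℝ) (m : Measure X) : ℝ≥0∞ := eLpNorm f p m + eLpNorm f 2 m

lemma eLpNorm_le_interNorm (p : ℝ≥0∞) (f : X → ℝ) : eLpNorm f p m ≤ interNorm p f m :=
  le_self_add

lemma eLpNorm_two_le_interNorm (p : ℝ≥0∞) (f : X → ℝ) : eLpNorm f 2 m ≤ interNorm p f m :=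
  le_add_self

lemma interNorm_lt_top {p : ℝ≥0∞} {f : X → ℝ} (h1 : MemLp f p m) (h2 : MemLp f 2 m) :
    interNorm p f m < ∞ := ENNReal.add_lt_top.2 ⟨h1.2, h2.2⟩

lemma interNorm_congr_ae {p : ℝ≥0∞} {f g : X → ℝ} (h : f =ᵐ[m] g) :
    interNorm p f m = interNorm p g m := by
  rw [interNorm, interNorm, eLpNorm_congr_ae h, eLpNorm_congr_ae h]

lemma interNorm_mono_ae {p : ℝ≥0∞} {f g : X → ℝ} (h : ∀ᵐ x ∂m, ‖f x‖ ≤ ‖g x‖) :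
    interNorm p f m ≤ interNorm p g m :=
  add_le_add (eLpNorm_mono_ae h) (eLpNorm_mono_ae h)

lemma interNorm_add_le {p : ℝ≥0∞} (hp : 1 ≤ p) {f g : X → ℝ} (hf : AEStronglyMeasurable f m)
    (hg : AEStronglyMeasurable g m) :
    interNorm p (f + g) m ≤ interNorm p f m + interNorm p g m := by
  refine (add_le_add (eLpNorm_add_le hf hg hp) (eLpNorm_add_le hf hg one_le_two)).trans ?_
  rw [interNorm, interNorm, add_add_add_comm]

lemma eLpNorm_le_of_tendsto_eLpNorm_two {p : ℝ≥0∞} {f : ℕ → X → ℝ} {g : X → ℝ} {c : ℝ≥0∞}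
    (hf : ∀ n, AEStronglyMeasurable (f n) m) (hg : AEStronglyMeasurable g m)
    (h : Tendsto (fun n => eLpNorm (f n - g) 2 m) atTop (𝓝 0))
    (hc : ∀ n, eLpNorm (f n) p m ≤ c) : eLpNorm g p m ≤ c := by
  obtain ⟨ns, -, hns⟩ :=
    (tendstoInMeasure_of_tendsto_eLpNorm two_ne_zero hf hg h).exists_seq_tendsto_ae
  refine (Lp.eLpNorm_lim_le_liminf_eLpNorm (fun n => hf (ns n)) g hns).trans ?_
  refine liminf_le_of_le (by isBoundedDefault) fun b hb => ?_
  obtain ⟨k, hk⟩ := hb.exists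
  exact hk.trans (hc _)

namespace CarreDuChamp

variable {E : DirichletForm m} (C : CarreDuChamp E)

lemma measurable_sqrtΓ (f : E.domain) : Measurable (C.sqrtΓ f) :=
  (Lp.stronglyMeasurable _).measurable.sqrt

lemma sqrtΓ_nonneg (f : E.domain) (x : X) : 0 ≤ C.sqrtΓ f x := Real.sqrt_nonneg _

lemma Γ_nonneg_ae (f : E.domain) : ∀ᵐ x ∂m, 0 ≤ C.Γ f f x :=
  (Lp.coeFn_nonneg _).2 (C.nonneg f)

lemma sq_sqrtΓ_ae (f : E.domain) : ∀ᵐ x ∂m, C.sqrtΓ f x ^ 2 = C.Γ f f x := by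
  filter_upwards [C.Γ_nonneg_ae f] with x hx
  exact Real.sq_sqrt hx

lemma Γ_add_smul_ae (f g : E.domain) (a : ℝ) : ∀ᵐ x ∂m,
    C.Γ (f + a • g) (f + a • g) x = C.Γ f f x + 2 * a * C.Γ f g x + a ^ 2 * C.Γ g g x := by
  have e : C.Γ (f + a • g) (f + a • g)
      = C.Γ f f + ((2 * a) • C.Γ f g + (a ^ 2) • C.Γ g g) := by
    simp only [map_add, LinearMap.add_apply, map_smul, LinearMap.smul_apply, C.symm g f]
    module
  rw [e]
  filter_upwards [Lp.coeFn_add (C.Γ f f) ((2 * a) • C.Γ f g + (a ^ 2) • C.Γ g g),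
    Lp.coeFn_add ((2 * a) • C.Γ f g) ((a ^ 2) • C.Γ g g), Lp.coeFn_smul (2 * a) (C.Γ f g),
    Lp.coeFn_smul (a ^ 2) (C.Γ g g)] with x h1 h2 h3 h4
  rw [h1, Pi.add_apply, h2, Pi.add_apply, h3, h4]
  simp only [Pi.smul_apply, smul_eq_mul]
  ring

/-- Γ(f + a g) ≥ 0 holds a.e. for each fixed a. Rational a give a common null set, continuity
extends the inequality to real a, and the discriminant concludes. -/
lemma abs_Γ_le_ae (f g : E.domain) : ∀ᵐ x ∂m, |C.Γ f g x| ≤ C.sqrtΓ f x * C.sqrtΓ g x := by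
  have h : ∀ a : ℚ, ∀ᵐ x ∂m,
      0 ≤ C.Γ f f x + 2 * (a : ℝ) * C.Γ f g x + (a : ℝ) ^ 2 * C.Γ g g x := by
    intro a
    filter_upwards [C.Γ_add_smul_ae f g a, C.Γ_nonneg_ae (f + (a : ℝ) • g)] with x h1 h2
    rwa [← h1]
  filter_upwards [ae_all_iff.2 h, C.Γ_nonneg_ae f, C.Γ_nonneg_ae g] with x hx hf hg
  have hr : ∀ a : ℝ, 0 ≤ C.Γ g g x * (a * a) + (2 * C.Γ f g x) * a + C.Γ f f x := by
    have hc : IsClosed {a : ℝ | 0 ≤ C.Γ g g x * (a * a) + (2 * C.Γ f g x) * a + C.Γ f f x} :=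
      isClosed_le continuous_const (by fun_prop)
    intro a
    refine hc.closure_subset_iff.2 ?_ (Rat.denseRange_cast (𝕜 := ℝ) a)
    rintro _ ⟨q, rfl⟩
    have := hx q
    simp only [mem_ofPred_eq]
    linarith
  have hd := discrim_le_zero hr
  rw [discrim] at hd
  rw [sqrtΓ, sqrtΓ, ← Real.sqrt_mul hf]
  apply Real.abs_le_sqrt
  nlinarith

lemma sqrtΓ_add_le_ae (f g : E.domain) :
    ∀ᵐ x ∂m, C.sqrtΓ (f + g) x ≤ C.sqrtΓ f x + C.sqrtΓ g x := by
  filter_upwards [C.Γ_add_smul_ae f g 1, C.abs_Γ_le_ae f g, C.sq_sqrtΓ_ae f, C.sq_sqrtΓ_ae g]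
    with x h1 h2 h3 h4
  rw [one_smul] at h1
  refine Real.sqrt_le_iff.2 ⟨add_nonneg (C.sqrtΓ_nonneg f x) (C.sqrtΓ_nonneg g x), ?_⟩
  rw [h1, ← h3, ← h4]
  nlinarith [le_abs_self (C.Γ f g x)]

lemma sqrtΓ_smul_ae (a : ℝ) (f : E.domain) : ∀ᵐ x ∂m, C.sqrtΓ (a • f) x = |a| * C.sqrtΓ f x := by
  have e : C.Γ (a • f) (a • f) = (a ^ 2) • C.Γ f f := by
    simp only [map_smul, LinearMap.smul_apply, smul_smul, sq]
  filter_upwards [Lp.coeFn_smul (a ^ 2) (C.Γ f f)] with x h1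
  rw [sqrtΓ, e, h1, Pi.smul_apply, smul_eq_mul, Real.sqrt_mul (sq_nonneg a), Real.sqrt_sq_eq_abs]
  rfl

lemma sqrtΓ_sub_comm (f g : E.domain) : C.sqrtΓ (f - g) = C.sqrtΓ (g - f) := by
  have : C.Γ (f - g) (f - g) = C.Γ (g - f) (g - f) := by
    simp only [map_sub, LinearMap.sub_apply]; abel
  unfold sqrtΓ
  rw [this]

lemma abs_sqrtΓ_sub_le_ae (f g : E.domain) :
    ∀ᵐ x ∂m, |C.sqrtΓ f x - C.sqrtΓ g x| ≤ C.sqrtΓ (f - g) x := by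
  have h1 := C.sqrtΓ_add_le_ae (f - g) g
  have h2 := C.sqrtΓ_add_le_ae (g - f) f
  rw [sub_add_cancel] at h1 h2
  filter_upwards [h1, h2] with x h1 h2
  rw [C.sqrtΓ_sub_comm g f] at h2
  rw [abs_le]
  constructor <;> linarith

lemma eLpNorm_sqrtΓ_two_sq (f : E.domain) :
    eLpNorm (C.sqrtΓ f) 2 m ^ 2 = ENNReal.ofReal ‖C.Γ f f‖ := by
  have h1 : eLpNorm (C.sqrtΓ f) 2 m ^ 2 = ∫⁻ x, ‖C.sqrtΓ f x‖ₑ ^ 2 ∂m := by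
    rw [eLpNorm_eq_lintegral_rpow_enorm_toReal two_ne_zero ENNReal.ofNat_ne_top]
    simp only [ENNReal.toReal_ofNat, ENNReal.rpow_ofNat]
    rw [← ENNReal.rpow_ofNat, ← ENNReal.rpow_mul]
    norm_num
  have h2 : ENNReal.ofReal ‖C.Γ f f‖ = ∫⁻ x, ‖C.Γ f f x‖ₑ ∂m := by
    rw [Lp.norm_def, ENNReal.ofReal_toReal (Lp.eLpNorm_ne_top _), eLpNorm_one_eq_lintegral_enorm]
  rw [h1, h2]
  apply lintegral_congr_ae
  filter_upwards [C.sq_sqrtΓ_ae f] with x hx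
  rw [← hx, enorm_pow]

lemma exists_eLpNorm_sqrtΓ_two_le :
    ∃ K : ℝ≥0, ∀ f, eLpNorm (C.sqrtΓ f) 2 m ≤ K * ENNReal.ofReal ‖E.toV f‖ := by
  obtain ⟨K, hK⟩ := C.bounded
  refine ⟨(Real.sqrt (max K 0)).toNNReal, fun f => ?_⟩
  have h1 := C.eLpNorm_sqrtΓ_two_sq f
  have h2 : ‖C.Γ f f‖ ≤ (Real.sqrt (max K 0) * ‖E.toV f‖) ^ 2 := by
    rw [mul_pow, Real.sq_sqrt (le_max_right _ _), E.norm_toV]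
    refine (hK f).trans ?_
    gcongr
    exact le_max_left _ _
  have h3 : eLpNorm (C.sqrtΓ f) 2 m ^ 2
      ≤ ENNReal.ofReal (Real.sqrt (max K 0) * ‖E.toV f‖) ^ 2 := by
    rw [h1, ← ENNReal.ofReal_pow (by positivity)]
    exact ENNReal.ofReal_le_ofReal h2
  have h4 := (ENNReal.pow_le_pow_left_iff two_ne_zero).1 h3
  rwa [ENNReal.ofReal_mul (by positivity)] at h4

lemma memLp_sqrtΓ_two (f : E.domain) : MemLp (C.sqrtΓ f) 2 m := by
  obtain ⟨K, hK⟩ := C.exists_eLpNorm_sqrtΓ_two_le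
  exact ⟨(C.measurable_sqrtΓ f).aestronglyMeasurable,
    (hK f).trans_lt (ENNReal.mul_lt_top ENNReal.coe_lt_top ENNReal.ofReal_lt_top)⟩

lemma tendsto_eLpNorm_sqrtΓ_two {v : ℕ → E.domain} {f : E.domain}
    (h : Tendsto (fun n => E.toV (v n)) atTop (𝓝 (E.toV f))) :
    Tendsto (fun n => eLpNorm (C.sqrtΓ (v n - f)) 2 m) atTop (𝓝 0) := by
  obtain ⟨K, hK⟩ := C.exists_eLpNorm_sqrtΓ_two_le
  have h1 : Tendsto (fun n => K * ENNReal.ofReal ‖E.toV (v n - f)‖) atTop (𝓝 0) := by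
    have h2 : Tendsto (fun n => ‖E.toV (v n - f)‖) atTop (𝓝 0) := by
      simp only [map_sub]
      exact tendsto_iff_norm_sub_tendsto_zero.1 h
    have h3 := ENNReal.Tendsto.const_mul (a := (K : ℝ≥0∞)) (ENNReal.tendsto_ofReal h2)
      (Or.inr ENNReal.coe_ne_top)
    simpa using h3
  exact tendsto_of_tendsto_of_tendsto_of_le_of_le tendsto_const_nhds h1
    (fun _ => zero_le) (fun n => hK _)

/-- The elements of the energy space whose gradient has `L^p` norm at most `c`. -/
def gradBall (p c : ℝ≥0∞) : Set E.EnergySpace := {v | eLpNorm (C.sqrtΓ (E.toV.symm v)) p m ≤ c}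

lemma toV_mem_gradBall {p c : ℝ≥0∞} {f : E.domain} :
    E.toV f ∈ C.gradBall p c ↔ eLpNorm (C.sqrtΓ f) p m ≤ c := by
  simp [gradBall]

lemma eLpNorm_sqrtΓ_add_le {p : ℝ≥0∞} (hp : 1 ≤ p) (f g : E.domain) :
    eLpNorm (C.sqrtΓ (f + g)) p m ≤ eLpNorm (C.sqrtΓ f) p m + eLpNorm (C.sqrtΓ g) p m := by
  refine le_trans ?_ (eLpNorm_add_le (C.measurable_sqrtΓ f).aestronglyMeasurable
    (C.measurable_sqrtΓ g).aestronglyMeasurable hp)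
  refine eLpNorm_mono_ae_real ?_
  filter_upwards [C.sqrtΓ_add_le_ae f g] with x hx
  rw [Real.norm_of_nonneg (C.sqrtΓ_nonneg _ _)]
  exact hx

lemma eLpNorm_sqrtΓ_smul (p : ℝ≥0∞) (a : ℝ) (f : E.domain) :
    eLpNorm (C.sqrtΓ (a • f)) p m = ENNReal.ofReal |a| * eLpNorm (C.sqrtΓ f) p m := by
  have : C.sqrtΓ (a • f) =ᵐ[m] |a| • C.sqrtΓ f := C.sqrtΓ_smul_ae a f
  rw [eLpNorm_congr_ae this, eLpNorm_const_smul, ← ofReal_norm, Real.norm_eq_abs, abs_abs]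

lemma convex_gradBall {p : ℝ≥0∞} (hp : 1 ≤ p) (c : ℝ≥0∞) : Convex ℝ (C.gradBall p c) := by
  intro v hv w hw a b ha hb hab
  obtain ⟨f, rfl⟩ := E.toV.surjective v
  obtain ⟨g, rfl⟩ := E.toV.surjective w
  rw [toV_mem_gradBall] at hv hw
  rw [← map_smul, ← map_smul, ← map_add, toV_mem_gradBall]
  refine (C.eLpNorm_sqrtΓ_add_le hp _ _).trans ?_
  rw [eLpNorm_sqrtΓ_smul, eLpNorm_sqrtΓ_smul, abs_of_nonneg ha, abs_of_nonneg hb]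
  calc _ ≤ ENNReal.ofReal a * c + ENNReal.ofReal b * c := by gcongr
    _ = c := by rw [← add_mul, ← ENNReal.ofReal_add ha hb, hab, ENNReal.ofReal_one, one_mul]

/-- Energy convergence gives `L²` convergence of √Γ, and Fatou's lemma then preserves the L^p bound.
Being closed and convex in the energy space, gradient balls are stable under averages and limits
taken there, so no integration with values in L^p is needed. -/
lemma isClosed_gradBall (p c : ℝ≥0∞) : IsClosed (C.gradBall p c) := by
  refine IsSeqClosed.isClosed fun u v hu huv => ?_
  obtain ⟨w, rfl⟩ : ∃ w : ℕ → E.domain, u = fun n => E.toV (w n) :=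
    ⟨fun n => E.toV.symm (u n), by simp⟩
  obtain ⟨f, rfl⟩ := E.toV.surjective v
  simp only [toV_mem_gradBall] at hu ⊢
  refine eLpNorm_le_of_tendsto_eLpNorm_two
    (fun n => (C.measurable_sqrtΓ (w n)).aestronglyMeasurable)
    (C.measurable_sqrtΓ f).aestronglyMeasurable ?_ hu
  refine tendsto_of_tendsto_of_tendsto_of_le_of_le tendsto_const_nhds
    (C.tendsto_eLpNorm_sqrtΓ_two huv) (fun _ => zero_le) (fun n => ?_)
  refine eLpNorm_mono_ae_real ?_
  filter_upwards [C.abs_sqrtΓ_sub_le_ae (w n) f] with x hx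
  exact hx

end CarreDuChamp

end ContEq

end

/-! ### From the L^p-Γ inequality for the heat flow to a gradient bound for the resolvent. -/

noncomputable section

namespace ContEq

variable {X : Type*} [MeasurableSpace X] {m : Measure X}

namespace CarreDuChamp

variable {E : DirichletForm m} (C : CarreDuChamp E)

lemma smul_mem_gradBall {p c : ℝ≥0∞} {v : E.EnergySpace} (hv : v ∈ C.gradBall p c) (a : ℝ) :
    a • v ∈ C.gradBall p (ENNReal.ofReal |a| * c) := by
  obtain ⟨f, rfl⟩ := E.toV.surjective v
  rw [toV_mem_gradBall] at hv
  rw [← map_smul, toV_mem_gradBall, eLpNorm_sqrtΓ_smul]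
  gcongr

lemma add_mem_gradBall {p c d : ℝ≥0∞} (hp : 1 ≤ p) {v w : E.EnergySpace}
    (hv : v ∈ C.gradBall p c) (hw : w ∈ C.gradBall p d) : v + w ∈ C.gradBall p (c + d) := by
  obtain ⟨f, rfl⟩ := E.toV.surjective v
  obtain ⟨g, rfl⟩ := E.toV.surjective w
  rw [toV_mem_gradBall] at hv hw
  rw [← map_add, toV_mem_gradBall]
  exact (C.eLpNorm_sqrtΓ_add_le hp f g).trans (add_le_add hv hw)

/-- Minkowski's integral inequality for √Γ. With respect to the finite measure c(s) ds, the integral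
of f is the total mass times the average of f / c, and f / c takes its values in the closed convex
ball of radius N. -/
lemma integral_mem_gradBall {p N : ℝ≥0∞} (hp : 1 ≤ p) {a b : ℝ} (hab : a < b)
    {f : ℝ → E.EnergySpace} {c : ℝ → ℝ} (hf : ContinuousOn f (Icc a b))
    (hc : ContinuousOn c (Icc a b)) (hpos : ∀ s ∈ Icc a b, 0 < c s)
    (h : ∀ s ∈ Icc a b, f s ∈ C.gradBall p (ENNReal.ofReal (c s) * N)) :
    ∫ s in a..b, f s ∈ C.gradBall p (ENNReal.ofReal (∫ s in a..b, c s) * N) := by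
  set ν : Measure ℝ := volume.restrict (Ioc a b)
  set μ : Measure ℝ := ν.withDensity (fun s => ENNReal.ofReal (c s))
  have hae : ∀ᵐ s ∂ν, s ∈ Icc a b :=
    (ae_restrict_mem measurableSet_Ioc).mono fun s hs => Ioc_subset_Icc_self hs
  have hci : Integrable c ν := (hc.integrableOn_Icc).mono_set Ioc_subset_Icc_self
  have hfi : Integrable f ν := (hf.integrableOn_Icc).mono_set Ioc_subset_Icc_self
  have hcm : AEMeasurable (fun s => ENNReal.ofReal (c s)) ν := hci.aemeasurable.ennreal_ofReal
  have hlt : ∀ᵐ s ∂ν, ENNReal.ofReal (c s) < ∞ := ae_of_all _ fun s => ENNReal.ofReal_lt_top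
  have hR : ENNReal.ofReal (∫ s in a..b, c s) = μ univ := by
    rw [withDensity_apply _ MeasurableSet.univ, Measure.restrict_univ,
      intervalIntegral.integral_of_le hab.le]
    exact ofReal_integral_eq_lintegral_ofReal hci (hae.mono fun s hs => (hpos s hs).le)
  have hfin : IsFiniteMeasure μ := ⟨by rw [← hR]; exact ENNReal.ofReal_lt_top⟩
  have hRpos : 0 < ∫ s in a..b, c s :=
    intervalIntegral.intervalIntegral_pos_of_pos_on
      ((intervalIntegrable_iff_integrableOn_Ioc_of_le hab.le).2 hci)
      (fun s hs => hpos s (Ioo_subset_Icc_self hs)) hab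
  have hne : NeZero μ := ⟨fun h0 => by
    rw [h0, Measure.coe_zero, Pi.zero_apply, ENNReal.ofReal_eq_zero] at hR
    linarith⟩
  have hsm : ∀ᵐ s ∂ν, (ENNReal.ofReal (c s)).toReal • ((c s)⁻¹ • f s) = f s := by
    filter_upwards [hae] with s hs
    have := hpos s hs
    rw [ENNReal.toReal_ofReal this.le, smul_smul, mul_inv_cancel₀ this.ne', one_smul]
  have hmem : ∀ᵐ s ∂μ, (c s)⁻¹ • f s ∈ C.gradBall p N := by
    refine (withDensity_absolutelyContinuous ν _).ae_le ?_
    filter_upwards [hae] with s hs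
    have h1 := C.smul_mem_gradBall (h s hs) (c s)⁻¹
    have h2 := hpos s hs
    rwa [← mul_assoc, ← ENNReal.ofReal_mul (abs_nonneg _), abs_of_pos (by positivity),
      inv_mul_cancel₀ h2.ne', ENNReal.ofReal_one, one_mul] at h1
  have hint : Integrable (fun s => (c s)⁻¹ • f s) μ := by
    rw [integrable_withDensity_iff_integrable_smul₀' hcm hlt]
    exact hfi.congr (hsm.mono fun s hs => hs.symm)
  have key := (C.convex_gradBall hp N).average_mem (C.isClosed_gradBall p N) hmem hint
  rw [average_eq, integral_withDensity_eq_integral_toReal_smul₀ hcm hlt,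
    integral_congr_ae hsm] at key
  have h3 := C.smul_mem_gradBall key (μ.real univ)
  have h4 : μ.real univ = ∫ s in a..b, c s := by
    rw [Measure.real, ← hR, ENNReal.toReal_ofReal hRpos.le]
  rw [smul_smul, h4, mul_inv_cancel₀ hRpos.ne', one_smul, abs_of_pos hRpos,
    ← intervalIntegral.integral_of_le hab.le] at h3
  exact h3

/-- Over the half line the integral is a Gamma integral. The prefactor l against l^(-1/2) leaves the
growth √l of the gradient bound. -/
lemma integral_exp_div_sqrt_le {l : ℝ} (hl : 0 < l) {a b : ℝ} (ha : 0 < a) (hab : a ≤ b) :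
    ∫ s in a..b, l * Real.exp (-(l * s)) * s ^ (-(1 / 2) : ℝ)
      ≤ Real.Gamma (1 / 2) * Real.sqrt l := by
  have h1 := Real.integral_rpow_mul_exp_neg_mul_Ioi (a := 1 / 2) (by norm_num) hl
  have hi : IntegrableOn (fun s => l * Real.exp (-(l * s)) * s ^ (-(1 / 2) : ℝ)) (Ioi 0) := by
    have := integrableOn_rpow_mul_exp_neg_mul_rpow (p := 1) (s := -(1 / 2)) (by norm_num)
      one_pos hl
    refine IntegrableOn.congr_fun (this.const_mul l) (fun s _ => ?_) measurableSet_Ioi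
    simp only [Real.rpow_one, neg_mul]
    ring
  rw [intervalIntegral.integral_of_le hab]
  have h2 : ∫ s in Ioi 0, l * Real.exp (-(l * s)) * s ^ (-(1 / 2) : ℝ)
      = Real.Gamma (1 / 2) * Real.sqrt l := by
    have : ∀ s : ℝ, l * Real.exp (-(l * s)) * s ^ (-(1 / 2) : ℝ)
        = l * (s ^ ((1 / 2 : ℝ) - 1) * Real.exp (-(l * s))) := by
      intro s
      rw [show ((1 / 2 : ℝ) - 1) = -(1 / 2) by norm_num]; ring
    simp only [this]
    rw [integral_const_mul, h1, ← Real.sqrt_eq_rpow, Real.sqrt_div zero_le_one, Real.sqrt_one]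
    have h3 : Real.sqrt l ≠ 0 := (Real.sqrt_pos.2 hl).ne'
    field_simp
    rw [Real.sq_sqrt hl.le]
  rw [← h2]
  refine setIntegral_mono_set hi ?_ (Eventually.of_forall fun s hs => lt_trans ha hs.1)
  filter_upwards [ae_restrict_mem measurableSet_Ioi] with s hs
  have : (0 : ℝ) < s := hs
  simp only [Pi.zero_apply]
  positivity

/-- The gradient estimate for the resolvent. -/
lemma LpGamma.exists_eLpNorm_sqrtΓ_resolvent_le {p : ℝ≥0∞} (hΓ : C.LpGamma p) (hp : 1 < p)
    (hp' : p < ∞) :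
    ∃ c : ℝ, 0 < c ∧ ∀ (l : ℝ) (hl : 0 < l), 1 ≤ l → ∀ w : Lp ℝ 2 m, MemLp w p m →
      eLpNorm (C.sqrtΓ (E.resolvent hl w)) p m
        ≤ ENNReal.ofReal (c * Real.sqrt l) * eLpNorm w p m := by
  obtain ⟨c, hc, hcΓ⟩ := hΓ
  have hG : 0 < Real.Gamma (1 / 2) := Real.Gamma_pos_of_pos (by norm_num)
  refine ⟨c * 2 + c * Real.Gamma (1 / 2), by positivity, fun l hl hl1 w hw => ?_⟩
  obtain ⟨⟨v, hv, h1⟩, h0⟩ := DirichletForm.isHeatCurve_heat (E := E) w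
  set u : ℝ → E.domain := fun t => E.heat t w
  set N := eLpNorm w p m
  -- J is inverse to 1 - l⁻¹ Δ, and v = Δu.
  have hres : ∀ t, 0 < t → E.resolventV hl ((u t : Lp ℝ 2 m) - l⁻¹ • v t) = E.toV (u t) := by
    intro t ht
    rw [← DirichletForm.toV_resolvent]
    congr 1
    refine (DirichletForm.resolvent_unique hl _ _ fun g => ?_).symm
    rw [(DirichletForm.isLaplacian_iff _ _).1 (h1 t ht).2 g, inner_sub_left,
      real_inner_smul_left]
    field_simp
    ring
  -- The L^p-Γ inequality is available only for times below 1, so the Laplace transform over the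
  -- half line is not used directly. Since F' = -l exp(-l t) P_t w, the value J w is F(1/2) plus the
  -- integral over (0, 1/2). Moreover F(1/2) = exp(-l/2) P_{1/2} J w, which the inequality at time
  -- 1/2 controls.
  set F : ℝ → E.EnergySpace := fun t => Real.exp (-(l * t)) • E.resolventV hl (u t : Lp ℝ 2 m)
  have hF : ∀ t, 0 < t → HasDerivAt F (-((l * Real.exp (-(l * t))) • E.toV (u t))) t := by
    intro t ht
    have e1 : HasDerivAt (fun t => E.resolventV hl (u t : Lp ℝ 2 m)) (E.resolventV hl (v t)) t :=
      (E.resolventV hl).hasFDerivAt.comp_hasDerivAt t (h1 t ht).1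
    have e2 : HasDerivAt (fun t => Real.exp (-(l * t))) (Real.exp (-(l * t)) * (-(l * 1))) t :=
      ((hasDerivAt_id t).const_mul l).neg.exp
    refine (e2.smul e1).congr_deriv ?_
    rw [← hres t ht, map_sub, ContinuousLinearMap.map_smul, smul_sub, smul_smul, neg_sub]
    rw [mul_right_comm, mul_inv_cancel₀ hl.ne', one_mul, mul_one, mul_neg, neg_smul,
      mul_comm (Real.exp _) l, sub_eq_add_neg]
  have hcont : ContinuousOn (fun t => (l * Real.exp (-(l * t))) • E.toV (u t)) (Ioi 0) :=
    have h : Continuous fun t => l * Real.exp (-(l * t)) := by fun_prop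
    h.continuousOn.smul (DirichletForm.continuousOn_toV_heat w)
  have hFh : ∀ t, 0 < t → F t = Real.exp (-(l * t)) • E.toV (E.heat t (E.res hl w)) := by
    intro t ht
    rw [DirichletForm.heat_res hl w ht, DirichletForm.toV_resolvent]
  set M : ℝ≥0∞ := ENNReal.ofReal ((c * 2 + c * Real.Gamma (1 / 2)) * Real.sqrt l) * N
  have hmem : ∀ ε ∈ Ioo (0 : ℝ) (1 / 2), F ε ∈ C.gradBall p M := by
    intro ε hε
    have hsub : Icc ε (1 / 2) ⊆ Ioi 0 := fun s hs => lt_of_lt_of_le hε.1 hs.1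
    have hftc : ∫ t in ε..(1 / 2), -((l * Real.exp (-(l * t))) • E.toV (u t))
        = F (1 / 2) - F ε := by
      apply intervalIntegral.integral_eq_sub_of_hasDerivAt
      · intro t ht
        rw [uIcc_of_le hε.2.le] at ht
        exact hF t (hsub ht)
      · apply ContinuousOn.intervalIntegrable
        rw [uIcc_of_le hε.2.le]
        exact (hcont.mono hsub).neg
    have e : F ε = F (1 / 2) + ∫ t in ε..(1 / 2), (l * Real.exp (-(l * t))) • E.toV (u t) := by
      rw [intervalIntegral.integral_neg] at hftc
      rw [← neg_neg (∫ t in ε..(1 / 2), _), hftc]; abel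
    have b1 : F (1 / 2) ∈ C.gradBall p (ENNReal.ofReal (c * 2) * N) := by
      have g1 : E.toV (E.heat (1 / 2) (E.res hl w))
          ∈ C.gradBall p (ENNReal.ofReal (c / Real.sqrt (1 / 2)) * N) := by
        rw [toV_mem_gradBall]
        refine (hcΓ _ (DirichletForm.memLp_res hl hp hp' hw) _ (by norm_num)).trans ?_
        gcongr
        exact DirichletForm.eLpNorm_res_le hl hp hp' w
      have g2 := C.smul_mem_gradBall g1 (Real.exp (-(l * (1 / 2))))
      rw [hFh _ (by norm_num)]
      refine le_trans (α := ℝ≥0∞) g2 ?_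
      rw [← mul_assoc, ← ENNReal.ofReal_mul (abs_nonneg _)]
      refine mul_le_mul' (ENNReal.ofReal_le_ofReal ?_) le_rfl
      rw [abs_of_pos (Real.exp_pos _)]
      have g3 : Real.exp (-(l * (1 / 2))) ≤ 1 := Real.exp_le_one_iff.2 (by linarith)
      -- A crude bound that turns c / √(1/2) into the constant c * 2.
      have g4 : (1 / 2 : ℝ) ≤ Real.sqrt (1 / 2) := Real.le_sqrt_of_sq_le (by norm_num)
      have g5 : c / Real.sqrt (1 / 2) ≤ c * 2 := by
        rw [div_le_iff₀ (by positivity)]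
        nlinarith
      exact (mul_le_of_le_one_left (by positivity) g3).trans g5
    have b2 : ∫ t in ε..(1 / 2), (l * Real.exp (-(l * t))) • E.toV (u t)
        ∈ C.gradBall p (ENNReal.ofReal (∫ t in ε..(1 / 2), c * (l * Real.exp (-(l * t))
          * t ^ (-(1 / 2) : ℝ))) * N) := by
      refine C.integral_mem_gradBall hp.le hε.2 (hcont.mono hsub) ?_ ?_ ?_
      · refine ContinuousOn.mul continuousOn_const (ContinuousOn.mul (by fun_prop) ?_)
        exact continuousOn_id.rpow_const fun s hs => Or.inl (ne_of_gt (hsub hs))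
      · intro s hs
        have : 0 < s := hsub hs
        positivity
      · intro s hs
        have hs0 : 0 < s := hsub hs
        have g1 : E.toV (u s) ∈ C.gradBall p (ENNReal.ofReal (c / Real.sqrt s) * N) := by
          rw [toV_mem_gradBall]
          exact hcΓ w hw s ⟨hs0, by linarith [hs.2]⟩
        have g2 := C.smul_mem_gradBall g1 (l * Real.exp (-(l * s)))
        rw [← mul_assoc, ← ENNReal.ofReal_mul (abs_nonneg _), abs_of_pos (by positivity)] at g2
        convert g2 using 3
        rw [Real.rpow_neg hs0.le, ← Real.sqrt_eq_rpow]
        field_simp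
    rw [e]
    have b3 := C.add_mem_gradBall hp.le b1 b2
    refine le_trans (α := ℝ≥0∞) b3 ?_
    rw [← add_mul, ← ENNReal.ofReal_add (by positivity) ?_]
    · refine mul_le_mul' (ENNReal.ofReal_le_ofReal ?_) le_rfl
      rw [intervalIntegral.integral_const_mul]
      have := integral_exp_div_sqrt_le hl hε.1 hε.2.le
      have hs : 1 ≤ Real.sqrt l := Real.one_le_sqrt.2 hl1
      nlinarith
    · refine intervalIntegral.integral_nonneg hε.2.le fun s hs => ?_
      have : 0 < s := hsub hs
      positivity
  have hlim : Tendsto F (𝓝[>] 0) (𝓝 (E.toV (E.resolvent hl w))) := by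
    have e1 : Tendsto (fun t => Real.exp (-(l * t))) (𝓝[>] 0) (𝓝 1) := by
      have : Continuous fun t => Real.exp (-(l * t)) := by fun_prop
      have h := this.tendsto 0
      simp only [mul_zero, neg_zero, Real.exp_zero] at h
      exact h.mono_left nhdsWithin_le_nhds
    have e2 := e1.smul (((E.resolventV hl).continuous.tendsto w).comp h0)
    rw [one_smul] at e2
    exact e2
  rw [← toV_mem_gradBall]
  refine (C.isClosed_gradBall p M).mem_of_tendsto hlim ?_
  filter_upwards [Ioo_mem_nhdsGT (show (0 : ℝ) < 1 / 2 by norm_num)] with ε hε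
  exact hmem ε hε

end CarreDuChamp

end ContEq

end

/-! ### Hölder estimates for L^q + L^∞, interpolation, and strong convergence in L^p. -/

noncomputable section

namespace ContEq

variable {X : Type*} [MeasurableSpace X] {m : Measure X}

/-- `a` belongs to `L^q + L^∞`, with norm at most `S`. -/
def IsSumBounded (q : ℝ≥0∞) (a : X → ℝ) (S : ℝ≥0∞) (m : Measure X) : Prop :=
  ∃ a₁ a₂ : X → ℝ, AEStronglyMeasurable a₁ m ∧ AEStronglyMeasurable a₂ m ∧
    (∀ᵐ x ∂m, a x = a₁ x + a₂ x) ∧ eLpNorm a₁ q m + eLpNorm a₂ ∞ m ≤ S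

lemma IsSumBounded.aestronglyMeasurable {q S : ℝ≥0∞} {a : X → ℝ} (h : IsSumBounded q a S m) :
    AEStronglyMeasurable a m := by
  obtain ⟨a₁, a₂, h1, h2, h3, -⟩ := h
  exact (h1.add h2).congr (h3.mono fun x hx => hx.symm)

lemma lintegral_enorm_mul_le {p p' : ℝ≥0∞} (hpp : p⁻¹ + p'⁻¹ = 1) {f g : X → ℝ}
    (hf : AEStronglyMeasurable f m) (hg : AEStronglyMeasurable g m) :
    ∫⁻ x, ‖f x‖ₑ * ‖g x‖ₑ ∂m ≤ eLpNorm f p m * eLpNorm g p' m := by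
  have : ENNReal.HolderTriple p p' 1 := ⟨by simpa using hpp⟩
  have h := eLpNorm_smul_le_mul_eLpNorm (r := 1) (p := p) (q := p') hg hf
  rw [eLpNorm_one_eq_lintegral_enorm] at h
  simpa [enorm_mul] using h

lemma lintegral_enorm_mul_mul_le {q r s : ℝ≥0∞} (hqrs : q⁻¹ + r⁻¹ + s⁻¹ = 1) {h a k : X → ℝ}
    (hh : AEStronglyMeasurable h m) (ha : AEStronglyMeasurable a m)
    (hk : AEStronglyMeasurable k m) :
    ∫⁻ x, ‖h x‖ₑ * ‖a x‖ₑ * ‖k x‖ₑ ∂m ≤ eLpNorm a q m * eLpNorm h r m * eLpNorm k s m := by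
  have : ENNReal.HolderTriple r q (q⁻¹ + r⁻¹)⁻¹ := ⟨by rw [inv_inv, add_comm]⟩
  have h1 := eLpNorm_smul_le_mul_eLpNorm (r := (q⁻¹ + r⁻¹)⁻¹) (p := r) (q := q) ha hh
  have h2 := lintegral_enorm_mul_le (p := (q⁻¹ + r⁻¹)⁻¹) (p' := s) (by rw [inv_inv, hqrs])
    (hh.smul ha) hk
  simp only [Pi.smul_apply', smul_eq_mul, enorm_mul] at h2
  refine h2.trans ?_
  rw [mul_comm (eLpNorm a q m)]
  gcongr
  exact h1

/-- The trilinear estimate for `a ∈ L^q + L^∞`, `h ∈ L^r ∩ L²`, `k ∈ L^s ∩ L²`. -/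
lemma IsSumBounded.lintegral_le {q r s S : ℝ≥0∞} {a : X → ℝ} (ha : IsSumBounded q a S m)
    (hqrs : q⁻¹ + r⁻¹ + s⁻¹ = 1) {h k : X → ℝ} (hh : AEStronglyMeasurable h m)
    (hk : AEStronglyMeasurable k m) :
    ∫⁻ x, ‖h x‖ₑ * ‖a x‖ₑ * ‖k x‖ₑ ∂m ≤ S * interNorm r h m * interNorm s k m := by
  obtain ⟨a₁, a₂, h1, h2, h3, hS⟩ := ha
  have e2 : (∞ : ℝ≥0∞)⁻¹ + 2⁻¹ + 2⁻¹ = 1 := by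
    rw [ENNReal.inv_top, zero_add, ENNReal.inv_two_add_inv_two]
  calc ∫⁻ x, ‖h x‖ₑ * ‖a x‖ₑ * ‖k x‖ₑ ∂m
      ≤ ∫⁻ x, (‖h x‖ₑ * ‖a₁ x‖ₑ * ‖k x‖ₑ + ‖h x‖ₑ * ‖a₂ x‖ₑ * ‖k x‖ₑ) ∂m := by
        apply lintegral_mono_ae
        filter_upwards [h3] with x hx
        rw [hx, ← add_mul, ← mul_add]
        gcongr
        exact enorm_add_le _ _
    _ = ∫⁻ x, ‖h x‖ₑ * ‖a₁ x‖ₑ * ‖k x‖ₑ ∂m + ∫⁻ x, ‖h x‖ₑ * ‖a₂ x‖ₑ * ‖k x‖ₑ ∂m :=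
        lintegral_add_left' ((hh.enorm.mul h1.enorm).mul hk.enorm) _
    _ ≤ eLpNorm a₁ q m * eLpNorm h r m * eLpNorm k s m
        + eLpNorm a₂ ∞ m * eLpNorm h 2 m * eLpNorm k 2 m :=
        add_le_add (lintegral_enorm_mul_mul_le hqrs hh h1 hk)
          (lintegral_enorm_mul_mul_le e2 hh h2 hk)
    _ ≤ eLpNorm a₁ q m * interNorm r h m * interNorm s k m
        + eLpNorm a₂ ∞ m * interNorm r h m * interNorm s k m := by
        gcongr
        · exact eLpNorm_le_interNorm _ _
        · exact eLpNorm_le_interNorm _ _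
        · exact eLpNorm_two_le_interNorm _ _
        · exact eLpNorm_two_le_interNorm _ _
    _ ≤ _ := by
        rw [← add_mul, ← add_mul]
        gcongr

/-- Below the level M the first term dominates, above it the second. Taking M to be the sum of the
two endpoint norms then makes both terms comparable to M^p. -/
lemma ENNReal_rpow_le_add {y M : ℝ≥0∞} {p t : ℝ} (hp : 1 ≤ p) (hpt : p ≤ t) (hM0 : M ≠ 0)
    (hM : M ≠ ∞) : y ^ p ≤ M ^ (p - 1) * y + M ^ (p - t) * y ^ t := by
  rcases le_total y M with h | h
  · refine le_add_right ?_
    have hy : y ≠ ∞ := ne_top_of_le_ne_top hM h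
    by_cases hy0 : y = 0
    · rw [hy0, ENNReal.zero_rpow_of_pos (by linarith)]; exact zero_le
    calc y ^ p = y ^ (p - 1) * y := by
          nth_rewrite 3 [← ENNReal.rpow_one y]
          rw [← ENNReal.rpow_add _ _ hy0 hy]; ring_nf
      _ ≤ _ := by gcongr
  · refine le_add_left ?_
    by_cases hy : y = ∞
    · rw [hy, ENNReal.top_rpow_of_pos (by linarith : 0 < t), ENNReal.mul_top]
      · exact le_top
      · exact (ENNReal.rpow_pos (pos_iff_ne_zero.2 hM0) hM).ne'
    have hy0 : y ≠ 0 := (lt_of_lt_of_le (pos_iff_ne_zero.2 hM0) h).ne'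
    calc y ^ p = y ^ (p - t) * y ^ t := by rw [← ENNReal.rpow_add _ _ hy0 hy]; ring_nf
      _ ≤ _ := by
        gcongr ?_ * _
        rw [← neg_sub, ENNReal.rpow_neg, ENNReal.rpow_neg, ENNReal.inv_le_inv]
        exact ENNReal.rpow_le_rpow h (by linarith)

/-- Interpolation between `L^1` and `L^t`. -/
lemma eLpNorm_le_two_mul_add {p t : ℝ≥0∞} (hp : 1 ≤ p) (hpt : p ≤ t) {f : X → ℝ}
    (hf : AEStronglyMeasurable f m) :
    eLpNorm f p m ≤ 2 * (eLpNorm f 1 m + eLpNorm f t m) := by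
  by_cases hptop : p = ∞
  · have : t = ∞ := top_le_iff.1 (hptop ▸ hpt)
    rw [hptop, this, two_mul]
    exact le_add_right le_add_self
  set M := eLpNorm f 1 m + eLpNorm f t m
  by_cases hM : M = ∞
  · rw [hM]; simp
  by_cases hM0 : M = 0
  · have h1 : eLpNorm f 1 m = 0 := by
      have : eLpNorm f 1 m ≤ M := le_self_add
      rw [hM0] at this
      exact le_antisymm this zero_le
    have h2 := (eLpNorm_eq_zero_iff hf one_ne_zero).1 h1
    rw [eLpNorm_congr_ae h2]
    simp
  have hp0 : p ≠ 0 := (zero_lt_one.trans_le hp).ne'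
  have hp1 : 1 ≤ p.toReal := by
    have := (ENNReal.toReal_le_toReal ENNReal.one_ne_top hptop).2 hp
    simpa using this
  have hA : ∫⁻ x, ‖f x‖ₑ ∂m ≤ M := by
    rw [← eLpNorm_one_eq_lintegral_enorm]; exact le_self_add
  have hMp : M ^ (p.toReal - 1) * M = M ^ p.toReal := by
    nth_rewrite 2 [← ENNReal.rpow_one M]
    rw [← ENNReal.rpow_add _ _ hM0 hM]; ring_nf
  have key : ∫⁻ x, ‖f x‖ₑ ^ p.toReal ∂m ≤ 2 * M ^ p.toReal := by
    by_cases ht : t = ∞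
    · have hle : ∀ᵐ x ∂m, ‖f x‖ₑ ≤ M := by
        have := ae_le_eLpNormEssSup (f := f) (μ := m)
        filter_upwards [this] with x hx
        refine hx.trans ?_
        rw [← eLpNorm_exponent_top, ← ht]; exact le_add_self
      calc ∫⁻ x, ‖f x‖ₑ ^ p.toReal ∂m ≤ ∫⁻ x, M ^ (p.toReal - 1) * ‖f x‖ₑ ∂m := by
            apply lintegral_mono_ae
            filter_upwards [hle] with x hx
            have hy : ‖f x‖ₑ ≠ ∞ := enorm_ne_top
            by_cases hy0 : ‖f x‖ₑ = 0
            · rw [hy0, ENNReal.zero_rpow_of_pos (by linarith)]; exact zero_le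
            calc ‖f x‖ₑ ^ p.toReal = ‖f x‖ₑ ^ (p.toReal - 1) * ‖f x‖ₑ := by
                  nth_rewrite 3 [← ENNReal.rpow_one ‖f x‖ₑ]
                  rw [← ENNReal.rpow_add _ _ hy0 hy]; ring_nf
              _ ≤ _ := by gcongr
        _ = M ^ (p.toReal - 1) * ∫⁻ x, ‖f x‖ₑ ∂m :=
            lintegral_const_mul'' _ hf.enorm
        _ ≤ M ^ (p.toReal - 1) * M := by gcongr
        _ = M ^ p.toReal := hMp
        _ ≤ _ := by rw [two_mul]; exact le_self_add
    · have ht0 : t ≠ 0 := (zero_lt_one.trans_le (hp.trans hpt)).ne'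
      have hpt' : p.toReal ≤ t.toReal := (ENNReal.toReal_le_toReal hptop ht).2 hpt
      have hB : ∫⁻ x, ‖f x‖ₑ ^ t.toReal ∂m ≤ M ^ t.toReal := by
        have : eLpNorm f t m ≤ M := le_add_self
        rw [eLpNorm_eq_lintegral_rpow_enorm_toReal ht0 ht, one_div,
          ENNReal.rpow_inv_le_iff (by linarith)] at this
        exact this
      calc ∫⁻ x, ‖f x‖ₑ ^ p.toReal ∂m
          ≤ ∫⁻ x, (M ^ (p.toReal - 1) * ‖f x‖ₑ
            + M ^ (p.toReal - t.toReal) * ‖f x‖ₑ ^ t.toReal) ∂m :=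
            lintegral_mono fun x => ENNReal_rpow_le_add hp1 hpt' hM0 hM
        _ = M ^ (p.toReal - 1) * ∫⁻ x, ‖f x‖ₑ ∂m
            + M ^ (p.toReal - t.toReal) * ∫⁻ x, ‖f x‖ₑ ^ t.toReal ∂m := by
            rw [lintegral_add_left' (hf.enorm.const_mul _), lintegral_const_mul'' _ hf.enorm,
              lintegral_const_mul'' _ (hf.enorm.pow_const _)]
        _ ≤ M ^ (p.toReal - 1) * M + M ^ (p.toReal - t.toReal) * M ^ t.toReal := by gcongr
        _ = 2 * M ^ p.toReal := by
            rw [hMp, ← ENNReal.rpow_add _ _ hM0 hM, sub_add_cancel, two_mul]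
  rw [eLpNorm_eq_lintegral_rpow_enorm_toReal hp0 hptop, one_div,
    ENNReal.rpow_inv_le_iff (by linarith), ENNReal.mul_rpow_of_nonneg _ _ (by linarith)]
  refine key.trans ?_
  gcongr
  calc (2 : ℝ≥0∞) = 2 ^ (1 : ℝ) := (ENNReal.rpow_one 2).symm
    _ ≤ _ := ENNReal.rpow_le_rpow_of_exponent_le one_le_two hp1

/-- The L^q part of a is paired with f in L^{q'}, which is interpolated between L¹ and L^t. The L^∞
part is paired with f in L¹. -/
lemma IsSumBounded.lintegral_le_one_add {q q' t S : ℝ≥0∞} {a : X → ℝ}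
    (ha : IsSumBounded q a S m) (hqq : q⁻¹ + q'⁻¹ = 1) (hq' : q' ≤ t) {f : X → ℝ}
    (hf : AEStronglyMeasurable f m) :
    ∫⁻ x, ‖f x‖ₑ * ‖a x‖ₑ ∂m ≤ 2 * (eLpNorm f 1 m + eLpNorm f t m) * S := by
  obtain ⟨a₁, a₂, h1, h2, h3, hS⟩ := ha
  have hq1 : 1 ≤ q' := by
    rw [← ENNReal.inv_le_inv, inv_one, ← hqq]; exact le_add_self
  have e2 : (1 : ℝ≥0∞)⁻¹ + ∞⁻¹ = 1 := by simp
  calc ∫⁻ x, ‖f x‖ₑ * ‖a x‖ₑ ∂m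
      ≤ ∫⁻ x, (‖f x‖ₑ * ‖a₁ x‖ₑ + ‖f x‖ₑ * ‖a₂ x‖ₑ) ∂m := by
        apply lintegral_mono_ae
        filter_upwards [h3] with x hx
        rw [hx, ← mul_add]
        gcongr
        exact enorm_add_le _ _
    _ = ∫⁻ x, ‖f x‖ₑ * ‖a₁ x‖ₑ ∂m + ∫⁻ x, ‖f x‖ₑ * ‖a₂ x‖ₑ ∂m :=
        lintegral_add_left' (hf.enorm.mul h1.enorm) _
    _ ≤ eLpNorm f q' m * eLpNorm a₁ q m + eLpNorm f 1 m * eLpNorm a₂ ∞ m :=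
        add_le_add (lintegral_enorm_mul_le (by rw [add_comm, hqq]) hf h1)
          (lintegral_enorm_mul_le e2 hf h2)
    _ ≤ 2 * (eLpNorm f 1 m + eLpNorm f t m) * eLpNorm a₁ q m
        + 2 * (eLpNorm f 1 m + eLpNorm f t m) * eLpNorm a₂ ∞ m := by
        gcongr
        · exact eLpNorm_le_two_mul_add hq1 hq' hf
        · rw [two_mul]
          exact le_add_right le_self_add
    _ ≤ _ := by rw [← mul_add]; gcongr

/-- Convergence in `L²` without loss of `L^p` norm implies convergence in `L^p`. -/
lemma tendsto_eLpNorm_sub_of_le {p : ℝ≥0∞} (hp : 1 ≤ p) (hp' : p < ∞) {f : ℕ → X → ℝ} {g : X → ℝ}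
    (hf : ∀ n, AEStronglyMeasurable (f n) m) (hg : MemLp g p m)
    (h2 : Tendsto (fun n => eLpNorm (f n - g) 2 m) atTop (𝓝 0))
    (hle : ∀ n, eLpNorm (f n) p m ≤ eLpNorm g p m) :
    Tendsto (fun n => eLpNorm (f n - g) p m) atTop (𝓝 0) := by
  have hp0 : p ≠ 0 := (zero_lt_one.trans_le hp).ne'
  have hp1 : 1 ≤ p.toReal := by
    have := (ENNReal.toReal_le_toReal ENNReal.one_ne_top hp'.ne).2 hp
    simpa using this
  have hpr : 0 < p.toReal := by linarith
  refine tendsto_of_subseq_tendsto fun ns hns => ?_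
  obtain ⟨ms, -, hms⟩ := (tendstoInMeasure_of_tendsto_eLpNorm two_ne_zero (fun n => hf (ns n))
    hg.1 (h2.comp hns)).exists_seq_tendsto_ae
  refine ⟨ms, ?_⟩
  set F : ℕ → X → ℝ := fun n => f (ns (ms n))
  have hFm : ∀ n, AEStronglyMeasurable (F n) m := fun n => hf _
  set c : ℝ≥0∞ := 2 ^ (p.toReal - 1)
  have hc : c ≠ ∞ := ENNReal.rpow_ne_top_of_nonneg (by linarith) ENNReal.ofNat_ne_top
  set G : ℝ≥0∞ := ∫⁻ x, ‖g x‖ₑ ^ p.toReal ∂m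
  have hG : G ≠ ∞ := (lintegral_rpow_enorm_lt_top_of_eLpNorm_lt_top hp0 hp'.ne hg.2).ne
  have hFG : ∀ n, ∫⁻ x, ‖F n x‖ₑ ^ p.toReal ∂m ≤ G := by
    intro n
    have := hle (ns (ms n))
    rw [eLpNorm_eq_lintegral_rpow_enorm_toReal hp0 hp'.ne,
      eLpNorm_eq_lintegral_rpow_enorm_toReal hp0 hp'.ne, one_div,
      ENNReal.rpow_le_rpow_iff (by positivity)] at this
    exact this
  set I : ℕ → ℝ≥0∞ := fun n => ∫⁻ x, ‖F n x - g x‖ₑ ^ p.toReal ∂m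
  -- Fatou's lemma is applied to 2^(p-1) (|F|^p + |g|^p) - |F - g|^p, which is nonnegative by
  -- convexity. Its integral plus that of |F - g|^p is at most 2^p ∫ |g|^p, exactly the value of the
  -- Fatou lower bound, so ∫ |F - g|^p has no room to stay positive.
  set D : ℕ → X → ℝ≥0∞ := fun n x =>
    c * (‖F n x‖ₑ ^ p.toReal + ‖g x‖ₑ ^ p.toReal) - ‖F n x - g x‖ₑ ^ p.toReal
  have hpt : ∀ n x, ‖F n x - g x‖ₑ ^ p.toReal
      ≤ c * (‖F n x‖ₑ ^ p.toReal + ‖g x‖ₑ ^ p.toReal) := by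
    intro n x
    refine le_trans ?_ (ENNReal.rpow_add_le_mul_rpow_add_rpow _ _ hp1)
    gcongr
    rw [sub_eq_add_neg]
    refine (enorm_add_le _ _).trans ?_
    rw [enorm_neg]
  have hIm : ∀ n, AEMeasurable (fun x => ‖F n x - g x‖ₑ ^ p.toReal) m := fun n =>
    (((hFm n).sub hg.1).enorm).pow_const _
  have hsum : ∀ n, I n + ∫⁻ x, D n x ∂m ≤ 2 * c * G := by
    intro n
    rw [← lintegral_add_left' (hIm n)]
    calc _ = ∫⁻ x, c * (‖F n x‖ₑ ^ p.toReal + ‖g x‖ₑ ^ p.toReal) ∂m :=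
          lintegral_congr fun x => add_tsub_cancel_of_le (hpt n x)
      _ = c * (∫⁻ x, ‖F n x‖ₑ ^ p.toReal ∂m + G) := by
          rw [lintegral_const_mul' _ _ hc, lintegral_add_left' ((hFm n).enorm.pow_const _)]
      _ ≤ c * (G + G) := by gcongr; exact hFG n
      _ = _ := by ring
  have hliminf : 2 * c * G ≤ liminf (fun n => ∫⁻ x, D n x ∂m) atTop := by
    refine le_trans ?_ (lintegral_liminf_le' fun n =>
      (((((hFm n).enorm.pow_const _).add (hg.1.enorm.pow_const _)).const_mul c).sub (hIm n)))
    rw [← lintegral_const_mul' _ _ (ENNReal.mul_ne_top ENNReal.ofNat_ne_top hc)]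
    apply lintegral_mono_ae
    filter_upwards [hms] with x hx
    have t1 : Tendsto (fun n => ‖F n x‖ₑ ^ p.toReal) atTop (𝓝 (‖g x‖ₑ ^ p.toReal)) :=
      (ENNReal.continuous_rpow_const.tendsto _).comp ((continuous_enorm.tendsto _).comp hx)
    have t2 : Tendsto (fun n => ‖F n x - g x‖ₑ ^ p.toReal) atTop (𝓝 0) := by
      have := (ENNReal.continuous_rpow_const (y := p.toReal)).tendsto ‖g x - g x‖ₑ
      have h3 := this.comp ((continuous_enorm.tendsto _).comp (hx.sub_const (g x)))
      rw [sub_self, enorm_zero, ENNReal.zero_rpow_of_pos hpr] at h3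
      exact h3
    have t3 : Tendsto (fun n => D n x) atTop (𝓝 (2 * c * ‖g x‖ₑ ^ p.toReal)) := by
      have hne : c * (‖g x‖ₑ ^ p.toReal + ‖g x‖ₑ ^ p.toReal) ≠ ∞ :=
        ENNReal.mul_ne_top hc (by simp [hpr.le])
      have := ENNReal.Tendsto.sub (ENNReal.Tendsto.const_mul (a := c)
        (t1.add (tendsto_const_nhds (x := ‖g x‖ₑ ^ p.toReal))) (Or.inr hc)) t2 (Or.inl hne)
      rw [tsub_zero] at this
      convert this using 2
      ring
    exact t3.liminf_eq.ge
  have hI : Tendsto I atTop (𝓝 0) := by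
    rw [ENNReal.tendsto_nhds_zero]
    intro δ hδ
    set A := 2 * c * G
    have hA : A ≠ ∞ := ENNReal.mul_ne_top (ENNReal.mul_ne_top ENNReal.ofNat_ne_top hc) hG
    by_cases hA0 : A = 0
    · filter_upwards with n
      have := hsum n
      rw [hA0] at this
      exact (le_self_add.trans this).trans zero_le
    · have hlt : A - δ < liminf (fun n => ∫⁻ x, D n x ∂m) atTop :=
        lt_of_lt_of_le (ENNReal.sub_lt_self hA hA0 hδ.ne') hliminf
      filter_upwards [eventually_lt_of_lt_liminf hlt] with n hn
      have h3 := hsum n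
      have h4 : A ≤ δ + ∫⁻ x, D n x ∂m := by
        have := tsub_le_iff_left.1 hn.le
        exact this
      have hDfin : ∫⁻ x, D n x ∂m ≠ ∞ := ne_top_of_le_ne_top hA (le_add_self.trans h3)
      exact (ENNReal.add_le_add_iff_right hDfin).1 (h3.trans h4)
  have := (ENNReal.continuous_rpow_const (y := 1 / p.toReal)).tendsto 0 |>.comp hI
  rw [ENNReal.zero_rpow_of_pos (by positivity)] at this
  refine this.congr fun n => ?_
  rw [eLpNorm_eq_lintegral_rpow_enorm_toReal hp0 hp'.ne]
  rfl

end ContEq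

end

/-! ### Resolvent approximation in L^p ∩ L² and gradients of order below √l. -/

noncomputable section

namespace ContEq

variable {X : Type*} [MeasurableSpace X] {m : Measure X} {E : DirichletForm m}

lemma ofReal_norm_eq_eLpNorm (w : Lp ℝ 2 m) : ENNReal.ofReal ‖w‖ = eLpNorm w 2 m := by
  rw [Lp.norm_def, ENNReal.ofReal_toReal (Lp.eLpNorm_ne_top _)]

lemma interNorm_smul {p : ℝ≥0∞} (a : ℝ) (f : X → ℝ) :
    interNorm p (a • f) m = ENNReal.ofReal |a| * interNorm p f m := by
  rw [interNorm, eLpNorm_const_smul, eLpNorm_const_smul, ← mul_add, ← ofReal_norm, Real.norm_eq_abs]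
  rfl

lemma interNorm_neg {p : ℝ≥0∞} (f : X → ℝ) : interNorm p (-f) m = interNorm p f m := by
  rw [interNorm, eLpNorm_neg, eLpNorm_neg, interNorm]

lemma interNorm_sub_le {p : ℝ≥0∞} (hp : 1 ≤ p) {f g : X → ℝ} (hf : AEStronglyMeasurable f m)
    (hg : AEStronglyMeasurable g m) :
    interNorm p (f - g) m ≤ interNorm p f m + interNorm p g m := by
  rw [sub_eq_add_neg, ← interNorm_neg g]
  exact interNorm_add_le hp hf hg.neg

/-- The approximation `J_{n+1}` of the identity. -/
abbrev DirichletForm.approx (E : DirichletForm m) (n : ℕ) : Lp ℝ 2 m →ₗ[ℝ] E.domain :=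
  E.resolvent (Nat.cast_add_one_pos (α := ℝ) n)

lemma interNorm_res_le {l : ℝ} (hl : 0 < l) {p : ℝ≥0∞} (hp : 1 < p) (hp' : p < ∞)
    (w : Lp ℝ 2 m) : interNorm p (E.res hl w) m ≤ interNorm p w m :=
  add_le_add (DirichletForm.eLpNorm_res_le hl hp hp' w) (by
    rw [← ofReal_norm_eq_eLpNorm, ← ofReal_norm_eq_eLpNorm]
    exact ENNReal.ofReal_le_ofReal (DirichletForm.norm_res_le hl w))

lemma interNorm_resolvent_le {l : ℝ} (hl : 0 < l) {p : ℝ≥0∞} (hp : 1 < p) (hp' : p < ∞)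
    (w : Lp ℝ 2 m) : interNorm p (E.resolvent hl w : Lp ℝ 2 m) m ≤ interNorm p w m :=
  interNorm_res_le hl hp hp' w

lemma tendsto_interNorm_approx_sub {p : ℝ≥0∞} (hp : 1 < p) (hp' : p < ∞) {w : Lp ℝ 2 m}
    (hw : MemLp w p m) :
    Tendsto (fun n => interNorm p (⇑(E.approx n w : Lp ℝ 2 m) - ⇑w) m) atTop (𝓝 0) := by
  have h2 : Tendsto (fun n => eLpNorm (⇑(E.approx n w : Lp ℝ 2 m) - ⇑w) 2 m) atTop (𝓝 0) := by
    have h1 := tendsto_iff_norm_sub_tendsto_zero.1 (DirichletForm.tendsto_res (E := E) w)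
    have h2 := ENNReal.tendsto_ofReal h1
    rw [ENNReal.ofReal_zero] at h2
    refine h2.congr fun n => ?_
    rw [ofReal_norm_eq_eLpNorm]
    exact eLpNorm_congr_ae (Lp.coeFn_sub _ _)
  have h3 := tendsto_eLpNorm_sub_of_le hp.le hp' (fun n => (Lp.aestronglyMeasurable _)) hw h2
    (fun n => DirichletForm.eLpNorm_res_le (Nat.cast_add_one_pos n) hp hp' w)
  simpa only [add_zero, interNorm] using h3.add h2

namespace CarreDuChamp

variable (C : CarreDuChamp E)

lemma interNorm_sqrtΓ_lt_top {p : ℝ≥0∞} {f : E.domain} (hf : C.MemV p f) :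
    interNorm p (C.sqrtΓ f) m < ∞ := interNorm_lt_top hf.2 (C.memLp_sqrtΓ_two f)

lemma interNorm_sqrtΓ_add_le {p : ℝ≥0∞} (hp : 1 ≤ p) (f g : E.domain) :
    interNorm p (C.sqrtΓ (f + g)) m ≤ interNorm p (C.sqrtΓ f) m + interNorm p (C.sqrtΓ g) m := by
  refine (add_le_add (C.eLpNorm_sqrtΓ_add_le hp f g)
    (C.eLpNorm_sqrtΓ_add_le one_le_two f g)).trans ?_
  rw [interNorm, interNorm, add_add_add_comm]

/-- In `L²` the growth √l needs no assumption on the heat flow. It follows from the energy identity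
E(J w) = l ∫ (w - J w) J w. -/
lemma eLpNorm_sqrtΓ_resolvent_two_le : ∃ c : ℝ, 0 < c ∧ ∀ (l : ℝ) (hl : 0 < l), 1 ≤ l →
    ∀ w, eLpNorm (C.sqrtΓ (E.resolvent hl w)) 2 m
      ≤ ENNReal.ofReal (c * Real.sqrt l) * eLpNorm w 2 m := by
  obtain ⟨K, hK⟩ := C.exists_eLpNorm_sqrtΓ_two_le
  refine ⟨K * 2 + 1, by positivity, fun l hl h1 w => (hK _).trans ?_⟩
  have h2 : ‖E.toV (E.resolvent hl w)‖ ≤ 2 * Real.sqrt l * ‖w‖ := by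
    refine abs_le_of_sq_le_sq' ?_ (by positivity) |>.2
    rw [E.norm_toV_sq, DirichletForm.coe_resolvent, DirichletForm.energy_resolvent, inner_sub_left,
      real_inner_self_eq_norm_sq, mul_pow, mul_pow, Real.sq_sqrt hl.le]
    have h3 := DirichletForm.norm_res_le (E := E) hl w
    have h4 := real_inner_le_norm w (E.res hl w)
    have h5 := norm_nonneg (E.res hl w)
    have h6 : ‖w‖ * ‖E.res hl w‖ ≤ ‖w‖ ^ 2 := by nlinarith [norm_nonneg w]
    have h7 : ‖E.res hl w‖ ^ 2 ≤ ‖w‖ ^ 2 := by gcongr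
    have h8 := mul_le_mul_of_nonneg_left (h4.trans h6) hl.le
    have h9 : 0 ≤ l * ‖E.res hl w‖ ^ 2 := by positivity
    have h10 := mul_le_mul_of_nonneg_right h1 (sq_nonneg ‖w‖)
    nlinarith
  calc (K : ℝ≥0∞) * ENNReal.ofReal ‖E.toV (E.resolvent hl w)‖
      ≤ ENNReal.ofReal K * ENNReal.ofReal (2 * Real.sqrt l * ‖w‖) := by
        rw [ENNReal.ofReal_coe_nnreal]
        gcongr
    _ = ENNReal.ofReal (K * 2 * Real.sqrt l) * eLpNorm w 2 m := by
        rw [← ofReal_norm_eq_eLpNorm, ← ENNReal.ofReal_mul (by positivity),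
          ← ENNReal.ofReal_mul (by positivity)]
        ring_nf
    _ ≤ _ := by
        refine mul_le_mul' (ENNReal.ofReal_le_ofReal ?_) le_rfl
        gcongr
        linarith

variable {C} in
lemma LpGamma.exists_interNorm_sqrtΓ_resolvent_le {p : ℝ≥0∞} (hΓ : C.LpGamma p) (hp : 1 < p)
    (hp' : p < ∞) : ∃ c : ℝ, 0 < c ∧ ∀ (l : ℝ) (hl : 0 < l), 1 ≤ l →
      ∀ w : Lp ℝ 2 m, MemLp w p m → interNorm p (C.sqrtΓ (E.resolvent hl w)) m
        ≤ ENNReal.ofReal (c * Real.sqrt l) * interNorm p w m := by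
  obtain ⟨c₁, hc₁, h1⟩ := LpGamma.exists_eLpNorm_sqrtΓ_resolvent_le C hΓ hp hp'
  obtain ⟨c₂, hc₂, h2⟩ := C.eLpNorm_sqrtΓ_resolvent_two_le
  refine ⟨max c₁ c₂, by positivity, fun l hl hl1 w hw => ?_⟩
  rw [interNorm, interNorm, mul_add]
  refine add_le_add ((h1 l hl hl1 w hw).trans ?_) ((h2 l hl hl1 w).trans ?_)
  · refine mul_le_mul' (ENNReal.ofReal_le_ofReal ?_) le_rfl
    gcongr; exact le_max_left _ _
  · refine mul_le_mul' (ENNReal.ofReal_le_ofReal ?_) le_rfl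
    gcongr; exact le_max_right _ _

variable {C} in
lemma LpGamma.memV_resolvent {p : ℝ≥0∞} (hΓ : C.LpGamma p) (hp : 1 < p) (hp' : p < ∞) {l : ℝ}
    (hl : 0 < l) (hl1 : 1 ≤ l) {w : Lp ℝ 2 m} (hw : MemLp w p m) :
    C.MemV p (E.resolvent hl w) := by
  obtain ⟨c, -, hc⟩ := hΓ.exists_interNorm_sqrtΓ_resolvent_le hp hp'
  exact ⟨DirichletForm.memLp_res hl hp hp' hw, (C.measurable_sqrtΓ _).aestronglyMeasurable,
    (eLpNorm_le_interNorm _ _).trans_lt <| (hc l hl hl1 w hw).trans_lt <|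
      ENNReal.mul_lt_top ENNReal.ofReal_lt_top (interNorm_lt_top hw (Lp.memLp w))⟩

-- The gradient of J_l w is o(√l), which is what makes the commutator vanish. Split w into w - J_k w
-- and J_k w with k fixed: the first part contributes at most c ‖w - J_k w‖, small for large k, and
-- the second has bounded gradient as n grows.
variable {C} in
lemma LpGamma.tendsto_interNorm_sqrtΓ_approx {p : ℝ≥0∞} (hΓ : C.LpGamma p) (hp : 1 < p)
    (hp' : p < ∞) {w : Lp ℝ 2 m} (hw : MemLp w p m) :
    Tendsto (fun n : ℕ => ENNReal.ofReal (1 / Real.sqrt (n + 1))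
      * interNorm p (C.sqrtΓ (E.approx n w)) m) atTop (𝓝 0) := by
  obtain ⟨c, hc0, hc⟩ := hΓ.exists_interNorm_sqrtΓ_resolvent_le hp hp'
  have hl1 : ∀ n : ℕ, (1 : ℝ) ≤ n + 1 := fun n => by
    have := Nat.cast_nonneg (α := ℝ) n
    linarith
  set N := interNorm p w m
  have hN : N < ∞ := interNorm_lt_top hw (Lp.memLp w)
  have hbd : ∀ n k : ℕ, ENNReal.ofReal (1 / Real.sqrt (n + 1))
      * interNorm p (C.sqrtΓ (E.approx n w)) m
      ≤ ENNReal.ofReal c * interNorm p (⇑(E.approx k w : Lp ℝ 2 m) - ⇑w) m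
        + ENNReal.ofReal (1 / Real.sqrt (n + 1)) * (ENNReal.ofReal (c * Real.sqrt (k + 1)) * N) := by
    intro n k
    set J : Lp ℝ 2 m := (E.approx k w : Lp ℝ 2 m)
    have hJ : MemLp J p m := DirichletForm.memLp_res (Nat.cast_add_one_pos k) hp hp' hw
    -- The resolvents commute, so for the smooth part the gradient falls on the one with the fixed
    -- parameter k.
    have e1 : E.approx n w = E.approx n (w - J) + E.approx k (E.approx n w : Lp ℝ 2 m) := by
      have e2 : E.approx n J = E.approx k (E.approx n w : Lp ℝ 2 m) :=
        DirichletForm.resolvent_comm _ _ w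
      rw [← e2, ← map_add, sub_add_cancel]
    have b1 : interNorm p (C.sqrtΓ (E.approx n (w - J))) m
        ≤ ENNReal.ofReal (c * Real.sqrt (n + 1)) * interNorm p (⇑J - ⇑w) m := by
      have e3 : interNorm p (⇑J - ⇑w) m = interNorm p (w - J : Lp ℝ 2 m) m := by
        rw [← interNorm_neg, neg_sub]
        exact interNorm_congr_ae (Lp.coeFn_sub _ _).symm
      rw [e3]
      exact hc _ _ (hl1 n) _ ((memLp_congr_ae (Lp.coeFn_sub _ _)).2 (hw.sub hJ))
    have b2 : interNorm p (C.sqrtΓ (E.approx k (E.approx n w : Lp ℝ 2 m))) m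
        ≤ ENNReal.ofReal (c * Real.sqrt (k + 1)) * N := by
      refine (hc _ _ (hl1 k) _ (DirichletForm.memLp_res (Nat.cast_add_one_pos n) hp hp' hw)).trans ?_
      gcongr
      exact interNorm_res_le _ hp hp' w
    rw [e1]
    calc _ ≤ ENNReal.ofReal (1 / Real.sqrt (n + 1)) *
          (ENNReal.ofReal (c * Real.sqrt (n + 1)) * interNorm p (⇑J - ⇑w) m
            + ENNReal.ofReal (c * Real.sqrt (k + 1)) * N) := by
          gcongr
          exact (C.interNorm_sqrtΓ_add_le hp.le _ _).trans (add_le_add b1 b2)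
      _ = _ := by
          rw [mul_add, ← mul_assoc, ← ENNReal.ofReal_mul (by positivity)]
          congr 3
          have : Real.sqrt ((n : ℝ) + 1) ≠ 0 := by positivity
          field_simp
  rw [ENNReal.tendsto_nhds_zero]
  intro ε hε
  have hε2 : 0 < ε / 2 := ENNReal.half_pos hε.ne'
  have h1 := ENNReal.Tendsto.const_mul (a := ENNReal.ofReal c)
    (tendsto_interNorm_approx_sub (E := E) hp hp' hw) (Or.inr ENNReal.ofReal_ne_top)
  rw [mul_zero] at h1
  obtain ⟨k, hk⟩ := ((ENNReal.tendsto_nhds_zero.1 h1) (ε / 2) hε2).exists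
  have h2 : Tendsto (fun n : ℕ => ENNReal.ofReal (1 / Real.sqrt (n + 1))) atTop (𝓝 0) := by
    rw [← ENNReal.ofReal_zero]
    refine ENNReal.tendsto_ofReal ?_
    refine tendsto_const_nhds.div_atTop ?_
    exact Real.tendsto_sqrt_atTop.comp
      (tendsto_atTop_add_const_right _ _ tendsto_natCast_atTop_atTop)
  have h3 := ENNReal.Tendsto.mul_const (b := ENNReal.ofReal (c * Real.sqrt (k + 1)) * N) h2
    (Or.inr (ENNReal.mul_ne_top ENNReal.ofReal_ne_top hN.ne))
  rw [zero_mul] at h3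
  filter_upwards [(ENNReal.tendsto_nhds_zero.1 h3) (ε / 2) hε2] with n hn
  refine (hbd n k).trans ?_
  rw [← ENNReal.add_halves ε]
  exact add_le_add hk hn

end CarreDuChamp

end ContEq

end

/-! ### Extension of a derivation to the whole form domain. -/

noncomputable section

namespace ContEq

variable {X : Type*} [MeasurableSpace X] {m : Measure X} {E : DirichletForm m}

namespace CarreDuChamp

variable {C : CarreDuChamp E} {A : Submodule ℝ E.domain}

lemma tendsto_ofReal_toV {φ : ℕ → E.domain} {f : E.domain} {p : ℝ≥0∞}
    (h : Tendsto (fun n => C.vpNorm p (f - φ n)) atTop (𝓝 0)) :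
    Tendsto (fun n => E.toV (φ n)) atTop (𝓝 (E.toV f)) := by
  rw [tendsto_iff_norm_sub_tendsto_zero]
  have h1 : Tendsto (fun n => ENNReal.ofReal ‖E.toV (φ n) - E.toV f‖) atTop (𝓝 0) := by
    refine tendsto_of_tendsto_of_tendsto_of_le_of_le tendsto_const_nhds h (fun _ => zero_le) ?_
    intro n
    have : ‖E.toV (φ n) - E.toV f‖ = E.vNorm (f - φ n) := by
      rw [← E.norm_toV, map_sub, norm_sub_rev]
    simp only [this]
    rw [vpNorm, add_assoc]
    exact le_self_add
  have h2 := (ENNReal.tendsto_toReal ENNReal.zero_ne_top).comp h1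
  rw [ENNReal.toReal_zero] at h2
  refine h2.congr fun n => ?_
  exact ENNReal.toReal_ofReal (norm_nonneg _)

lemma IsTestAlgebra.exists_seq_tendsto (hA : C.IsTestAlgebra A) (f : E.domain) :
    ∃ φ : ℕ → A, Tendsto (fun n => E.toV (φ n).1) atTop (𝓝 (E.toV f)) := by
  choose φ hφ hφ' using fun n : ℕ => hA.dense f (1 / (n + 1)) (by positivity)
  refine ⟨fun n => ⟨φ n, hφ n⟩, ?_⟩
  rw [tendsto_iff_norm_sub_tendsto_zero]
  refine squeeze_zero (fun _ => norm_nonneg _) (fun n => ?_) tendsto_one_div_add_atTop_nhds_zero_nat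
  rw [norm_sub_rev, ← map_sub, E.norm_toV]
  exact (hφ' n).le

lemma exists_subseq_tendsto_sqrtΓ {φ : ℕ → E.domain} {f : E.domain}
    (h : Tendsto (fun n => E.toV (φ n)) atTop (𝓝 (E.toV f))) :
    ∃ ns : ℕ → ℕ, StrictMono ns ∧
      ∀ᵐ x ∂m, Tendsto (fun n => C.sqrtΓ (φ (ns n) - f) x) atTop (𝓝 0) := by
  have h1 : Tendsto (fun n => eLpNorm (C.sqrtΓ (φ n - f) - 0) 2 m) atTop (𝓝 0) := by
    simpa using C.tendsto_eLpNorm_sqrtΓ_two h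
  exact (tendstoInMeasure_of_tendsto_eLpNorm two_ne_zero
    (fun n => (C.measurable_sqrtΓ _).aestronglyMeasurable)
    aestronglyMeasurable_zero h1).exists_seq_tendsto_ae

namespace VDerivation

variable (b : C.VDerivation A)

lemma sub_ae (f g : A) : ∀ᵐ x ∂m, b.toLin f x - b.toLin g x = b.toLin (f - g) x := by
  rw [map_sub]
  filter_upwards [AEEqFun.coeFn_sub (b.toLin f) (b.toLin g)] with x hx
  rw [hx, Pi.sub_apply]

/-- `G` is a pointwise limit of `b φ_n`, where `√Γ(φ_n - f) → 0` a.e. -/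
def IsLimitValue (f : E.domain) (G : X →ₘ[m] ℝ) : Prop :=
  ∃ φ : ℕ → A, (∀ᵐ x ∂m, Tendsto (fun n => C.sqrtΓ ((φ n).1 - f) x) atTop (𝓝 0)) ∧
    ∀ᵐ x ∂m, Tendsto (fun n => b.toLin (φ n) x) atTop (𝓝 (G x))

variable {b}

lemma abs_sub_le_ae {g : X → ℝ} (hg0 : ∀ᵐ x ∂m, 0 ≤ g x)
    (hg : ∀ f : A, ∀ᵐ x ∂m, |b.toLin f x| ≤ g x * C.sqrtΓ f.1 x) (φ ψ : A) (f : E.domain) :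
    ∀ᵐ x ∂m, |b.toLin φ x - b.toLin ψ x|
      ≤ g x * (C.sqrtΓ (φ.1 - f) x + C.sqrtΓ (ψ.1 - f) x) := by
  have h1 : C.sqrtΓ (φ - ψ : A).1 = C.sqrtΓ ((φ.1 - f) + (f - ψ.1)) := by
    congr 1
    rw [Submodule.coe_sub]
    abel
  filter_upwards [b.sub_ae φ ψ, hg (φ - ψ), C.sqrtΓ_add_le_ae (φ.1 - f) (f - ψ.1), hg0]
    with x h2 h3 h4 h5
  rw [h2]
  refine h3.trans ?_
  rw [h1, C.sqrtΓ_sub_comm ψ.1 f]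
  gcongr

variable (b) in
lemma exists_nonneg_bound : ∃ g : X → ℝ, (∀ᵐ x ∂m, 0 ≤ g x) ∧
    ∀ f : A, ∀ᵐ x ∂m, |b.toLin f x| ≤ g x * C.sqrtΓ f.1 x := by
  obtain ⟨g, hg⟩ := b.bound
  refine ⟨fun x => |g x|, Eventually.of_forall fun x => abs_nonneg _, fun f => ?_⟩
  filter_upwards [hg f] with x hx
  refine hx.trans ?_
  gcongr
  · exact C.sqrtΓ_nonneg _ _
  · exact le_abs_self _

/-- Two approximating sequences are compared through f: the difference of their images is at most g
(√Γ(φ_n - f) + √Γ(ψ_n - f)). An a.e. limit refers to no exponent, so the extensions in the L^r and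
the L^s setting can be compared through it. Linearity of `extend` also rests on this uniqueness. -/
lemma IsLimitValue.unique {f : E.domain} {G G' : X →ₘ[m] ℝ} (h : b.IsLimitValue f G)
    (h' : b.IsLimitValue f G') : G = G' := by
  obtain ⟨g, hg0, hg⟩ := b.exists_nonneg_bound
  obtain ⟨φ, h1, h2⟩ := h
  obtain ⟨ψ, h3, h4⟩ := h'
  apply AEEqFun.ext
  have h5 := ae_all_iff.2 fun n => abs_sub_le_ae hg0 hg (φ n) (ψ n) f
  filter_upwards [h1, h2, h3, h4, h5] with x h1 h2 h3 h4 h5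
  have h6 := ((h1.add h3).const_mul (g x))
  rw [add_zero, mul_zero] at h6
  have h7 := squeeze_zero (fun _ => abs_nonneg _) h5 h6
  have h8 := (h2.sub h4).abs
  have := tendsto_nhds_unique h7 h8
  rw [eq_comm, abs_eq_zero] at this
  linarith

lemma IsLimitValue.add_smul {f f' : E.domain} {G G' : X →ₘ[m] ℝ} (h : b.IsLimitValue f G)
    (h' : b.IsLimitValue f' G') (a : ℝ) : b.IsLimitValue (f + a • f') (G + a • G') := by
  obtain ⟨φ, h1, h2⟩ := h
  obtain ⟨ψ, h3, h4⟩ := h'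
  refine ⟨fun n => φ n + a • ψ n, ?_, ?_⟩
  · have h5 := ae_all_iff.2 fun n => C.sqrtΓ_add_le_ae ((φ n).1 - f) (a • ((ψ n).1 - f'))
    have h6 := ae_all_iff.2 fun n => C.sqrtΓ_smul_ae a ((ψ n).1 - f')
    filter_upwards [h1, h3, h5, h6] with x h1 h3 h5 h6
    have h7 := h1.add (h3.const_mul |a|)
    rw [mul_zero, add_zero] at h7
    refine squeeze_zero (fun _ => C.sqrtΓ_nonneg _ _) (fun n => ?_) h7
    have e : ((φ n + a • ψ n : A) : E.domain) - (f + a • f')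
        = ((φ n).1 - f) + a • ((ψ n).1 - f') := by
      rw [Submodule.coe_add, Submodule.coe_smul]
      module
    rw [e, ← h6 n]
    exact h5 n
  · have h5 := ae_all_iff.2 fun n => AEEqFun.coeFn_add (b.toLin (φ n)) (a • b.toLin (ψ n))
    have h6 := ae_all_iff.2 fun n => AEEqFun.coeFn_smul a (b.toLin (ψ n))
    filter_upwards [h2, h4, h5, h6, AEEqFun.coeFn_add G (a • G'), AEEqFun.coeFn_smul a G']
      with x h2 h4 h5 h6 h7 h8
    rw [h7, Pi.add_apply, h8, Pi.smul_apply, smul_eq_mul]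
    refine (h2.add (h4.const_mul a)).congr fun n => ?_
    rw [map_add, map_smul, h5 n, Pi.add_apply, h6 n, Pi.smul_apply, smul_eq_mul]

variable (b) in
lemma isLimitValue_coe (φ : A) : b.IsLimitValue φ.1 (b.toLin φ) := by
  refine ⟨fun _ => φ, ?_, Eventually.of_forall fun x => tendsto_const_nhds⟩
  have h := C.sqrtΓ_smul_ae 0 φ.1
  filter_upwards [h] with x hx
  rw [zero_smul, abs_zero, zero_mul] at hx
  simp only [sub_self, hx]
  exact tendsto_const_nhds

-- Density of the algebra in energy suffices. Along a subsequence √Γ(φ_n - f) → 0 a.e., and the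
-- bound by g √Γ makes the images a Cauchy sequence a.e., whatever the integrability of g.
variable (b) in
lemma exists_isLimitValue (hA : C.IsTestAlgebra A) (f : E.domain) :
    ∃ G, b.IsLimitValue f G := by
  obtain ⟨g, hg0, hg⟩ := b.exists_nonneg_bound
  obtain ⟨φ, hφ⟩ := hA.exists_seq_tendsto f
  obtain ⟨ns, -, hns⟩ := exists_subseq_tendsto_sqrtΓ (C := C) hφ
  have h5 := ae_all_iff.2 fun k => ae_all_iff.2 fun n =>
    abs_sub_le_ae hg0 hg (φ (ns k)) (φ (ns n)) f
  obtain ⟨G, hGm, hG⟩ := exists_stronglyMeasurable_limit_of_tendsto_ae (μ := m)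
    (f := fun n x => b.toLin (φ (ns n)) x) (fun n => (b.toLin (φ (ns n))).aestronglyMeasurable) (by
      filter_upwards [hns, h5] with x h1 h2
      apply cauchySeq_tendsto_of_complete
      rw [cauchySeq_iff_tendsto_dist_atTop_0]
      have h3 := ((h1.comp tendsto_fst).add (h1.comp tendsto_snd)).const_mul (g x)
      rw [add_zero, mul_zero] at h3
      rw [← prod_atTop_atTop_eq]
      exact squeeze_zero (fun _ => dist_nonneg) (fun p => h2 p.1 p.2) h3)
  refine ⟨AEEqFun.mk G hGm.aestronglyMeasurable, fun n => φ (ns n), hns, ?_⟩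
  filter_upwards [hG, AEEqFun.coeFn_mk G hGm.aestronglyMeasurable] with x h1 h2
  rw [h2]
  exact h1

variable (b) in
/-- The extension of a derivation to the domain of the form. -/
def extend (hA : C.IsTestAlgebra A) : E.domain →ₗ[ℝ] (X →ₘ[m] ℝ) where
  toFun f := (b.exists_isLimitValue hA f).choose
  map_add' f g := by
    refine (b.exists_isLimitValue hA (f + g)).choose_spec.unique ?_
    have := (b.exists_isLimitValue hA f).choose_spec.add_smul
      (b.exists_isLimitValue hA g).choose_spec 1
    rwa [one_smul, one_smul] at this
  map_smul' a f := by
    refine (b.exists_isLimitValue hA (a • f)).choose_spec.unique ?_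
    have := (b.isLimitValue_coe 0).add_smul (b.exists_isLimitValue hA f).choose_spec a
    rwa [map_zero, zero_add, Submodule.coe_zero, zero_add] at this

lemma isLimitValue_extend (hA : C.IsTestAlgebra A) (f : E.domain) :
    b.IsLimitValue f (b.extend hA f) := (b.exists_isLimitValue hA f).choose_spec

lemma extend_coe (hA : C.IsTestAlgebra A) (φ : A) : b.extend hA φ.1 = b.toLin φ :=
  (isLimitValue_extend hA _).unique (b.isLimitValue_coe φ)

lemma abs_extend_le_ae (hA : C.IsTestAlgebra A) {g : X → ℝ}
    (hg : ∀ f : A, ∀ᵐ x ∂m, |b.toLin f x| ≤ g x * C.sqrtΓ f.1 x) (f : E.domain) :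
    ∀ᵐ x ∂m, |b.extend hA f x| ≤ g x * C.sqrtΓ f x := by
  obtain ⟨φ, h1, h2⟩ := isLimitValue_extend (b := b) hA f
  have h3 := ae_all_iff.2 fun n => hg (φ n)
  have h4 := ae_all_iff.2 fun n => C.abs_sqrtΓ_sub_le_ae (φ n).1 f
  filter_upwards [h1, h2, h3, h4] with x h1 h2 h3 h4
  have h5 : Tendsto (fun n => C.sqrtΓ (φ n).1 x) atTop (𝓝 (C.sqrtΓ f x)) := by
    rw [tendsto_iff_dist_tendsto_zero]
    exact squeeze_zero (fun _ => dist_nonneg) h4 h1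
  exact le_of_tendsto_of_tendsto' h2.abs (h5.const_mul _) h3

lemma eLpNorm_mul_sqrtΓ_le {q p σ : ℝ≥0∞} (hσ : σ⁻¹ = p⁻¹ + q⁻¹) {a k : X → ℝ}
    (ha : AEStronglyMeasurable a m) (hk : AEStronglyMeasurable k m) :
    eLpNorm (fun x => a x * k x) σ m ≤ eLpNorm a q m * eLpNorm k p m := by
  have : ENNReal.HolderTriple q p σ := ⟨by rw [hσ, add_comm]⟩
  have h := eLpNorm_smul_le_mul_eLpNorm (r := σ) (p := q) (q := p) hk ha
  have e : (fun x => a x * k x) = a • k := rfl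
  rw [e]
  exact h

/-- `ext` is a choice guarded by existence, so an extension value has to be exhibited. The
difference db(φ_n - f) must be split into parts converging in L^σ and in `L²`, and the splitting g =
g₁ + g₂ of the bound provides it. -/
lemma isExtensionValue_extend (hA : C.IsTestAlgebra A) {g : X → ℝ}
    (hg : ∀ f : A, ∀ᵐ x ∂m, |b.toLin f x| ≤ g x * C.sqrtΓ f.1 x) {q S : ℝ≥0∞} (hS : S < ∞)
    (hgS : IsSumBounded q g S m) {p σ : ℝ≥0∞} (hσ : σ⁻¹ = p⁻¹ + q⁻¹) (hp : C.DenseInV A p)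
    {f : E.domain} (hf : C.MemV p f) : b.IsExtensionValue p σ f (b.extend hA f) := by
  obtain ⟨g₁, g₂, hg1, hg2, hsum, hS'⟩ := hgS
  choose φ hφ hφ' using fun n : ℕ => hp.2 f hf (ENNReal.ofReal (1 / (n + 1))) (by positivity)
  have hlim : Tendsto (fun n : ℕ => ENNReal.ofReal (1 / (n + 1))) atTop (𝓝 0) := by
    rw [← ENNReal.ofReal_zero]
    exact ENNReal.tendsto_ofReal tendsto_one_div_add_atTop_nhds_zero_nat
  have hv : Tendsto (fun n => C.vpNorm p (f - φ n)) atTop (𝓝 0) :=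
    tendsto_of_tendsto_of_tendsto_of_le_of_le tendsto_const_nhds hlim (fun _ => zero_le)
      (fun n => (hφ' n).le)
  set D : ℕ → (X →ₘ[m] ℝ) := fun n => b.toLin ⟨φ n, hφ n⟩ - b.extend hA f
  have hD : ∀ n, D n = b.extend hA (φ n - f) := by
    intro n
    rw [map_sub]
    simp only [D]
    rw [← extend_coe hA]
  -- Proportional splitting makes |k₁| ≤ |g₁| √Γ and |k₂| ≤ |g₂| √Γ. Where g₁ and g₂ both vanish, `D
  -- n` vanishes too, so the value 0 of 0 / 0 is harmless.
  set k₁ : ℕ → X → ℝ := fun n x => D n x * (|g₁ x| / (|g₁ x| + |g₂ x|))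
  set k₂ : ℕ → X → ℝ := fun n x => D n x * (|g₂ x| / (|g₁ x| + |g₂ x|))
  have hk1 : ∀ n, AEStronglyMeasurable (k₁ n) m := fun n =>
    (D n).aestronglyMeasurable.mul
      (hg1.norm.aemeasurable.div (hg1.norm.add hg2.norm).aemeasurable).aestronglyMeasurable
  have hk2 : ∀ n, AEStronglyMeasurable (k₂ n) m := fun n =>
    (D n).aestronglyMeasurable.mul
      (hg2.norm.aemeasurable.div (hg1.norm.add hg2.norm).aemeasurable).aestronglyMeasurable
  have hbd : ∀ n, ∀ᵐ x ∂m, |D n x| ≤ (|g₁ x| + |g₂ x|) * C.sqrtΓ (f - φ n) x := by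
    intro n
    filter_upwards [abs_extend_le_ae (b := b) hA hg (φ n - f), hsum] with x h1 h2
    rw [hD, C.sqrtΓ_sub_comm f]
    refine h1.trans ?_
    rw [h2]
    gcongr
    · exact C.sqrtΓ_nonneg _ _
    · exact le_abs_self _
    · exact le_abs_self _
  refine ⟨fun n => ⟨φ n, hφ n⟩, hv, fun n => AEEqFun.mk _ (hk1 n), fun n => AEEqFun.mk _ (hk2 n),
    fun n => ?_, ?_, ?_⟩
  · change D n = _
    apply AEEqFun.ext
    filter_upwards [AEEqFun.coeFn_add (AEEqFun.mk _ (hk1 n)) (AEEqFun.mk _ (hk2 n)),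
      AEEqFun.coeFn_mk _ (hk1 n), AEEqFun.coeFn_mk _ (hk2 n), hbd n] with x h1 h2 h3 h4
    rw [h1, Pi.add_apply, h2, h3]
    simp only [k₁, k₂]
    rcases eq_or_ne (|g₁ x| + |g₂ x|) 0 with h0 | h0
    · rw [h0, zero_mul, abs_nonpos_iff] at h4
      rw [h4]; ring
    · field_simp
  · have hb1 : ∀ n, eLpNorm (AEEqFun.mk _ (hk1 n)) σ m
        ≤ eLpNorm g₁ q m * C.vpNorm p (f - φ n) := by
      intro n
      rw [eLpNorm_congr_ae (AEEqFun.coeFn_mk _ (hk1 n))]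
      calc _ ≤ eLpNorm (fun x => g₁ x * C.sqrtΓ (f - φ n) x) σ m := by
            apply eLpNorm_mono_ae
            filter_upwards [hbd n] with x hx
            simp only [k₁, norm_mul, Real.norm_eq_abs, abs_div, abs_abs,
              abs_of_nonneg (C.sqrtΓ_nonneg (f - φ n) x)]
            rw [abs_of_nonneg (by positivity : 0 ≤ |g₁ x| + |g₂ x|)]
            rcases eq_or_ne (|g₁ x| + |g₂ x|) 0 with h0 | h0
            · rw [h0, div_zero, mul_zero]
              exact mul_nonneg (abs_nonneg _) (C.sqrtΓ_nonneg _ _)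
            · have hpos : 0 < |g₁ x| + |g₂ x| := lt_of_le_of_ne (by positivity) h0.symm
              rw [mul_div_assoc', div_le_iff₀ hpos]
              nlinarith [mul_le_mul_of_nonneg_left hx (abs_nonneg (g₁ x))]
        _ ≤ eLpNorm g₁ q m * eLpNorm (C.sqrtΓ (f - φ n)) p m :=
            eLpNorm_mul_sqrtΓ_le hσ hg1 (C.measurable_sqrtΓ _).aestronglyMeasurable
        _ ≤ _ := by
            gcongr
            exact le_add_self
    have h1 := ENNReal.Tendsto.const_mul (a := eLpNorm g₁ q m) hv
      (Or.inr ((le_self_add.trans hS').trans_lt hS).ne)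
    rw [mul_zero] at h1
    exact tendsto_of_tendsto_of_tendsto_of_le_of_le tendsto_const_nhds h1 (fun _ => zero_le) hb1
  · have hb1 : ∀ n, eLpNorm (AEEqFun.mk _ (hk2 n)) 2 m
        ≤ eLpNorm g₂ ∞ m * eLpNorm (C.sqrtΓ (φ n - f)) 2 m := by
      intro n
      rw [eLpNorm_congr_ae (AEEqFun.coeFn_mk _ (hk2 n))]
      calc _ ≤ eLpNorm (fun x => g₂ x * C.sqrtΓ (φ n - f) x) 2 m := by
            apply eLpNorm_mono_ae
            filter_upwards [hbd n] with x hx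
            rw [C.sqrtΓ_sub_comm f] at hx
            simp only [k₂, norm_mul, Real.norm_eq_abs, abs_div, abs_abs,
              abs_of_nonneg (C.sqrtΓ_nonneg (φ n - f) x)]
            rw [abs_of_nonneg (by positivity : 0 ≤ |g₁ x| + |g₂ x|)]
            rcases eq_or_ne (|g₁ x| + |g₂ x|) 0 with h0 | h0
            · rw [h0, div_zero, mul_zero]
              exact mul_nonneg (abs_nonneg _) (C.sqrtΓ_nonneg _ _)
            · have hpos : 0 < |g₁ x| + |g₂ x| := lt_of_le_of_ne (by positivity) h0.symm
              rw [mul_div_assoc', div_le_iff₀ hpos]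
              nlinarith [mul_le_mul_of_nonneg_left hx (abs_nonneg (g₂ x))]
        _ ≤ _ := eLpNorm_mul_sqrtΓ_le (by simp) hg2 (C.measurable_sqrtΓ _).aestronglyMeasurable
    have h1 := ENNReal.Tendsto.const_mul (a := eLpNorm g₂ ∞ m)
      (C.tendsto_eLpNorm_sqrtΓ_two (tendsto_ofReal_toV hv))
      (Or.inr ((le_add_self.trans hS').trans_lt hS).ne)
    rw [mul_zero] at h1
    exact tendsto_of_tendsto_of_tendsto_of_le_of_le tendsto_const_nhds h1 (fun _ => zero_le) hb1

/-- Three successive subsequences make the L^σ part, the `L²` part and the gradients converge a.e.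
-/
lemma IsExtensionValue.isLimitValue {p σ : ℝ≥0∞} (hσ : σ ≠ 0) {f : E.domain} {G : X →ₘ[m] ℝ}
    (h : b.IsExtensionValue p σ f G) : b.IsLimitValue f G := by
  obtain ⟨φ, hφ, h₁, h₂, hsum, hh1, hh2⟩ := h
  have sub : ∀ {τ : ℝ≥0∞} {k : ℕ → (X →ₘ[m] ℝ)}, τ ≠ 0 →
      Tendsto (fun n => eLpNorm (k n) τ m) atTop (𝓝 0) →
      ∃ ns : ℕ → ℕ, StrictMono ns ∧ ∀ᵐ x ∂m, Tendsto (fun n => k (ns n) x) atTop (𝓝 0) := by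
    intro τ k hτ hk
    exact (tendstoInMeasure_of_tendsto_eLpNorm (g := 0) hτ
      (fun n => (k n).aestronglyMeasurable) aestronglyMeasurable_zero
      (by simpa using hk)).exists_seq_tendsto_ae
  obtain ⟨n₁, hn1, ht1⟩ := sub hσ hh1
  obtain ⟨n₂, hn2, ht2⟩ := sub two_ne_zero (hh2.comp hn1.tendsto_atTop)
  obtain ⟨n₃, hn3, ht3⟩ := exists_subseq_tendsto_sqrtΓ (C := C)
    (φ := fun n => (φ (n₁ (n₂ n))).1) ((tendsto_ofReal_toV hφ).comp
      (hn1.tendsto_atTop.comp hn2.tendsto_atTop))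
  refine ⟨fun n => φ (n₁ (n₂ (n₃ n))), ht3, ?_⟩
  have h5 := ae_all_iff.2 fun n => AEEqFun.coeFn_sub (b.toLin (φ n)) G
  have h6 := ae_all_iff.2 fun n => AEEqFun.coeFn_add (h₁ n) (h₂ n)
  filter_upwards [ht1, ht2, h5, h6] with x h1 h2 h5 h6
  have h7 := ((h1.comp (hn2.tendsto_atTop.comp hn3.tendsto_atTop)).add
    (h2.comp hn3.tendsto_atTop)).add_const (G x)
  rw [add_zero, zero_add] at h7
  refine h7.congr fun n => ?_
  have h8 := h5 (n₁ (n₂ (n₃ n)))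
  have h9 := h6 (n₁ (n₂ (n₃ n)))
  rw [hsum, h9, Pi.add_apply, Pi.sub_apply] at h8
  simp only [Function.comp_apply]
  linarith

lemma ext_eq_extend (hA : C.IsTestAlgebra A) {g : X → ℝ}
    (hg : ∀ f : A, ∀ᵐ x ∂m, |b.toLin f x| ≤ g x * C.sqrtΓ f.1 x) {q S : ℝ≥0∞} (hS : S < ∞)
    (hgS : IsSumBounded q g S m) {p σ : ℝ≥0∞} (hσ : σ⁻¹ = p⁻¹ + q⁻¹) (hσ0 : σ ≠ 0)
    (hp : C.DenseInV A p) {f : E.domain} (hf : C.MemV p f) : b.ext p σ f = b.extend hA f := by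
  have h : ∃ G, b.IsExtensionValue p σ f G :=
    ⟨_, isExtensionValue_extend hA hg hS hgS hσ hp hf⟩
  rw [ext, dif_pos h]
  exact (h.choose_spec.isLimitValue hσ0).unique (isLimitValue_extend hA f)

end VDerivation

end CarreDuChamp

end ContEq

end

/-! ### The regularised absolute value, its chain rule, and the standing assumptions. -/

noncomputable section

namespace ContEq

/-- The convex function `√(z² + δ²) - δ`, a smooth approximation of `|z|`. -/
def smoothAbs (δ z : ℝ) : ℝ := Real.sqrt (z ^ 2 + δ ^ 2) - δ

/-- The derivative of `smoothAbs δ`. -/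
def smoothSign (δ z : ℝ) : ℝ := z / Real.sqrt (z ^ 2 + δ ^ 2)

section

variable {δ : ℝ} (hδ : 0 < δ)

lemma le_sqrt_add_sq (z : ℝ) : δ ≤ Real.sqrt (z ^ 2 + δ ^ 2) :=
  Real.le_sqrt_of_sq_le (by nlinarith [sq_nonneg z])

lemma abs_le_sqrt_add_sq (z : ℝ) : |z| ≤ Real.sqrt (z ^ 2 + δ ^ 2) :=
  Real.abs_le_sqrt (by nlinarith [sq_nonneg δ])

lemma sq_sqrt_add_sq (z : ℝ) : Real.sqrt (z ^ 2 + δ ^ 2) ^ 2 = z ^ 2 + δ ^ 2 :=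
  Real.sq_sqrt (by positivity)

lemma smoothAbs_nonneg (z : ℝ) : 0 ≤ smoothAbs δ z := sub_nonneg.2 (le_sqrt_add_sq z)

@[simp] lemma smoothAbs_zero (hδ : 0 ≤ δ) : smoothAbs δ 0 = 0 := by
  simp [smoothAbs, Real.sqrt_sq hδ]

include hδ

lemma sqrt_add_sq_pos (z : ℝ) : 0 < Real.sqrt (z ^ 2 + δ ^ 2) := hδ.trans_le (le_sqrt_add_sq z)

omit hδ in
lemma continuous_smoothAbs : Continuous (smoothAbs δ) := by unfold smoothAbs; fun_prop

lemma continuous_smoothSign : Continuous (smoothSign δ) := by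
  unfold smoothSign
  exact continuous_id.div (by fun_prop) fun z => (sqrt_add_sq_pos hδ z).ne'

lemma contDiff_smoothAbs : ContDiff ℝ 1 (smoothAbs δ) := by
  unfold smoothAbs
  refine ContDiff.sub ?_ contDiff_const
  exact ContDiff.sqrt (by fun_prop) fun z => by positivity

lemma abs_smoothSign_le (z : ℝ) : |smoothSign δ z| ≤ 1 := by
  rw [smoothSign, abs_div, abs_of_pos (sqrt_add_sq_pos hδ z), div_le_one (sqrt_add_sq_pos hδ z)]
  exact abs_le_sqrt_add_sq z

/-- The tangent inequality for a convex function. It reduces to Cauchy–Schwarz for the vectors (a,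
δ) and (b, δ). -/
lemma smoothAbs_sub_le (a b : ℝ) :
    smoothAbs δ a - smoothAbs δ b ≤ smoothSign δ a * (a - b) := by
  have hA := sqrt_add_sq_pos hδ a
  have hB := sqrt_add_sq_pos hδ b
  have h1 : a * b + δ ^ 2 ≤ Real.sqrt (b ^ 2 + δ ^ 2) * Real.sqrt (a ^ 2 + δ ^ 2) := by
    rw [← Real.sqrt_mul (by positivity)]
    apply Real.le_sqrt_of_sq_le
    nlinarith [sq_nonneg (a - b), mul_nonneg (sq_nonneg δ) (sq_nonneg (a - b))]
  rw [smoothAbs, smoothAbs, smoothSign, div_mul_eq_mul_div, le_div_iff₀ hA]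
  have := sq_sqrt_add_sq (δ := δ) a
  nlinarith

lemma abs_smoothAbs_sub_le (a b : ℝ) : |smoothAbs δ a - smoothAbs δ b| ≤ |a - b| := by
  have key : ∀ a b : ℝ, smoothAbs δ a - smoothAbs δ b ≤ |a - b| := fun a b => by
    refine (smoothAbs_sub_le hδ a b).trans ((le_abs_self _).trans ?_)
    rw [abs_mul]
    exact mul_le_of_le_one_left (abs_nonneg _) (abs_smoothSign_le hδ a)
  rw [abs_le]
  refine ⟨?_, key a b⟩
  have := key b a
  rw [abs_sub_comm] at this
  linarith

lemma smoothAbs_le_abs (z : ℝ) : smoothAbs δ z ≤ |z| := by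
  have := (le_abs_self _).trans (abs_smoothAbs_sub_le hδ z 0)
  simpa [hδ.le] using this

lemma abs_smoothSign_sub_le (a b : ℝ) :
    |smoothSign δ a - smoothSign δ b| ≤ 2 / δ * |a - b| := by
  have hA := sqrt_add_sq_pos hδ a
  have hB := sqrt_add_sq_pos hδ b
  set A := Real.sqrt (a ^ 2 + δ ^ 2) with hAdef
  set B := Real.sqrt (b ^ 2 + δ ^ 2) with hBdef
  have h1 : smoothSign δ a - smoothSign δ b = (a - b) / A + smoothSign δ b * ((B - A) / A) := by
    rw [smoothSign, smoothSign, ← hAdef, ← hBdef]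
    field_simp
    ring
  have h2 : |B - A| ≤ |a - b| := by
    have := abs_smoothAbs_sub_le hδ b a
    rw [smoothAbs, smoothAbs, sub_sub_sub_cancel_right, abs_sub_comm b a] at this
    exact this
  have h3 : |a - b| / A ≤ |a - b| / δ := by
    gcongr
    exact le_sqrt_add_sq a
  rw [h1]
  calc _ ≤ |a - b| / A + 1 * (|a - b| / A) := by
        refine (abs_add_le _ _).trans ?_
        rw [abs_mul, abs_div, abs_div, abs_of_pos hA]
        gcongr
        exact abs_smoothSign_le hδ b
    _ ≤ |a - b| / δ + 1 * (|a - b| / δ) := by gcongr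
    _ = _ := by ring

/-- The defect z β' - β is the factor multiplying the divergence in the renormalised inequality.
This form shows at once that it lies between 0 and min (β, δ), the two bounds that follow. -/
lemma smoothSign_mul_self (z : ℝ) :
    z * smoothSign δ z - smoothAbs δ z = δ * (smoothAbs δ z / Real.sqrt (z ^ 2 + δ ^ 2)) := by
  have hA := sqrt_add_sq_pos hδ z
  have := sq_sqrt_add_sq (δ := δ) z
  rw [smoothAbs, smoothSign]
  field_simp
  nlinarith

lemma abs_smoothAbs_sub_mul_le (z : ℝ) : |smoothAbs δ z - z * smoothSign δ z| ≤ smoothAbs δ z := by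
  have hA := sqrt_add_sq_pos hδ z
  have h0 := smoothAbs_nonneg (δ := δ) z
  rw [abs_sub_comm, smoothSign_mul_self hδ, abs_of_nonneg (by positivity), ← mul_div_assoc,
    div_le_iff₀ hA, mul_comm]
  gcongr
  exact le_sqrt_add_sq z

lemma abs_smoothAbs_sub_mul_le' (z : ℝ) : |smoothAbs δ z - z * smoothSign δ z| ≤ δ := by
  have hA := sqrt_add_sq_pos hδ z
  have h0 := smoothAbs_nonneg (δ := δ) z
  rw [abs_sub_comm, smoothSign_mul_self hδ, abs_of_nonneg (by positivity)]
  refine mul_le_of_le_one_right hδ.le ?_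
  rw [div_le_one hA, smoothAbs]
  linarith

lemma smoothAbs_le_sq (z : ℝ) : smoothAbs δ z ≤ z ^ 2 / (2 * δ) := by
  have h0 := smoothAbs_nonneg (δ := δ) z
  have := sq_sqrt_add_sq (δ := δ) z
  rw [smoothAbs] at h0 ⊢
  rw [le_div_iff₀ (by positivity)]
  nlinarith

-- β solves β² + 2 δ β = z². This polynomial relation is what lets the Leibniz rule alone produce
-- the chain rule.
omit hδ in
lemma smoothAbs_sq_add (z : ℝ) : smoothAbs δ z * smoothAbs δ z + 2 * δ * smoothAbs δ z = z * z := by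
  have := sq_sqrt_add_sq (δ := δ) z
  rw [smoothAbs]
  nlinarith

omit hδ in
lemma smoothAbs_eq_zero {z : ℝ} (h : smoothAbs δ z = 0) : z = 0 := by
  have := smoothAbs_sq_add (δ := δ) z
  rw [h] at this
  simpa using this.symm

lemma smoothAbs_anti {ε : ℝ} (hε : δ ≤ ε) (z : ℝ) : smoothAbs ε z ≤ smoothAbs δ z := by
  have h1 := smoothAbs_sq_add (δ := δ) z
  have h2 := smoothAbs_sq_add (δ := ε) z
  have h3 := smoothAbs_nonneg (δ := δ) z
  have h4 := smoothAbs_nonneg (δ := ε) z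
  by_contra! h
  nlinarith

end

variable {X : Type*} [MeasurableSpace X] {m : Measure X} {E : DirichletForm m}

/-- The relations between the exponents. -/
structure IsTriple (q r s : ℝ≥0∞) : Prop where
  one_lt : 1 < s
  le : s ≤ r
  lt_top : r < ∞
  sum_eq : q⁻¹ + r⁻¹ + s⁻¹ = 1

namespace IsTriple

variable {q r s : ℝ≥0∞} (h : IsTriple q r s)
include h

lemma one_lt' : 1 < r := h.one_lt.trans_le h.le

lemma lt_top' : s < ∞ := h.le.trans_lt h.lt_top

lemma sum_eq' : q⁻¹ + s⁻¹ + r⁻¹ = 1 := by rw [← h.sum_eq]; ring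

end IsTriple

namespace CarreDuChamp

/-- The assumptions on the space and on the algebra of test functions. -/
structure Setting (C : CarreDuChamp E) (A : Submodule ℝ E.domain) (q r s : ℝ≥0∞) : Prop
    extends IsTriple q r s where
  alg : C.IsTestAlgebra A
  dense_r : C.DenseInV A r
  dense_s : C.DenseInV A s
  lpGamma_r : C.LpGamma r
  lpGamma_s : C.LpGamma s

variable {C : CarreDuChamp E} {A : Submodule ℝ E.domain}

/-- Interpolation between 𝕍₁ and 𝕍_∞. -/
lemma IsTestAlgebra.memLp_sqrtΓ (hA : C.IsTestAlgebra A) {f : E.domain} (hf : f ∈ A) {p : ℝ≥0∞}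
    (hp : 1 ≤ p) : MemLp (C.sqrtΓ f) p m := by
  have hm := (C.measurable_sqrtΓ f).aestronglyMeasurable (μ := m)
  refine ⟨hm, (eLpNorm_le_two_mul_add hp le_top hm).trans_lt ?_⟩
  exact ENNReal.mul_lt_top ENNReal.ofNat_lt_top (ENNReal.add_lt_top.2
    ⟨((hA.denseInV 1 le_rfl one_le_two).1 f hf).2.2, (hA.memV_top f hf).2.2⟩)

lemma IsTestAlgebra.exists_mul (hA : C.IsTestAlgebra A) (f g : A) :
    ∃ h : A, ∀ᵐ x ∂m, (h.1 : Lp ℝ 2 m) x = (f.1 : Lp ℝ 2 m) x * (g.1 : Lp ℝ 2 m) x := by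
  obtain ⟨h, hh, hx⟩ := hA.comp 2 (fun z => z 0 * z 1) (by fun_prop) (by simp)
    ![f.1, g.1] (fun i => by fin_cases i <;> simp)
  exact ⟨⟨h, hh⟩, by simpa using hx⟩

lemma IsTestAlgebra.exists_smoothAbs (hA : C.IsTestAlgebra A) {δ : ℝ} (hδ : 0 < δ) (f : A) :
    ∃ h : A, ∀ᵐ x ∂m, (h.1 : Lp ℝ 2 m) x = smoothAbs δ ((f.1 : Lp ℝ 2 m) x) := by
  obtain ⟨h, hh, hx⟩ := hA.comp 1 (fun z => smoothAbs δ (z 0))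
    ((contDiff_smoothAbs hδ).comp (by fun_prop)) (by simp [hδ.le])
    ![f.1] (fun i => by fin_cases i; simp)
  exact ⟨⟨h, hh⟩, by simpa using hx⟩

/-- With h = β(f) one has f² = h² + 2 δ h in the algebra. Applying b and Leibniz gives f df(b) = (h
+ δ) dh(b), and h + δ = √(f² + δ²) is positive. -/
lemma VDerivation.toLin_smoothAbs (b : C.VDerivation A) (hA : C.IsTestAlgebra A) {δ : ℝ}
    (hδ : 0 < δ) {f h : A}
    (hh : ∀ᵐ x ∂m, (h.1 : Lp ℝ 2 m) x = smoothAbs δ ((f.1 : Lp ℝ 2 m) x)) :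
    ∀ᵐ x ∂m, b.toLin h x = smoothSign δ ((f.1 : Lp ℝ 2 m) x) * b.toLin f x := by
  obtain ⟨f2, hf2⟩ := hA.exists_mul f f
  obtain ⟨h2, hh2⟩ := hA.exists_mul h h
  have e : f2 = h2 + (2 * δ) • h := by
    apply Subtype.ext
    apply Subtype.ext
    apply Lp.ext
    rw [Submodule.coe_add, Submodule.coe_add, Submodule.coe_smul, Submodule.coe_smul]
    filter_upwards [hf2, hh2, hh, Lp.coeFn_add (h2.1 : Lp ℝ 2 m) ((2 * δ) • (h.1 : Lp ℝ 2 m)),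
      Lp.coeFn_smul (2 * δ) (h.1 : Lp ℝ 2 m)] with x h1 h2 h3 h4 h5
    rw [h4, Pi.add_apply, h5, Pi.smul_apply, h1, h2, h3, smul_eq_mul, smoothAbs_sq_add]
  have e' : b.toLin f2 = b.toLin h2 + (2 * δ) • b.toLin h := by rw [e, map_add, map_smul]
  filter_upwards [b.leibniz f f f2 hf2, b.leibniz h h h2 hh2, hh,
    AEEqFun.coeFn_add (b.toLin h2) ((2 * δ) • b.toLin h), AEEqFun.coeFn_smul (2 * δ) (b.toLin h)]
    with x h1 h2 h3 h4 h5
  rw [e', h4, Pi.add_apply, h5, Pi.smul_apply, smul_eq_mul, h2, h3] at h1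
  have hA := sqrt_add_sq_pos hδ ((f.1 : Lp ℝ 2 m) x)
  rw [smoothSign]
  rw [smoothAbs] at h1
  field_simp
  linarith

/-- The assumptions on a derivation `b` with divergence `d` and modulus at most `g`. -/
structure VDerivation.IsControlled (b : C.VDerivation A) (g d : X → ℝ) (q Sb Sd : ℝ≥0∞) :
    Prop where
  bound : ∀ f : A, ∀ᵐ x ∂m, |b.toLin f x| ≤ g x * C.sqrtΓ f.1 x
  nonneg : ∀ x, 0 ≤ g x
  sum_bound : IsSumBounded q g Sb m
  sum_div : IsSumBounded q d Sd m
  fin_bound : Sb < ∞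
  fin_div : Sd < ∞
  isDiv : b.IsDivergence d

end CarreDuChamp

end ContEq

end

/-! ### Integration by parts for the extended derivation. -/

noncomputable section

namespace ContEq

variable {X : Type*} [MeasurableSpace X] {m : Measure X} {E : DirichletForm m}

lemma coe_sub_ae (f g : E.domain) :
    (((f - g : E.domain) : Lp ℝ 2 m) : X → ℝ) =ᵐ[m] (f : Lp ℝ 2 m) - (g : Lp ℝ 2 m) := by
  rw [Submodule.coe_sub]
  exact Lp.coeFn_sub _ _

lemma integral_eq_zero_of_tendsto {F : ℕ → X → ℝ} {G : X → ℝ} (hG : Integrable G m)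
    (hF : ∀ n, Integrable (F n) m) (h0 : ∀ n, ∫ x, F n x ∂m = 0)
    (h : Tendsto (fun n => ∫⁻ x, ‖F n x - G x‖ₑ ∂m) atTop (𝓝 0)) : ∫ x, G x ∂m = 0 := by
  have := tendsto_integral_of_L1 G hG.1 (Eventually.of_forall hF) h
  simp only [h0] at this
  exact (tendsto_nhds_unique this tendsto_const_nhds)

lemma lintegral_enorm_add_le {F₁ F₂ : X → ℝ} (h₁ : AEStronglyMeasurable F₁ m) :
    ∫⁻ x, ‖F₁ x + F₂ x‖ₑ ∂m ≤ ∫⁻ x, ‖F₁ x‖ₑ ∂m + ∫⁻ x, ‖F₂ x‖ₑ ∂m := by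
  rw [← lintegral_add_left' h₁.enorm]
  exact lintegral_mono fun x => enorm_add_le _ _

namespace CarreDuChamp

variable (C : CarreDuChamp E)

/-- The norm of `f` and of its gradient in `L^p ∩ L²`. -/
def gradNorm (p : ℝ≥0∞) (f : E.domain) : ℝ≥0∞ :=
  interNorm p (f : Lp ℝ 2 m) m + interNorm p (C.sqrtΓ f) m

lemma interNorm_le_gradNorm (p : ℝ≥0∞) (f : E.domain) :
    interNorm p (f : Lp ℝ 2 m) m ≤ C.gradNorm p f := le_self_add

lemma interNorm_sqrtΓ_le_gradNorm (p : ℝ≥0∞) (f : E.domain) :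
    interNorm p (C.sqrtΓ f) m ≤ C.gradNorm p f := le_add_self

lemma gradNorm_lt_top {p : ℝ≥0∞} {f : E.domain} (hf : C.MemV p f) : C.gradNorm p f < ∞ :=
  ENNReal.add_lt_top.2 ⟨interNorm_lt_top hf.1 (Lp.memLp _), C.interNorm_sqrtΓ_lt_top hf⟩

lemma gradNorm_sub_comm (p : ℝ≥0∞) (f g : E.domain) :
    C.gradNorm p (f - g) = C.gradNorm p (g - f) := by
  rw [gradNorm, gradNorm, C.sqrtΓ_sub_comm, interNorm_congr_ae (coe_sub_ae f g),
    interNorm_congr_ae (coe_sub_ae g f), ← interNorm_neg, neg_sub]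

lemma exists_gradNorm_le_vpNorm :
    ∃ K : ℝ≥0, ∀ (p : ℝ≥0∞) (f : E.domain), C.gradNorm p f ≤ K * C.vpNorm p f := by
  obtain ⟨K, hK⟩ := C.exists_eLpNorm_sqrtΓ_two_le
  refine ⟨1 + 1 + K, fun p f => ?_⟩
  have h1 : eLpNorm (f : Lp ℝ 2 m) 2 m ≤ C.vpNorm p f := by
    rw [← ofReal_norm_eq_eLpNorm, vpNorm, add_assoc]
    refine le_trans (ENNReal.ofReal_le_ofReal ?_) le_self_add
    rw [← E.norm_toV]
    exact E.norm_coe_le f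
  have h2 : eLpNorm (C.sqrtΓ f) 2 m ≤ K * C.vpNorm p f := by
    refine (hK f).trans ?_
    rw [E.norm_toV, vpNorm, add_assoc]
    gcongr
    exact le_self_add
  have h3 : eLpNorm (f : Lp ℝ 2 m) p m + eLpNorm (C.sqrtΓ f) p m ≤ C.vpNorm p f := by
    rw [vpNorm, add_assoc]
    exact le_add_self
  calc C.gradNorm p f = (eLpNorm (f : Lp ℝ 2 m) p m + eLpNorm (C.sqrtΓ f) p m)
        + eLpNorm (f : Lp ℝ 2 m) 2 m + eLpNorm (C.sqrtΓ f) 2 m := by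
        rw [gradNorm, interNorm, interNorm]; ring
    _ ≤ C.vpNorm p f + C.vpNorm p f + K * C.vpNorm p f := by gcongr
    _ = _ := by push_cast; ring

variable {C} {A : Submodule ℝ E.domain}

lemma DenseInV.exists_seq {p : ℝ≥0∞} (h : C.DenseInV A p) {f : E.domain} (hf : C.MemV p f) :
    ∃ φ : ℕ → A, Tendsto (fun n => C.gradNorm p ((φ n).1 - f)) atTop (𝓝 0) := by
  obtain ⟨K, hK⟩ := C.exists_gradNorm_le_vpNorm
  choose φ hφ hφ' using fun n : ℕ => h.2 f hf (ENNReal.ofReal (1 / (n + 1))) (by positivity)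
  have hlim : Tendsto (fun n : ℕ => (K : ℝ≥0∞) * ENNReal.ofReal (1 / (n + 1))) atTop (𝓝 0) := by
    have := ENNReal.Tendsto.const_mul (a := (K : ℝ≥0∞))
      (ENNReal.tendsto_ofReal (tendsto_one_div_add_atTop_nhds_zero_nat (𝕜 := ℝ)))
      (Or.inr ENNReal.coe_ne_top)
    simpa using this
  refine ⟨fun n => ⟨φ n, hφ n⟩, tendsto_of_tendsto_of_tendsto_of_le_of_le tendsto_const_nhds hlim
    (fun _ => zero_le) fun n => ?_⟩
  change C.gradNorm p (φ n - f) ≤ _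
  rw [C.gradNorm_sub_comm]
  refine (hK p _).trans ?_
  gcongr
  exact (hφ' n).le

lemma MemV.sub {p : ℝ≥0∞} (hp : 1 ≤ p) {f g : E.domain} (hf : C.MemV p f) (hg : C.MemV p g) :
    C.MemV p (f - g) := by
  refine ⟨(memLp_congr_ae (coe_sub_ae f g)).2 (hf.1.sub hg.1),
    (C.measurable_sqrtΓ _).aestronglyMeasurable, ?_⟩
  have := C.eLpNorm_sqrtΓ_add_le hp f ((-1 : ℝ) • g)
  rw [C.eLpNorm_sqrtΓ_smul, abs_neg, abs_one, ENNReal.ofReal_one, one_mul, neg_one_smul,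
    ← sub_eq_add_neg] at this
  exact this.trans_lt (ENNReal.add_lt_top.2 ⟨hf.2.2, hg.2.2⟩)

lemma IsTestAlgebra.memV (hA : C.IsTestAlgebra A) (f : A) {p : ℝ≥0∞} (hp : 1 ≤ p) :
    C.MemV p f.1 := ⟨hA.memLp f.1 f.2 p hp, hA.memLp_sqrtΓ f.2 hp⟩

namespace VDerivation.IsControlled

variable {b : C.VDerivation A} {g d : X → ℝ} {q p p' Sb Sd : ℝ≥0∞}
  (hb : b.IsControlled g d q Sb Sd) (hA : C.IsTestAlgebra A) (hpp : q⁻¹ + p⁻¹ + p'⁻¹ = 1)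
include hb hpp

lemma lintegral_mul_extend_le {k : X → ℝ} (hk : AEStronglyMeasurable k m) (f : E.domain) :
    ∫⁻ x, ‖k x * b.extend hA f x‖ₑ ∂m ≤ Sb * interNorm p k m * interNorm p' (C.sqrtΓ f) m := by
  refine le_trans (lintegral_mono_ae ?_) (hb.sum_bound.lintegral_le hpp hk
    (C.measurable_sqrtΓ f).aestronglyMeasurable)
  filter_upwards [abs_extend_le_ae hA hb.bound f] with x hx
  rw [enorm_mul, mul_assoc]
  gcongr
  rw [← enorm_mul]
  exact enorm_le_iff_norm_le.2 (hx.trans (le_abs_self _))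

lemma integrable_mul_extend {k : X → ℝ} (hk : AEStronglyMeasurable k m)
    (hk' : interNorm p k m < ∞) {f : E.domain} (hf : C.MemV p' f) :
    Integrable (fun x => k x * b.extend hA f x) m :=
  ⟨hk.mul (b.extend hA f).aestronglyMeasurable, by
    rw [hasFiniteIntegral_iff_enorm]
    exact (hb.lintegral_mul_extend_le hA hpp hk f).trans_lt (ENNReal.mul_lt_top
      (ENNReal.mul_lt_top hb.fin_bound hk') (C.interNorm_sqrtΓ_lt_top hf))⟩

lemma lintegral_mul_mul_div_le {k h : X → ℝ} (hk : AEStronglyMeasurable k m)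
    (hh : AEStronglyMeasurable h m) :
    ∫⁻ x, ‖k x * h x * d x‖ₑ ∂m ≤ Sd * interNorm p k m * interNorm p' h m := by
  refine le_trans (lintegral_mono fun x => ?_) (hb.sum_div.lintegral_le hpp hk hh)
  rw [enorm_mul, enorm_mul, mul_right_comm]

lemma integrable_mul_mul_div {k h : X → ℝ} (hk : AEStronglyMeasurable k m)
    (hh : AEStronglyMeasurable h m) (hk' : interNorm p k m < ∞) (hh' : interNorm p' h m < ∞) :
    Integrable (fun x => k x * h x * d x) m :=
  ⟨(hk.mul hh).mul hb.sum_div.aestronglyMeasurable, by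
    rw [hasFiniteIntegral_iff_enorm]
    exact (hb.lintegral_mul_mul_div_le hpp hk hh).trans_lt (ENNReal.mul_lt_top
      (ENNReal.mul_lt_top hb.fin_div hk') hh')⟩

/-- The definition of the divergence applied to the product φ ψ, which lies in the algebra. -/
lemma integral_byParts_of_mem (hp : 1 ≤ p) (hp' : 1 ≤ p') (φ ψ : A) :
    ∫ x, ((φ.1 : Lp ℝ 2 m) x * b.extend hA ψ.1 x + (ψ.1 : Lp ℝ 2 m) x * b.extend hA φ.1 x
      + (φ.1 : Lp ℝ 2 m) x * (ψ.1 : Lp ℝ 2 m) x * d x) ∂m = 0 := by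
  obtain ⟨h, hh⟩ := hA.exists_mul φ ψ
  have m1 : ∀ (φ : A) {p : ℝ≥0∞}, 1 ≤ p → interNorm p (φ.1 : Lp ℝ 2 m) m < ∞ := fun φ p hp =>
    interNorm_lt_top (hA.memLp φ.1 φ.2 p hp) (Lp.memLp _)
  have i1 := hb.integrable_mul_extend hA hpp (Lp.aestronglyMeasurable (φ.1 : Lp ℝ 2 m))
    (m1 φ hp) (hA.memV ψ hp')
  have i2 := hb.integrable_mul_extend hA hpp (Lp.aestronglyMeasurable (ψ.1 : Lp ℝ 2 m))
    (m1 ψ hp) (hA.memV φ hp')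
  have i3 := hb.integrable_mul_mul_div hpp (Lp.aestronglyMeasurable (φ.1 : Lp ℝ 2 m))
    (Lp.aestronglyMeasurable (ψ.1 : Lp ℝ 2 m)) (m1 φ hp) (m1 ψ hp')
  have e3 := integral_add (i1.add i2) i3
  simp only [Pi.add_apply] at e3
  rw [e3]
  have e1 : ∫ x, ((φ.1 : Lp ℝ 2 m) x * b.extend hA ψ.1 x
      + (ψ.1 : Lp ℝ 2 m) x * b.extend hA φ.1 x) ∂m = ∫ x, b.toLin h x ∂m := by
    apply integral_congr_ae
    filter_upwards [b.leibniz φ ψ h hh] with x hx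
    rw [hx, extend_coe, extend_coe]
  have e2 : ∫ x, (φ.1 : Lp ℝ 2 m) x * (ψ.1 : Lp ℝ 2 m) x * d x ∂m
      = ∫ x, (h.1 : Lp ℝ 2 m) x * d x ∂m := by
    apply integral_congr_ae
    filter_upwards [hh] with x hx
    rw [hx]
  have := hb.isDiv h
  rw [e1, e2, this]; ring

lemma integrable_byParts {f g' : E.domain} (hf : C.MemV p f) (hg : C.MemV p' g') :
    Integrable (fun x => (f : Lp ℝ 2 m) x * b.extend hA g' x + (g' : Lp ℝ 2 m) x * b.extend hA f x
      + (f : Lp ℝ 2 m) x * (g' : Lp ℝ 2 m) x * d x) m := by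
  have hpp' : q⁻¹ + p'⁻¹ + p⁻¹ = 1 := by rw [← hpp]; ring
  have n1 := interNorm_lt_top hf.1 (Lp.memLp _)
  have n2 := interNorm_lt_top hg.1 (Lp.memLp _)
  exact ((hb.integrable_mul_extend hA hpp (Lp.aestronglyMeasurable _) n1 hg).add
    (hb.integrable_mul_extend hA hpp' (Lp.aestronglyMeasurable _) n2 hf)).add
    (hb.integrable_mul_mul_div hpp (Lp.aestronglyMeasurable _) (Lp.aestronglyMeasurable _) n1 n2)

lemma lintegral_byParts_le (f g' : E.domain) :
    ∫⁻ x, ‖(f : Lp ℝ 2 m) x * b.extend hA g' x + (g' : Lp ℝ 2 m) x * b.extend hA f x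
      + (f : Lp ℝ 2 m) x * (g' : Lp ℝ 2 m) x * d x‖ₑ ∂m
      ≤ (2 * Sb + Sd) * C.gradNorm p f * C.gradNorm p' g' := by
  have hpp' : q⁻¹ + p'⁻¹ + p⁻¹ = 1 := by rw [← hpp]; ring
  have m1 := Lp.aestronglyMeasurable (f : Lp ℝ 2 m)
  have m2 := Lp.aestronglyMeasurable (g' : Lp ℝ 2 m)
  have h1 := hb.lintegral_mul_extend_le hA hpp m1 g'
  have h2 := hb.lintegral_mul_extend_le hA hpp' m2 f
  have h3 := hb.lintegral_mul_mul_div_le hpp m1 m2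
  have a1 := m1.mul (b.extend hA g').aestronglyMeasurable
  have a2 := m2.mul (b.extend hA f).aestronglyMeasurable
  have g1 := C.interNorm_le_gradNorm p f
  have g2 := C.interNorm_sqrtΓ_le_gradNorm p f
  have g3 := C.interNorm_le_gradNorm p' g'
  have g4 := C.interNorm_sqrtΓ_le_gradNorm p' g'
  refine (lintegral_enorm_add_le (a1.add a2)).trans ?_
  refine (add_le_add (lintegral_enorm_add_le a1) le_rfl).trans ?_
  refine (add_le_add (add_le_add h1 h2) h3).trans ?_
  calc _ ≤ Sb * C.gradNorm p f * C.gradNorm p' g' + Sb * C.gradNorm p' g' * C.gradNorm p f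
        + Sd * C.gradNorm p f * C.gradNorm p' g' :=
        add_le_add (add_le_add (mul_le_mul' (mul_le_mul' le_rfl g1) g4)
          (mul_le_mul' (mul_le_mul' le_rfl g3) g2)) (mul_le_mul' (mul_le_mul' le_rfl g1) g3)
    _ = _ := by ring

omit hb hpp in
lemma extend_sub_ae (f g' : E.domain) :
    ∀ᵐ x ∂m, b.extend hA (f - g') x = b.extend hA f x - b.extend hA g' x := by
  rw [map_sub]
  exact AEEqFun.coeFn_sub _ _

/-- The integrand is bilinear and bounded in L¹ by the product of the two gradient norms, so the
identity passes to the limit, first in one factor and then in the other. -/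
lemma integral_byParts (hp : 1 ≤ p) (hp' : 1 ≤ p') (hdp : C.DenseInV A p)
    (hdp' : C.DenseInV A p') {f g' : E.domain} (hf : C.MemV p f) (hg : C.MemV p' g') :
    ∫ x, ((f : Lp ℝ 2 m) x * b.extend hA g' x + (g' : Lp ℝ 2 m) x * b.extend hA f x
      + (f : Lp ℝ 2 m) x * (g' : Lp ℝ 2 m) x * d x) ∂m = 0 := by
  have hM : 2 * Sb + Sd ≠ ∞ := by
    have h1 := hb.fin_bound.ne
    have h2 := hb.fin_div.ne
    finiteness
  have step : ∀ φ : A, ∫ x, ((φ.1 : Lp ℝ 2 m) x * b.extend hA g' x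
      + (g' : Lp ℝ 2 m) x * b.extend hA φ.1 x
      + (φ.1 : Lp ℝ 2 m) x * (g' : Lp ℝ 2 m) x * d x) ∂m = 0 := by
    intro φ
    obtain ⟨ψ, hψ⟩ := hdp'.exists_seq hg
    refine integral_eq_zero_of_tendsto (hb.integrable_byParts hA hpp (hA.memV φ hp) hg)
      (fun n => hb.integrable_byParts hA hpp (hA.memV φ hp) (hA.memV (ψ n) hp'))
      (fun n => hb.integral_byParts_of_mem hA hpp hp hp' φ (ψ n)) ?_
    have h1 := ENNReal.Tendsto.const_mul (a := (2 * Sb + Sd) * C.gradNorm p φ.1) hψ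
      (Or.inr (ENNReal.mul_ne_top hM (C.gradNorm_lt_top (hA.memV φ hp)).ne))
    rw [mul_zero] at h1
    refine tendsto_of_tendsto_of_tendsto_of_le_of_le tendsto_const_nhds h1 (fun _ => zero_le)
      fun n => le_trans (lintegral_mono_ae ?_) (hb.lintegral_byParts_le hA hpp φ.1 ((ψ n).1 - g'))
    filter_upwards [extend_sub_ae (b := b) hA (ψ n).1 g', coe_sub_ae (ψ n).1 g'] with x h2 h3
    rw [h2, h3, Pi.sub_apply]
    apply le_of_eq
    congr 1
    ring
  obtain ⟨φ, hφ⟩ := hdp.exists_seq hf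
  refine integral_eq_zero_of_tendsto (hb.integrable_byParts hA hpp hf hg)
    (fun n => hb.integrable_byParts hA hpp (hA.memV (φ n) hp) hg) (fun n => step (φ n)) ?_
  have h1 := ENNReal.Tendsto.mul_const (b := C.gradNorm p' g')
    (ENNReal.Tendsto.const_mul (a := 2 * Sb + Sd) hφ (Or.inr hM))
    (Or.inr (C.gradNorm_lt_top hg).ne)
  rw [mul_zero, zero_mul] at h1
  refine tendsto_of_tendsto_of_tendsto_of_le_of_le tendsto_const_nhds h1 (fun _ => zero_le)
    fun n => le_trans (lintegral_mono_ae ?_) (hb.lintegral_byParts_le hA hpp ((φ n).1 - f) g')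
  filter_upwards [extend_sub_ae (b := b) hA (φ n).1 f, coe_sub_ae (φ n).1 f] with x h2 h3
  rw [h2, h3, Pi.sub_apply]
  apply le_of_eq
  congr 1
  ring

end VDerivation.IsControlled

end CarreDuChamp

end ContEq

end

/-! ### The chain rule for β(f) when f is not in the algebra. -/

noncomputable section

namespace ContEq

variable {X : Type*} [MeasurableSpace X] {m : Measure X} {E : DirichletForm m}

/-- The target exponent s' used in `deformation` is the Hölder exponent of an L^q bound against a
gradient in L^r. -/
lemma IsTriple.conjExponent_inv {q r s : ℝ≥0∞} (h : q⁻¹ + r⁻¹ + s⁻¹ = 1) (hs : 1 ≤ s) :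
    s.conjExponent⁻¹ = r⁻¹ + q⁻¹ := by
  have h1 := (ENNReal.HolderConjugate.conjExponent hs).inv_add_inv_eq_one
  have hs0 : s⁻¹ ≠ ∞ := ENNReal.inv_ne_top.2 (zero_lt_one.trans_le hs).ne'
  refine (ENNReal.add_right_inj hs0).1 (h1.trans ?_)
  rw [← h]; ring

lemma enorm_abs_eq (a : ℝ) : ‖|a|‖ₑ = ‖a‖ₑ := by rw [← ofReal_norm, ← ofReal_norm, norm_abs_eq_norm]

namespace CarreDuChamp

variable {C : CarreDuChamp E} {A : Submodule ℝ E.domain}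

namespace VDerivation.IsControlled

section

variable {b : C.VDerivation A} {g d : X → ℝ} {q p p' Sb Sd : ℝ≥0∞}
  (hb : b.IsControlled g d q Sb Sd) (hA : C.IsTestAlgebra A) (hpp : q⁻¹ + p⁻¹ + p'⁻¹ = 1)
  {δ : ℝ} (hδ : 0 < δ)
include hb hpp hδ

lemma integral_smoothAbs_of_mem (hp : 1 ≤ p) (hp' : 1 ≤ p') (φ κ : A) :
    ∫ x, (smoothAbs δ ((φ.1 : Lp ℝ 2 m) x) * b.extend hA κ.1 x
      + (κ.1 : Lp ℝ 2 m) x * smoothSign δ ((φ.1 : Lp ℝ 2 m) x) * b.extend hA φ.1 x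
      + smoothAbs δ ((φ.1 : Lp ℝ 2 m) x) * (κ.1 : Lp ℝ 2 m) x * d x) ∂m = 0 := by
  obtain ⟨h, hh⟩ := hA.exists_smoothAbs hδ φ
  rw [← hb.integral_byParts_of_mem hA hpp hp hp' h κ]
  apply integral_congr_ae
  filter_upwards [hh, b.toLin_smoothAbs hA hδ hh] with x h1 h2
  rw [extend_coe, extend_coe, extend_coe, h1, h2]
  ring

lemma integrable_smoothAbs (hp' : 1 ≤ p') {f : E.domain} (hf : C.MemV p f) (κ : A) :
    Integrable (fun x => smoothAbs δ ((f : Lp ℝ 2 m) x) * b.extend hA κ.1 x) m ∧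
    Integrable (fun x => (κ.1 : Lp ℝ 2 m) x * smoothSign δ ((f : Lp ℝ 2 m) x)
      * b.extend hA f x) m ∧
    Integrable (fun x => smoothAbs δ ((f : Lp ℝ 2 m) x) * (κ.1 : Lp ℝ 2 m) x * d x) m := by
  have hpp' : q⁻¹ + p'⁻¹ + p⁻¹ = 1 := by rw [← hpp]; ring
  have m1 : AEStronglyMeasurable (fun x => smoothAbs δ ((f : Lp ℝ 2 m) x)) m :=
    continuous_smoothAbs.comp_aestronglyMeasurable (Lp.aestronglyMeasurable _)
  have m2 : AEStronglyMeasurable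
      (fun x => (κ.1 : Lp ℝ 2 m) x * smoothSign δ ((f : Lp ℝ 2 m) x)) m :=
    (Lp.aestronglyMeasurable _).mul
      ((continuous_smoothSign hδ).comp_aestronglyMeasurable (Lp.aestronglyMeasurable _))
  have n1 : interNorm p (fun x => smoothAbs δ ((f : Lp ℝ 2 m) x)) m < ∞ := by
    refine lt_of_le_of_lt (interNorm_mono_ae (Eventually.of_forall fun x => ?_))
      (interNorm_lt_top hf.1 (Lp.memLp _))
    rw [Real.norm_of_nonneg (smoothAbs_nonneg _)]
    exact smoothAbs_le_abs hδ _
  have n3 : interNorm p' (κ.1 : Lp ℝ 2 m) m < ∞ :=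
    interNorm_lt_top (hA.memLp _ κ.2 p' hp') (Lp.memLp _)
  have n2 : interNorm p' (fun x => (κ.1 : Lp ℝ 2 m) x * smoothSign δ ((f : Lp ℝ 2 m) x)) m
      < ∞ := by
    refine lt_of_le_of_lt (interNorm_mono_ae (Eventually.of_forall fun x => ?_)) n3
    rw [norm_mul]
    exact mul_le_of_le_one_right (norm_nonneg _) (abs_smoothSign_le hδ _)
  exact ⟨hb.integrable_mul_extend hA hpp m1 n1 (hA.memV κ hp'),
    hb.integrable_mul_extend hA hpp' m2 n2 hf,
    hb.integrable_mul_mul_div hpp m1 (Lp.aestronglyMeasurable _) n1 n3⟩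

/-- The identity ∫ d(β(f) κ)(b) = -∫ β(f) κ div b in expanded form, so that β(f) need not itself be
approximated in 𝕍_p. It is passed to the limit from f in the algebra. -/
lemma integral_smoothAbs (hp : 1 ≤ p) (hp' : 1 ≤ p') (hdp : C.DenseInV A p) {f : E.domain}
    (hf : C.MemV p f) (κ : A) :
    ∫ x, (smoothAbs δ ((f : Lp ℝ 2 m) x) * b.extend hA κ.1 x
      + (κ.1 : Lp ℝ 2 m) x * smoothSign δ ((f : Lp ℝ 2 m) x) * b.extend hA f x
      + smoothAbs δ ((f : Lp ℝ 2 m) x) * (κ.1 : Lp ℝ 2 m) x * d x) ∂m = 0 := by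
  have hpp' : q⁻¹ + p'⁻¹ + p⁻¹ = 1 := by rw [← hpp]; ring
  obtain ⟨φ₀, hφ₀⟩ := hdp.exists_seq hf
  obtain ⟨ns, hns, hae⟩ := (tendstoInMeasure_of_tendsto_eLpNorm (μ := m) (p := 2)
    (f := fun n => ((φ₀ n).1 : Lp ℝ 2 m)) (g := (f : Lp ℝ 2 m)) two_ne_zero
    (fun n => Lp.aestronglyMeasurable _) (Lp.aestronglyMeasurable _) (by
      refine tendsto_of_tendsto_of_tendsto_of_le_of_le tendsto_const_nhds hφ₀
        (fun _ => zero_le) fun n => ?_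
      rw [← eLpNorm_congr_ae (coe_sub_ae _ _)]
      exact (eLpNorm_two_le_interNorm p _).trans
        (C.interNorm_le_gradNorm _ _))).exists_seq_tendsto_ae
  set φ : ℕ → A := fun n => φ₀ (ns n)
  have hφ : Tendsto (fun n => C.gradNorm p ((φ n).1 - f)) atTop (𝓝 0) :=
    hφ₀.comp hns.tendsto_atTop
  obtain ⟨i1, i2, i3⟩ := hb.integrable_smoothAbs hA hpp hδ hp' hf κ
  have iφ := fun n => hb.integrable_smoothAbs hA hpp hδ hp' (hA.memV (φ n) hp) κ
  refine integral_eq_zero_of_tendsto ((i1.add i2).add i3)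
    (fun n => ((iφ n).1.add (iφ n).2.1).add (iφ n).2.2)
    (fun n => hb.integral_smoothAbs_of_mem hA hpp hδ hp hp' (φ n) κ) ?_
  set k : X → ℝ := ⇑(κ.1 : Lp ℝ 2 m)
  have mk : AEStronglyMeasurable k m := Lp.aestronglyMeasurable _
  have nk : interNorm p' k m < ∞ := interNorm_lt_top (hA.memLp _ κ.2 p' hp') (Lp.memLp _)
  have nk' : interNorm p' (C.sqrtΓ κ.1) m < ∞ := C.interNorm_sqrtΓ_lt_top (hA.memV κ hp')
  set M : ℝ≥0∞ := Sb * interNorm p' (C.sqrtΓ κ.1) m + Sb * interNorm p' k m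
    + Sd * interNorm p' k m
  have hM : M ≠ ∞ := by
    have := hb.fin_bound.ne
    have := hb.fin_div.ne
    have := nk.ne
    have := nk'.ne
    finiteness
  -- All differences are linear in φ_n - f, up to factors of size at most 1, except this one. It is
  -- handled by dominated convergence along the a.e. convergent subsequence, since β' is bounded by
  -- 1.
  set R : ℕ → X → ℝ := fun n x => k x * (smoothSign δ (((φ n).1 : Lp ℝ 2 m) x)
    - smoothSign δ ((f : Lp ℝ 2 m) x)) * b.extend hA f x
  have mR : ∀ n, AEStronglyMeasurable (R n) m := fun n =>
    (mk.mul (((continuous_smoothSign hδ).comp_aestronglyMeasurable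
      (Lp.aestronglyMeasurable _)).sub ((continuous_smoothSign hδ).comp_aestronglyMeasurable
      (Lp.aestronglyMeasurable _)))).mul (b.extend hA f).aestronglyMeasurable
  have hR : Tendsto (fun n => ∫⁻ x, ‖R n x‖ₑ ∂m) atTop (𝓝 0) := by
    have ikf := (hb.integrable_mul_extend hA hpp' mk nk hf).const_mul 2
    have := tendsto_lintegral_of_dominated_convergence' (F := fun n x => ‖R n x‖ₑ)
      (f := fun _ => 0) (μ := m)
      (fun x => ‖2 * (k x * b.extend hA f x)‖ₑ) (fun n => (mR n).enorm) (fun n => by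
        refine Eventually.of_forall fun x => enorm_le_iff_norm_le.2 ?_
        simp only [R, norm_mul, Real.norm_eq_abs]
        have h1 := abs_smoothSign_le hδ (((φ n).1 : Lp ℝ 2 m) x)
        have h2 := abs_smoothSign_le hδ ((f : Lp ℝ 2 m) x)
        have h3 := abs_sub (smoothSign δ (((φ n).1 : Lp ℝ 2 m) x))
          (smoothSign δ ((f : Lp ℝ 2 m) x))
        have h4 : |smoothSign δ (((φ n).1 : Lp ℝ 2 m) x) - smoothSign δ ((f : Lp ℝ 2 m) x)| ≤ 2 := by
          linarith
        calc _ ≤ |k x| * 2 * |b.extend hA f x| := by gcongr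
          _ = _ := by rw [abs_two]; ring) ikf.2.ne (by
        filter_upwards [hae] with x hx
        have h1 := (((continuous_smoothSign hδ).tendsto _).comp hx).sub_const
          (smoothSign δ ((f : Lp ℝ 2 m) x))
        rw [sub_self] at h1
        have h2 := ((h1.const_mul (k x)).mul_const (b.extend hA f x)).enorm
        rw [mul_zero, zero_mul, enorm_zero] at h2
        exact h2)
    simpa using this
  have hlim := (ENNReal.Tendsto.const_mul (a := M) hφ (Or.inr hM)).add hR
  rw [mul_zero, add_zero] at hlim
  refine tendsto_of_tendsto_of_tendsto_of_le_of_le tendsto_const_nhds hlim (fun _ => zero_le)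
    fun n => ?_
  set u : E.domain := (φ n).1 - f
  have mu : AEStronglyMeasurable (u : Lp ℝ 2 m) m := Lp.aestronglyMeasurable _
  have a1 : AEStronglyMeasurable (fun x => |(u : Lp ℝ 2 m) x * b.extend hA κ.1 x|) m :=
    (mu.mul (b.extend hA κ.1).aestronglyMeasurable).norm
  have a2 : AEStronglyMeasurable (fun x => |k x * b.extend hA u x|) m :=
    (mk.mul (b.extend hA u).aestronglyMeasurable).norm
  have a3 : AEStronglyMeasurable (fun x => |(u : Lp ℝ 2 m) x * k x * d x|) m :=
    ((mu.mul mk).mul hb.sum_div.aestronglyMeasurable).norm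
  have b1 := hb.lintegral_mul_extend_le hA hpp mu κ.1
  have b2 := hb.lintegral_mul_extend_le hA hpp' mk u
  have b3 := hb.lintegral_mul_mul_div_le hpp mu mk
  have g1 := C.interNorm_le_gradNorm p u
  have g2 := C.interNorm_sqrtΓ_le_gradNorm p u
  calc _ ≤ ∫⁻ x, ‖|(u : Lp ℝ 2 m) x * b.extend hA κ.1 x| + |k x * b.extend hA u x|
        + |(u : Lp ℝ 2 m) x * k x * d x| + |R n x|‖ₑ ∂m := by
        refine lintegral_mono_ae ?_
        filter_upwards [extend_sub_ae (b := b) hA (φ n).1 f, coe_sub_ae (φ n).1 f] with x h1 h2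
        refine enorm_le_iff_norm_le.2 ?_
        rw [Real.norm_of_nonneg (by positivity : 0 ≤ |(u : Lp ℝ 2 m) x * b.extend hA κ.1 x|
          + |k x * b.extend hA u x| + |(u : Lp ℝ 2 m) x * k x * d x| + |R n x|)]
        simp only [Pi.add_apply, Real.norm_eq_abs]
        set φx := ((φ n).1 : Lp ℝ 2 m) x
        set fx := (f : Lp ℝ 2 m) x
        have h3 : (u : Lp ℝ 2 m) x = φx - fx := h2
        have h4 := abs_smoothAbs_sub_le hδ φx fx
        rw [← h3] at h4
        have e : smoothAbs δ φx * b.extend hA κ.1 x + k x * smoothSign δ φx * b.extend hA (φ n).1 x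
            + smoothAbs δ φx * k x * d x - (smoothAbs δ fx * b.extend hA κ.1 x
              + k x * smoothSign δ fx * b.extend hA f x + smoothAbs δ fx * k x * d x)
            = (smoothAbs δ φx - smoothAbs δ fx) * b.extend hA κ.1 x
              + smoothSign δ φx * (k x * b.extend hA u x)
              + (smoothAbs δ φx - smoothAbs δ fx) * (k x * d x) + R n x := by
          rw [h1]; simp only [R]; ring
        rw [e]
        refine (abs_add_le _ _).trans (add_le_add ((abs_add_le _ _).trans (add_le_add
          ((abs_add_le _ _).trans (add_le_add ?_ ?_)) ?_)) le_rfl)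
        · rw [abs_mul, abs_mul]; gcongr
        · rw [abs_mul]
          exact mul_le_of_le_one_left (abs_nonneg _) (abs_smoothSign_le hδ _)
        · rw [abs_mul, mul_assoc, abs_mul (_ : ℝ) (k x * d x)]; gcongr
    _ ≤ Sb * interNorm p u m * interNorm p' (C.sqrtΓ κ.1) m
        + Sb * interNorm p' k m * interNorm p (C.sqrtΓ u) m
        + Sd * interNorm p u m * interNorm p' k m + ∫⁻ x, ‖R n x‖ₑ ∂m := by
        refine (lintegral_enorm_add_le ((a1.add a2).add a3)).trans (add_le_add
          ((lintegral_enorm_add_le (a1.add a2)).trans (add_le_add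
          ((lintegral_enorm_add_le a1).trans (add_le_add ?_ ?_)) ?_)) ?_)
        · simpa only [enorm_abs_eq] using b1
        · simpa only [enorm_abs_eq] using b2
        · simpa only [enorm_abs_eq] using b3
        · simp only [enorm_abs_eq, le_refl]
    _ ≤ Sb * C.gradNorm p u * interNorm p' (C.sqrtΓ κ.1) m
        + Sb * interNorm p' k m * C.gradNorm p u
        + Sd * C.gradNorm p u * interNorm p' k m + ∫⁻ x, ‖R n x‖ₑ ∂m := by
        refine add_le_add (add_le_add (add_le_add ?_ ?_) ?_) le_rfl
        · exact mul_le_mul' (mul_le_mul' le_rfl g1) le_rfl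
        · exact mul_le_mul' le_rfl g2
        · exact mul_le_mul' (mul_le_mul' le_rfl g1) le_rfl
    _ = _ := by
        simp only [M, u]
        ring

end

end VDerivation.IsControlled

end CarreDuChamp

end ContEq

end

/-! ### The test function β'(v) κ and the commutator identity. -/

noncomputable section

namespace ContEq

variable {X : Type*} [MeasurableSpace X] {m : Measure X} {E : DirichletForm m}

lemma memLp_smoothSign_mul {δ : ℝ} (hδ : 0 < δ) {p : ℝ≥0∞} {v κ : X → ℝ}
    (hv : AEStronglyMeasurable v m) (hκ : MemLp κ p m) :
    MemLp (fun x => smoothSign δ (v x) * κ x) p m :=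
  hκ.of_le (((continuous_smoothSign hδ).comp_aestronglyMeasurable hv).mul hκ.1)
    (Eventually.of_forall fun x => by
      rw [norm_mul]
      exact mul_le_of_le_one_left (norm_nonneg _) (abs_smoothSign_le hδ _))

/-- The function `smoothSign δ v * κ`. -/
def signMul {δ : ℝ} (hδ : 0 < δ) (κ v : Lp ℝ 2 m) : Lp ℝ 2 m :=
  (memLp_smoothSign_mul hδ (Lp.aestronglyMeasurable v) (Lp.memLp κ)).toLp

section signMul

variable {δ : ℝ} (hδ : 0 < δ) (κ v w : Lp ℝ 2 m)

lemma signMul_ae : ∀ᵐ x ∂m, signMul hδ κ v x = smoothSign δ (v x) * κ x :=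
  MemLp.coeFn_toLp _

lemma abs_signMul_le_ae : ∀ᵐ x ∂m, ‖signMul hδ κ v x‖ ≤ ‖κ x‖ := by
  filter_upwards [signMul_ae hδ κ v] with x hx
  rw [hx, norm_mul]
  exact mul_le_of_le_one_left (norm_nonneg _) (abs_smoothSign_le hδ _)

variable {κ} in
lemma memLp_signMul {p : ℝ≥0∞} (hκ : MemLp κ p m) : MemLp (signMul hδ κ v) p m :=
  hκ.of_le (Lp.aestronglyMeasurable _) (abs_signMul_le_ae hδ κ v)

lemma interNorm_signMul_le (p : ℝ≥0∞) : interNorm p (signMul hδ κ v) m ≤ interNorm p κ m :=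
  interNorm_mono_ae (abs_signMul_le_ae hδ κ v)

/-- The Lipschitz constant of `v ↦ signMul hδ κ v` from `L^r ∩ L²` to `L^s ∩ L²`. -/
def signMulConst (δ : ℝ) (κ : Lp ℝ 2 m) (r s : ℝ≥0∞) : ℝ≥0∞ :=
  ENNReal.ofReal (2 / δ) * (eLpNorm κ (s⁻¹ - r⁻¹)⁻¹ m + eLpNorm κ ∞ m)

/-- β' is Lipschitz with constant 2 / δ. Hölder with the exponent of inverse 1/s - 1/r brings v - w
from L^r down to L^s, which uses s ≤ r and integrability of κ at that exponent. The `L²` part uses κ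
in L^∞. -/
lemma interNorm_signMul_sub_le {r s : ℝ≥0∞} (hsr : s ≤ r) :
    interNorm s (signMul hδ κ v - signMul hδ κ w : Lp ℝ 2 m) m
      ≤ signMulConst δ κ r s * interNorm r (v - w : Lp ℝ 2 m) m := by
  have mvw := Lp.aestronglyMeasurable (v - w)
  have mκ := Lp.aestronglyMeasurable κ
  have hpt : ∀ᵐ x ∂m, ‖(signMul hδ κ v - signMul hδ κ w : Lp ℝ 2 m) x‖
      ≤ ‖((2 / δ) • (fun x => κ x * (v - w : Lp ℝ 2 m) x)) x‖ := by
    filter_upwards [Lp.coeFn_sub (signMul hδ κ v) (signMul hδ κ w), signMul_ae hδ κ v,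
      signMul_ae hδ κ w, Lp.coeFn_sub v w] with x h1 h2 h3 h4
    rw [h1, Pi.sub_apply, h2, h3, Pi.smul_apply, h4, Pi.sub_apply, ← sub_mul, norm_mul,
      smul_eq_mul, norm_mul, norm_mul, Real.norm_of_nonneg (by positivity : 0 ≤ 2 / δ)]
    have := mul_le_mul_of_nonneg_right (abs_smoothSign_sub_le hδ (v x) (w x)) (abs_nonneg (κ x))
    calc _ ≤ _ := this
      _ = _ := by simp only [Real.norm_eq_abs]; ring
  have hsr' : r⁻¹ ≤ s⁻¹ := ENNReal.inv_le_inv.2 hsr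
  have h1 := CarreDuChamp.VDerivation.eLpNorm_mul_sqrtΓ_le (σ := s) (p := r)
    (q := (s⁻¹ - r⁻¹)⁻¹) (by rw [inv_inv, add_tsub_cancel_of_le hsr']) mκ mvw
  have h2 := CarreDuChamp.VDerivation.eLpNorm_mul_sqrtΓ_le (σ := 2) (p := 2)
    (q := ∞) (by simp) mκ mvw
  refine (interNorm_mono_ae hpt).trans ?_
  rw [interNorm_smul, abs_of_pos (by positivity), signMulConst, mul_assoc]
  gcongr
  rw [add_mul]
  exact add_le_add (h1.trans (mul_le_mul' le_rfl (eLpNorm_le_interNorm _ _)))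
    (h2.trans (mul_le_mul' le_rfl (eLpNorm_two_le_interNorm _ _)))

end signMul

namespace CarreDuChamp

variable {C : CarreDuChamp E} {A : Submodule ℝ E.domain}

namespace VDerivation.IsControlled

variable {b : C.VDerivation A} {g d : X → ℝ} {q r s Sb Sd : ℝ≥0∞} {c : ℝ≥0}

/-- Write f = J w and k = J φ, so that Δf = l (f - w) and Δk = l (k - φ). Then df(b) Δk + dk(b) Δf
is l times the difference of the integration-by-parts expression for (f, k), of integral 0, and the
commutator integrand. The commutator is therefore l⁻¹ times the deformation term corrected by div b
Γ(f, k). -/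
lemma enorm_commutator_le (hS : C.Setting A q r s) (hb : b.IsControlled g d q Sb Sd)
    (hD : b.DeformationBound d r s c) {l : ℝ} (hl : 0 < l) (hl1 : 1 ≤ l) {w φ : Lp ℝ 2 m}
    (hw : MemLp w r m) (hφ : MemLp φ s m) :
    ‖∫ x, w x * b.extend hS.alg (E.resolvent hl φ) x ∂m
      + ∫ x, φ x * b.extend hS.alg (E.resolvent hl w) x ∂m
      + ∫ x, (E.resolvent hl w : Lp ℝ 2 m) x * (E.resolvent hl φ : Lp ℝ 2 m) x * d x ∂m‖ₑ
    ≤ ENNReal.ofReal (1 / l) * ((2 * c + Sd) * interNorm r (C.sqrtΓ (E.resolvent hl w)) m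
        * interNorm s (C.sqrtΓ (E.resolvent hl φ)) m) := by
  have hr1 : 1 < r := hS.one_lt'
  set f := E.resolvent hl w with hf
  set k := E.resolvent hl φ with hk
  have hfV : C.MemV r f := hS.lpGamma_r.memV_resolvent hr1 hS.lt_top hl hl1 hw
  have hkV : C.MemV s k := hS.lpGamma_s.memV_resolvent hS.one_lt hS.lt_top' hl hl1 hφ
  set Lf : Lp ℝ 2 m := l • (E.res hl w - w)
  set Lk : Lp ℝ 2 m := l • (E.res hl φ - φ)
  have mLf : MemLp Lf r m := by
    have : MemLp (l • (⇑(E.res hl w) - ⇑w)) r m := (hfV.1.sub hw).const_smul l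
    refine (memLp_congr_ae ?_).2 this
    filter_upwards [Lp.coeFn_smul l (E.res hl w - w), Lp.coeFn_sub (E.res hl w) w] with x h1 h2
    rw [h1, Pi.smul_apply, h2, Pi.smul_apply]
  have mLk : MemLp Lk s m := by
    have : MemLp (l • (⇑(E.res hl φ) - ⇑φ)) s m := (hkV.1.sub hφ).const_smul l
    refine (memLp_congr_ae ?_).2 this
    filter_upwards [Lp.coeFn_smul l (E.res hl φ - φ), Lp.coeFn_sub (E.res hl φ) φ] with x h1 h2
    rw [h1, Pi.smul_apply, h2, Pi.smul_apply]
  have hDf := hD f k Lf Lk hfV (DirichletForm.isLaplacian_resolvent hl w) mLf hkV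
    (DirichletForm.isLaplacian_resolvent hl φ) mLk
  have ht : ∀ p : ℝ≥0∞, p.conjExponent ≠ 0 := fun p => by
    rw [ENNReal.conjExponent]; positivity
  -- The two extensions in `deformation` are taken with different exponents; both are restrictions
  -- of `extend`.
  have ef := ext_eq_extend hS.alg hb.bound hb.fin_bound hb.sum_bound
    (IsTriple.conjExponent_inv hS.sum_eq hS.one_lt.le) (ht s) hS.dense_r hfV
  have ek := ext_eq_extend hS.alg hb.bound hb.fin_bound hb.sum_bound
    (IsTriple.conjExponent_inv hS.sum_eq' hr1.le) (ht r) hS.dense_s hkV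
  set B := b.extend hS.alg
  have mw := Lp.aestronglyMeasurable w
  have mφ := Lp.aestronglyMeasurable φ
  have mf := Lp.aestronglyMeasurable (f : Lp ℝ 2 m)
  have mk := Lp.aestronglyMeasurable (k : Lp ℝ 2 m)
  have nw := interNorm_lt_top hw (Lp.memLp _)
  have nφ := interNorm_lt_top hφ (Lp.memLp _)
  have nf := interNorm_lt_top hfV.1 (Lp.memLp _)
  have nk := interNorm_lt_top hkV.1 (Lp.memLp _)
  have i1 := hb.integrable_mul_extend hS.alg hS.sum_eq mw nw hkV
  have i2 := hb.integrable_mul_extend hS.alg hS.sum_eq' mφ nφ hfV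
  have i3 := hb.integrable_mul_mul_div hS.sum_eq mf mk nf nk
  have i4 := hb.integrable_byParts hS.alg hS.sum_eq hfV hkV
  have z4 := hb.integral_byParts hS.alg hS.sum_eq hr1.le hS.one_lt.le hS.dense_r hS.dense_s
    hfV hkV
  have mΓ := Lp.aestronglyMeasurable (C.Γ f k)
  have bΓ : ∫⁻ x, ‖d x * C.Γ f k x‖ₑ ∂m
      ≤ Sd * interNorm r (C.sqrtΓ f) m * interNorm s (C.sqrtΓ k) m := by
    refine le_trans (lintegral_mono_ae ?_) (hb.lintegral_mul_mul_div_le hS.sum_eq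
      (C.measurable_sqrtΓ f).aestronglyMeasurable (C.measurable_sqrtΓ k).aestronglyMeasurable)
    filter_upwards [C.abs_Γ_le_ae f k] with x hx
    rw [mul_comm (d x), enorm_mul, enorm_mul]
    gcongr
    exact enorm_le_iff_norm_le.2 (hx.trans (le_abs_self _))
  have nΓ : ∫⁻ x, ‖d x * C.Γ f k x‖ₑ ∂m < ∞ := bΓ.trans_lt (ENNReal.mul_lt_top
    (ENNReal.mul_lt_top hb.fin_div (C.interNorm_sqrtΓ_lt_top hfV)) (C.interNorm_sqrtΓ_lt_top hkV))
  have iΓ : Integrable (fun x => d x * C.Γ f k x) m :=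
    ⟨hb.sum_div.aestronglyMeasurable.mul mΓ, nΓ⟩
  set Q := ∫ x, w x * B k x ∂m + ∫ x, φ x * B f x ∂m
      + ∫ x, (f : Lp ℝ 2 m) x * (k : Lp ℝ 2 m) x * d x ∂m with hQ
  have e : b.deformation d r s f k Lf Lk
      = -(1 / 2) * (-(l * Q) - ∫ x, d x * C.Γ f k x ∂m) := by
    have e1 : ∫ x, (b.ext r s.conjExponent f x * Lk x + b.ext s r.conjExponent k x * Lf x
        - d x * C.Γ f k x) ∂m
        = ∫ x, (l * (((f : Lp ℝ 2 m) x * B k x + (k : Lp ℝ 2 m) x * B f x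
          + (f : Lp ℝ 2 m) x * (k : Lp ℝ 2 m) x * d x)
          - ((w x * B k x + φ x * B f x) + (f : Lp ℝ 2 m) x * (k : Lp ℝ 2 m) x * d x))
          - d x * C.Γ f k x) ∂m := by
      rw [ef, ek]
      apply integral_congr_ae
      filter_upwards [Lp.coeFn_smul l (E.res hl w - w), Lp.coeFn_sub (E.res hl w) w,
        Lp.coeFn_smul l (E.res hl φ - φ), Lp.coeFn_sub (E.res hl φ) φ] with x h1 h2 h3 h4
      rw [h1, h3, Pi.smul_apply, Pi.smul_apply, h2, h4]
      simp only [Pi.sub_apply, smul_eq_mul]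
      rw [hf, hk]
      simp only [DirichletForm.coe_resolvent]
      ring
    have i12 : Integrable (fun x => w x * B k x + φ x * B f x) m := i1.add i2
    have i123 : Integrable (fun x => (w x * B k x + φ x * B f x)
      + (f : Lp ℝ 2 m) x * (k : Lp ℝ 2 m) x * d x) m := i12.add i3
    have iD : Integrable (fun x => l * (((f : Lp ℝ 2 m) x * B k x + (k : Lp ℝ 2 m) x * B f x
        + (f : Lp ℝ 2 m) x * (k : Lp ℝ 2 m) x * d x)
        - ((w x * B k x + φ x * B f x) + (f : Lp ℝ 2 m) x * (k : Lp ℝ 2 m) x * d x))) m :=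
      (i4.sub i123).const_mul l
    rw [deformation, e1, integral_sub iD iΓ, integral_const_mul,
      integral_sub i4 i123, integral_add i12 i3, integral_add i1 i2, z4, zero_sub, ← hQ]
    ring
  have hl0 := hl.ne'
  have e2 : Q = (1 / l) * (2 * b.deformation d r s f k Lf Lk - ∫ x, d x * C.Γ f k x ∂m) := by
    rw [e]; field_simp; ring
  rw [e2, enorm_mul, ← ofReal_norm (1 / l), Real.norm_of_nonneg (by positivity)]
  gcongr
  calc ‖2 * b.deformation d r s f k Lf Lk - ∫ x, d x * C.Γ f k x ∂m‖ₑ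
      ≤ ‖2 * b.deformation d r s f k Lf Lk‖ₑ + ‖∫ x, d x * C.Γ f k x ∂m‖ₑ := by
        rw [sub_eq_add_neg]
        refine (enorm_add_le _ _).trans ?_
        rw [enorm_neg]
    _ ≤ 2 * (c * interNorm r (C.sqrtΓ f) m * interNorm s (C.sqrtΓ k) m)
        + Sd * interNorm r (C.sqrtΓ f) m * interNorm s (C.sqrtΓ k) m := by
        refine add_le_add ?_ ((enorm_integral_le_lintegral_enorm _).trans bΓ)
        rw [enorm_mul, ← ofReal_norm (2 : ℝ), Real.norm_ofNat, ENNReal.ofReal_ofNat,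
          ← ofReal_norm, Real.norm_eq_abs]
        refine mul_le_mul' le_rfl (hDf.trans ?_)
        exact mul_le_mul' (mul_le_mul' le_rfl (eLpNorm_le_interNorm _ _))
          (eLpNorm_le_interNorm _ _)
    _ = _ := by ring

end VDerivation.IsControlled

end CarreDuChamp

end ContEq

end

/-! ### The regularised transport term at a fixed time. -/

noncomputable section

namespace ContEq

variable {X : Type*} [MeasurableSpace X] {m : Measure X} {E : DirichletForm m}

lemma interNorm_coe_sub (p : ℝ≥0∞) (v w : Lp ℝ 2 m) :
    interNorm p (v - w : Lp ℝ 2 m) m = interNorm p (⇑v - ⇑w) m :=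
  interNorm_congr_ae (Lp.coeFn_sub _ _)

lemma interNorm_coe_sub_le {p : ℝ≥0∞} (hp : 1 ≤ p) (u v w : Lp ℝ 2 m) :
    interNorm p (u - w : Lp ℝ 2 m) m
      ≤ interNorm p (u - v : Lp ℝ 2 m) m + interNorm p (v - w : Lp ℝ 2 m) m := by
  have e : u - w = (u - v) + (v - w) := by abel
  rw [e, interNorm_congr_ae (Lp.coeFn_add _ _)]
  exact interNorm_add_le hp (Lp.aestronglyMeasurable _) (Lp.aestronglyMeasurable _)

namespace CarreDuChamp

variable {C : CarreDuChamp E} {A : Submodule ℝ E.domain}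

/-- The error made when the transport term is regularized by the resolvent. -/
def commutatorError (C : CarreDuChamp E) (r s : ℝ≥0∞) {δ : ℝ} (hδ : 0 < δ) (κ : Lp ℝ 2 m) {l : ℝ}
    (hl : 0 < l) (w : Lp ℝ 2 m) : ℝ≥0∞ :=
  interNorm r (E.res hl w - w : Lp ℝ 2 m) m
    + interNorm s (E.res hl (signMul hδ κ w) - signMul hδ κ w : Lp ℝ 2 m) m
    + ENNReal.ofReal (1 / Real.sqrt l) * interNorm r (C.sqrtΓ (E.resolvent hl w)) m

/-- With f = J w and y = J(β'(f) κ), the term ∫ w dy(b) is rewritten through the commutator and the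
chain rule. As l → ∞, f → w and y → β'(w) κ, and the cost of replacing them by their limits is
linear in `commutatorError`. The constant is chosen before b, so it serves all times; b enters only
through Sb + Sd + c. -/
lemma Setting.exists_ofReal_integral_mul_extend_le {q r s : ℝ≥0∞} (hS : C.Setting A q r s) {δ : ℝ}
    (hδ : 0 < δ) (κ : A) {K : ℝ≥0∞} (hK : K < ∞) :
    ∃ M : ℝ≥0∞, M < ∞ ∧ ∀ (b : C.VDerivation A) (g d : X → ℝ) (Sb Sd : ℝ≥0∞) (c : ℝ≥0),
      b.IsControlled g d q Sb Sd → b.DeformationBound d r s c →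
      ∀ (l : ℝ) (hl : 0 < l), 1 ≤ l → ∀ w : Lp ℝ 2 m, MemLp w r m → interNorm r w m ≤ K →
      ENNReal.ofReal (∫ x, w x * b.extend hS.alg
          (E.resolvent hl (signMul hδ (κ.1 : Lp ℝ 2 m) (E.res hl w))) x ∂m)
        ≤ ∫⁻ x, ‖smoothAbs δ (w x) * (g x * C.sqrtΓ κ.1 x)‖ₑ ∂m
          + ∫⁻ x, ‖(smoothAbs δ (w x) - w x * smoothSign δ (w x))
            * (κ.1 : Lp ℝ 2 m) x * d x‖ₑ ∂m
          + M * (Sb + Sd + c) * C.commutatorError r s hδ (κ.1 : Lp ℝ 2 m) hl w := by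
  have hr1 : 1 < r := hS.one_lt'
  have hs1 := hS.one_lt
  obtain ⟨Cs, hCs, hCs'⟩ := hS.lpGamma_s.exists_interNorm_sqrtΓ_resolvent_le hs1 hS.lt_top'
  set k : Lp ℝ 2 m := (κ.1 : Lp ℝ 2 m)
  have hkp : ∀ p, 1 ≤ p → MemLp k p m := fun p hp => hS.alg.memLp _ κ.2 p hp
  have nk : interNorm s k m < ∞ := interNorm_lt_top (hkp s hs1.le) (Lp.memLp _)
  have nΓ : interNorm s (C.sqrtΓ κ.1) m < ∞ := C.interNorm_sqrtΓ_lt_top (hS.alg.memV κ hs1.le)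
  set H := signMulConst δ k r s
  have hH : H < ∞ := by
    refine ENNReal.mul_lt_top ENNReal.ofReal_lt_top (ENNReal.add_lt_top.2
      ⟨(hkp _ ?_).2, (hkp _ le_top).2⟩)
    rw [← ENNReal.inv_le_inv, inv_inv, inv_one]
    exact tsub_le_self.trans (ENNReal.inv_le_one.2 hs1.le)
  set Kκ := interNorm s k m
  set Kγ := interNorm s (C.sqrtΓ κ.1) m
  set cs := ENNReal.ofReal Cs
  refine ⟨Kγ + 2 * Kκ + K + K * H + 2 * cs * Kκ, ?_, ?_⟩
  · have h1 := nk.ne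
    have h2 := nΓ.ne
    have h3 := hH.ne
    have h4 := hK.ne
    have h5 : cs ≠ ∞ := ENNReal.ofReal_ne_top
    have : Kγ + 2 * Kκ + K + K * H + 2 * cs * Kκ ≠ ∞ := by finiteness
    exact this.lt_top
  intro b g d Sb Sd c hb hD l hl hl1 w hw hwK
  set f := E.resolvent hl w with hf
  set φ := signMul hδ k (E.res hl w) with hφdef
  set ψ := signMul hδ k w with hψdef
  have hφ : MemLp φ s m := memLp_signMul hδ _ (hkp s hs1.le)
  have hψ : MemLp ψ s m := memLp_signMul hδ _ (hkp s hs1.le)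
  set y := E.resolvent hl φ with hy
  have hfV : C.MemV r f := hS.lpGamma_r.memV_resolvent hr1 hS.lt_top hl hl1 hw
  have hyV : C.MemV s y := hS.lpGamma_s.memV_resolvent hs1 hS.lt_top' hl hl1 hφ
  set e := interNorm r (E.res hl w - w : Lp ℝ 2 m) m
  set e' := interNorm s (E.res hl ψ - ψ : Lp ℝ 2 m) m
  set G := interNorm r (C.sqrtΓ f) m
  set ρ := ENNReal.ofReal (1 / Real.sqrt l) * G
  have herr : C.commutatorError r s hδ k hl w = e + e' + ρ := rfl
  set B := b.extend hS.alg
  set Q := ∫ x, w x * B y x ∂m + ∫ x, φ x * B f x ∂m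
      + ∫ x, (f : Lp ℝ 2 m) x * (y : Lp ℝ 2 m) x * d x ∂m with hQ
  have hQle := hb.enorm_commutator_le hS hD hl hl1 hw hφ
  have mw := Lp.aestronglyMeasurable w
  have mφ := Lp.aestronglyMeasurable φ
  have mψ := Lp.aestronglyMeasurable ψ
  have mk := Lp.aestronglyMeasurable k
  have mf := Lp.aestronglyMeasurable (f : Lp ℝ 2 m)
  have my := Lp.aestronglyMeasurable (y : Lp ℝ 2 m)
  have nφ : interNorm s φ m ≤ Kκ := interNorm_signMul_le hδ _ _ s
  have ny : interNorm s (y : Lp ℝ 2 m) m ≤ Kκ :=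
    (interNorm_resolvent_le hl hs1 hS.lt_top' φ).trans nφ
  -- The gradient of y takes one factor √l out of 1/l in the commutator. The remaining 1/√l goes
  -- with the gradient of f and forms ρ, which tends to 0.
  have ngy : interNorm s (C.sqrtΓ y) m ≤ cs * ENNReal.ofReal (Real.sqrt l) * Kκ := by
    refine (hCs' l hl hl1 φ hφ).trans ?_
    rw [ENNReal.ofReal_mul hCs.le]
    gcongr
  have hQ' : ‖Q‖ₑ ≤ (2 * c + Sd) * (cs * Kκ) * ρ := by
    refine hQle.trans ?_
    calc _ ≤ ENNReal.ofReal (1 / l) * ((2 * c + Sd) * G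
          * (cs * ENNReal.ofReal (Real.sqrt l) * Kκ)) := by gcongr
      _ = (2 * c + Sd) * (cs * Kκ) * (ENNReal.ofReal (1 / l) * ENNReal.ofReal (Real.sqrt l) * G) := by
          ring
      _ = _ := by
          have e0 : 1 / l * Real.sqrt l = 1 / Real.sqrt l := by
            rw [one_div_mul_eq_div, Real.sqrt_div_self, one_div]
          rw [← ENNReal.ofReal_mul (by positivity), e0]
  have nf := interNorm_lt_top hfV.1 (Lp.memLp _)
  have i3 := hb.integrable_mul_mul_div hS.sum_eq mf my nf (ny.trans_lt nk)
  obtain ⟨j1, j2, j3⟩ := hb.integrable_smoothAbs hS.alg hS.sum_eq hδ hs1.le hfV κ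
  have z := hb.integral_smoothAbs hS.alg hS.sum_eq hδ hr1.le hs1.le hS.dense_r hfV κ
  have j12 : Integrable (fun x => smoothAbs δ ((f : Lp ℝ 2 m) x) * b.extend hS.alg κ.1 x
    + (κ.1 : Lp ℝ 2 m) x * smoothSign δ ((f : Lp ℝ 2 m) x) * b.extend hS.alg f x) m := j1.add j2
  rw [integral_add j12 j3, integral_add j1 j2] at z
  have ej2 : ∫ x, (κ.1 : Lp ℝ 2 m) x * smoothSign δ ((f : Lp ℝ 2 m) x)
      * b.extend hS.alg f x ∂m = ∫ x, φ x * B f x ∂m := by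
    apply integral_congr_ae
    filter_upwards [signMul_ae hδ k (E.res hl w)] with x hx
    rw [hφdef, hx, mul_comm (smoothSign _ _)]
    rfl
  rw [ej2] at z
  -- The term ∫ φ df(b) is common to the commutator and to the chain rule, and is eliminated between
  -- them.
  have hmain : ∫ x, w x * B y x ∂m = ∫ x, smoothAbs δ ((f : Lp ℝ 2 m) x) * B κ.1 x ∂m
      + ∫ x, (smoothAbs δ ((f : Lp ℝ 2 m) x) * k x * d x
        - (f : Lp ℝ 2 m) x * (y : Lp ℝ 2 m) x * d x) ∂m + Q := by
    rw [integral_sub j3 i3]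
    linarith
  have hfw : ∀ᵐ x ∂m, (E.res hl w - w : Lp ℝ 2 m) x = (f : Lp ℝ 2 m) x - w x := by
    filter_upwards [Lp.coeFn_sub (E.res hl w) w] with x hx
    rw [hx, Pi.sub_apply, hf, DirichletForm.coe_resolvent]
  have mfw := Lp.aestronglyMeasurable (E.res hl w - w)
  have myψ := Lp.aestronglyMeasurable ((y : Lp ℝ 2 m) - ψ)
  -- y - ψ = J(φ - ψ) + (J ψ - ψ). The first term uses contractivity of J and the Lipschitz bound in
  -- w, the second is e'.
  have nyψ : interNorm s ((y : Lp ℝ 2 m) - ψ : Lp ℝ 2 m) m ≤ e' + H * e := by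
    refine (interNorm_coe_sub_le hs1.le (y : Lp ℝ 2 m) (E.res hl ψ) ψ).trans ?_
    rw [add_comm]
    refine add_le_add le_rfl ?_
    have e1 : (y : Lp ℝ 2 m) - E.res hl ψ = E.res hl (φ - ψ) := by
      rw [map_sub, hy, DirichletForm.coe_resolvent]
    rw [e1]
    refine (interNorm_res_le hl hs1 hS.lt_top' _).trans ?_
    exact interNorm_signMul_sub_le hδ k (E.res hl w) w hS.le
  have b1 : ∫⁻ x, ‖smoothAbs δ ((f : Lp ℝ 2 m) x) * B κ.1 x‖ₑ ∂m
      ≤ ∫⁻ x, ‖smoothAbs δ (w x) * (g x * C.sqrtΓ κ.1 x)‖ₑ ∂m + Sb * e * Kγ := by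
    refine le_trans ?_ (add_le_add le_rfl (hb.lintegral_mul_extend_le hS.alg hS.sum_eq mfw κ.1))
    have mm : AEStronglyMeasurable (fun x => smoothAbs δ (w x) * (g x * C.sqrtΓ κ.1 x)) m :=
      (continuous_smoothAbs.comp_aestronglyMeasurable mw).mul
        (hb.sum_bound.aestronglyMeasurable.mul (C.measurable_sqrtΓ _).aestronglyMeasurable)
    have mm' := (mfw.mul (b.extend hS.alg κ.1).aestronglyMeasurable).norm
    refine le_trans ?_ ((lintegral_enorm_add_le mm
      (F₂ := fun x => |(E.res hl w - w : Lp ℝ 2 m) x * B κ.1 x|)).trans ?_)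
    · refine lintegral_mono_ae ?_
      filter_upwards [hfw, VDerivation.abs_extend_le_ae hS.alg hb.bound κ.1] with x h1 h2
      have h3 := smoothAbs_nonneg (δ := δ) (w x)
      have h4 := hb.nonneg x
      have h5 := C.sqrtΓ_nonneg κ.1 x
      refine enorm_le_iff_norm_le.2 ?_
      rw [Real.norm_of_nonneg (by positivity : 0 ≤ smoothAbs δ (w x) * (g x * C.sqrtΓ κ.1 x)
        + |(E.res hl w - w : Lp ℝ 2 m) x * B κ.1 x|), h1, abs_mul, Real.norm_eq_abs, abs_mul,
        abs_of_nonneg (smoothAbs_nonneg _)]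
      have h6 := (le_abs_self _).trans (abs_smoothAbs_sub_le hδ ((f : Lp ℝ 2 m) x) (w x))
      have h7 : smoothAbs δ ((f : Lp ℝ 2 m) x)
          ≤ smoothAbs δ (w x) + |(f : Lp ℝ 2 m) x - w x| := by linarith
      calc _ ≤ (smoothAbs δ (w x) + |(f : Lp ℝ 2 m) x - w x|) * |B κ.1 x| := by gcongr
        _ ≤ _ := by
          rw [add_mul]
          gcongr
    · simp only [enorm_abs_eq, B, le_refl]
  have b2 : ∫⁻ x, ‖smoothAbs δ ((f : Lp ℝ 2 m) x) * k x * d x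
        - (f : Lp ℝ 2 m) x * (y : Lp ℝ 2 m) x * d x‖ₑ ∂m
      ≤ ∫⁻ x, ‖(smoothAbs δ (w x) - w x * smoothSign δ (w x)) * k x * d x‖ₑ ∂m
        + (Sd * e * Kκ + Sd * e * Kκ + Sd * K * (e' + H * e)) := by
    have c1 := hb.lintegral_mul_mul_div_le hS.sum_eq mfw mk
    have c2 := hb.lintegral_mul_mul_div_le hS.sum_eq mfw my
    have c3 := hb.lintegral_mul_mul_div_le hS.sum_eq mw myψ
    have md := hb.sum_div.aestronglyMeasurable
    have m1 := ((mfw.mul mk).mul md).norm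
    have m2 := ((mfw.mul my).mul md).norm
    have m0 : AEStronglyMeasurable
        (fun x => |(smoothAbs δ (w x) - w x * smoothSign δ (w x)) * k x * d x|) m :=
      (((continuous_smoothAbs.comp_aestronglyMeasurable mw).sub
        (mw.mul ((continuous_smoothSign hδ).comp_aestronglyMeasurable mw))).mul mk |>.mul md).norm
    calc _ ≤ ∫⁻ x, ‖|(smoothAbs δ (w x) - w x * smoothSign δ (w x)) * k x * d x|
          + (|(E.res hl w - w : Lp ℝ 2 m) x * k x * d x|
            + |(E.res hl w - w : Lp ℝ 2 m) x * (y : Lp ℝ 2 m) x * d x|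
            + |w x * ((y : Lp ℝ 2 m) - ψ : Lp ℝ 2 m) x * d x|)‖ₑ ∂m := by
          refine lintegral_mono_ae ?_
          filter_upwards [hfw, Lp.coeFn_sub (y : Lp ℝ 2 m) ψ, signMul_ae hδ k w] with x h1 h2 h3
          refine enorm_le_iff_norm_le.2 ((le_trans ?_ (le_abs_self _)))
          rw [h1, h2, Pi.sub_apply, hψdef, h3]
          set fx := (f : Lp ℝ 2 m) x
          have e1 : smoothAbs δ fx * k x * d x - fx * (y : Lp ℝ 2 m) x * d x
            = (smoothAbs δ (w x) - w x * smoothSign δ (w x)) * k x * d x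
              + ((smoothAbs δ fx - smoothAbs δ (w x)) * k x * d x
              - (fx - w x) * (y : Lp ℝ 2 m) x * d x
              - w x * ((y : Lp ℝ 2 m) x - smoothSign δ (w x) * k x) * d x) := by ring
          rw [e1]
          refine (abs_add_le _ _).trans (add_le_add le_rfl ((abs_sub _ _).trans
            (add_le_add ((abs_sub _ _).trans (add_le_add ?_ le_rfl)) le_rfl)))
          rw [abs_mul, abs_mul, abs_mul, abs_mul]
          exact mul_le_mul_of_nonneg_right (mul_le_mul_of_nonneg_right
            (abs_smoothAbs_sub_le hδ _ _) (abs_nonneg _)) (abs_nonneg _)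
      _ ≤ _ := by
          refine (lintegral_enorm_add_le m0).trans (add_le_add ?_
            ((lintegral_enorm_add_le (m1.add m2)).trans (add_le_add
              ((lintegral_enorm_add_le m1).trans (add_le_add ?_ ?_)) ?_)))
          · simp only [enorm_abs_eq, le_refl]
          · exact le_trans (by simp) c1
          · refine le_trans (by simp) (c2.trans (mul_le_mul' le_rfl ny))
          · refine le_trans (by simp) (c3.trans
              (mul_le_mul' (mul_le_mul' le_rfl hwK) nyψ))
  rw [hmain, herr]
  refine (Real.ofReal_le_enorm _).trans ?_
  refine (enorm_add_le _ _).trans ((add_le_add ((enorm_add_le _ _).trans (add_le_add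
    ((enorm_integral_le_lintegral_enorm _).trans b1)
    ((enorm_integral_le_lintegral_enorm _).trans b2))) hQ').trans ?_)
  set I₁ := ∫⁻ x, ‖smoothAbs δ (w x) * (g x * C.sqrtΓ κ.1 x)‖ₑ ∂m
  set I₂ := ∫⁻ x, ‖(smoothAbs δ (w x) - w x * smoothSign δ (w x)) * k x * d x‖ₑ ∂m
  have hS1 : Sb ≤ Sb + Sd + c := by rw [add_assoc]; exact le_self_add
  have hS2 : Sd ≤ Sb + Sd + c := by rw [add_comm Sb, add_assoc]; exact le_self_add
  have hS3 : 2 * (c : ℝ≥0∞) + Sd ≤ 2 * (Sb + Sd + c) := by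
    calc 2 * (c : ℝ≥0∞) + Sd ≤ (2 * (c : ℝ≥0∞) + Sd) + (2 * Sb + Sd) := le_self_add
      _ = _ := by ring
  have he1 : e ≤ e + e' + ρ := by rw [add_assoc]; exact le_self_add
  have he2 : e' ≤ e + e' + ρ := by rw [add_comm e, add_assoc]; exact le_self_add
  have he3 : ρ ≤ e + e' + ρ := le_add_self
  set SS := Sb + Sd + (c : ℝ≥0∞)
  set ee := e + e' + ρ
  calc I₁ + Sb * e * Kγ + (I₂ + (Sd * e * Kκ + Sd * e * Kκ + Sd * K * (e' + H * e)))
        + (2 * c + Sd) * (cs * Kκ) * ρ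
      ≤ I₁ + SS * ee * Kγ + (I₂ + (SS * ee * Kκ + SS * ee * Kκ + SS * K * (ee + H * ee)))
        + (2 * SS) * (cs * Kκ) * ee := by gcongr
    _ = _ := by ring

end CarreDuChamp

end ContEq

end

/-! ### Measurability, convergence and domination of the commutator error. -/

noncomputable section

namespace ContEq

variable {X : Type*} [MeasurableSpace X] {m : Measure X} {E : DirichletForm m}

lemma lowerSemicontinuous_eLpNorm (p : ℝ≥0∞) :
    LowerSemicontinuous (fun v : Lp ℝ 2 m => eLpNorm v p m) := by
  rw [lowerSemicontinuous_iff_isClosed_preimage]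
  intro c
  refine IsSeqClosed.isClosed fun u v hu huv => ?_
  refine eLpNorm_le_of_tendsto_eLpNorm_two (fun n => Lp.aestronglyMeasurable (u n))
    (Lp.aestronglyMeasurable v) ?_ hu
  have h := tendsto_iff_edist_tendsto_0.1 huv
  simpa only [Lp.edist_def] using h

section Measurability

variable {S : Type*} [MeasurableSpace S] {μ : Measure S}

lemma aemeasurable_comp_of_lowerSemicontinuous {Y : Type*} [TopologicalSpace Y]
    [TopologicalSpace.PseudoMetrizableSpace Y] {F : Y → ℝ≥0∞} (hF : LowerSemicontinuous F)
    {f : S → Y} (hf : AEStronglyMeasurable f μ) : AEMeasurable (fun τ => F (f τ)) μ := by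
  let : MeasurableSpace Y := borel Y
  have : BorelSpace Y := ⟨rfl⟩
  exact hF.measurable.comp_aemeasurable hf.aemeasurable

lemma aemeasurable_eLpNorm_coe {f : S → Lp ℝ 2 m} (hf : AEStronglyMeasurable f μ) (p : ℝ≥0∞) :
    AEMeasurable (fun τ => eLpNorm (f τ) p m) μ :=
  aemeasurable_comp_of_lowerSemicontinuous (lowerSemicontinuous_eLpNorm p) hf

lemma aemeasurable_interNorm_coe {f : S → Lp ℝ 2 m} (hf : AEStronglyMeasurable f μ) (p : ℝ≥0∞) :
    AEMeasurable (fun τ => interNorm p (f τ) m) μ :=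
  (aemeasurable_eLpNorm_coe hf p).add (aemeasurable_eLpNorm_coe hf 2)

/-- Closedness of the gradient balls is lower semicontinuity of the gradient norm on the energy
space. It is composed with the strongly measurable curve J w. -/
lemma aemeasurable_interNorm_sqrtΓ_resolvent (C : CarreDuChamp E) {l : ℝ} (hl : 0 < l)
    {f : S → Lp ℝ 2 m} (hf : AEStronglyMeasurable f μ) (p : ℝ≥0∞) :
    AEMeasurable (fun τ => interNorm p (C.sqrtΓ (E.resolvent hl (f τ))) m) μ := by
  have key : ∀ p, AEMeasurable (fun τ => eLpNorm (C.sqrtΓ (E.resolvent hl (f τ))) p m) μ := by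
    intro p
    have hlsc : LowerSemicontinuous
        (fun v : E.EnergySpace => eLpNorm (C.sqrtΓ (E.toV.symm v)) p m) := by
      rw [lowerSemicontinuous_iff_isClosed_preimage]
      exact fun c => C.isClosed_gradBall p c
    exact aemeasurable_comp_of_lowerSemicontinuous hlsc
      ((E.resolventV hl).continuous.comp_aestronglyMeasurable hf)
  exact (key p).add (key 2)

end Measurability

lemma edist_le_interNorm (p : ℝ≥0∞) (v w : Lp ℝ 2 m) :
    edist v w ≤ interNorm p (v - w : Lp ℝ 2 m) m := by
  rw [Lp.edist_def, ← eLpNorm_congr_ae (Lp.coeFn_sub v w)]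
  exact eLpNorm_two_le_interNorm _ _

lemma continuous_signMul {δ : ℝ} (hδ : 0 < δ) {κ : Lp ℝ 2 m} (hκ : MemLp κ ∞ m) :
    Continuous (signMul hδ κ) := by
  set c := signMulConst δ κ 2 2 * 2
  have hc : c ≠ ∞ := by
    refine ENNReal.mul_ne_top (ENNReal.mul_ne_top ENNReal.ofReal_ne_top ?_) ENNReal.ofNat_ne_top
    rw [tsub_self, ENNReal.inv_zero]
    exact ENNReal.add_ne_top.2 ⟨hκ.2.ne, hκ.2.ne⟩
  have : LipschitzWith c.toNNReal (signMul hδ κ) := fun v w => by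
    rw [ENNReal.coe_toNNReal hc]
    refine (edist_le_interNorm 2 _ _).trans ((interNorm_signMul_sub_le hδ κ v w le_rfl).trans ?_)
    rw [mul_assoc]
    gcongr
    rw [interNorm, ← two_mul, Lp.edist_def, eLpNorm_congr_ae (Lp.coeFn_sub v w)]
  exact this.continuous

namespace CarreDuChamp

variable {C : CarreDuChamp E} {A : Submodule ℝ E.domain}

lemma aemeasurable_commutatorError {S : Type*} [MeasurableSpace S] {μ : Measure S} (r s : ℝ≥0∞)
    {δ : ℝ} (hδ : 0 < δ) {κ : Lp ℝ 2 m} (hκ : MemLp κ ∞ m) {l : ℝ} (hl : 0 < l)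
    {f : S → Lp ℝ 2 m} (hf : AEStronglyMeasurable f μ) :
    AEMeasurable (fun τ => C.commutatorError r s hδ κ hl (f τ)) μ := by
  have h1 := (E.res hl).continuous.comp_aestronglyMeasurable hf
  have h2 := (continuous_signMul hδ hκ).comp_aestronglyMeasurable hf
  have h3 := (E.res hl).continuous.comp_aestronglyMeasurable h2
  exact ((aemeasurable_interNorm_coe (h1.sub hf) r).add
    (aemeasurable_interNorm_coe (h3.sub h2) s)).add
    ((aemeasurable_interNorm_sqrtΓ_resolvent C hl hf r).const_mul _)

lemma Setting.tendsto_commutatorError {q r s : ℝ≥0∞} (hS : C.Setting A q r s) {δ : ℝ} (hδ : 0 < δ)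
    {κ : Lp ℝ 2 m} (hκ : MemLp κ s m) {w : Lp ℝ 2 m} (hw : MemLp w r m) :
    Tendsto (fun n : ℕ => C.commutatorError r s hδ κ (Nat.cast_add_one_pos (α := ℝ) n) w) atTop
      (𝓝 0) := by
  have h1 := tendsto_interNorm_approx_sub (E := E) hS.one_lt' hS.lt_top hw
  have h2 := tendsto_interNorm_approx_sub (E := E) hS.one_lt hS.lt_top' (memLp_signMul hδ w hκ)
  have h3 := hS.lpGamma_r.tendsto_interNorm_sqrtΓ_approx hS.one_lt' hS.lt_top hw
  have h4 := (h1.add h2).add h3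
  rw [add_zero, add_zero] at h4
  refine h4.congr fun n => ?_
  rw [commutatorError, interNorm_coe_sub, interNorm_coe_sub]
  rfl

/-- A bound uniform in l ≥ 1 and over bounded sets of w. It supplies the dominating function for the
limit l → ∞ under the time integral. -/
lemma Setting.exists_commutatorError_le {q r s : ℝ≥0∞} (hS : C.Setting A q r s) {δ : ℝ} (hδ : 0 < δ)
    {κ : Lp ℝ 2 m} (hκ : MemLp κ s m) {K : ℝ≥0∞} (hK : K < ∞) :
    ∃ M : ℝ≥0∞, M < ∞ ∧ ∀ (l : ℝ) (hl : 0 < l), 1 ≤ l → ∀ w : Lp ℝ 2 m, MemLp w r m →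
      interNorm r w m ≤ K → C.commutatorError r s hδ κ hl w ≤ M := by
  obtain ⟨c, hc, hc'⟩ := hS.lpGamma_r.exists_interNorm_sqrtΓ_resolvent_le hS.one_lt' hS.lt_top
  have nκ := interNorm_lt_top hκ (Lp.memLp κ)
  refine ⟨2 * K + 2 * interNorm s κ m + ENNReal.ofReal c * K, ?_, fun l hl hl1 w hw hwK => ?_⟩
  · have h1 := hK.ne
    have h2 := nκ.ne
    have h3 : 2 * K + 2 * interNorm s κ m + ENNReal.ofReal c * K ≠ ∞ := by finiteness
    exact h3.lt_top
  · refine add_le_add (add_le_add ?_ ?_) ?_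
    · rw [interNorm_coe_sub, two_mul]
      refine (interNorm_sub_le hS.one_lt'.le (Lp.aestronglyMeasurable _)
        (Lp.aestronglyMeasurable _)).trans (add_le_add ?_ hwK)
      exact (interNorm_res_le hl hS.one_lt' hS.lt_top w).trans hwK
    · rw [interNorm_coe_sub, two_mul]
      have := interNorm_signMul_le hδ κ w s
      refine (interNorm_sub_le hS.one_lt.le (Lp.aestronglyMeasurable _)
        (Lp.aestronglyMeasurable _)).trans (add_le_add ?_ this)
      exact (interNorm_res_le hl hS.one_lt hS.lt_top' _).trans this
    · have h0 : 0 < Real.sqrt l := Real.sqrt_pos.2 hl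
      calc _ ≤ ENNReal.ofReal (1 / Real.sqrt l) * (ENNReal.ofReal (c * Real.sqrt l) * K) := by
            gcongr
            exact (hc' l hl hl1 w hw).trans (mul_le_mul' le_rfl hwK)
        _ = _ := by
            rw [← mul_assoc, ← ENNReal.ofReal_mul (by positivity)]
            congr 2
            field_simp

end CarreDuChamp

end ContEq

end

/-! ### Jointly measurable representatives of curves in L². -/

noncomputable section

namespace ContEq

variable {X : Type*} [MeasurableSpace X] {m : Measure X} {S : Type*} [MeasurableSpace S]

/-- A geometric rate in `L²` gives a.e. convergence of the whole sequence. No subsequence depending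
on the time parameter has to be chosen later. -/
lemma tendsto_ae_of_eLpNorm_sub_le {f : ℕ → X → ℝ} {g : X → ℝ}
    (hf : ∀ n, AEStronglyMeasurable (f n) m) (hg : AEStronglyMeasurable g m)
    (h : ∀ n, eLpNorm (f n - g) 2 m ≤ ENNReal.ofReal ((1 / 2) ^ n)) :
    ∀ᵐ x ∂m, Tendsto (fun n => f n x) atTop (𝓝 (g x)) := by
  have hB : ∑' i : ℕ, ENNReal.ofReal (4 * (1 / 2) ^ i) ≠ ∞ := by
    rw [← ENNReal.ofReal_tsum_of_nonneg (fun n => by positivity)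
      (summable_geometric_two.mul_left 4)]
    exact ENNReal.ofReal_ne_top
  have h1 := Lp.ae_tendsto_of_cauchy_eLpNorm hf one_le_two hB fun N n k hn hk => by
    have e : f n - f k = (f n - g) - (f k - g) := by abel
    rw [e]
    refine (eLpNorm_sub_le ((hf n).sub hg) ((hf k).sub hg) one_le_two).trans_lt ?_
    refine (add_le_add (h n) (h k)).trans_lt ?_
    rw [← ENNReal.ofReal_add (by positivity) (by positivity)]
    refine (ENNReal.ofReal_lt_ofReal_iff (by positivity)).2 ?_
    have h1 : ((1 : ℝ) / 2) ^ n ≤ (1 / 2) ^ N :=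
      pow_le_pow_of_le_one (by norm_num) (by norm_num) hn
    have h2 : ((1 : ℝ) / 2) ^ k ≤ (1 / 2) ^ N :=
      pow_le_pow_of_le_one (by norm_num) (by norm_num) hk
    have h3 : (0 : ℝ) < (1 / 2) ^ N := by positivity
    linarith
  have hlim : Tendsto (fun n => eLpNorm (f n - g) 2 m) atTop (𝓝 0) := by
    have := ENNReal.tendsto_ofReal
      (tendsto_pow_atTop_nhds_zero_of_lt_one (r := (1 / 2 : ℝ)) (by norm_num) (by norm_num))
    rw [ENNReal.ofReal_zero] at this
    exact tendsto_of_tendsto_of_tendsto_of_le_of_le tendsto_const_nhds this (fun _ => zero_le) h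
  obtain ⟨ns, hns, h2⟩ :=
    (tendstoInMeasure_of_tendsto_eLpNorm two_ne_zero hf hg hlim).exists_seq_tendsto_ae
  filter_upwards [h1, h2] with x ⟨l, hl⟩ h2
  rwa [tendsto_nhds_unique h2 (hl.comp hns.tendsto_atTop)]

/-- A strongly measurable curve in `L²` has a jointly measurable representative. -/
lemma exists_measurable_uncurry {μ : Measure S} {f : S → Lp ℝ 2 m}
    (hf : AEStronglyMeasurable f μ) :
    ∃ W : S → X → ℝ, Measurable (Function.uncurry W) ∧ ∀ᵐ t ∂μ, W t =ᵐ[m] f t := by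
  classical
  set g := hf.mk f
  have hg : StronglyMeasurable g := hf.stronglyMeasurable_mk
  have hlim : ∀ t, Tendsto (fun n => hg.approx n t) atTop (𝓝 (g t)) := hg.tendsto_approx
  have hex : ∀ (j : ℕ) (t : S), ∃ n, dist (hg.approx n t) (g t) < (1 / 2) ^ j := fun j t =>
    ((tendsto_iff_dist_tendsto_zero.1 (hlim t)).eventually_lt_const
      (by positivity : (0 : ℝ) < (1 / 2) ^ j)).exists
  have hmeas : ∀ j n, MeasurableSet {t | dist (hg.approx n t) (g t) < (1 / 2) ^ j} := fun j n =>
    measurableSet_lt ((((hg.approx n).stronglyMeasurable.dist hg)).measurable) measurable_const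
  -- The index is the first simple approximation within (1/2)^j of the curve at the given time. It
  -- depends measurably on time, and the rate in j is geometric.
  set V : ℕ → S × X → ℝ := fun j z =>
    (hg.approx (Nat.find (hex j z.1)) z.1 : Lp ℝ 2 m) z.2
  have hV : ∀ j, Measurable (V j) := by
    intro j
    have h1 : ∀ n, Measurable fun z : S × X => (hg.approx n z.1 : Lp ℝ 2 m) z.2 := fun n =>
      ((hg.approx n).comp Prod.fst measurable_fst).measurable_bind
        (fun (v : Lp ℝ 2 m) (z : S × X) => v z.2)
        fun v => (Lp.stronglyMeasurable v).measurable.comp measurable_snd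
    exact Measurable.find (p := fun n (z : S × X) => dist (hg.approx n z.1) (g z.1) < (1 / 2) ^ j)
      h1 (fun n => measurable_fst (hmeas j n)) fun z => hex j z.1
  -- The limsup is jointly measurable at every point and equals the limit wherever that exists.
  refine ⟨fun t x => limsup (fun j => V j (t, x)) atTop, Measurable.limsup hV, ?_⟩
  filter_upwards [hf.ae_eq_mk] with t ht
  rw [ht]
  have h2 : ∀ᵐ x ∂m, Tendsto (fun j => V j (t, x)) atTop (𝓝 (g t x)) := by
    refine tendsto_ae_of_eLpNorm_sub_le
      (f := fun j => (hg.approx (Nat.find (hex j t)) t : Lp ℝ 2 m))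
      (fun j => Lp.aestronglyMeasurable _) (Lp.aestronglyMeasurable _) fun j => ?_
    rw [← Lp.edist_def, edist_dist]
    exact ENNReal.ofReal_le_ofReal (Nat.find_spec (hex j t)).le
  filter_upwards [h2] with x hx
  exact hx.limsup_eq

lemma measurable_eLpNorm_uncurry [SFinite m] {g : S → X → ℝ}
    (hg : Measurable (Function.uncurry g)) {p : ℝ≥0∞} (hp : p ≠ 0) :
    Measurable fun t => eLpNorm (g t) p m := by
  by_cases hp' : p = ∞
  · subst hp'
    simp only [eLpNorm_exponent_top]
    refine measurable_of_Iic fun c => ?_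
    have e : (fun t => eLpNormEssSup (g t) m) ⁻¹' Iic c = {t | m {x | c < ‖g t x‖ₑ} = 0} := by
      ext t
      simp only [mem_preimage, mem_Iic, mem_ofPred_eq]
      constructor
      · intro h
        have := ae_le_eLpNormEssSup (f := g t) (μ := m)
        have h2 : ∀ᵐ x ∂m, ¬ (c < ‖g t x‖ₑ) := by
          filter_upwards [this] with x hx
          exact not_lt.2 (hx.trans h)
        simpa [ae_iff] using h2
      · intro h
        refine essSup_le_of_ae_le c ?_
        have h2 : ∀ᵐ x ∂m, ¬ (c < ‖g t x‖ₑ) := by simpa [ae_iff] using h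
        filter_upwards [h2] with x hx
        exact not_lt.1 hx
    rw [e]
    have hs : MeasurableSet {z : S × X | c < ‖Function.uncurry g z‖ₑ} :=
      measurableSet_lt measurable_const hg.enorm
    exact measurable_measure_prodMk_left hs (measurableSet_singleton 0)
  · simp only [eLpNorm_eq_lintegral_rpow_enorm_toReal hp hp']
    have h1 : Measurable fun z : S × X => ‖Function.uncurry g z‖ₑ ^ p.toReal := hg.enorm.pow_const _
    exact (h1.lintegral_prod_right').pow_const _

end ContEq

end

/-! ### The weak equation in time as an integral equation. -/

noncomputable section

namespace ContEq

lemma integral_zero_eq_setIntegral_Ioo {t : ℝ} (ht : 0 ≤ t) (G : ℝ → ℝ) :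
    ∫ τ in (0 : ℝ)..t, G τ = ∫ τ in Ioo 0 t, G τ := by
  rw [intervalIntegral.integral_of_le ht, integral_Ioc_eq_integral_Ioo]

lemma intervalIntegrable_of_integrableOn_Ioo {T : ℝ} (hT : 0 ≤ T) {G : ℝ → ℝ}
    (hG : IntegrableOn G (Ioo 0 T)) : IntervalIntegrable G volume 0 T :=
  (intervalIntegrable_iff_integrableOn_Ioo_of_le hT).2 hG

/-- A curve solving `p' = G` in the weak sense, with initial value `c`, is the primitive of `G`. -/
lemma eq_add_integral_of_weak {T : ℝ} (hT : 0 < T) {p G : ℝ → ℝ} {c : ℝ}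
    (hp : ContinuousOn p (Ico 0 T)) (hpi : IntegrableOn p (Ioo 0 T))
    (hG : IntegrableOn G (Ioo 0 T))
    (h : ∀ ψ : ℝ → ℝ, ContDiff ℝ 1 ψ → ψ T = 0 →
      ∫ t in Ioo 0 T, (-(deriv ψ t) * p t - ψ t * G t) = ψ 0 * c) :
    ∀ t ∈ Ico 0 T, p t = c + ∫ τ in Ioo 0 t, G τ := by
  have hGi := intervalIntegrable_of_integrableOn_Ioo hT.le hG
  set Q : ℝ → ℝ := fun t => ∫ τ in (0 : ℝ)..t, G τ with hQ
  have hQac : AbsolutelyContinuousOnInterval Q 0 T :=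
    hGi.absolutelyContinuousOnInterval_intervalIntegral (by simp)
  have hQc : ContinuousOn Q (Icc 0 T) := by
    have := hQac.continuousOn
    rwa [uIcc_of_le hT.le] at this
  have hQc' : ContinuousOn Q (Ico 0 T) := hQc.mono Ico_subset_Icc_self
  have hQi : IntegrableOn Q (Ioo 0 T) :=
    (hQc.integrableOn_compact isCompact_Icc).mono_set Ioo_subset_Icc_self
  set P : ℝ → ℝ := fun t => p t - (c + Q t) with hP
  have hPc : ContinuousOn P (Ico 0 T) := hp.sub (continuousOn_const.add hQc')
  have hfin : IntegrableOn (fun _ : ℝ => c) (Ioo 0 T) := integrableOn_const (by simp)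
  have hPi : IntegrableOn P (Ioo 0 T) := hpi.sub (hfin.add hQi)
  -- The admissible test function is the primitive of χ that vanishes at T. Integrating the
  -- absolutely continuous primitive of G by parts identifies ∫ χ P, and the boundary value ψ(0) =
  -- -∫ χ fixes the constant c.
  have key : ∀ χ : ℝ → ℝ, Continuous χ → ∫ t in Ioo 0 T, χ t * P t = 0 := by
    intro χ hχ
    set ψ : ℝ → ℝ := fun t => ∫ τ in T..t, χ τ with hψ
    have hder : ∀ t, HasDerivAt ψ (χ t) t := fun t =>
      intervalIntegral.integral_hasDerivAt_right (hχ.intervalIntegrable _ _)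
        (hχ.stronglyMeasurableAtFilter _ _) hχ.continuousAt
    have hderiv : deriv ψ = χ := funext fun t => (hder t).deriv
    have hψ1 : ContDiff ℝ 1 ψ := by
      rw [contDiff_one_iff_deriv]
      exact ⟨fun t => (hder t).differentiableAt, by rwa [hderiv]⟩
    have hψT : ψ T = 0 := by simp [hψ]
    have hψac : AbsolutelyContinuousOnInterval ψ 0 T :=
      hψ1.contDiffOn.absolutelyContinuousOnInterval
    have ibp := hQac.integral_mul_deriv_eq_deriv_mul hψac
    have hQ0 : Q 0 = 0 := by simp [hQ]
    rw [hψT, hQ0, hderiv] at ibp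
    have e1 : ∫ t in (0 : ℝ)..T, deriv Q t * ψ t = ∫ t in (0 : ℝ)..T, G t * ψ t := by
      apply intervalIntegral.integral_congr_ae
      filter_upwards [hGi.ae_hasDerivAt_integral] with t ht ht'
      rw [(ht (uIoc_subset_uIcc ht') 0 (by simp)).deriv]
    have e2 : ∫ t in (0 : ℝ)..T, χ t = -ψ 0 := by
      simp only [hψ]
      rw [intervalIntegral.integral_symm]
    have hw := h ψ hψ1 hψT
    rw [hderiv] at hw
    rw [e1, integral_zero_eq_setIntegral_Ioo hT.le, integral_zero_eq_setIntegral_Ioo hT.le] at ibp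
    rw [integral_zero_eq_setIntegral_Ioo hT.le] at e2
    have bdd : ∀ {f k : ℝ → ℝ}, Continuous k → IntegrableOn f (Ioo 0 T) →
        IntegrableOn (fun t => k t * f t) (Ioo 0 T) := by
      intro f k hk hf
      have := hf.continuousOn_mul_of_subset hk.continuousOn (isCompact_Icc (a := 0) (b := T))
        measurableSet_Ioo Ioo_subset_Icc_self
      exact this
    have i1 := bdd hχ hpi
    have i2 := bdd hχ hfin
    have i3 := bdd hχ hQi
    have i4 := bdd hψ1.continuous hG
    have e3 : ∫ t in Ioo 0 T, χ t * P t = (∫ t in Ioo 0 T, χ t * p t)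
        - ((∫ t in Ioo 0 T, χ t * c) + ∫ t in Ioo 0 T, χ t * Q t) := by
      have i23 : IntegrableOn (fun t => χ t * c + χ t * Q t) (Ioo 0 T) := i2.add i3
      rw [← integral_add i2 i3, ← integral_sub i1 i23]
      apply integral_congr_ae
      filter_upwards with t
      simp only [hP]
      ring
    have e4 : ∫ t in Ioo 0 T, (-(χ t) * p t - ψ t * G t)
        = -(∫ t in Ioo 0 T, χ t * p t) - ∫ t in Ioo 0 T, ψ t * G t := by
      have i1' : IntegrableOn (fun t => -(χ t * p t)) (Ioo 0 T) := i1.neg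
      rw [← integral_neg, ← integral_sub i1' i4]
      apply integral_congr_ae
      filter_upwards with t
      ring
    have e5 : ∫ t in Ioo 0 T, χ t * Q t = ∫ t in Ioo 0 T, Q t * χ t := by simp only [mul_comm]
    have e6 : ∫ t in Ioo 0 T, G t * ψ t = ∫ t in Ioo 0 T, ψ t * G t := by simp only [mul_comm]
    rw [integral_mul_const, e2] at e3
    rw [e3, e5, ibp, e6]
    rw [e4] at hw
    linarith
  have hae : ∀ᵐ t, t ∈ Ioo 0 T → P t = 0 := by
    refine isOpen_Ioo.ae_eq_zero_of_integral_contDiff_smul_eq_zero hPi.locallyIntegrableOn ?_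
    intro χ hχ _ hsupp
    rw [← key χ hχ.continuous]
    simp only [smul_eq_mul]
    refine (setIntegral_eq_integral_of_forall_compl_eq_zero fun t ht => ?_).symm
    rw [image_eq_zero_of_notMem_tsupport fun h => ht (hsupp h), zero_mul]
  -- Continuity upgrades a.e. to every t, including t = 0.
  have heq : EqOn P (fun _ => 0) (Ico 0 T) := by
    refine Measure.eqOn_of_ae_eq (μ := volume) ?_ hPc continuousOn_const ?_
    · rw [← restrict_Ioo_eq_restrict_Ico]
      exact (ae_restrict_iff' measurableSet_Ioo).2 hae
    · rw [interior_Ico, closure_Ioo hT.ne]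
      exact Ico_subset_Icc_self
  intro t ht
  have := heq ht
  simp only [hP] at this
  rw [← integral_zero_eq_setIntegral_Ioo ht.1]
  simp only [hQ] at this
  linarith

end ContEq

end

/-! ### Evolutions: the equation tested against elements of 𝕍_s. -/

noncomputable section

namespace ContEq

variable {X : Type*} [MeasurableSpace X] {m : Measure X} {E : DirichletForm m}

namespace CarreDuChamp

variable {C : CarreDuChamp E} {A : Submodule ℝ E.domain}

/-- A time dependent family of derivations with integrable bounds on the modulus, the divergence
and the deformation. -/
structure IsTransport (T : ℝ) (b : ℝ → C.VDerivation A) (g d : ℝ → X → ℝ) (Sb Sd : ℝ → ℝ≥0∞)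
    (c : ℝ → ℝ≥0) (q r s : ℝ≥0∞) : Prop where
  pos : 0 < T
  measurable_bound : Measurable (Function.uncurry g)
  controlled : ∀ᵐ t ∂(volume.restrict (Ioo 0 T)), (b t).IsControlled (g t) (d t) q (Sb t) (Sd t)
  deformation : ∀ᵐ t ∂(volume.restrict (Ioo 0 T)), (b t).DeformationBound (d t) r s (c t)
  aemeasurable_Sb : AEMeasurable Sb (volume.restrict (Ioo 0 T))
  aemeasurable_Sd : AEMeasurable Sd (volume.restrict (Ioo 0 T))
  aemeasurable_c : AEMeasurable (fun t => (c t : ℝ≥0∞)) (volume.restrict (Ioo 0 T))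
  lintegral_Sb : ∫⁻ t in Ioo 0 T, Sb t ≠ ∞
  lintegral_Sd : ∫⁻ t in Ioo 0 T, Sd t ≠ ∞
  lintegral_c : ∫⁻ t in Ioo 0 T, (c t : ℝ≥0∞) ≠ ∞
  family : ∀ f : A, ∃ F : ℝ → X → ℝ, Measurable (Function.uncurry F) ∧
    ∀ᵐ t ∂(volume.restrict (Ioo 0 T)), ∀ᵐ x ∂m, (b t).toLin f x = F t x

/-- A measurable curve, bounded in `L^r ∩ L²`. -/
structure IsBoundedCurve (T : ℝ) (r K : ℝ≥0∞) (w : ℝ → Lp ℝ 2 m) : Prop where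
  aestronglyMeasurable : AEStronglyMeasurable w (volume.restrict (Ioo 0 T))
  lt_top : K < ∞
  bound : ∀ᵐ t ∂(volume.restrict (Ioo 0 T)), MemLp (w t) r m ∧ interNorm r (w t) m ≤ K

section

variable [SFinite m] {T : ℝ} {b : ℝ → C.VDerivation A} {g d : ℝ → X → ℝ} {Sb Sd : ℝ → ℝ≥0∞}
  {c : ℝ → ℝ≥0} {q r s K : ℝ≥0∞} {w : ℝ → Lp ℝ 2 m}

/-- The rate of change of `∫ φ w` along the flow. -/
def pairing (hA : C.IsTestAlgebra A) (b : ℝ → C.VDerivation A) (w : ℝ → Lp ℝ 2 m) (φ : E.domain)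
    (t : ℝ) : ℝ := ∫ x, w t x * (b t).extend hA φ x ∂m

variable (hS : C.Setting A q r s) (hb : IsTransport T b g d Sb Sd c q r s)
include hb

lemma aestronglyMeasurable_pairing_of_mem
    (hw : AEStronglyMeasurable w (volume.restrict (Ioo 0 T))) (φ : A) :
    AEStronglyMeasurable (pairing hS.alg b w φ.1) (volume.restrict (Ioo 0 T)) := by
  obtain ⟨W, hW, hW'⟩ := exists_measurable_uncurry hw
  obtain ⟨F, hF, hF'⟩ := hb.family φ
  have h1 : StronglyMeasurable fun t => ∫ x, W t x * F t x ∂m :=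
    (hW.mul hF).stronglyMeasurable.integral_prod_right
  refine h1.aestronglyMeasurable.congr ?_
  filter_upwards [hW', hF'] with t h2 h3
  apply integral_congr_ae
  filter_upwards [h2, h3] with x h4 h5
  rw [h4, VDerivation.extend_coe, h5]

omit [SFinite m] in
lemma enorm_pairing_le (hw : IsBoundedCurve T r K w) :
    ∀ᵐ t ∂(volume.restrict (Ioo 0 T)), ∀ φ, ‖pairing hS.alg b w φ t‖ₑ
      ≤ Sb t * K * interNorm s (C.sqrtΓ φ) m := by
  filter_upwards [hb.controlled, hw.bound] with t h1 h2 φ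
  refine (enorm_integral_le_lintegral_enorm _).trans
    ((h1.lintegral_mul_extend_le hS.alg hS.sum_eq (Lp.aestronglyMeasurable _) φ).trans ?_)
  gcongr
  exact h2.2

omit [SFinite m] in
lemma pairing_sub (hw : IsBoundedCurve T r K w) :
    ∀ᵐ t ∂(volume.restrict (Ioo 0 T)), ∀ φ ψ, C.MemV s φ → C.MemV s ψ →
      pairing hS.alg b w (φ - ψ) t = pairing hS.alg b w φ t - pairing hS.alg b w ψ t := by
  filter_upwards [hb.controlled, hw.bound] with t h1 h2 φ ψ hφ hψ
  have n := h2.2.trans_lt hw.lt_top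
  rw [pairing, pairing, pairing, ← integral_sub
    (h1.integrable_mul_extend hS.alg hS.sum_eq (Lp.aestronglyMeasurable _) n hφ)
    (h1.integrable_mul_extend hS.alg hS.sum_eq (Lp.aestronglyMeasurable _) n hψ)]
  apply integral_congr_ae
  filter_upwards [VDerivation.IsControlled.extend_sub_ae (b := b t) hS.alg φ ψ] with x hx
  rw [hx]; ring

/-- Only elements of the algebra come with joint measurability in (t, x). Other φ are a limit of
these, for a.e. t. -/
lemma aestronglyMeasurable_pairing (hw : IsBoundedCurve T r K w) {φ : E.domain}
    (hφ : C.MemV s φ) :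
    AEStronglyMeasurable (pairing hS.alg b w φ) (volume.restrict (Ioo 0 T)) := by
  obtain ⟨f, hf⟩ := hS.dense_s.exists_seq hφ
  refine aestronglyMeasurable_of_tendsto_ae atTop
    (fun n => aestronglyMeasurable_pairing_of_mem hS hb hw.aestronglyMeasurable (f n)) ?_
  filter_upwards [hb.controlled, enorm_pairing_le hS hb hw, pairing_sub hS hb hw] with t h1 h2 h3
  rw [tendsto_iff_edist_tendsto_0]
  have h4 := ENNReal.Tendsto.const_mul (a := Sb t * K) hf
    (Or.inr (ENNReal.mul_ne_top h1.fin_bound.ne hw.lt_top.ne))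
  rw [mul_zero] at h4
  refine tendsto_of_tendsto_of_tendsto_of_le_of_le tendsto_const_nhds h4 (fun _ => zero_le)
    fun n => ?_
  simp only [edist_eq_enorm_sub]
  rw [← h3 _ _ (hS.alg.memV (f n) hS.one_lt.le) hφ]
  refine (h2 _).trans ?_
  gcongr
  exact C.interNorm_sqrtΓ_le_gradNorm _ _

lemma integrableOn_pairing (hw : IsBoundedCurve T r K w) {φ : E.domain}
    (hφ : C.MemV s φ) : IntegrableOn (pairing hS.alg b w φ) (Ioo 0 T) := by
  refine ⟨aestronglyMeasurable_pairing hS hb hw hφ, ?_⟩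
  rw [hasFiniteIntegral_iff_enorm]
  have hfin : K * interNorm s (C.sqrtΓ φ) m ≠ ∞ :=
    ENNReal.mul_ne_top hw.lt_top.ne (C.interNorm_sqrtΓ_lt_top hφ).ne
  calc _ ≤ ∫⁻ t in Ioo 0 T, Sb t * (K * interNorm s (C.sqrtΓ φ) m) := by
        apply lintegral_mono_ae
        filter_upwards [enorm_pairing_le hS hb hw] with t ht
        rw [← mul_assoc]
        exact ht φ
    _ = (∫⁻ t in Ioo 0 T, Sb t) * (K * interNorm s (C.sqrtΓ φ) m) :=
        lintegral_mul_const' _ _ hfin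
    _ < ∞ := ENNReal.mul_lt_top hb.lintegral_Sb.lt_top hfin.lt_top

omit [SFinite m] in
lemma lintegral_enorm_pairing_le (hw : IsBoundedCurve T r K w) {φ : E.domain}
    (hφ : C.MemV s φ) {S : Set ℝ} (hST : S ⊆ Ioo 0 T) :
    ‖∫ t in S, pairing hS.alg b w φ t‖ₑ
      ≤ (∫⁻ t in S, Sb t) * (K * interNorm s (C.sqrtΓ φ) m) := by
  have hfin : K * interNorm s (C.sqrtΓ φ) m ≠ ∞ :=
    ENNReal.mul_ne_top hw.lt_top.ne (C.interNorm_sqrtΓ_lt_top hφ).ne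
  refine (enorm_integral_le_lintegral_enorm _).trans ?_
  rw [← lintegral_mul_const' _ _ hfin]
  apply lintegral_mono_ae
  filter_upwards [ae_restrict_of_ae_restrict_of_subset hST (enorm_pairing_le hS hb hw)] with t ht
  rw [← mul_assoc]
  exact ht φ

end

/-- `∫ φ w` is, for `φ ∈ A`, the primitive of its rate of change, and vanishes at time `0`. -/
def IsEvolution (hA : C.IsTestAlgebra A) (T : ℝ) (b : ℝ → C.VDerivation A) (w : ℝ → Lp ℝ 2 m) :
    Prop :=
  ∀ φ : A, ∀ t ∈ Ico 0 T, inner ℝ (φ.1 : Lp ℝ 2 m) (w t)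
    = ∫ τ in Ioo 0 t, pairing hA b w φ.1 τ

section

variable [SFinite m] {T : ℝ} {b : ℝ → C.VDerivation A} {g d : ℝ → X → ℝ} {Sb Sd : ℝ → ℝ≥0∞}
  {c : ℝ → ℝ≥0} {q r s K : ℝ≥0∞} {w : ℝ → Lp ℝ 2 m} (hS : C.Setting A q r s)
  (hb : IsTransport T b g d Sb Sd c q r s)
include hb

/-- Both sides are continuous in φ for the gradient norm. The extension beyond the algebra is
essential because the later test functions are values of the resolvent. -/
lemma IsEvolution.inner_eq (hw : IsBoundedCurve T r K w) (hev : IsEvolution hS.alg T b w)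
    {φ : E.domain} (hφ : C.MemV s φ) {t : ℝ} (ht : t ∈ Ico 0 T) :
    inner ℝ (φ : Lp ℝ 2 m) (w t) = ∫ τ in Ioo 0 t, pairing hS.alg b w φ τ := by
  obtain ⟨f, hf⟩ := hS.dense_s.exists_seq hφ
  have hsub : Ioo 0 t ⊆ Ioo 0 T := Ioo_subset_Ioo_right ht.2.le
  have h1 : Tendsto (fun n => inner ℝ ((f n).1 : Lp ℝ 2 m) (w t)) atTop
      (𝓝 (inner ℝ (φ : Lp ℝ 2 m) (w t))) := by
    refine Tendsto.inner ?_ tendsto_const_nhds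
    rw [tendsto_iff_edist_tendsto_0]
    refine tendsto_of_tendsto_of_tendsto_of_le_of_le tendsto_const_nhds hf (fun _ => zero_le)
      fun n => ?_
    have h0 := C.interNorm_le_gradNorm s ((f n).1 - φ)
    rw [Submodule.coe_sub] at h0
    exact (edist_le_interNorm s _ _).trans h0
  have h2 : Tendsto (fun n => ∫ τ in Ioo 0 t, pairing hS.alg b w (f n).1 τ) atTop
      (𝓝 (∫ τ in Ioo 0 t, pairing hS.alg b w φ τ)) := by
    rw [tendsto_iff_edist_tendsto_0]
    have hfin : (∫⁻ τ in Ioo 0 t, Sb τ) ≠ ∞ :=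
      ne_top_of_le_ne_top hb.lintegral_Sb (lintegral_mono_set hsub)
    have h4 := ENNReal.Tendsto.const_mul (a := (∫⁻ τ in Ioo 0 t, Sb τ) * K) hf
      (Or.inr (ENNReal.mul_ne_top hfin hw.lt_top.ne))
    rw [mul_zero] at h4
    refine tendsto_of_tendsto_of_tendsto_of_le_of_le tendsto_const_nhds h4 (fun _ => zero_le)
      fun n => ?_
    have hn : C.MemV s (f n).1 := hS.alg.memV (f n) hS.one_lt.le
    have e : (∫ τ in Ioo 0 t, pairing hS.alg b w (f n).1 τ)
        - ∫ τ in Ioo 0 t, pairing hS.alg b w φ τ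
        = ∫ τ in Ioo 0 t, pairing hS.alg b w ((f n).1 - φ) τ := by
      rw [← integral_sub ((integrableOn_pairing hS hb hw hn).mono_set hsub)
        ((integrableOn_pairing hS hb hw hφ).mono_set hsub)]
      apply integral_congr_ae
      filter_upwards [ae_restrict_of_ae_restrict_of_subset hsub (pairing_sub hS hb hw)] with τ hτ
      rw [hτ _ _ hn hφ]
    simp only [edist_eq_enorm_sub]
    rw [e]
    refine (lintegral_enorm_pairing_le hS hb hw (hn.sub hS.one_lt.le hφ) hsub).trans ?_
    rw [mul_assoc]
    gcongr
    exact C.interNorm_sqrtΓ_le_gradNorm _ _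
  refine tendsto_nhds_unique h1 (h2.congr fun n => ?_)
  exact (hev (f n) t ht).symm

lemma IsWeakSolution.inner_eq (hw : IsBoundedCurve T r K w) {u0 : Lp ℝ 2 m}
    (hu : IsWeakSolution T b r u0 w) (φ : A) {t : ℝ} (ht : t ∈ Ico 0 T) :
    inner ℝ (φ.1 : Lp ℝ 2 m) (w t) = inner ℝ (φ.1 : Lp ℝ 2 m) u0
      + ∫ τ in Ioo 0 t, pairing hS.alg b w φ.1 τ := by
  have hφV : C.MemV s φ.1 := hS.alg.memV φ hS.one_lt.le
  have ei : ∀ v : Lp ℝ 2 m, ∫ x, (φ.1 : Lp ℝ 2 m) x * v x ∂m = inner ℝ (φ.1 : Lp ℝ 2 m) v := by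
    intro v
    rw [L2.inner_def]
    simp [mul_comm]
  refine eq_add_integral_of_weak (p := fun t => inner ℝ (φ.1 : Lp ℝ 2 m) (w t))
    hb.pos ?_ ?_ (integrableOn_pairing hS hb hw hφV) ?_ t ht
  · have := hu.weaklyContinuous φ
    simpa only [ei] using this
  · refine Integrable.of_bound (aestronglyMeasurable_const.inner hw.aestronglyMeasurable)
      (‖(φ.1 : Lp ℝ 2 m)‖ * K.toReal) ?_
    filter_upwards [hw.bound] with t ht
    refine (norm_inner_le_norm _ _).trans ?_
    gcongr
    rw [Lp.norm_def]
    exact ENNReal.toReal_mono hw.lt_top.ne ((eLpNorm_two_le_interNorm r _).trans ht.2)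
  · intro ψ hψ hψT
    have h1 := hu.equation φ ψ hψ hψT
    rw [ei] at h1
    rw [← h1]
    apply integral_congr_ae
    filter_upwards [hb.controlled, hw.bound] with t h2 h3
    have i1 : Integrable (fun x => (φ.1 : Lp ℝ 2 m) x * w t x) m := by
      have := L2.integrable_inner (𝕜 := ℝ) (φ.1 : Lp ℝ 2 m) (w t)
      simpa [mul_comm] using this
    have i2 := h2.integrable_mul_extend hS.alg hS.sum_eq (Lp.aestronglyMeasurable (w t))
      (h3.2.trans_lt hw.lt_top) hφV
    rw [pairing, ← ei, ← integral_const_mul, ← integral_const_mul,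
      ← integral_sub (i1.const_mul _) (i2.const_mul _)]
    apply integral_congr_ae
    filter_upwards with x
    rw [VDerivation.extend_coe]
    ring

end

end CarreDuChamp

end ContEq

end

/-! ### Tools in time: smallness of φ_t - φ_τ, patching of short intervals, Gronwall. -/

noncomputable section

namespace ContEq

/-- z β₁'(z) = z² / √(z² + 1), and √(z² + 1) ≤ |z| + 1. The pairing of z with its regularised sign
thus controls a truncated square. -/
lemma min_one_abs_sq_le (z : ℝ) : min 1 |z| ^ 2 ≤ 2 * (z * smoothSign 1 z) := by
  have h1 := sqrt_add_sq_pos one_pos z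
  have h2 : Real.sqrt (z ^ 2 + 1 ^ 2) ≤ |z| + 1 := by
    rw [Real.sqrt_le_left (by positivity)]
    nlinarith [sq_abs z, abs_nonneg z]
  have h3 : 0 ≤ |z| := abs_nonneg z
  have e : 2 * (z * smoothSign 1 z) = 2 * |z| ^ 2 / Real.sqrt (z ^ 2 + 1 ^ 2) := by
    rw [smoothSign, sq_abs]; ring
  rw [e, le_div_iff₀ h1]
  have hm : 0 ≤ min 1 |z| := le_min zero_le_one h3
  calc min 1 |z| ^ 2 * Real.sqrt (z ^ 2 + 1 ^ 2) ≤ min 1 |z| ^ 2 * (|z| + 1) := by gcongr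
    _ ≤ 2 * |z| ^ 2 := by
      rcases le_total 1 |z| with h | h
      · rw [min_eq_left h]; nlinarith
      · rw [min_eq_right h]; nlinarith [sq_nonneg |z|]

/-- β' is bounded and Lipschitz, so its increments are controlled by μ = min (1, |a - b|). Then μ ≤
θ + μ² / θ brings in the truncated square. -/
lemma abs_smoothSign_sub_le_add {δ θ : ℝ} (hδ : 0 < δ) (hθ : 0 < θ) (a b : ℝ) :
    |smoothSign δ a - smoothSign δ b| ≤ (2 + 2 / δ) * (θ + θ⁻¹ * min 1 |a - b| ^ 2) := by
  have h0 : 0 ≤ |a - b| := abs_nonneg _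
  have h1 : |smoothSign δ a - smoothSign δ b| ≤ (2 + 2 / δ) * min 1 |a - b| := by
    rcases le_total 1 |a - b| with h | h
    · rw [min_eq_left h]
      have := abs_sub (smoothSign δ a) (smoothSign δ b)
      have := abs_smoothSign_le hδ a
      have := abs_smoothSign_le hδ b
      have : 0 ≤ 2 / δ := by positivity
      linarith
    · rw [min_eq_right h]
      refine (abs_smoothSign_sub_le hδ a b).trans ?_
      gcongr
      linarith
  refine h1.trans ?_
  set μ := min 1 |a - b|
  have hμ : 0 ≤ μ := le_min zero_le_one h0
  gcongr
  rcases le_total μ θ with h | h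
  · have : 0 ≤ θ⁻¹ * μ ^ 2 := by positivity
    linarith
  · have : μ ≤ θ⁻¹ * μ ^ 2 := by
      rw [← div_eq_inv_mul, le_div_iff₀ hθ]
      nlinarith
    linarith

variable {X : Type*} [MeasurableSpace X] {m : Measure X} {E : DirichletForm m}

lemma eLpNorm_le_lintegral_rpow {p : ℝ≥0∞} (hp : 1 ≤ p) (hp' : p ≠ ∞) {f : X → ℝ}
    (hf : ∀ᵐ x ∂m, ‖f x‖ₑ ≤ 1) : eLpNorm f p m ≤ (∫⁻ x, ‖f x‖ₑ ∂m) ^ (1 / p.toReal) := by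
  have h1 : 1 ≤ p.toReal := by
    have := ENNReal.toReal_mono hp' hp
    simpa using this
  rw [eLpNorm_eq_lintegral_rpow_enorm_toReal (one_pos.trans_le hp).ne' hp']
  refine ENNReal.rpow_le_rpow (lintegral_mono_ae ?_) (by positivity)
  filter_upwards [hf] with x hx
  exact ENNReal.rpow_le_self_of_le_one hx h1

/-- Up to the term θ κ, the difference is bounded by min (1, |v - w|)² κ / θ. The truncated square
times κ takes values in [0, 1], so its L^p norm is at most a power of its L¹ norm, and the latter is
bounded by the pairing. -/
lemma interNorm_signMul_sub_le_add {p : ℝ≥0∞} (hp : 1 ≤ p) (hp' : p ≠ ∞) {δ θ : ℝ} (hδ : 0 < δ)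
    (hθ : 0 < θ) {κ : Lp ℝ 2 m} (h01 : ∀ᵐ x ∂m, 0 ≤ κ x ∧ κ x ≤ 1) (v w : Lp ℝ 2 m) :
    interNorm p (signMul hδ κ v - signMul hδ κ w : Lp ℝ 2 m) m
      ≤ ENNReal.ofReal (2 + 2 / δ) * (ENNReal.ofReal θ * interNorm p κ m + ENNReal.ofReal θ⁻¹ *
        ((2 * ENNReal.ofReal (inner ℝ (signMul one_pos κ (v - w)) (v - w))) ^ (1 / p.toReal)
        + (2 * ENNReal.ofReal (inner ℝ (signMul one_pos κ (v - w)) (v - w)))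
          ^ (1 / (2 : ℝ≥0∞).toReal))) := by
  set z : Lp ℝ 2 m := v - w with hz
  set f : X → ℝ := fun x => min 1 |z x| ^ 2 * κ x with hf
  have mz := Lp.aestronglyMeasurable z
  have mκ := Lp.aestronglyMeasurable κ
  have mf : AEStronglyMeasurable f m := by
    have hc : Continuous fun y : ℝ => min 1 |y| ^ 2 := by fun_prop
    exact (hc.comp_aestronglyMeasurable mz).mul mκ
  have hf0 : ∀ᵐ x ∂m, 0 ≤ f x := by
    filter_upwards [h01] with x hx
    exact mul_nonneg (sq_nonneg _) hx.1
  have hf1 : ∀ᵐ x ∂m, ‖f x‖ₑ ≤ 1 := by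
    filter_upwards [h01, hf0] with x hx h0
    have h1 : 0 ≤ min 1 |z x| := le_min zero_le_one (abs_nonneg _)
    have h2 : min 1 |z x| ≤ 1 := min_le_left _ _
    rw [Real.enorm_of_nonneg h0]
    exact ENNReal.ofReal_le_one.2 (mul_le_one₀ (pow_le_one₀ h1 h2) hx.1 hx.2)
  have ei : ∫ x, z x * signMul one_pos κ z x ∂m = inner ℝ (signMul one_pos κ z) z := by
    rw [L2.inner_def]
    simp
  have ii : Integrable (fun x => z x * signMul one_pos κ z x) m := by
    have := L2.integrable_inner (𝕜 := ℝ) (signMul one_pos κ z) z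
    simpa using this
  have hpt1 : ∀ᵐ x ∂m, f x ≤ 2 * (z x * signMul one_pos κ z x) := by
    filter_upwards [h01, signMul_ae one_pos κ z] with x hx h1
    rw [h1]
    calc f x ≤ 2 * (z x * smoothSign 1 (z x)) * κ x :=
          mul_le_mul_of_nonneg_right (min_one_abs_sq_le _) hx.1
      _ = _ := by ring
  have hlin : ∫⁻ x, ‖f x‖ₑ ∂m ≤ 2 * ENNReal.ofReal (inner ℝ (signMul one_pos κ z) z) := by
    have e2 : ∀ a : ℝ, 2 * ENNReal.ofReal a = ENNReal.ofReal (2 * a) := fun a => by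
      rw [ENNReal.ofReal_mul zero_le_two, ENNReal.ofReal_ofNat]
    rw [← ei, e2, ← integral_const_mul,
      ofReal_integral_eq_lintegral_ofReal (ii.const_mul 2)]
    · apply lintegral_mono_ae
      filter_upwards [hf0, hpt1] with x h0 h1
      rw [Real.enorm_of_nonneg h0]
      exact ENNReal.ofReal_le_ofReal h1
    · filter_upwards [hf0, hpt1] with x h0 h1 using h0.trans h1
  have hfn : interNorm p f m
      ≤ (2 * ENNReal.ofReal (inner ℝ (signMul one_pos κ z) z)) ^ (1 / p.toReal)
        + (2 * ENNReal.ofReal (inner ℝ (signMul one_pos κ z) z)) ^ (1 / (2 : ℝ≥0∞).toReal) :=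
    add_le_add
      ((eLpNorm_le_lintegral_rpow hp hp' hf1).trans (ENNReal.rpow_le_rpow hlin (by positivity)))
      ((eLpNorm_le_lintegral_rpow one_le_two (by simp) hf1).trans
        (ENNReal.rpow_le_rpow hlin (by positivity)))
  have hpt : ∀ᵐ x ∂m, ‖(signMul hδ κ v - signMul hδ κ w : Lp ℝ 2 m) x‖
      ≤ ‖((2 + 2 / δ) • (θ • ⇑κ + θ⁻¹ • f)) x‖ := by
    filter_upwards [h01, Lp.coeFn_sub (signMul hδ κ v) (signMul hδ κ w), signMul_ae hδ κ v,
      signMul_ae hδ κ w, Lp.coeFn_sub v w] with x hx h1 h2 h3 h4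
    rw [h1, Pi.sub_apply, h2, h3, ← sub_mul, norm_mul, Real.norm_of_nonneg hx.1]
    refine le_trans ?_ (Real.le_norm_self _)
    calc _ ≤ (2 + 2 / δ) * (θ + θ⁻¹ * min 1 |v x - w x| ^ 2) * κ x :=
          mul_le_mul_of_nonneg_right (abs_smoothSign_sub_le_add hδ hθ _ _) hx.1
      _ = _ := by
        simp only [Pi.smul_apply, Pi.add_apply, smul_eq_mul, hf]
        rw [hz, h4, Pi.sub_apply]
        ring
  refine (interNorm_mono_ae hpt).trans ?_
  rw [interNorm_smul, abs_of_pos (by positivity)]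
  gcongr
  refine (interNorm_add_le hp (mκ.const_smul θ) (mf.const_smul θ⁻¹)).trans ?_
  rw [interNorm_smul, interNorm_smul, abs_of_pos hθ, abs_of_pos (inv_pos.2 hθ)]
  gcongr

/-- `signMul hδ κ v - signMul hδ κ w` is small in `L^p ∩ L²` when the pairing of `v - w` with its
own regularised sign is small. -/
lemma exists_interNorm_signMul_sub_le {p : ℝ≥0∞} (hp : 1 ≤ p) (hp' : p ≠ ∞) {δ : ℝ} (hδ : 0 < δ)
    {κ : Lp ℝ 2 m} (h01 : ∀ᵐ x ∂m, 0 ≤ κ x ∧ κ x ≤ 1) (hκ : MemLp κ p m) {ε : ℝ≥0∞}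
    (hε : 0 < ε) : ∃ η : ℝ≥0∞, 0 < η ∧ ∀ v w : Lp ℝ 2 m,
      ENNReal.ofReal (inner ℝ (signMul one_pos κ (v - w)) (v - w)) ≤ η →
      interNorm p (signMul hδ κ v - signMul hδ κ w : Lp ℝ 2 m) m ≤ ε := by
  have nκ := interNorm_lt_top hκ (Lp.memLp κ)
  have hε2 : 0 < ε / 2 := ENNReal.half_pos hε.ne'
  -- θ is fixed first, then η is chosen so that the term with 1/θ is small.
  obtain ⟨θ, hθ, hθε⟩ : ∃ θ : ℝ, 0 < θ ∧
      ENNReal.ofReal (2 + 2 / δ) * (ENNReal.ofReal θ * interNorm p κ m) ≤ ε / 2 := by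
    have h1 : Tendsto (fun θ : ℝ => ENNReal.ofReal (2 + 2 / δ) *
        (ENNReal.ofReal θ * interNorm p κ m)) (𝓝[>] 0) (𝓝 0) := by
      have h2 : Tendsto (fun θ : ℝ => ENNReal.ofReal θ) (𝓝[>] 0) (𝓝 0) := by
        have := (ENNReal.continuous_ofReal.tendsto 0).mono_left (nhdsWithin_le_nhds (s := Ioi 0))
        simpa using this
      have h3 := ENNReal.Tendsto.mul_const h2 (Or.inr nκ.ne)
      rw [zero_mul] at h3
      have h4 := ENNReal.Tendsto.const_mul (a := ENNReal.ofReal (2 + 2 / δ)) h3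
        (Or.inr ENNReal.ofReal_ne_top)
      rwa [mul_zero] at h4
    obtain ⟨θ, h5, h6⟩ := ((h1.eventually_le_const hε2).and self_mem_nhdsWithin).exists
    exact ⟨θ, h6, h5⟩
  have hrpow : ∀ a : ℝ≥0∞, 1 ≤ a → a ≠ ∞ →
      Tendsto (fun ω : ℝ≥0∞ => (2 * ω) ^ (1 / a.toReal)) (𝓝 0) (𝓝 0) := by
    intro a ha ha'
    have h1 : Tendsto (fun ω : ℝ≥0∞ => 2 * ω) (𝓝 0) (𝓝 0) := by
      have := ENNReal.Tendsto.const_mul (a := 2) (tendsto_id (x := 𝓝 (0 : ℝ≥0∞)))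
        (Or.inr ENNReal.ofNat_ne_top)
      simpa using this
    have h2 : 0 < 1 / a.toReal := one_div_pos.2 (ENNReal.toReal_pos (one_pos.trans_le ha).ne' ha')
    have := (ENNReal.continuous_rpow_const (y := 1 / a.toReal)).tendsto 0
    rw [ENNReal.zero_rpow_of_pos h2] at this
    exact this.comp h1
  have h1 : Tendsto (fun ω : ℝ≥0∞ => ENNReal.ofReal (2 + 2 / δ) * (ENNReal.ofReal θ⁻¹ *
      ((2 * ω) ^ (1 / p.toReal) + (2 * ω) ^ (1 / (2 : ℝ≥0∞).toReal)))) (𝓝 0) (𝓝 0) := by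
    have h2 := (hrpow p hp hp').add (hrpow 2 one_le_two ENNReal.ofNat_ne_top)
    rw [add_zero] at h2
    have h3 := ENNReal.Tendsto.const_mul (a := ENNReal.ofReal θ⁻¹) h2
      (Or.inr ENNReal.ofReal_ne_top)
    rw [mul_zero] at h3
    have h4 := ENNReal.Tendsto.const_mul (a := ENNReal.ofReal (2 + 2 / δ)) h3
      (Or.inr ENNReal.ofReal_ne_top)
    rwa [mul_zero] at h4
  obtain ⟨η, hη, hη'⟩ := (ENNReal.nhds_zero_basis_Iic.eventually_iff).1
    (h1.eventually_le_const hε2)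
  refine ⟨η, hη, fun v w hvw => ?_⟩
  refine (interNorm_signMul_sub_le_add hp hp' hδ hθ h01 v w).trans ?_
  rw [mul_add, ← ENNReal.add_halves ε]
  exact add_le_add hθε (hη' hvw)

lemma exists_pos_forall_setLIntegral_Ioc_le {T : ℝ} {S : ℝ → ℝ≥0∞}
    (hS : ∫⁻ t in Ioo 0 T, S t ≠ ∞) {η : ℝ≥0∞} (hη : 0 < η) :
    ∃ σ : ℝ, 0 < σ ∧ ∀ a t : ℝ, 0 ≤ a → t < T → t - a ≤ σ → ∫⁻ τ in Ioc a t, S τ ≤ η := by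
  obtain ⟨ρ, hρ, hρ'⟩ := exists_pos_setLIntegral_lt_of_measure_lt hS hη.ne'
  obtain ⟨σ, h1, h2⟩ := ENNReal.lt_iff_exists_nnreal_btwn.1 hρ
  refine ⟨σ, by exact_mod_cast h1, fun a t ha ht hat => ?_⟩
  have hsub : Ioc a t ⊆ Ioo 0 T := fun x hx => ⟨ha.trans_lt hx.1, hx.2.trans_lt ht⟩
  have h3 : volume (Ioc a t) < ρ := by
    rw [Real.volume_Ioc]
    exact (ENNReal.ofReal_le_ofReal hat).trans_lt (by simpa using h2)
  have := hρ' (Ioc a t) ((Measure.restrict_apply_le _ _).trans_lt h3)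
  rw [Measure.restrict_restrict measurableSet_Ioc, inter_eq_self_of_subset_left hsub] at this
  exact this.le

/-- Additivity over intervals needs no measurability of G, which is therefore never required of the
integrands in the patching and Gronwall arguments. -/
lemma setLIntegral_Ioc_add {a t : ℝ} (ha : 0 ≤ a) (hat : a ≤ t) (G : ℝ → ℝ≥0∞) :
    (∫⁻ τ in Ioc 0 a, G τ) + ∫⁻ τ in Ioc a t, G τ = ∫⁻ τ in Ioc 0 t, G τ := by
  rw [← lintegral_union measurableSet_Ioc (Ioc_disjoint_Ioc_of_le le_rfl),
    Ioc_union_Ioc_eq_Ioc ha hat]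

/-- A subadditive comparison on short time intervals implies the comparison on `(0, t]`. -/
lemma le_setLIntegral_of_forall_short {T : ℝ} {S G f : ℝ → ℝ≥0∞}
    (hS : ∫⁻ t in Ioo 0 T, S t ≠ ∞) (h0 : f 0 = 0) {η : ℝ≥0∞} (hη : 0 < η)
    (h : ∀ a t : ℝ, 0 ≤ a → a ≤ t → t < T → ∫⁻ τ in Ioc a t, S τ ≤ η →
      f t ≤ f a + ∫⁻ τ in Ioc a t, G τ) :
    ∀ t ∈ Ico 0 T, f t ≤ ∫⁻ τ in Ioc 0 t, G τ := by
  obtain ⟨σ, hσ, hσ'⟩ := exists_pos_forall_setLIntegral_Ioc_le hS hη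
  have key : ∀ n : ℕ, ∀ t : ℝ, 0 ≤ t → t < T → t ≤ n * σ → f t ≤ ∫⁻ τ in Ioc 0 t, G τ := by
    intro n
    induction n with
    | zero =>
      intro t ht0 _ ht
      have : t = 0 := le_antisymm (by simpa using ht) ht0
      rw [this, h0]
      exact zero_le
    | succ n ih =>
      intro t ht0 htT ht
      push_cast at ht
      rcases le_total t σ with hts | hts
      · have h2 := h 0 t le_rfl ht0 htT (hσ' 0 t le_rfl htT (by linarith))
        rwa [h0, zero_add] at h2
      · have ha : 0 ≤ t - σ := by linarith
        refine (h (t - σ) t ha (by linarith) htT (hσ' _ t ha htT (by linarith))).trans ?_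
        rw [← setLIntegral_Ioc_add ha (by linarith : t - σ ≤ t)]
        exact add_le_add (ih (t - σ) ha (by linarith) (by linarith)) le_rfl
  intro t ht
  obtain ⟨n, hn⟩ := exists_nat_ge (t / σ)
  exact key n t ht.1 ht.2 ((div_le_iff₀ hσ).1 hn)

/-- Gronwall's inequality with an integrable coefficient. -/
lemma exists_le_mul_of_le_add_setLIntegral {T : ℝ} {S : ℝ → ℝ≥0∞}
    (hS : ∫⁻ t in Ioo 0 T, S t ≠ ∞) :
    ∃ M : ℝ≥0∞, M ≠ ∞ ∧ ∀ (y : ℝ → ℝ≥0∞) (B c : ℝ≥0∞), B ≠ ∞ → (∀ t ∈ Ico 0 T, y t ≤ B) →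
      (∀ t ∈ Ico 0 T, y t ≤ c + ∫⁻ τ in Ioc 0 t, y τ * S τ) → ∀ t ∈ Ico 0 T, y t ≤ M * c := by
  obtain ⟨σ, hσ, hσ'⟩ := exists_pos_forall_setLIntegral_Ioc_le hS
    (show (0 : ℝ≥0∞) < 2⁻¹ by simp)
  set I := ∫⁻ t in Ioo 0 T, S t
  have hI : ∀ t < T, ∫⁻ τ in Ioc 0 t, S τ ≤ I := fun t ht =>
    lintegral_mono_set fun x hx => ⟨hx.1, hx.2.trans_lt ht⟩
  -- y is not assumed measurable, so only bounds by constants are used. The interval is cut into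
  -- pieces on which S has integral at most 1/2, and the constant is built up piece by piece.
  have hmul : ∀ {a t : ℝ} {y : ℝ → ℝ≥0∞} {B : ℝ≥0∞}, B ≠ ∞ → (∀ τ ∈ Ioc a t, y τ ≤ B) →
      ∫⁻ τ in Ioc a t, y τ * S τ ≤ B * ∫⁻ τ in Ioc a t, S τ := by
    intro a t y B hB h
    rw [← lintegral_const_mul' _ _ hB]
    exact setLIntegral_mono' measurableSet_Ioc fun τ hτ => mul_le_mul' (h τ hτ) le_rfl
  have key : ∀ n : ℕ, ∃ M : ℝ≥0∞, M ≠ ∞ ∧ ∀ (y : ℝ → ℝ≥0∞) (B c : ℝ≥0∞), B ≠ ∞ → c ≠ ∞ →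
      (∀ t ∈ Ico 0 T, y t ≤ B) → (∀ t ∈ Ico 0 T, y t ≤ c + ∫⁻ τ in Ioc 0 t, y τ * S τ) →
      ∀ t ∈ Ico 0 T, t ≤ n * σ → y t ≤ M * c := by
    intro n
    induction n with
    | zero =>
      refine ⟨1, ENNReal.one_ne_top, fun y B c _ _ _ h t ht htn => ?_⟩
      have : t = 0 := le_antisymm (by simpa using htn) ht.1
      have h1 := h t ht
      simpa [this] using h1
    | succ n ih =>
      obtain ⟨M, hM, ih⟩ := ih
      refine ⟨2 * (1 + M * I), by finiteness, fun y B c hB hc hyB h t ht htn => ?_⟩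
      -- The last piece contributes at most half of this supremum, which is absorbed because the a
      -- priori bound B makes it finite. B does not enter M.
      set B' : ℝ≥0∞ := ⨆ t ∈ {t | t ∈ Ico 0 T ∧ t ≤ (n + 1) * σ}, y t with hB'
      have hB'B : B' ≤ B := iSup₂_le fun t ht => hyB t ht.1
      have hB'top : B' ≠ ∞ := ne_top_of_le_ne_top hB hB'B
      have hle : ∀ t ∈ Ico 0 T, t ≤ (n + 1) * σ → y t ≤ B' := fun t ht htn =>
        le_iSup₂_of_le (f := fun t (_ : t ∈ {t | t ∈ Ico 0 T ∧ t ≤ (n + 1) * σ}) => y t)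
          t ⟨ht, htn⟩ le_rfl
      have hnσ : 0 ≤ n * σ := by positivity
      have hbound : B' ≤ (1 + M * I) * c + B' / 2 := by
        refine iSup₂_le fun t ht => ?_
        refine (h t ht.1).trans ?_
        have hMI : M * c * I + c = (1 + M * I) * c := by ring
        rw [← hMI]
        have hMc : M * c ≠ ∞ := ENNReal.mul_ne_top hM hc
        rcases le_total t (n * σ) with h1 | h1
        · have h2 := hmul (a := 0) (t := t) (y := y) hMc fun τ hτ =>
            ih y B c hB hc hyB h τ ⟨hτ.1.le, hτ.2.trans_lt ht.1.2⟩ (hτ.2.trans h1)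
          calc _ ≤ c + M * c * I := by
                refine add_le_add le_rfl (h2.trans ?_)
                gcongr
                exact hI t ht.1.2
            _ ≤ _ := by rw [add_comm c]; exact le_self_add
        · rw [← setLIntegral_Ioc_add hnσ h1]
          have h2 := hmul (a := 0) (t := n * σ) (y := y) hMc fun τ hτ =>
            ih y B c hB hc hyB h τ ⟨hτ.1.le, hτ.2.trans_lt (h1.trans_lt ht.1.2)⟩ hτ.2
          have h3 := hmul (a := n * σ) (t := t) (y := y) hB'top fun τ hτ =>
            hle τ ⟨hnσ.trans hτ.1.le, hτ.2.trans_lt ht.1.2⟩ (hτ.2.trans ht.2)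
          have h4 := hσ' (n * σ) t hnσ ht.1.2 (by linarith [ht.2])
          have h5 := hI (n * σ) (h1.trans_lt ht.1.2)
          calc _ ≤ c + (M * c * I + B' * 2⁻¹) := by
                refine add_le_add le_rfl (add_le_add (h2.trans ?_) (h3.trans ?_)) <;> gcongr
            _ = _ := by rw [div_eq_mul_inv]; ring
      have hfin : B' / 2 ≠ ∞ := by finiteness
      have h6 : B' / 2 ≤ (1 + M * I) * c := by
        rw [← ENNReal.add_le_add_iff_right hfin, ENNReal.add_halves]
        exact hbound
      refine (hle t ht (by exact_mod_cast htn)).trans ?_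
      calc B' = 2 * (B' / 2) := (ENNReal.mul_div_cancel two_ne_zero ENNReal.ofNat_ne_top).symm
        _ ≤ 2 * ((1 + M * I) * c) := by gcongr
        _ = _ := by ring
  obtain ⟨n, hn⟩ := exists_nat_ge (T / σ)
  obtain ⟨M, hM, hM'⟩ := key n
  refine ⟨M + 1, by finiteness, fun y B c hB hyB h t ht => ?_⟩
  rcases eq_or_ne c ∞ with rfl | hc
  · rw [ENNReal.mul_top (by simp)]
    exact le_top
  · refine (hM' y B c hB hc hyB h t ht (ht.2.le.trans ((div_le_iff₀ hσ).1 hn))).trans ?_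
    gcongr
    exact le_self_add

end ContEq

end

/-! ### The chain rule in time for the regularised solution. -/

noncomputable section

namespace ContEq

variable {X : Type*} [MeasurableSpace X] {m : Measure X} {E : DirichletForm m}

lemma integrable_smoothAbs_mul {δ : ℝ} (hδ : 0 < δ) (κ v : Lp ℝ 2 m) :
    Integrable (fun x => smoothAbs δ (v x) * κ x) m := by
  have h1 : Integrable (fun x => κ x * v x) m := by
    simpa using L2.integrable_inner (𝕜 := ℝ) v κ
  refine h1.mono ((continuous_smoothAbs.comp_aestronglyMeasurable
    (Lp.aestronglyMeasurable v)).mul (Lp.aestronglyMeasurable κ))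
    (Eventually.of_forall fun x => ?_)
  rw [norm_mul, norm_mul, mul_comm, Real.norm_of_nonneg (smoothAbs_nonneg _)]
  gcongr
  exact smoothAbs_le_abs hδ _

/-- Convexity of the regularised absolute value, tested after applying the resolvent. -/
lemma integral_smoothAbs_res_sub_le {δ : ℝ} (hδ : 0 < δ) {κ : Lp ℝ 2 m}
    (h0 : ∀ᵐ x ∂m, 0 ≤ κ x) {l : ℝ} (hl : 0 < l) (v w : Lp ℝ 2 m) :
    ∫ x, smoothAbs δ (E.res hl v x) * κ x ∂m - ∫ x, smoothAbs δ (E.res hl w x) * κ x ∂m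
      ≤ inner ℝ (E.resolvent hl (signMul hδ κ (E.res hl v)) : Lp ℝ 2 m) (v - w) := by
  rw [DirichletForm.coe_resolvent, DirichletForm.inner_res_comm, ← integral_sub
    (integrable_smoothAbs_mul hδ κ _) (integrable_smoothAbs_mul hδ κ _), L2.inner_def]
  refine integral_mono_ae ((integrable_smoothAbs_mul hδ κ _).sub
    (integrable_smoothAbs_mul hδ κ _)) (L2.integrable_inner _ _) ?_
  rw [map_sub]
  filter_upwards [h0, signMul_ae hδ κ (E.res hl v), Lp.coeFn_sub (E.res hl v) (E.res hl w)]
    with x hx h1 h2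
  rw [h1, h2]
  simp only [Pi.sub_apply, RCLike.inner_apply, conj_trivial]
  calc _ = (smoothAbs δ (E.res hl v x) - smoothAbs δ (E.res hl w x)) * κ x := by ring
    _ ≤ smoothSign δ (E.res hl v x) * (E.res hl v x - E.res hl w x) * κ x :=
      mul_le_mul_of_nonneg_right (smoothAbs_sub_le hδ _ _) hx
    _ = _ := by ring

lemma _root_.ENNReal.ofReal_integral_le_lintegral {S : Type*} [MeasurableSpace S] {μ : Measure S}
    {f : S → ℝ} : ENNReal.ofReal (∫ x, f x ∂μ) ≤ ∫⁻ x, ENNReal.ofReal (f x) ∂μ := by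
  by_cases hf : Integrable f μ
  · calc ENNReal.ofReal (∫ x, f x ∂μ) ≤ ENNReal.ofReal (∫ x, max (f x) 0 ∂μ) :=
          ENNReal.ofReal_le_ofReal (integral_mono hf hf.pos_part fun x => le_max_left _ _)
      _ = ∫⁻ x, ENNReal.ofReal (max (f x) 0) ∂μ :=
          ofReal_integral_eq_lintegral_ofReal hf.pos_part
            (Eventually.of_forall fun x => le_max_right _ _)
      _ = _ := by simp
  · rw [integral_undef hf]
    simp

lemma exists_pos_mul_le {c ε : ℝ≥0∞} (hc : c ≠ ∞) (hε : 0 < ε) : ∃ η : ℝ≥0∞, 0 < η ∧ c * η ≤ ε := by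
  have h1 : c + 1 ≠ ∞ := by finiteness
  refine ⟨ε / (c + 1), ENNReal.div_pos hε.ne' h1, ?_⟩
  calc c * (ε / (c + 1)) ≤ (c + 1) * (ε / (c + 1)) := by gcongr; exact le_self_add
    _ = ε := ENNReal.mul_div_cancel (by simp) h1

namespace CarreDuChamp

variable {C : CarreDuChamp E} {A : Submodule ℝ E.domain} [SFinite m] {T : ℝ}
  {b : ℝ → C.VDerivation A} {g d : ℝ → X → ℝ} {Sb Sd : ℝ → ℝ≥0∞}
  {c : ℝ → ℝ≥0} {q r s K : ℝ≥0∞} {w : ℝ → Lp ℝ 2 m} (hS : C.Setting A q r s)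
  (hb : IsTransport T b g d Sb Sd c q r s)
include hb

lemma IsEvolution.inner_sub_eq (hw : IsBoundedCurve T r K w) (hev : IsEvolution hS.alg T b w)
    {φ : E.domain} (hφ : C.MemV s φ) {a t : ℝ} (ha : 0 ≤ a) (hat : a ≤ t) (ht : t < T) :
    inner ℝ (φ : Lp ℝ 2 m) (w t - w a) = ∫ τ in Ioc a t, pairing hS.alg b w φ τ := by
  have hi := intervalIntegrable_of_integrableOn_Ioo hb.pos.le (integrableOn_pairing hS hb hw hφ)
  rw [inner_sub_right, hev.inner_eq hS hb hw hφ ⟨ha.trans hat, ht⟩,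
    hev.inner_eq hS hb hw hφ ⟨ha, hat.trans_lt ht⟩, ← integral_zero_eq_setIntegral_Ioo ha,
    ← integral_zero_eq_setIntegral_Ioo (ha.trans hat), intervalIntegral.integral_interval_sub_left,
    intervalIntegral.integral_of_le hat]
  · exact hi.mono_set (by rw [uIcc_of_le (ha.trans hat), uIcc_of_le hb.pos.le]
                          exact Icc_subset_Icc_right ht.le)
  · exact hi.mono_set (by rw [uIcc_of_le ha, uIcc_of_le hb.pos.le]
                          exact Icc_subset_Icc_right (hat.trans ht.le))

/-- The chain rule, as an inequality, for the regularised absolute value of the resolvent. -/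
lemma IsEvolution.ofReal_integral_smoothAbs_res_le (hw : IsBoundedCurve T r K w)
    (hev : IsEvolution hS.alg T b w) {δ : ℝ} (hδ : 0 < δ) {κ : Lp ℝ 2 m}
    (h01 : ∀ᵐ x ∂m, 0 ≤ κ x ∧ κ x ≤ 1) (hκ : MemLp κ s m) {l : ℝ} (hl : 0 < l) (hl1 : 1 ≤ l) :
    ∀ t ∈ Ico 0 T, ENNReal.ofReal (∫ x, smoothAbs δ (E.res hl (w t) x) * κ x ∂m)
      ≤ ∫⁻ τ in Ioc 0 t, ENNReal.ofReal
        (pairing hS.alg b w (E.resolvent hl (signMul hδ κ (E.res hl (w τ)))) τ) := by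
  have h0 : ∀ᵐ x ∂m, 0 ≤ κ x := h01.mono fun _ h => h.1
  have nκ := interNorm_lt_top hκ (Lp.memLp κ)
  obtain ⟨cΓ, -, hcΓ⟩ :=
    hS.lpGamma_s.exists_interNorm_sqrtΓ_resolvent_le hS.one_lt hS.lt_top'
  set L := ENNReal.ofReal (cΓ * Real.sqrt l)
  have hL : ∀ v : Lp ℝ 2 m, MemLp v s m → interNorm s (C.sqrtΓ (E.resolvent hl v)) m ≤ L * interNorm s v m :=
    fun v hv => hcΓ l hl hl1 v hv
  have hV : ∀ v : Lp ℝ 2 m, MemLp v s m → C.MemV s (E.resolvent hl v) := fun v hv =>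
    hS.lpGamma_s.memV_resolvent hS.one_lt hS.lt_top' hl hl1 hv
  set φ : ℝ → Lp ℝ 2 m := fun t => signMul hδ κ (E.res hl (w t)) with hφ
  have mφ : ∀ t, MemLp (φ t) s m := fun t => memLp_signMul hδ _ hκ
  set f : ℝ → ℝ≥0∞ := fun t => ENNReal.ofReal (∫ x, smoothAbs δ (E.res hl (w t) x) * κ x ∂m)
  set Ψ : ℝ → ℝ≥0∞ := fun τ => ENNReal.ofReal (pairing hS.alg b w (E.resolvent hl (φ τ)) τ)
  have hsub : ∀ {a t : ℝ}, 0 ≤ a → t < T → Ioc a t ⊆ Ioo 0 T := fun ha ht x hx =>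
    ⟨ha.trans_lt hx.1, hx.2.trans_lt ht⟩
  -- The evolution identity at t = 0, tested with J φ₀, says that J φ₀ is orthogonal to w₀.
  -- Convexity compared with the zero function then gives the claim.
  have hf0 : f 0 = 0 := by
    have h1 := integral_smoothAbs_res_sub_le (E := E) hδ h0 hl (w 0) 0
    have h2 := hev.inner_eq hS hb hw (hV _ (mφ 0)) ⟨le_rfl, hb.pos⟩
    simp only [hφ, Ioo_self, Measure.restrict_empty, integral_zero_measure] at h2
    rw [sub_zero, h2, map_zero] at h1
    have h3 : ∫ x, smoothAbs δ ((0 : Lp ℝ 2 m) x) * κ x ∂m = 0 := by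
      refine integral_eq_zero_of_ae ?_
      filter_upwards [Lp.coeFn_zero ℝ 2 m] with x hx
      rw [hx]
      simp [smoothAbs_zero hδ.le]
    rw [h3, sub_zero] at h1
    exact ENNReal.ofReal_eq_zero.2 h1
  -- Weak continuity is turned into quantitative smallness. With z = J w_t - J w_a, pairing z with
  -- β₁'(z) κ equals pairing w_t - w_a with J(β₁'(z) κ). The evolution bounds the latter by the
  -- integral of Sb over (a, t], uniformly in the test function.
  have hω : ∀ a t : ℝ, 0 ≤ a → a ≤ t → t < T →
      ENNReal.ofReal (inner ℝ (signMul one_pos κ (E.res hl (w t) - E.res hl (w a)))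
        (E.res hl (w t) - E.res hl (w a)))
      ≤ (∫⁻ τ in Ioc a t, Sb τ) * (K * (L * interNorm s κ m)) := by
    intro a t ha hat ht
    have m1 := memLp_signMul (m := m) one_pos (E.res hl (w t) - E.res hl (w a)) hκ
    have e : inner ℝ (signMul one_pos κ (E.res hl (w t) - E.res hl (w a)))
        (E.res hl (w t) - E.res hl (w a))
        = ∫ τ in Ioc a t, pairing hS.alg b w
          (E.resolvent hl (signMul one_pos κ (E.res hl (w t) - E.res hl (w a)))) τ := by
      rw [← hev.inner_sub_eq hS hb hw (hV _ m1) ha hat ht, DirichletForm.coe_resolvent,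
        DirichletForm.inner_res_comm, map_sub]
    rw [e]
    refine (Real.ofReal_le_enorm _).trans
      ((lintegral_enorm_pairing_le hS hb hw (hV _ m1) (hsub ha ht)).trans ?_)
    gcongr
    refine (hL _ m1).trans ?_
    gcongr
    exact interNorm_signMul_le _ _ _ _
  -- On a short interval convexity yields the bound with the frozen test function φ_t. Replacing φ_t
  -- by φ_τ costs Sb K L ε, which is additive over intervals, so the short estimates add up with
  -- total error of order ε.
  have step : ∀ ε : ℝ≥0∞, 0 < ε → ∀ t ∈ Ico 0 T,
      f t ≤ ∫⁻ τ in Ioc 0 t, (Ψ τ + Sb τ * (K * (L * ε))) := by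
    intro ε hε
    obtain ⟨η₁, hη₁, hη₁'⟩ := exists_interNorm_signMul_sub_le hS.one_lt.le hS.lt_top'.ne hδ h01 hκ hε
    obtain ⟨η, hη, hη'⟩ := exists_pos_mul_le (c := K * (L * interNorm s κ m))
      (ENNReal.mul_ne_top hw.lt_top.ne (ENNReal.mul_ne_top ENNReal.ofReal_ne_top nκ.ne)) hη₁
    refine le_setLIntegral_of_forall_short hb.lintegral_Sb hf0 hη fun a t ha hat ht hat' => ?_
    have h1 := integral_smoothAbs_res_sub_le (E := E) hδ h0 hl (w t) (w a)
    have h2 : f t ≤ f a + ENNReal.ofReal (∫ τ in Ioc a t,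
        pairing hS.alg b w (E.resolvent hl (φ t)) τ) := by
      rw [← hev.inner_sub_eq hS hb hw (hV _ (mφ t)) ha hat ht]
      refine (ENNReal.ofReal_le_ofReal ?_).trans ENNReal.ofReal_add_le
      exact sub_le_iff_le_add'.1 h1
    refine h2.trans (add_le_add le_rfl (ENNReal.ofReal_integral_le_lintegral.trans ?_))
    apply lintegral_mono_ae
    filter_upwards [ae_restrict_of_ae_restrict_of_subset (hsub ha ht) (enorm_pairing_le hS hb hw),
      ae_restrict_of_ae_restrict_of_subset (hsub ha ht) (pairing_sub hS hb hw),
      ae_restrict_mem measurableSet_Ioc] with τ h3 h4 hτ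
    have h5 := h4 _ _ (hV _ (mφ t)) (hV _ (mφ τ))
    rw [← map_sub] at h5
    have h6 : interNorm s (φ t - φ τ : Lp ℝ 2 m) m ≤ ε := by
      refine hη₁' _ _ ((hω τ t (ha.trans hτ.1.le) hτ.2 ht).trans ?_)
      rw [mul_comm]
      refine (mul_le_mul' le_rfl ?_).trans hη'
      exact (lintegral_mono_set (Ioc_subset_Ioc_left hτ.1.le)).trans hat'
    have m6 : MemLp (φ t - φ τ : Lp ℝ 2 m) s m :=
      (memLp_congr_ae (Lp.coeFn_sub _ _)).2 ((mφ t).sub (mφ τ))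
    have h7 : ENNReal.ofReal (pairing hS.alg b w (E.resolvent hl (φ t - φ τ)) τ)
        ≤ Sb τ * (K * (L * ε)) := by
      refine (Real.ofReal_le_enorm _).trans ((h3 _).trans ?_)
      rw [mul_assoc]
      gcongr
      exact (hL _ m6).trans (mul_le_mul' le_rfl h6)
    calc _ = ENNReal.ofReal (pairing hS.alg b w (E.resolvent hl (φ τ)) τ
          + pairing hS.alg b w (E.resolvent hl (φ t - φ τ)) τ) := by rw [h5]; congr 1; ring
      _ ≤ _ := ENNReal.ofReal_add_le.trans (add_le_add le_rfl h7)
  intro t ht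
  refine ENNReal.le_of_forall_pos_le_add fun ε hε _ => ?_
  have hfin : (∫⁻ τ in Ioc 0 t, Sb τ) ≠ ∞ :=
    ne_top_of_le_ne_top hb.lintegral_Sb (lintegral_mono_set (hsub le_rfl ht.2))
  obtain ⟨η, hη, hη'⟩ := exists_pos_mul_le (c := (∫⁻ τ in Ioc 0 t, Sb τ) * (K * L))
    (ENNReal.mul_ne_top hfin (ENNReal.mul_ne_top hw.lt_top.ne ENNReal.ofReal_ne_top))
    (ENNReal.coe_pos.2 hε)
  have mSb : AEMeasurable Sb (volume.restrict (Ioc 0 t)) :=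
    hb.aemeasurable_Sb.mono_measure (Measure.restrict_mono_set _ (hsub le_rfl ht.2))
  refine (step η hη t ht).trans ?_
  -- Only the error term has to be measurable for the splitting; nothing is needed for Ψ.
  rw [lintegral_add_right' _ (mSb.mul_const _), lintegral_mul_const'' _ mSb]
  refine add_le_add le_rfl (le_trans (le_of_eq ?_) hη')
  ring

end CarreDuChamp

end ContEq

end

/-! ### The renormalised inequality. -/

noncomputable section

namespace ContEq

variable {X : Type*} [MeasurableSpace X] {m : Measure X} {E : DirichletForm m}

lemma continuous_integral_smoothAbs_mul {δ : ℝ} (hδ : 0 < δ) (κ : Lp ℝ 2 m) :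
    Continuous fun v : Lp ℝ 2 m => ∫ x, smoothAbs δ (v x) * κ x ∂m := by
  have : LipschitzWith ‖κ‖₊ fun v : Lp ℝ 2 m => ∫ x, smoothAbs δ (v x) * κ x ∂m := fun v w => by
    rw [edist_eq_enorm_sub, ← integral_sub (integrable_smoothAbs_mul hδ κ v)
      (integrable_smoothAbs_mul hδ κ w)]
    refine (enorm_integral_le_lintegral_enorm _).trans ?_
    calc ∫⁻ x, ‖smoothAbs δ (v x) * κ x - smoothAbs δ (w x) * κ x‖ₑ ∂m
        ≤ ∫⁻ x, ‖κ x‖ₑ * ‖(v - w : Lp ℝ 2 m) x‖ₑ ∂m := by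
          apply lintegral_mono_ae
          filter_upwards [Lp.coeFn_sub v w] with x hx
          rw [← sub_mul, enorm_mul, mul_comm, hx]
          gcongr
          exact enorm_le_iff_norm_le.2 (abs_smoothAbs_sub_le hδ _ _)
      _ ≤ eLpNorm κ 2 m * eLpNorm (v - w : Lp ℝ 2 m) 2 m :=
          lintegral_enorm_mul_le (ENNReal.inv_two_add_inv_two) (Lp.aestronglyMeasurable _)
            (Lp.aestronglyMeasurable _)
      _ = _ := by
          rw [edist_eq_enorm_sub, Lp.enorm_def, ← Lp.enorm_def κ]
          rfl
  exact this.continuous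

namespace CarreDuChamp

variable {C : CarreDuChamp E} {A : Submodule ℝ E.domain} [SFinite m] {T : ℝ}
  {b : ℝ → C.VDerivation A} {g d : ℝ → X → ℝ} {Sb Sd : ℝ → ℝ≥0∞}
  {c : ℝ → ℝ≥0} {q r s K : ℝ≥0∞} {w : ℝ → Lp ℝ 2 m} (hS : C.Setting A q r s)
  (hb : IsTransport T b g d Sb Sd c q r s)
include hb

/-- The renormalised equation, as an inequality, tested against `κ ∈ A`. -/
lemma IsEvolution.ofReal_integral_smoothAbs_le (hw : IsBoundedCurve T r K w)
    (hev : IsEvolution hS.alg T b w) {δ : ℝ} (hδ : 0 < δ) {κ : A}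
    (h01 : ∀ᵐ x ∂m, 0 ≤ (κ.1 : Lp ℝ 2 m) x ∧ (κ.1 : Lp ℝ 2 m) x ≤ 1) :
    ∀ t ∈ Ico 0 T, ENNReal.ofReal (∫ x, smoothAbs δ (w t x) * (κ.1 : Lp ℝ 2 m) x ∂m)
      ≤ ∫⁻ τ in Ioc 0 t, (∫⁻ x, ‖smoothAbs δ (w τ x) * (g τ x * C.sqrtΓ κ.1 x)‖ₑ ∂m
        + ∫⁻ x, ‖(smoothAbs δ (w τ x) - w τ x * smoothSign δ (w τ x))
          * (κ.1 : Lp ℝ 2 m) x * d τ x‖ₑ ∂m) := by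
  intro t ht
  set k : Lp ℝ 2 m := (κ.1 : Lp ℝ 2 m) with hk
  have hκs : MemLp k s m := (hS.alg.memV κ hS.one_lt.le).1
  have hκi : MemLp k ∞ m := (hS.alg.memV_top κ.1 κ.2).1
  obtain ⟨M, hM, hM'⟩ := hS.exists_ofReal_integral_mul_extend_le hδ κ hw.lt_top
  obtain ⟨N, hN, hN'⟩ := hS.exists_commutatorError_le hδ hκs hw.lt_top
  set I : ℝ → ℝ≥0∞ := fun τ => ∫⁻ x, ‖smoothAbs δ (w τ x) * (g τ x * C.sqrtΓ κ.1 x)‖ₑ ∂m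
        + ∫⁻ x, ‖(smoothAbs δ (w τ x) - w τ x * smoothSign δ (w τ x)) * k x * d τ x‖ₑ ∂m
  set μ : Measure ℝ := volume.restrict (Ioc 0 t)
  have hsub : Ioc 0 t ⊆ Ioo 0 T := fun x hx => ⟨hx.1, hx.2.trans_lt ht.2⟩
  have hμ : μ ≤ volume.restrict (Ioo 0 T) := Measure.restrict_mono_set _ hsub
  have hae : ∀ {P : ℝ → Prop}, (∀ᵐ τ ∂(volume.restrict (Ioo 0 T)), P τ) → ∀ᵐ τ ∂μ, P τ :=
    fun h => ae_restrict_of_ae_restrict_of_subset hsub h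
  set R : ℕ → ℝ → ℝ≥0∞ := fun n τ => M * (Sb τ + Sd τ + c τ)
    * C.commutatorError r s hδ k (Nat.cast_add_one_pos (α := ℝ) n) (w τ) with hR
  have mS : AEMeasurable (fun τ => M * (Sb τ + Sd τ + c τ)) μ :=
    (((hb.aemeasurable_Sb.add hb.aemeasurable_Sd).add hb.aemeasurable_c).const_mul M).mono_measure
      hμ
  have fS : ∫⁻ τ, M * (Sb τ + Sd τ + c τ) ∂μ ≠ ∞ := by
    refine ne_top_of_le_ne_top ?_ (lintegral_mono' hμ le_rfl)
    rw [lintegral_const_mul' _ _ hM.ne, lintegral_add_right' _ hb.aemeasurable_c,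
      lintegral_add_right' _ hb.aemeasurable_Sd]
    have h1 := hb.lintegral_Sb
    have h2 := hb.lintegral_Sd
    have h3 := hb.lintegral_c
    have h4 := hM.ne
    finiteness
  have mR : ∀ n, AEMeasurable (R n) μ := fun n =>
    mS.mul (aemeasurable_commutatorError r s hδ hκi _ (hw.aestronglyMeasurable.mono_measure hμ))
  -- The commutator error tends to 0 at a.e. fixed time and is bounded uniformly, while Sb + Sd + c
  -- is integrable in time.
  have hRle : Tendsto (fun n => ∫⁻ τ, R n τ ∂μ) atTop (𝓝 0) := by
    rw [← lintegral_zero (μ := μ)]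
    refine tendsto_lintegral_of_dominated_convergence' (fun τ => M * (Sb τ + Sd τ + c τ) * N)
      mR (fun n => ?_) ?_ ?_
    · filter_upwards [hae hw.bound] with τ h1
      refine mul_le_mul' le_rfl (hN' _ _ ?_ _ h1.1 h1.2)
      exact le_add_of_nonneg_left (Nat.cast_nonneg n)
    · rw [lintegral_mul_const'' _ mS]
      exact ENNReal.mul_ne_top fS hN.ne
    · filter_upwards [hae hw.bound, hae hb.controlled] with τ h1 h2
      have h3 : M * (Sb τ + Sd τ + c τ) ≠ ∞ := by
        have h4 := hM.ne
        have h5 := h2.fin_bound.ne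
        have h6 := h2.fin_div.ne
        finiteness
      have := ENNReal.Tendsto.const_mul (hS.tendsto_commutatorError hδ hκs h1.1) (Or.inr h3)
      rwa [mul_zero] at this
  have hn : ∀ n : ℕ, ENNReal.ofReal (∫ x, smoothAbs δ
        (E.res (Nat.cast_add_one_pos (α := ℝ) n) (w t) x) * k x ∂m)
      ≤ ∫⁻ τ, I τ ∂μ + ∫⁻ τ, R n τ ∂μ := by
    intro n
    have hn1 : (1 : ℝ) ≤ n + 1 := le_add_of_nonneg_left (Nat.cast_nonneg n)
    refine (hev.ofReal_integral_smoothAbs_res_le hS hb hw hδ h01 hκs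
      (Nat.cast_add_one_pos (α := ℝ) n) hn1 t ht).trans ?_
    rw [← lintegral_add_right' _ (mR n)]
    apply lintegral_mono_ae
    filter_upwards [hae hw.bound, hae hb.controlled, hae hb.deformation] with τ h1 h2 h3
    exact hM' (b τ) (g τ) (d τ) (Sb τ) (Sd τ) (c τ) h2 h3 _ _ hn1 (w τ) h1.1 h1.2
  have hlim : Tendsto (fun n : ℕ => ENNReal.ofReal (∫ x, smoothAbs δ
      (E.res (Nat.cast_add_one_pos (α := ℝ) n) (w t) x) * k x ∂m)) atTop
      (𝓝 (ENNReal.ofReal (∫ x, smoothAbs δ (w t x) * k x ∂m))) :=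
    (ENNReal.continuous_ofReal.tendsto _).comp
      (((continuous_integral_smoothAbs_mul hδ k).tendsto _).comp (DirichletForm.tendsto_res (w t)))
  have hlim' := (tendsto_const_nhds (x := ∫⁻ τ, I τ ∂μ)).add hRle
  rw [add_zero] at hlim'
  exact le_of_tendsto_of_tendsto' hlim hlim' hn

end CarreDuChamp

end ContEq

end

/-! ### Removal of the cutoff, and uniqueness. -/

noncomputable section

namespace ContEq

variable {X : Type*} [MeasurableSpace X] {m : Measure X} {E : DirichletForm m}

lemma aestronglyMeasurable_smoothAbs (δ : ℝ) (v : Lp ℝ 2 m) :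
    AEStronglyMeasurable (fun x => smoothAbs δ (v x)) m :=
  continuous_smoothAbs.comp_aestronglyMeasurable (Lp.aestronglyMeasurable v)

lemma lintegral_smoothAbs_le_sq {δ : ℝ} (hδ : 0 < δ) (v : Lp ℝ 2 m) :
    ∫⁻ x, ‖smoothAbs δ (v x)‖ₑ ∂m
      ≤ ENNReal.ofReal (1 / (2 * δ)) * (eLpNorm v 2 m * eLpNorm v 2 m) := by
  have mv := Lp.aestronglyMeasurable v
  calc ∫⁻ x, ‖smoothAbs δ (v x)‖ₑ ∂m
      ≤ ∫⁻ x, ENNReal.ofReal (1 / (2 * δ)) * (‖v x‖ₑ * ‖v x‖ₑ) ∂m := by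
        refine lintegral_mono fun x => ?_
        rw [← enorm_mul, Real.enorm_of_nonneg (smoothAbs_nonneg _),
          Real.enorm_of_nonneg (mul_self_nonneg _), ← ENNReal.ofReal_mul (by positivity)]
        refine ENNReal.ofReal_le_ofReal ((smoothAbs_le_sq hδ _).trans_eq ?_)
        ring
    _ ≤ _ := by
        rw [lintegral_const_mul' _ _ ENNReal.ofReal_ne_top]
        gcongr
        exact lintegral_enorm_mul_le ENNReal.inv_two_add_inv_two mv mv

namespace CarreDuChamp

variable {C : CarreDuChamp E} {A : Submodule ℝ E.domain}

/-- Weak-* convergence of √Γ(f_n), tested with the integrable function H. Since both factors are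
nonnegative, the signed integral is the full L¹ quantity. -/
lemma IsCutoffSeq.tendsto_lintegral_mul {f : ℕ → E.domain} (hA : C.IsTestAlgebra A)
    (hf : C.IsCutoffSeq A f) {H : X → ℝ≥0∞} (hH : Measurable H) (hfin : ∫⁻ x, H x ∂m ≠ ∞) :
    Tendsto (fun n => ∫⁻ x, H x * ‖C.sqrtΓ (f n) x‖ₑ ∂m) atTop (𝓝 0) := by
  have hi : Integrable (fun x => (H x).toReal) m := integrable_toReal_of_lintegral_ne_top
    hH.aemeasurable hfin
  have h1 := (ENNReal.continuous_ofReal.tendsto _).comp (hf.weakStar _ hi)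
  rw [ENNReal.ofReal_zero] at h1
  refine h1.congr fun n => ?_
  have hprod : Integrable (fun x => (H x).toReal * C.sqrtΓ (f n) x) m := by
    have := hi.mul_of_top_left ((hA.memV_top _ (hf.mem n)).2)
    exact this
  rw [Function.comp_apply, ofReal_integral_eq_lintegral_ofReal hprod
    (Eventually.of_forall fun x => mul_nonneg ENNReal.toReal_nonneg (C.sqrtΓ_nonneg _ _))]
  apply lintegral_congr_ae
  filter_upwards [ae_lt_top hH hfin] with x hx
  rw [ENNReal.ofReal_mul ENNReal.toReal_nonneg, ENNReal.ofReal_toReal hx.ne,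
    Real.enorm_of_nonneg (C.sqrtΓ_nonneg _ _)]

lemma IsCutoffSeq.tendsto_ofReal_integral_mul {f : ℕ → E.domain}
    (hf : C.IsCutoffSeq A f) {δ : ℝ} (hδ : 0 < δ) (v : Lp ℝ 2 m) :
    Tendsto (fun n => ENNReal.ofReal (∫ x, smoothAbs δ (v x) * (f n : Lp ℝ 2 m) x ∂m)) atTop
      (𝓝 (∫⁻ x, ‖smoothAbs δ (v x)‖ₑ ∂m)) := by
  have hb := ae_all_iff.2 hf.bounds
  have e : ∀ n, ENNReal.ofReal (∫ x, smoothAbs δ (v x) * (f n : Lp ℝ 2 m) x ∂m)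
      = ∫⁻ x, ENNReal.ofReal (smoothAbs δ (v x) * (f n : Lp ℝ 2 m) x) ∂m := fun n =>
    ofReal_integral_eq_lintegral_ofReal (integrable_smoothAbs_mul hδ _ v) (by
      filter_upwards [hb] with x hx using mul_nonneg (smoothAbs_nonneg _) (hx n).1)
  simp only [e]
  refine lintegral_tendsto_of_tendsto_of_monotone
    (fun n => (integrable_smoothAbs_mul hδ _ v).aestronglyMeasurable.aemeasurable.ennreal_ofReal)
    ?_ ?_
  · filter_upwards [ae_all_iff.2 hf.mono] with x hx
    refine monotone_nat_of_le_succ fun n => ENNReal.ofReal_le_ofReal ?_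
    exact mul_le_mul_of_nonneg_left (hx n) (smoothAbs_nonneg _)
  · filter_upwards [hf.tendsto_one] with x hx
    have := (ENNReal.continuous_ofReal.tendsto _).comp (hx.const_mul (smoothAbs δ (v x)))
    rwa [mul_one, ← Real.enorm_of_nonneg (smoothAbs_nonneg _)] at this

variable [SFinite m] {T : ℝ}
  {b : ℝ → C.VDerivation A} {g d : ℝ → X → ℝ} {Sb Sd : ℝ → ℝ≥0∞}
  {c : ℝ → ℝ≥0} {q r s K : ℝ≥0∞} {w : ℝ → Lp ℝ 2 m} (hS : C.Setting A q r s)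
  (hb : IsTransport T b g d Sb Sd c q r s)

omit [SFinite m] in
lemma IsBoundedCurve.ae_lintegral_smoothAbs_le (hw : IsBoundedCurve T r K w) {δ : ℝ} (hδ : 0 < δ) :
    ∀ᵐ τ ∂(volume.restrict (Ioo 0 T)), ∫⁻ x, ‖smoothAbs δ (w τ x)‖ₑ ∂m
      ≤ ENNReal.ofReal (1 / (2 * δ)) * (K * K) := by
  filter_upwards [hw.bound] with τ h1
  refine (lintegral_smoothAbs_le_sq hδ _).trans ?_
  have := (eLpNorm_two_le_interNorm r _).trans h1.2
  gcongr

include hS hb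

-- β(w) is in L¹ because β(z) ≤ z² / (2δ) and w is in `L²`, and in L^r because β(z) ≤ |z|. This
-- pairs with |b| in L^q + L^∞, as the conjugate exponent of q is at most r.
omit [SFinite m] in
lemma lintegral_lintegral_smoothAbs_mul_ne_top (hw : IsBoundedCurve T r K w) {δ : ℝ} (hδ : 0 < δ) :
    ∫⁻ τ in Ioo 0 T, ∫⁻ x, ‖smoothAbs δ (w τ x)‖ₑ * ‖g τ x‖ₑ ∂m ≠ ∞ := by
  have hq : q⁻¹ + ((r⁻¹ + s⁻¹)⁻¹)⁻¹ = 1 := by rw [inv_inv, ← add_assoc, hS.sum_eq]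
  have hle : (r⁻¹ + s⁻¹)⁻¹ ≤ r := by
    rw [← ENNReal.inv_le_inv, inv_inv]; exact le_self_add
  have hK := hw.lt_top.ne
  refine ne_top_of_le_ne_top (b := ∫⁻ τ in Ioo 0 T,
    2 * (ENNReal.ofReal (1 / (2 * δ)) * (K * K) + K) * Sb τ) ?_ ?_
  · rw [lintegral_const_mul' _ _ (by finiteness)]
    have := hb.lintegral_Sb
    finiteness
  · apply lintegral_mono_ae
    filter_upwards [hw.bound, hb.controlled, hw.ae_lintegral_smoothAbs_le hδ] with τ h1 h2 h3
    refine (h2.sum_bound.lintegral_le_one_add hq hle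
      (aestronglyMeasurable_smoothAbs δ (w τ))).trans ?_
    gcongr
    · rwa [eLpNorm_one_eq_lintegral_enorm]
    · refine (eLpNorm_mono fun x => ?_).trans ((eLpNorm_le_interNorm r _).trans h1.2)
      rw [Real.norm_of_nonneg (smoothAbs_nonneg _)]
      exact smoothAbs_le_abs hδ _

/-- The total mass of the regularised absolute value grows only through the divergence. -/
lemma IsEvolution.lintegral_smoothAbs_le (hw : IsBoundedCurve T r K w)
    (hev : IsEvolution hS.alg T b w) {f : ℕ → E.domain} (hf : C.IsCutoffSeq A f) {δ : ℝ}
    (hδ : 0 < δ) : ∀ t ∈ Ico 0 T, ∫⁻ x, ‖smoothAbs δ (w t x)‖ₑ ∂m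
      ≤ ∫⁻ τ in Ioc 0 t, (∫⁻ x, ‖smoothAbs δ (w τ x)‖ₑ ∂m + ENNReal.ofReal δ) * (2 * Sd τ) := by
  intro t ht
  set μ : Measure ℝ := volume.restrict (Ioc 0 t)
  have hsub : Ioc 0 t ⊆ Ioo 0 T := fun x hx => ⟨hx.1, hx.2.trans_lt ht.2⟩
  have hμ : μ ≤ volume.restrict (Ioo 0 T) := Measure.restrict_mono_set _ hsub
  have hae : ∀ {P : ℝ → Prop}, (∀ᵐ τ ∂(volume.restrict (Ioo 0 T)), P τ) → ∀ᵐ τ ∂μ, P τ :=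
    fun h => ae_restrict_of_ae_restrict_of_subset hsub h
  -- The cutoff gradients converge only against functions of x. Tonelli's theorem, hence a jointly
  -- measurable representative of w, is needed to integrate β(w) |b| in time first.
  obtain ⟨W, hW, hWw⟩ := exists_measurable_uncurry hw.aestronglyMeasurable
  set P : ℝ → X → ℝ≥0∞ := fun τ x => ‖smoothAbs δ (W τ x)‖ₑ * ‖g τ x‖ₑ with hP
  have mP : Measurable (Function.uncurry P) :=
    (continuous_smoothAbs.measurable.comp hW).enorm.mul hb.measurable_bound.enorm
  set H : X → ℝ≥0∞ := fun x => ∫⁻ τ, P τ x ∂μ with hH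
  have mH : Measurable H := mP.lintegral_prod_left'
  set G : ℝ → ℝ≥0∞ := fun τ =>
    (∫⁻ x, ‖smoothAbs δ (w τ x)‖ₑ ∂m + ENNReal.ofReal δ) * (2 * Sd τ)
  have hHfin : ∫⁻ x, H x ∂m ≠ ∞ := by
    rw [hH, ← lintegral_lintegral_swap mP.aemeasurable]
    refine ne_top_of_le_ne_top (lintegral_lintegral_smoothAbs_mul_ne_top hS hb hw hδ)
      (le_trans (lintegral_mono_ae (hae ?_)) (lintegral_mono' hμ le_rfl))
    filter_upwards [hWw] with τ hτ
    exact lintegral_mono_ae (by filter_upwards [hτ] with x hx; simp only [hP, hx, le_refl])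
  have hswap : ∀ k : X → ℝ, Measurable k →
      ∫⁻ x, H x * ‖k x‖ₑ ∂m = ∫⁻ τ, ∫⁻ x, P τ x * ‖k x‖ₑ ∂m ∂μ := by
    intro k hk
    have h1 : ∀ x, H x * ‖k x‖ₑ = ∫⁻ τ, P τ x * ‖k x‖ₑ ∂μ := fun x =>
      (lintegral_mul_const _ (mP.comp measurable_prodMk_right)).symm
    simp only [h1]
    have mPk : Measurable (Function.uncurry fun τ x => P τ x * ‖k x‖ₑ) :=
      mP.mul (hk.comp measurable_snd).enorm
    exact (lintegral_lintegral_swap mPk.aemeasurable).symm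
  have hn : ∀ n, ENNReal.ofReal (∫ x, smoothAbs δ (w t x) * (f n : Lp ℝ 2 m) x ∂m)
      ≤ ∫⁻ x, H x * ‖C.sqrtΓ (f n) x‖ₑ ∂m + ∫⁻ τ, G τ ∂μ := by
    intro n
    refine (hev.ofReal_integral_smoothAbs_le hS hb hw hδ (κ := ⟨f n, hf.mem n⟩)
      (hf.bounds n) t ht).trans ?_
    have mk := C.measurable_sqrtΓ (f n)
    have mI : Measurable fun τ => ∫⁻ x, P τ x * ‖C.sqrtΓ (f n) x‖ₑ ∂m :=
      (mP.mul (mk.comp measurable_snd).enorm).lintegral_prod_right'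
    rw [hswap _ mk, ← lintegral_add_left mI]
    apply lintegral_mono_ae
    filter_upwards [hae hWw, hae hb.controlled] with τ h1 h2
    refine add_le_add (le_of_eq ?_) ?_
    · apply lintegral_congr_ae
      filter_upwards [h1] with x hx
      simp only [hP, enorm_mul, hx, mul_assoc]
    · have mz : AEStronglyMeasurable
          (fun x => smoothAbs δ (w τ x) - w τ x * smoothSign δ (w τ x)) m := by
        have hc : Continuous fun z => smoothAbs δ z - z * smoothSign δ z :=
          continuous_smoothAbs.sub (continuous_id.mul (continuous_smoothSign hδ))
        exact hc.comp_aestronglyMeasurable (Lp.aestronglyMeasurable (w τ))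
      have hq : q⁻¹ + ((r⁻¹ + s⁻¹)⁻¹)⁻¹ = 1 := by rw [inv_inv, ← add_assoc, hS.sum_eq]
      calc _ ≤ ∫⁻ x, ‖smoothAbs δ (w τ x) - w τ x * smoothSign δ (w τ x)‖ₑ * ‖d τ x‖ₑ ∂m := by
            apply lintegral_mono_ae
            filter_upwards [hf.bounds n] with x hx
            rw [enorm_mul, enorm_mul]
            gcongr
            refine mul_le_of_le_one_right zero_le ?_
            rw [Real.enorm_of_nonneg hx.1]
            exact ENNReal.ofReal_le_one.2 hx.2
        -- The defect is bounded by β(w), which gives its L¹ norm, and by δ, which gives its L^∞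
        -- norm. So the divergence term costs ∫ β(w) + δ and no higher norm of w.
        _ ≤ 2 * (eLpNorm (fun x => smoothAbs δ (w τ x) - w τ x * smoothSign δ (w τ x)) 1 m
            + eLpNorm (fun x => smoothAbs δ (w τ x) - w τ x * smoothSign δ (w τ x)) ∞ m)
            * Sd τ := h2.sum_div.lintegral_le_one_add hq le_top mz
        _ ≤ 2 * (∫⁻ x, ‖smoothAbs δ (w τ x)‖ₑ ∂m + ENNReal.ofReal δ) * Sd τ := by
            gcongr
            · rw [eLpNorm_one_eq_lintegral_enorm]
              refine lintegral_mono fun x => ?_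
              rw [Real.enorm_of_nonneg (smoothAbs_nonneg _), ← ofReal_norm]
              exact ENNReal.ofReal_le_ofReal (abs_smoothAbs_sub_mul_le hδ _)
            · rw [eLpNorm_exponent_top]
              refine eLpNormEssSup_le_of_ae_bound (Eventually.of_forall fun x => ?_)
              exact abs_smoothAbs_sub_mul_le' hδ _
        _ = _ := by ring
  have hlim := (hf.tendsto_lintegral_mul hS.alg mH hHfin).add
    (tendsto_const_nhds (x := ∫⁻ τ, G τ ∂μ))
  rw [zero_add] at hlim
  exact le_of_tendsto_of_tendsto' (hf.tendsto_ofReal_integral_mul hδ (w t)) hlim hn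

/-- Uniqueness: an evolution bounded in `L^r ∩ L²` vanishes. -/
lemma IsEvolution.eq_zero (hw : IsBoundedCurve T r K w) (hev : IsEvolution hS.alg T b w)
    {f : ℕ → E.domain} (hf : C.IsCutoffSeq A f) : ∀ t ∈ Ico 0 T, w t = 0 := by
  have hfin : ∫⁻ τ in Ioo 0 T, 2 * Sd τ ≠ ∞ := by
    rw [lintegral_const_mul' _ _ ENNReal.ofNat_ne_top]
    exact ENNReal.mul_ne_top ENNReal.ofNat_ne_top hb.lintegral_Sd
  obtain ⟨M, hM, hM'⟩ := exists_le_mul_of_le_add_setLIntegral hfin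
  have hK := hw.lt_top.ne
  -- Adding δ to the unknown makes the inequality linear with initial value δ. The a priori bound
  -- required by Gronwall blows up as δ → 0 but does not affect M.
  have key : ∀ δ : ℝ, 0 < δ → ∀ t ∈ Ico 0 T,
      ∫⁻ x, ‖smoothAbs δ (w t x)‖ₑ ∂m + ENNReal.ofReal δ ≤ M * ENNReal.ofReal δ := by
    intro δ hδ
    have h1 := hev.lintegral_smoothAbs_le hS hb hw hf hδ
    set B := (ENNReal.ofReal (1 / (2 * δ)) * (K * K) + ENNReal.ofReal δ)
      * ∫⁻ τ in Ioo 0 T, 2 * Sd τ with hB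
    have hBfin : (ENNReal.ofReal (1 / (2 * δ)) * (K * K) + ENNReal.ofReal δ) ≠ ∞ := by finiteness
    have hle : ∀ t ∈ Ico 0 T, ∫⁻ x, ‖smoothAbs δ (w t x)‖ₑ ∂m ≤ B := by
      intro t ht
      have hsub : Ioc 0 t ⊆ Ioo 0 T := fun x hx => ⟨hx.1, hx.2.trans_lt ht.2⟩
      refine (h1 t ht).trans ?_
      rw [hB, ← lintegral_const_mul' _ _ hBfin]
      refine (lintegral_mono_ae (ae_restrict_of_ae_restrict_of_subset hsub ?_)).trans
        (lintegral_mono_set hsub)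
      filter_upwards [hw.ae_lintegral_smoothAbs_le hδ] with τ h2
      gcongr
    have hB' : B + ENNReal.ofReal δ ≠ ∞ :=
      ENNReal.add_ne_top.2 ⟨ENNReal.mul_ne_top hBfin hfin, ENNReal.ofReal_ne_top⟩
    refine hM' (fun t => ∫⁻ x, ‖smoothAbs δ (w t x)‖ₑ ∂m + ENNReal.ofReal δ) _ _ hB'
      (fun t ht => add_le_add (hle t ht) le_rfl) fun t ht => ?_
    rw [add_comm]
    exact add_le_add le_rfl (h1 t ht)
  intro t ht
  -- β is decreasing in δ, so the fixed function with δ = 1 lies below all those with δ ≤ 1.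
  have h1 : ∀ᶠ δ : ℝ in 𝓝[>] 0, ∫⁻ x, ‖smoothAbs 1 (w t x)‖ₑ ∂m ≤ M * ENNReal.ofReal δ := by
    have h2 : ∀ᶠ δ : ℝ in 𝓝[>] 0, δ ≤ 1 :=
      ((eventually_le_nhds one_pos).filter_mono nhdsWithin_le_nhds)
    filter_upwards [h2, self_mem_nhdsWithin] with δ hδ1 hδ
    refine le_trans ?_ (le_self_add.trans (key δ hδ t ht))
    refine lintegral_mono fun x => enorm_le_iff_norm_le.2 ?_
    rw [Real.norm_of_nonneg (smoothAbs_nonneg _), Real.norm_of_nonneg (smoothAbs_nonneg _)]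
    exact smoothAbs_anti hδ hδ1 _
  have h2 : Tendsto (fun δ : ℝ => M * ENNReal.ofReal δ) (𝓝[>] 0) (𝓝 0) := by
    have h3 := (ENNReal.continuous_ofReal.tendsto 0).mono_left (nhdsWithin_le_nhds (s := Ioi 0))
    rw [ENNReal.ofReal_zero] at h3
    have := ENNReal.Tendsto.const_mul h3 (Or.inr hM)
    rwa [mul_zero] at this
  have h3 : ∫⁻ x, ‖smoothAbs 1 (w t x)‖ₑ ∂m = 0 :=
    le_antisymm (ge_of_tendsto h2 h1) zero_le
  rw [lintegral_eq_zero_iff' (aestronglyMeasurable_smoothAbs 1 (w t)).enorm] at h3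
  refine Lp.eq_zero_iff_ae_eq_zero.2 ?_
  filter_upwards [h3] with x hx
  exact smoothAbs_eq_zero (enorm_eq_zero.1 hx)

end CarreDuChamp

end ContEq

end

/-! ### From the hypotheses of the theorem to a controlled transport problem. -/

noncomputable section

namespace ContEq

variable {X : Type*} [MeasurableSpace X] {m : Measure X} {E : DirichletForm m}

lemma IsSumBounded.congr_ae {q S : ℝ≥0∞} {a a' : X → ℝ} (h : IsSumBounded q a S m)
    (haa' : a =ᵐ[m] a') : IsSumBounded q a' S m := by
  obtain ⟨a₁, a₂, h1, h2, h3, h4⟩ := h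
  refine ⟨a₁, a₂, h1, h2, ?_, h4⟩
  filter_upwards [h3, haa'] with x h5 h6
  rw [← h6, h5]

/-- The integrable majorant in time is the sum of the two norms of the given splitting. The
representative g' is the literal sum, so that its slices are measurable even when those of g are
not. -/
lemma MemL1Sum.exists_isSumBounded [SFinite m] {T : ℝ} {q : ℝ≥0∞} (hq : q ≠ 0) {g : ℝ → X → ℝ}
    (hg : MemL1Sum m T q g) :
    ∃ (g' : ℝ → X → ℝ) (S : ℝ → ℝ≥0∞),
      AEMeasurable S (volume.restrict (Ioo 0 T)) ∧ ∫⁻ t in Ioo 0 T, S t ≠ ∞ ∧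
      ∀ᵐ t ∂(volume.restrict (Ioo 0 T)), g t =ᵐ[m] g' t ∧ IsSumBounded q (g' t) (S t) m ∧
        S t < ∞ := by
  obtain ⟨g₁, g₂, m1, m2, hsum, h1, h2⟩ := hg
  have n1 := measurable_eLpNorm_uncurry (m := m) m1 hq
  have n2 := measurable_eLpNorm_uncurry (m := m) m2 ENNReal.top_ne_zero
  have hfin : ∫⁻ t in Ioo 0 T, (eLpNorm (g₁ t) q m + eLpNorm (g₂ t) ∞ m) ≠ ∞ := by
    rw [lintegral_add_left n1]
    exact ENNReal.add_ne_top.2 ⟨h1.ne, h2.ne⟩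
  refine ⟨fun t x => g₁ t x + g₂ t x, fun t => eLpNorm (g₁ t) q m + eLpNorm (g₂ t) ∞ m,
    (n1.add n2).aemeasurable, hfin, ?_⟩
  filter_upwards [hsum, ae_lt_top' (n1.add n2).aemeasurable hfin] with t h3 h4
  exact ⟨h3, ⟨g₁ t, g₂ t, (m1.comp measurable_prodMk_left).aestronglyMeasurable,
    (m2.comp measurable_prodMk_left).aestronglyMeasurable, ae_of_all _ fun _ => rfl, le_rfl⟩, h4⟩

namespace CarreDuChamp

variable {C : CarreDuChamp E} {A : Submodule ℝ E.domain}

namespace VDerivation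

variable {b : C.VDerivation A} {d d' : X → ℝ} {r s : ℝ≥0∞}

lemma IsDivergence.congr_ae (h : b.IsDivergence d) (hd : d =ᵐ[m] d') : b.IsDivergence d' := by
  intro f
  rw [h f]
  congr 1
  exact integral_congr_ae (by filter_upwards [hd] with x hx; rw [hx])

lemma DeformationBound.congr_ae {c : ℝ≥0} (h : b.DeformationBound d r s c) (hd : d =ᵐ[m] d') :
    b.DeformationBound d' r s c := by
  intro f g Lf Lg hf hLf hLf' hg hLg hLg'
  have e : b.deformation d' r s f g Lf Lg = b.deformation d r s f g Lf Lg := by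
    rw [deformation, deformation]
    congr 1
    exact integral_congr_ae (by filter_upwards [hd] with x hx; rw [hx])
  rw [e]
  exact h f g Lf Lg hf hLf hLf' hg hLg hLg'

/-- The infimum is itself admissible, since dividing by the product of the gradient norms turns
admissibility into a lower bound on c. If that product is 0 the division is meaningless, and the
existence of one finite admissible constant is used instead. -/
lemma deformationBound_toNNReal (h : b.deformationNorm d r s ≠ ∞) :
    b.DeformationBound d r s (b.deformationNorm d r s).toNNReal := by
  intro f g Lf Lg hf hLf hLf' hg hLg hLg'
  rw [ENNReal.coe_toNNReal h, mul_assoc]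
  set N := eLpNorm (C.sqrtΓ f) r m * eLpNorm (C.sqrtΓ g) s m
  have hN : N ≠ ∞ := ENNReal.mul_ne_top hf.2.2.ne hg.2.2.ne
  have hle : ∀ c : ℝ≥0, b.DeformationBound d r s c →
      ENNReal.ofReal |b.deformation d r s f g Lf Lg| ≤ c * N := fun c hc => by
    rw [← mul_assoc]
    exact hc f g Lf Lg hf hLf hLf' hg hLg hLg'
  rcases eq_or_ne N 0 with h0 | h0
  · obtain ⟨c, hc⟩ : ∃ c : ℝ≥0, b.DeformationBound d r s c := by
      by_contra! hne
      exact h (by simp [deformationNorm, hne])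
    simpa [h0] using hle c hc
  · rw [← ENNReal.div_le_iff h0 hN]
    exact le_iInf₂ fun c hc => (ENNReal.div_le_iff h0 hN).2 (hle c hc)

end VDerivation

lemma IsTransport.of_isModulus [SFinite m] {T : ℝ} (hT : 0 < T) {b : ℝ → C.VDerivation A}
    (hb : IsBorelFamily T b) {q r s : ℝ≥0∞} (hq : q ≠ 0) {g d : ℝ → X → ℝ} (hg : IsBound T b g)
    (hgL : MemL1Sum m T q g) (hdL : MemL1Sum m T q d)
    (hdiv : ∀ᵐ t ∂(volume.restrict (Ioo 0 T)), (b t).IsDivergence (d t))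
    (hdefm : AEMeasurable (fun t => (b t).deformationNorm (d t) r s) (volume.restrict (Ioo 0 T)))
    (hdef : ∫⁻ t in Ioo 0 T, (b t).deformationNorm (d t) r s < ∞) :
    ∃ (d' : ℝ → X → ℝ) (Sb Sd : ℝ → ℝ≥0∞) (c : ℝ → ℝ≥0), IsTransport T b g d' Sb Sd c q r s := by
  obtain ⟨g', Sb, mSb, fSb, hSb⟩ := hgL.exists_isSumBounded hq
  obtain ⟨d', Sd, mSd, fSd, hSd⟩ := hdL.exists_isSumBounded hq
  refine ⟨d', Sb, Sd, fun t => ((b t).deformationNorm (d t) r s).toNNReal, hT, hg.1, ?_, ?_,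
    mSb, mSd, hdefm.ennreal_toNNReal.coe_nnreal_ennreal, fSb, fSd, ?_, hb.2⟩
  · filter_upwards [hSb, hSd, hdiv, hg.2.2] with t h1 h2 h3 h4
    exact ⟨h4, hg.2.1 t, h1.2.1.congr_ae h1.1.symm, h2.2.1, h1.2.2, h2.2.2, h3.congr_ae h2.1⟩
  · filter_upwards [hSd, ae_lt_top' hdefm hdef.ne] with t h1 h2
    exact (VDerivation.deformationBound_toNNReal h2.ne).congr_ae h1.1
  · refine ne_top_of_le_ne_top hdef.ne (lintegral_mono fun t => ?_)
    exact ENNReal.coe_toNNReal_le_self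

lemma IsWeakSolution.exists_isBoundedCurve {T : ℝ} {b : ℝ → C.VDerivation A} {r : ℝ≥0∞}
    {u0 : Lp ℝ 2 m} {u : ℝ → Lp ℝ 2 m} (hu : IsWeakSolution T b r u0 u) :
    ∃ K, IsBoundedCurve T r K u := by
  obtain ⟨K, hK⟩ := hu.bounded
  refine ⟨K + K, hu.aestronglyMeasurable, by finiteness, ?_⟩
  filter_upwards [hK] with t ht
  exact ⟨⟨Lp.aestronglyMeasurable _, ht.1.trans_lt ENNReal.coe_lt_top⟩, add_le_add ht.1 ht.2⟩

lemma IsBoundedCurve.sub {T : ℝ} {r K L : ℝ≥0∞} {u v : ℝ → Lp ℝ 2 m} (hr : 1 ≤ r)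
    (hu : IsBoundedCurve T r K u) (hv : IsBoundedCurve T r L v) :
    IsBoundedCurve T r (K + L) (fun t => u t - v t) := by
  refine ⟨hu.aestronglyMeasurable.sub hv.aestronglyMeasurable,
    ENNReal.add_lt_top.2 ⟨hu.lt_top, hv.lt_top⟩, ?_⟩
  filter_upwards [hu.bound, hv.bound] with t h1 h2
  refine ⟨(memLp_congr_ae (Lp.coeFn_sub _ _)).2 (h1.1.sub h2.1), ?_⟩
  rw [interNorm_coe_sub]
  exact (interNorm_sub_le hr (Lp.aestronglyMeasurable _) (Lp.aestronglyMeasurable _)).trans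
    (add_le_add h1.2 h2.2)

/-- The initial terms cancel because both solutions share the datum u0, and the rate of change is
linear in the solution. -/
lemma IsWeakSolution.isEvolution_sub [SFinite m] {T : ℝ} {b : ℝ → C.VDerivation A}
    {g d : ℝ → X → ℝ} {Sb Sd : ℝ → ℝ≥0∞} {c : ℝ → ℝ≥0} {q r s K L : ℝ≥0∞} (hS : C.Setting A q r s)
    (hb : IsTransport T b g d Sb Sd c q r s) {u0 : Lp ℝ 2 m} {u v : ℝ → Lp ℝ 2 m}
    (hu : IsWeakSolution T b r u0 u) (hv : IsWeakSolution T b r u0 v)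
    (hu' : IsBoundedCurve T r K u) (hv' : IsBoundedCurve T r L v) :
    IsEvolution hS.alg T b (fun t => u t - v t) := by
  intro φ t ht
  have hφ : C.MemV s φ.1 := hS.alg.memV φ hS.one_lt.le
  have hsub : Ioo 0 t ⊆ Ioo 0 T := Ioo_subset_Ioo_right ht.2.le
  rw [inner_sub_right, hu.inner_eq hS hb hu' φ ht, hv.inner_eq hS hb hv' φ ht,
    add_sub_add_left_eq_sub, ← integral_sub ((integrableOn_pairing hS hb hu' hφ).mono_set hsub)
      ((integrableOn_pairing hS hb hv' hφ).mono_set hsub)]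
  apply integral_congr_ae
  refine ae_restrict_of_ae_restrict_of_subset hsub ?_
  filter_upwards [hb.controlled, hu'.bound, hv'.bound] with τ h1 h2 h3
  have i1 := h1.integrable_mul_extend hS.alg hS.sum_eq (Lp.aestronglyMeasurable (u τ))
    (h2.2.trans_lt hu'.lt_top) hφ
  have i2 := h1.integrable_mul_extend hS.alg hS.sum_eq (Lp.aestronglyMeasurable (v τ))
    (h3.2.trans_lt hv'.lt_top) hφ
  rw [pairing, pairing, pairing, ← integral_sub i1 i2]
  apply integral_congr_ae
  filter_upwards [Lp.coeFn_sub (u τ) (v τ)] with x hx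
  rw [hx, Pi.sub_apply, sub_mul]

end CarreDuChamp

end ContEq

end

theorem theorem5p3 {X : Type*} [TopologicalSpace X] [PolishSpace X] [MeasurableSpace X]
    [BorelSpace X] (m : Measure X) [SigmaFinite m] [m.IsOpenPosMeasure]
    (E : ContEq.DirichletForm m) (hE : E.StronglyLocal) (C : ContEq.CarreDuChamp E)
    (A : Submodule ℝ E.domain) (hA : C.IsTestAlgebra A)
    (q r s : ℝ≥0∞) (hs : 1 < s) (hsr : s ≤ r) (hr : r < ∞) (hq : 1 < q)
    (hqrs : q⁻¹ + r⁻¹ + s⁻¹ = 1)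
    (hcut : ∃ f : ℕ → E.domain, C.IsCutoffSeq A f)
    (hAr : C.DenseInV A r) (hAs : C.DenseInV A s)
    (hΓr : C.LpGamma r) (hΓs : C.LpGamma s)
    (T : ℝ) (hT : 0 < T)
    (b : ℝ → C.VDerivation A) (hb : ContEq.CarreDuChamp.IsBorelFamily T b)
    (modb : ℝ → X → ℝ) (hmod : ContEq.CarreDuChamp.IsModulus T b modb)
    (hmodL : ContEq.MemL1Sum m T q modb)
    (divb : ℝ → X → ℝ) (hdivL : ContEq.MemL1Sum m T q divb)
    (hdiv : ∀ᵐ t ∂(volume.restrict (Ioo 0 T)), (b t).IsDivergence (divb t))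
    (hdefm : AEMeasurable (fun t => (b t).deformationNorm (divb t) r s)
      (volume.restrict (Ioo 0 T)))
    (hdef : ∫⁻ t in Ioo 0 T, (b t).deformationNorm (divb t) r s < ∞)
    (u0 : Lp ℝ 2 m) (hu0 : MemLp u0 r m)
    (u v : ℝ → Lp ℝ 2 m)
    (hu : ContEq.CarreDuChamp.IsWeakSolution T b r u0 u)
    (hv : ContEq.CarreDuChamp.IsWeakSolution T b r u0 v) :
    ∀ t ∈ Ico 0 T, u t = v t := by
  have hS : C.Setting A q r s :=
    { one_lt := hs, le := hsr, lt_top := hr, sum_eq := hqrs, alg := hA, dense_r := hAr,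
      dense_s := hAs, lpGamma_r := hΓr, lpGamma_s := hΓs }
  obtain ⟨d, Sb, Sd, c, hbt⟩ := ContEq.CarreDuChamp.IsTransport.of_isModulus hT hb
    (one_pos.trans hq).ne' hmod.1 hmodL hdivL hdiv hdefm hdef
  obtain ⟨K, hu'⟩ := hu.exists_isBoundedCurve
  obtain ⟨L, hv'⟩ := hv.exists_isBoundedCurve
  obtain ⟨f, hf⟩ := hcut
  intro t ht
  exact sub_eq_zero.1 ((hu.isEvolution_sub hS hbt hv hu' hv').eq_zero hS hbt
    (hu'.sub hS.one_lt'.le hv') hf t ht)
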